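/- Let $m\ge 1$ be an integer and let $\sigma\in W_2^m[0,\pi]$ be complex-valued, $q=\sigma'\in W_2^{m-1}[0,\pi]$; norms in $W_2^m$ and $W_2^{m-1}$ are denoted by $\|\cdot\|_m$ and $\|\cdot\|_{m-1}$. Put $y^{[1]}=y'-\sigma y$ and $Ly=-(y^{[1]})'-\sigma y^{[1]}-\sigma^2y$ $(=-y''+qy)$. Let $L_D$ and $L_{DN}$ be the operators $y\mapsto Ly$ in $L_2[0,\pi]$ on the functions $y$ with $y,y^{[1]}\in W_1^1[0,\pi]$, $Ly\in L_2[0,\pi]$ and, respectively, $y(0)=y(\pi)=0$ and $y(0)=y^{[1]}(\pi)=0$ (the latter is the classical condition $y(0)=y'(\pi)=0$ if $\sigma(\pi)=0$). Let $\{\lambda_k\}_{k\ge1}$ and $\{\mu_k\}_{k\ge1}$ be the eigenvalues of $L_D$ and $L_{DN}$, repeated according to algebraic multiplicity and numbered in the order of nondecreasing modulus or of nondecreasing real part; square roots are taken with argument in $(-\pi/2,\pi/2]$. For $l\ge1$ put $$a_l=\frac2\pi\int_0^\pi q^{(m-1)}(t)\cos lt\,dt,\qquad b_l=\frac2\pi\int_0^\pi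 q^{(m-1)}(t)\sin lt\,dt .$$ There are functionals $h_j,g_j: W_2^m[0,\pi]\to\mathbb C$, $0\le j\le s$, where $m=2s+1$ or $m=2s$, depending only on $m$, such that for all $\sigma$ and $k\ge1$ the following holds, with $h_j=h_j(\sigma)$, $g_j=g_j(\sigma)$. If $m=2s+1$ is odd, $$\sqrt{\lambda_k}=k+\sum_{j=0}^{s}\frac{h_j}{(2k)^{2j+1}}-(-1)^s\frac{a_{2k}}{2(2k)^{2s+1}}+\frac{\alpha_{2k}}{k^{2s+2}},$$ $$\sqrt{\mu_k}=k-\frac12+\sum_{j=0}^{s}\frac{g_j}{(2k-1)^{2j+1}}-(-1)^s\frac{a_{2k-1}}{2(2k-1)^{2s+1}}+\frac{\alpha_{2k-1}}{k^{2s+2}};$$ if $m=2s$ is even, $$\sqrt{\lambda_k}=k+\sum_{j=0}^{s}\frac{h_j}{(2k)^{2j+1}}-(-1)^s\frac{b_{2k}}{2(2k)^{2s}}+\frac{\alpha_{2k}}{k^{2s+1}},$$ $$\sqrt{\mu_k}=k-\frac12+\sum_{j=0}^{s}\frac{g_j}{(2k-1)^{2j+1}}-(-1)^s\frac{b_{2k-1}}{2(2k-1)^{2s}}+\frac{\alpha_{2k-1}}{k^{2s+1}}.$$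 Here $\{\alpha_l\}_1^\infty\in\ell_2$, with the following uniform bounds: for every $R$ there is $C=C(m,R)$ such that the $\ell_2$-norm of $\{\alpha_{2k}\}_{k\ge1}$ is at most $C$ for all $\sigma$ with $\|q\|_{m-1}\le R$, and the $\ell_2$-norm of $\{\alpha_{2k-1}\}_{k\ge1}$ is at most $C$ for all $\sigma$ with $\|q\|_{m-1}\le R$ and $|\sigma(\pi)|\le R$ (in particular on the whole ball $\|q\|_{m-1}\le R$ under the normalization $\sigma(\pi)=0$). The functionals $h_j,g_j$ are continuous on $W_2^m[0,\pi]$, bounded on every ball and vanish at $\sigma=0$. Their linear parts (Fréchet derivatives at $\sigma=0$) are, for $j\le s-1$, and for $j=s$ too if $m=2s+1$, $$h_j^0(\sigma)=\frac{(-1)^{j}}{\pi}\bigl[\sigma^{(2j)}(\pi)-\sigma^{(2j)}(0)\bigr],\qquad g_j^0(\sigma)=\frac{(-1)^{j+1}}{\pi}\bigl[\sigma^{(2j)}(\pi)+\sigma^{(2j)}(0)\bigr];$$ if $m=2s$, then $h_s^0=g_s^0=0$. -/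

import Mathlib

open MeasureTheory

noncomputable section

namespace SturmLiouville

/-- Lebesgue measure on `[0, π]`. -/
abbrev mu0 : Measure ℝ := volume.restrict (Set.Icc 0 Real.pi)

/-- The complex Hilbert space `L₂[0, π]`. -/
abbrev L2 : Type := Lp ℂ 2 mu0

/-- `F ∈ W₁¹[0, π]` and `F' = f`: on `[0, π]` the function `F` is absolutely continuous, with the
integrable derivative `f`. -/
def HasACDeriv (F f : ℝ → ℂ) : Prop :=
  IntegrableOn f (Set.Icc 0 Real.pi) ∧
    ∀ x ∈ Set.Icc 0 Real.pi, F x = F 0 + ∫ t in (0 : ℝ)..x, f t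

theorem HasACDeriv.intervalIntegrable {F f : ℝ → ℂ} (h : HasACDeriv F f) {x : ℝ}
    (hx : x ∈ Set.Icc 0 Real.pi) : IntervalIntegrable f volume 0 x := by
  rw [intervalIntegrable_iff_integrableOn_Ioc_of_le hx.1]
  exact h.1.mono_set fun t ht => ⟨ht.1.le, ht.2.trans hx.2⟩

theorem HasACDeriv.add {F f G g : ℝ → ℂ} (hF : HasACDeriv F f) (hG : HasACDeriv G g) :
    HasACDeriv (F + G) (f + g) := by
  refine ⟨hF.1.add hG.1, fun x hx => ?_⟩
  have h := intervalIntegral.integral_add (hF.intervalIntegrable hx) (hG.intervalIntegrable hx)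
  simp only [Pi.add_apply]
  rw [h, hF.2 x hx, hG.2 x hx]
  ring

theorem HasACDeriv.smul {F f : ℝ → ℂ} (c : ℂ) (hF : HasACDeriv F f) :
    HasACDeriv (c • F) (c • f) := by
  refine ⟨hF.1.smul c, fun x hx => ?_⟩
  simp only [Pi.smul_apply]
  rw [intervalIntegral.integral_smul, hF.2 x hx, smul_add]

theorem HasACDeriv.zero : HasACDeriv 0 0 := by
  refine ⟨integrableOn_zero, fun x _ => ?_⟩
  simp

/-- A change of the derivative on a null set is immaterial. -/
theorem HasACDeriv.congr {F f g : ℝ → ℂ} (hF : HasACDeriv F f) (h : f =ᵐ[mu0] g) :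
    HasACDeriv F g := by
  refine ⟨(integrable_congr h).1 hF.1, fun x hx => ?_⟩
  rw [hF.2 x hx]
  congr 1
  rw [intervalIntegral.integral_of_le hx.1, intervalIntegral.integral_of_le hx.1]
  have hsub : Set.Ioc 0 x ⊆ Set.Icc 0 Real.pi := fun t ht => ⟨ht.1.le, ht.2.trans hx.2⟩
  exact integral_congr_ae (ae_restrict_of_ae_restrict_of_subset hsub h)

/-- The Sobolev space `W₂ᵐ[0, π]`, its element `σ` being recorded as the tuple
`(σ, σ', …, σ⁽ᵐ⁾)` of elements of `L₂[0, π]`. As a subspace of the `ℓ₂`-product it carries the norm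
`(∑_{j ≤ m} ‖σ⁽ʲ⁾‖²)^{1/2}`. -/
def Sobolev (m : ℕ) : Submodule ℂ (PiLp 2 fun _ : Fin (m + 1) => L2) where
  carrier := {u | ∀ j : Fin m, ∃ F : ℝ → ℂ, HasACDeriv F (u j.succ) ∧ u j.castSucc =ᵐ[mu0] F}
  zero_mem' := fun _ => ⟨0, HasACDeriv.zero.congr (Lp.coeFn_zero ℂ 2 mu0).symm,
    Lp.coeFn_zero ℂ 2 mu0⟩
  add_mem' := by
    intro u v hu hv j
    obtain ⟨F, hF, hF'⟩ := hu j
    obtain ⟨G, hG, hG'⟩ := hv j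
    exact ⟨F + G, (hF.add hG).congr (Lp.coeFn_add _ _).symm,
      (Lp.coeFn_add _ _).trans (hF'.add hG')⟩
  smul_mem' := by
    intro c u hu j
    obtain ⟨F, hF, hF'⟩ := hu j
    exact ⟨c • F, (hF.smul c).congr (Lp.coeFn_smul _ _).symm,
      (Lp.coeFn_smul _ _).trans (hF'.const_smul c)⟩

/-- The absolutely continuous representative on `[0, π]` of `σ⁽ⁱ⁾`, for `σ ∈ W₂ᵐ[0, π]` and
`i < m`. (It is not used for `i ≥ m`.) -/
def rep {m : ℕ} (σ : Sobolev m) (i : ℕ) : ℝ → ℂ :=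
  if h : i < m then (σ.2 ⟨i, h⟩).choose else 0

/-- For `q = σ'`, the derivative `q⁽ᵐ⁻¹⁾ = σ⁽ᵐ⁾ ∈ L₂[0, π]`. -/
def topDeriv {m : ℕ} (σ : Sobolev m) : L2 := σ.1 (Fin.last m)

/-- For `q = σ'`, the norm `‖q‖_{m-1} = (∑_{j=1}^{m} ‖σ⁽ʲ⁾‖²)^{1/2}` of `q` in
`W₂ᵐ⁻¹[0, π]`. -/
def potentialNorm {m : ℕ} (σ : Sobolev m) : ℝ := √(∑ j : Fin m, ‖σ.1 j.succ‖ ^ 2)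

/-- Graph of the operator `L y = -(y^{[1]})' - σ y^{[1]} - σ² y`, `y^{[1]} = y' - σ y`, in
`L₂[0, π]`, on the domain of all `y` with `y, y^{[1]} ∈ W₁¹[0, π]`, `L y ∈ L₂[0, π]`, `y(0) = 0`
and with the pair `(y(π), y^{[1]}(π))` in the subspace `B`. In the definition `y = Y`,
`y^{[1]} = Z`. -/
def slGraph (σ : ℝ → ℂ) (B : Submodule ℂ (ℂ × ℂ)) : Submodule ℂ (L2 × L2) where
  carrier := {p | ∃ Y Z : ℝ → ℂ, p.1 =ᵐ[mu0] Y ∧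
    HasACDeriv Y (fun x => Z x + σ x * Y x) ∧
    HasACDeriv Z (fun x => -(σ x * Z x) - σ x ^ 2 * Y x - p.2 x) ∧
    Y 0 = 0 ∧ (Y Real.pi, Z Real.pi) ∈ B}
  zero_mem' := by
    refine ⟨0, 0, Lp.coeFn_zero ℂ 2 mu0, HasACDeriv.zero.congr (.of_forall fun x => by simp),
      HasACDeriv.zero.congr ?_, rfl, B.zero_mem⟩
    filter_upwards [Lp.coeFn_zero ℂ 2 mu0] with x hx
    simp only [Prod.snd_zero, hx, Pi.zero_apply, mul_zero, neg_zero, sub_zero]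
  add_mem' := by
    rintro p q ⟨Y, Z, h1, h2, h3, h4, h5⟩ ⟨Y', Z', h1', h2', h3', h4', h5'⟩
    refine ⟨Y + Y', Z + Z', (Lp.coeFn_add _ _).trans (h1.add h1'),
      (h2.add h2').congr (.of_forall fun x => ?_), (h3.add h3').congr ?_,
      by simp [h4, h4'], B.add_mem h5 h5'⟩
    · simp only [Pi.add_apply]; ring
    · filter_upwards [Lp.coeFn_add p.2 q.2] with x hx
      simp only [Pi.add_apply, Prod.snd_add, hx]; ring
  smul_mem' := by
    rintro c p ⟨Y, Z, h1, h2, h3, h4, h5⟩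
    refine ⟨c • Y, c • Z, (Lp.coeFn_smul _ _).trans (h1.const_smul c),
      (h2.smul c).congr (.of_forall fun x => ?_), (h3.smul c).congr ?_,
      by simp [h4], B.smul_mem c h5⟩
    · simp only [Pi.smul_apply, smul_eq_mul]; ring
    · filter_upwards [Lp.coeFn_smul c p.2] with x hx
      simp only [Pi.smul_apply, Prod.smul_snd, smul_eq_mul, hx]; ring

/-- Graph of the Dirichlet operator `L_D`: `y(0) = y(π) = 0`. -/
def opD {m : ℕ} (σ : Sobolev m) : Submodule ℂ (L2 × L2) :=
  slGraph (rep σ 0) (LinearMap.ker (LinearMap.fst ℂ ℂ ℂ))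

/-- Graph of the Dirichlet–Neumann operator `L_DN`: `y(0) = y^{[1]}(π) = 0`. -/
def opDN {m : ℕ} (σ : Sobolev m) : Submodule ℂ (L2 × L2) :=
  slGraph (rep σ 0) (LinearMap.ker (LinearMap.snd ℂ ℂ ℂ))

/-- `ker (T - z)ⁿ` for the operator `T` with graph `Γ`: a vector `y` of the domain of `T` lies in
`ker (T - z)ⁿ⁺¹` iff `T y - z y` lies in `ker (T - z)ⁿ`. -/
def kerPow (Γ : Submodule ℂ (L2 × L2)) (z : ℂ) : ℕ → Submodule ℂ L2
  | 0 => ⊥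
  | n + 1 => (Γ ⊓ (kerPow Γ z n).comap
      (LinearMap.snd ℂ L2 L2 - z • LinearMap.fst ℂ L2 L2)).map (LinearMap.fst ℂ L2 L2)

/-- Algebraic multiplicity of `z`: the dimension of the root subspace `⋃ₙ ker (T - z)ⁿ`
(`0` iff `z` is not an eigenvalue). -/
def algMult (Γ : Submodule ℂ (L2 × L2)) (z : ℂ) : ℕ∞ :=
  Cardinal.toENat (Module.rank ℂ (⨆ n, kerPow Γ z n : Submodule ℂ L2))

/-- `(ev k)`, `k = 1, 2, …`, is the sequence of all eigenvalues of the operator with graph `Γ`,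
each one repeated according to its algebraic multiplicity, numbered in the order of nondecreasing
modulus or in the order of nondecreasing real part. -/
def IsEigenvalueSeq (Γ : Submodule ℂ (L2 × L2)) (ev : ℕ+ → ℂ) : Prop :=
  ((Monotone fun k => ‖ev k‖) ∨ Monotone fun k => (ev k).re) ∧
    ∀ z : ℂ, {k | ev k = z}.encard = algMult Γ z

/-- `(2/π) ∫₀^π f(t) cos(l t) dt`. -/
def cosCoeff (f : ℝ → ℂ) (l : ℝ) : ℂ :=
  2 / (Real.pi : ℂ) * ∫ t in (0 : ℝ)..Real.pi, f t * (Real.cos (l * t) : ℂ)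

/-- `(2/π) ∫₀^π f(t) sin(l t) dt`. -/
def sinCoeff (f : ℝ → ℂ) (l : ℝ) : ℂ :=
  2 / (Real.pi : ℂ) * ∫ t in (0 : ℝ)..Real.pi, f t * (Real.sin (l * t) : ℂ)

/-- A (nonlinear) functional that is continuous and bounded on every ball. -/
def IsContBdd {m : ℕ} (f : Sobolev m → ℂ) : Prop :=
  Continuous f ∧ ∀ R : ℝ, ∃ C : ℝ, ∀ σ, ‖σ‖ ≤ R → ‖f σ‖ ≤ C

/-- `f₀` is the linear part of the functional `f`: `f₀` is linear and continuous, and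
`f(σ) = f₀(σ) + o(‖σ‖)` as `σ → 0`, with `f(0) = 0`. -/
def HasLinearPart {m : ℕ} (f f₀ : Sobolev m → ℂ) : Prop :=
  f 0 = 0 ∧ ∃ A : Sobolev m →L[ℂ] ℂ, (∀ σ, A σ = f₀ σ) ∧ HasFDerivAt f A 0

/-- `(-1)ʲ π⁻¹ [σ⁽²ʲ⁾(π) - σ⁽²ʲ⁾(0)]`. -/
def hLin {m : ℕ} (j : ℕ) (σ : Sobolev m) : ℂ :=
  (-1) ^ j / (Real.pi : ℂ) * (rep σ (2 * j) Real.pi - rep σ (2 * j) 0)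

/-- `(-1)ʲ⁺¹ π⁻¹ [σ⁽²ʲ⁾(π) + σ⁽²ʲ⁾(0)]`. -/
def gLin {m : ℕ} (j : ℕ) (σ : Sobolev m) : ℂ :=
  (-1) ^ (j + 1) / (Real.pi : ℂ) * (rep σ (2 * j) Real.pi + rep σ (2 * j) 0)

end SturmLiouville

end

open SturmLiouville

noncomputable section

namespace SturmLiouville

open Set intervalIntegral

/-! ### Calculus of absolutely continuous functions on `[0, π]` -/

/-! Write m = M + 1. Since q = σ' is in L₂, both operators are -y'' + qy with ordinary derivatives.
Their eigenvalues, with algebraic multiplicity, are the zeros of an entire function Δ(z) = b₀ y(π,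
z) + b₁ y'(π, z), where y is the solution with y(0) = 0, y'(0) = 1 (`algMult_eq`). With z = ρ² this
function is close to a sine, so Rouché's theorem on circles halfway between the unperturbed
eigenvalues puts the square root of the k-th eigenvalue within O(1/k) of ν = k or ν = k - 1/2, for
both admissible numberings (`csqrt_eigenvalue_near`).

The precise asymptotics are a WKB expansion. Put ε = 1/(2iρ). Looking for solutions exp(iρx + ∫S)
leads to the Riccati equation S' + S/ε + S² = q, solved formally by a power series in ε whose
coefficients are differential polynomials in q. Cut off where the smoothness of q ends, it leaves a
defect r = ε^M ((-1)^M q^(M) + O(ε)) (`wkb_riccati`). The exact solution is exp(iρx + ∫S) u with u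
close to 1, and log u(π) is computed up to errors governed by ε and by Fourier integrals of r at
frequency 2ν (`OscData.log_u_pi_approx`). These integrals are square summable in k by Bessel's
inequality, which is where the ℓ₂ remainder comes from.

The solutions built for ρ and for -ρ differ by a multiple of y, so the boundary condition at π
becomes exp(2πiρ + θ - θ') = exp(2πiν), where θ and θ' are essentially one polynomial taken at ε and
at -ε (`PhaseRel`). Only odd powers of ε survive in θ - θ', together with a cosine or sine
coefficient of q^(M), according to the parity of M. The Dirichlet–Neumann condition adds the
logarithm of 1 + 2ε(S(π) - σ(π)) to the phase.

Solving this relation for ρ in powers of 1/(2ν) is a fixed-point iteration carried out on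
polynomials whose coefficients are functionals of σ (`exists_root_asymptotics`). The functionals
form an algebra of differentiable functions bounded in terms of a size; modulo those vanishing to
second order at σ = 0 the iteration changes nothing (`rootCoeff_sub_mem`), and the phase
coefficients reduce to boundary values of σ^(j) (`phaseEl_sub_mem`, `coeff_phaseDN_sub_mem`). This
gives the linear parts. -/

theorem zero_mem_Icc_pi : (0 : ℝ) ∈ Icc 0 Real.pi := ⟨le_rfl, Real.pi_pos.le⟩

theorem pi_mem_Icc_pi : Real.pi ∈ Icc 0 Real.pi := ⟨Real.pi_pos.le, le_rfl⟩

theorem intervalIntegrable_of_integrableOn {f : ℝ → ℂ} (h : IntegrableOn f (Icc 0 Real.pi)) {x : ℝ}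
    (hx : x ∈ Icc 0 Real.pi) : IntervalIntegrable f volume 0 x := by
  rw [intervalIntegrable_iff_integrableOn_Ioc_of_le hx.1]
  exact h.mono_set fun t ht => ⟨ht.1.le, ht.2.trans hx.2⟩

theorem continuousOn_integral {f : ℝ → ℂ} (h : IntegrableOn f (Icc 0 Real.pi)) :
    ContinuousOn (fun x => ∫ t in (0 : ℝ)..x, f t) (Icc 0 Real.pi) :=
  continuousOn_primitive_Icc h |>.congr fun x hx => by
    simp only [integral_of_le hx.1, integral_Icc_eq_integral_Ioc]

theorem HasACDeriv.continuousOn {F f : ℝ → ℂ} (h : HasACDeriv F f) :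
    ContinuousOn F (Icc 0 Real.pi) :=
  (continuousOn_const.add (continuousOn_integral h.1)).congr fun x hx => h.2 x hx

theorem hasACDeriv_integral {f : ℝ → ℂ} (c : ℂ) (h : IntegrableOn f (Icc 0 Real.pi)) :
    HasACDeriv (fun x => c + ∫ t in (0 : ℝ)..x, f t) f :=
  ⟨h, fun x _ => by simp⟩

theorem HasACDeriv.congr_left {F G f : ℝ → ℂ} (h : HasACDeriv F f) (hFG : EqOn F G (Icc 0 Real.pi)) :
    HasACDeriv G f :=
  ⟨h.1, fun x hx => by rw [← hFG hx, ← hFG zero_mem_Icc_pi, h.2 x hx]⟩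

theorem HasACDeriv.congr_right {F f g : ℝ → ℂ} (h : HasACDeriv F f)
    (hfg : EqOn f g (Icc 0 Real.pi)) : HasACDeriv F g :=
  h.congr ((ae_restrict_iff' measurableSet_Icc).2 (.of_forall hfg))

theorem HasACDeriv.const_mul {F f : ℝ → ℂ} (c : ℂ) (hF : HasACDeriv F f) :
    HasACDeriv (fun x => c * F x) (fun x => c * f x) := hF.smul c

theorem HasACDeriv.sub {F f G g : ℝ → ℂ} (hF : HasACDeriv F f) (hG : HasACDeriv G g) :
    HasACDeriv (fun x => F x - G x) (fun x => f x - g x) := by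
  have h := hF.add (hG.smul (-1))
  refine (h.congr_left fun x _ => ?_).congr_right fun x _ => ?_ <;> simp [sub_eq_add_neg]

theorem hasACDeriv_const (c : ℂ) : HasACDeriv (fun _ => c) (fun _ => 0) :=
  ⟨integrableOn_zero, fun x _ => by simp⟩

theorem HasACDeriv.integral_eq {F f : ℝ → ℂ} (h : HasACDeriv F f) {x : ℝ}
    (hx : x ∈ Icc 0 Real.pi) : ∫ t in (0 : ℝ)..x, f t = F x - F 0 := by
  rw [h.2 x hx]; ring

theorem HasACDeriv.eqOn_of_same {F G f : ℝ → ℂ} (hF : HasACDeriv F f) (hG : HasACDeriv G f)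
    (h0 : F 0 = G 0) : EqOn F G (Icc 0 Real.pi) := fun x hx => by
  rw [hF.2 x hx, hG.2 x hx, h0]

/-- Integration by parts on a triangle. -/
theorem integral_mul_integral_add {f g : ℝ → ℂ} {x : ℝ} (hx : 0 ≤ x)
    (hf : IntegrableOn f (Ioc 0 x)) (hg : IntegrableOn g (Ioc 0 x)) :
    (∫ t in (0 : ℝ)..x, f t * ∫ s in (0 : ℝ)..t, g s) +
      (∫ t in (0 : ℝ)..x, (∫ s in (0 : ℝ)..t, f s) * g t) =
    (∫ t in (0 : ℝ)..x, f t) * ∫ t in (0 : ℝ)..x, g t := by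
  set μ : Measure ℝ := volume.restrict (Ioc 0 x) with hμ
  have hprod : Integrable (fun z : ℝ × ℝ => f z.1 * g z.2) (μ.prod μ) := hf.mul_prod hg
  -- Both iterated integrals are integrals of f(t)g(s) over parts of the square cut along its
  -- diagonal; the two parts are complementary.
  have hA : MeasurableSet {z : ℝ × ℝ | z.2 ≤ z.1} := measurableSet_le measurable_snd measurable_fst
  have hB : MeasurableSet {z : ℝ × ℝ | z.2 ≤ z.1}ᶜ := hA.compl
  have e1 : (∫ t in (0 : ℝ)..x, f t * ∫ s in (0 : ℝ)..t, g s) =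
      ∫ z, {z : ℝ × ℝ | z.2 ≤ z.1}.indicator (fun z : ℝ × ℝ => f z.1 * g z.2) z ∂(μ.prod μ) := by
    rw [integral_prod _ (hprod.indicator hA), integral_of_le hx]
    refine setIntegral_congr_fun measurableSet_Ioc fun t ht => ?_
    have : ∀ s, {z : ℝ × ℝ | z.2 ≤ z.1}.indicator (fun z : ℝ × ℝ => f z.1 * g z.2) (t, s) =
        f t * (Iic t).indicator g s := fun s => by
      by_cases h : s ≤ t <;> simp [indicator, h]
    simp only [this]
    rw [MeasureTheory.integral_const_mul, integral_of_le ht.1.le,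
      MeasureTheory.integral_indicator measurableSet_Iic, Measure.restrict_restrict measurableSet_Iic]
    congr 3
    ext s
    simp only [mem_Ioc, mem_inter_iff, mem_Iic]
    exact ⟨fun h => ⟨h.2, h.1, h.2.trans ht.2⟩, fun h => ⟨h.2.1, h.1⟩⟩
  have e2 : (∫ t in (0 : ℝ)..x, (∫ s in (0 : ℝ)..t, f s) * g t) =
      ∫ z, {z : ℝ × ℝ | z.2 ≤ z.1}ᶜ.indicator (fun z : ℝ × ℝ => f z.1 * g z.2) z ∂(μ.prod μ) := by
    rw [integral_prod_symm _ (hprod.indicator hB), integral_of_le hx]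
    refine setIntegral_congr_fun measurableSet_Ioc fun t ht => ?_
    have : ∀ s, {z : ℝ × ℝ | z.2 ≤ z.1}ᶜ.indicator (fun z : ℝ × ℝ => f z.1 * g z.2) (s, t) =
        (Iio t).indicator f s * g t := fun s => by
      by_cases h : s < t
      · simp [indicator, h]
      · simp [indicator, h, not_lt.1 h]
    simp only [this]
    rw [MeasureTheory.integral_mul_const, integral_of_le ht.1.le,
      MeasureTheory.integral_indicator measurableSet_Iio,
      Measure.restrict_restrict measurableSet_Iio, integral_Ioc_eq_integral_Ioo]
    congr 3
    ext s
    simp only [mem_Ioc, mem_inter_iff, mem_Iio, mem_Ioo]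
    exact ⟨fun h => ⟨h.2, h.1, h.2.le.trans ht.2⟩, fun h => ⟨h.2.1, h.1⟩⟩
  rw [e1, e2, ← integral_add (hprod.indicator hA) (hprod.indicator hB), integral_of_le hx,
    integral_of_le hx, ← integral_prod_mul]
  congr 1
  ext z
  exact congrFun (indicator_self_add_compl _ _) z

/-- Rests on Fubini over a triangle rather than on pointwise differentiation, since f and g are
merely integrable. -/
theorem HasACDeriv.mul {F f G g : ℝ → ℂ} (hF : HasACDeriv F f) (hG : HasACDeriv G g) :
    HasACDeriv (fun x => F x * G x) (fun x => f x * G x + F x * g x) := by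
  have i1 := hF.1.mul_continuousOn hG.continuousOn isCompact_Icc
  have i2 := hG.1.continuousOn_mul hF.continuousOn isCompact_Icc
  refine ⟨i1.add i2, fun x hx => ?_⟩
  have hsub : Ioc 0 x ⊆ Icc 0 Real.pi := fun t ht => ⟨ht.1.le, ht.2.trans hx.2⟩
  have key := integral_mul_integral_add hx.1 (hF.1.mono_set hsub) (hG.1.mono_set hsub)
  have hmem : ∀ t ∈ uIcc 0 x, t ∈ Icc 0 Real.pi := fun t ht => by
    rw [uIcc_of_le hx.1] at ht; exact ⟨ht.1, ht.2.trans hx.2⟩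
  have e1 : (∫ t in (0 : ℝ)..x, f t * ∫ s in (0 : ℝ)..t, g s) =
      (∫ t in (0 : ℝ)..x, f t * G t) - (∫ t in (0 : ℝ)..x, f t) * G 0 := by
    rw [← intervalIntegral.integral_mul_const, ← intervalIntegral.integral_sub
      (intervalIntegrable_of_integrableOn i1 hx) ((hF.intervalIntegrable hx).mul_const _)]
    refine integral_congr fun t ht => ?_
    rw [hG.2 t (hmem t ht)]; ring
  have e2 : (∫ t in (0 : ℝ)..x, (∫ s in (0 : ℝ)..t, f s) * g t) =
      (∫ t in (0 : ℝ)..x, F t * g t) - F 0 * (∫ t in (0 : ℝ)..x, g t) := by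
    rw [← intervalIntegral.integral_const_mul, ← intervalIntegral.integral_sub
      (intervalIntegrable_of_integrableOn i2 hx) ((hG.intervalIntegrable hx).const_mul _)]
    refine integral_congr fun t ht => ?_
    rw [hF.2 t (hmem t ht)]; ring
  rw [intervalIntegral.integral_add (intervalIntegrable_of_integrableOn i1 hx)
    (intervalIntegrable_of_integrableOn i2 hx)]
  rw [e1, e2, hF.integral_eq hx, hG.integral_eq hx] at key
  linear_combination -key

theorem hasACDeriv_of_hasDerivAt_Ioo {F f : ℝ → ℂ} (hF : ContinuousOn F (Icc 0 Real.pi))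
    (hd : ∀ x ∈ Ioo 0 Real.pi, HasDerivAt F (f x) x) (hf : IntegrableOn f (Icc 0 Real.pi)) :
    HasACDeriv F f := by
  refine ⟨hf, fun x hx => ?_⟩
  rw [integral_eq_sub_of_hasDerivAt_of_le hx.1 (hF.mono (Icc_subset_Icc_right hx.2))
    (fun t ht => hd t ⟨ht.1, ht.2.trans_le hx.2⟩) (intervalIntegrable_of_integrableOn hf hx)]
  ring

theorem hasACDeriv_of_hasDerivAt {F f : ℝ → ℂ} (hd : ∀ x, HasDerivAt F (f x) x)
    (hf : Continuous f) : HasACDeriv F f :=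
  hasACDeriv_of_hasDerivAt_Ioo (fun x _ => (hd x).continuousAt.continuousWithinAt)
    (fun x _ => hd x) hf.continuousOn.integrableOn_Icc

theorem HasACDeriv.hasDerivAt {F f : ℝ → ℂ} (h : HasACDeriv F f)
    (hf : ContinuousOn f (Icc 0 Real.pi)) {x : ℝ} (hx : x ∈ Ioo 0 Real.pi) :
    HasDerivAt F (f x) x := by
  have hmem : Icc 0 Real.pi ∈ nhds x := Icc_mem_nhds hx.1 hx.2
  have h1 : HasDerivAt (fun y => F 0 + ∫ t in (0 : ℝ)..y, f t) (f x) x := by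
    refine (integral_hasDerivAt_right (h.intervalIntegrable (Ioo_subset_Icc_self hx)) ?_
      (hf.continuousAt hmem)).const_add _
    exact hf.stronglyMeasurableAtFilter_nhdsWithin measurableSet_Icc x |>.filter_mono
      (by rw [nhdsWithin_eq_nhds.2 hmem])
  refine h1.congr_of_eventuallyEq ?_
  filter_upwards [hmem] with y hy using h.2 y hy

theorem HasACDeriv.cexp {F f : ℝ → ℂ} (h : HasACDeriv F f) (hf : ContinuousOn f (Icc 0 Real.pi)) :
    HasACDeriv (fun x => Complex.exp (F x)) (fun x => Complex.exp (F x) * f x) :=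
  hasACDeriv_of_hasDerivAt_Ioo (Complex.continuous_exp.comp_continuousOn h.continuousOn)
    (fun _ hx => (h.hasDerivAt hf hx).cexp)
    ((Complex.continuous_exp.comp_continuousOn h.continuousOn).mul hf).integrableOn_Icc

/-- Two functions absolutely continuous on `[0, π]` that agree a.e. agree on `[0, π]`. -/
theorem eqOn_of_ae_eq {F G : ℝ → ℂ} (hF : ContinuousOn F (Icc 0 Real.pi))
    (hG : ContinuousOn G (Icc 0 Real.pi)) (h : F =ᵐ[mu0] G) : EqOn F G (Icc 0 Real.pi) :=
  Measure.eqOn_Icc_of_ae_eq (μ := volume) Real.pi_pos.ne h hF hG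

/-! ### Estimates of integrals -/

theorem norm_integral_le_of_mem {f : ℝ → ℂ} (hf : IntegrableOn f (Icc 0 Real.pi)) {x : ℝ}
    (hx : x ∈ Icc 0 Real.pi) :
    ‖∫ t in (0 : ℝ)..x, f t‖ ≤ ∫ t in Icc 0 Real.pi, ‖f t‖ := by
  rw [integral_of_le hx.1]
  refine (MeasureTheory.norm_integral_le_integral_norm _).trans ?_
  exact setIntegral_mono_set hf.norm (.of_forall fun _ => norm_nonneg _)
    (.of_forall fun t (ht : t ∈ Ioc 0 x) => ⟨ht.1.le, ht.2.trans hx.2⟩)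

/-- A Sobolev embedding: average |F(x)| ≤ |F(t)| + 2∫|f| over t. -/
theorem HasACDeriv.norm_le {F f : ℝ → ℂ} (h : HasACDeriv F f) {x : ℝ} (hx : x ∈ Icc 0 Real.pi) :
    Real.pi * ‖F x‖ ≤
      (∫ t in Icc 0 Real.pi, ‖F t‖) + 2 * Real.pi * ∫ t in Icc 0 Real.pi, ‖f t‖ := by
  have hF : IntegrableOn F (Icc 0 Real.pi) := h.continuousOn.integrableOn_Icc
  have key : ∀ t ∈ Icc 0 Real.pi, ‖F x‖ ≤ ‖F t‖ + 2 * ∫ t in Icc 0 Real.pi, ‖f t‖ := by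
    intro t ht
    have e : F x = F t + ((∫ t in (0 : ℝ)..x, f t) - ∫ s in (0 : ℝ)..t, f s) := by
      rw [h.2 x hx, h.2 t ht]; ring
    have := norm_integral_le_of_mem h.1 hx
    have := norm_integral_le_of_mem h.1 ht
    have := norm_sub_le (∫ t in (0 : ℝ)..x, f t) (∫ s in (0 : ℝ)..t, f s)
    have := norm_add_le (F t) ((∫ t in (0 : ℝ)..x, f t) - ∫ s in (0 : ℝ)..t, f s)
    rw [← e] at this
    linarith
  have hc : ∀ c : ℝ, ∫ _ in Icc 0 Real.pi, c = Real.pi * c := fun c => by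
    simp [Real.pi_pos.le]
  have hk : ∀ {c : ℝ}, IntegrableOn (fun _ => c) (Icc 0 Real.pi) := continuousOn_const.integrableOn_Icc
  calc Real.pi * ‖F x‖ = ∫ t in Icc 0 Real.pi, ‖F x‖ := (hc _).symm
    _ ≤ ∫ t in Icc 0 Real.pi, (‖F t‖ + 2 * ∫ t in Icc 0 Real.pi, ‖f t‖) :=
      setIntegral_mono_on hk (hF.norm.add hk) measurableSet_Icc key
    _ = _ := by
      rw [MeasureTheory.integral_add hF.norm hk, hc]; ring

/-- The `L₂[0, π]` norm of a function. -/
def l2norm (f : ℝ → ℂ) : ℝ := (eLpNorm f 2 mu0).toReal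

theorem l2norm_nonneg (f : ℝ → ℂ) : 0 ≤ l2norm f := ENNReal.toReal_nonneg

theorem l2norm_coe (f : L2) : l2norm f = ‖f‖ := (Lp.norm_def f).symm

theorem l2norm_congr {f g : ℝ → ℂ} (h : f =ᵐ[mu0] g) : l2norm f = l2norm g := by
  rw [l2norm, l2norm, eLpNorm_congr_ae h]

theorem l2norm_sq {f : ℝ → ℂ} (hf : MemLp f 2 mu0) :
    l2norm f ^ 2 = ∫ t in Icc 0 Real.pi, ‖f t‖ ^ 2 := by
  rw [l2norm, hf.eLpNorm_eq_integral_rpow_norm (by norm_num) (by norm_num), ENNReal.toReal_ofReal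
    (by positivity), ← Real.rpow_natCast, ← Real.rpow_mul (by positivity)]
  norm_num

theorem l2norm_add_le {f g : ℝ → ℂ} (hf : MemLp f 2 mu0) (hg : MemLp g 2 mu0) :
    l2norm (fun x => f x + g x) ≤ l2norm f + l2norm g := by
  rw [l2norm, l2norm, l2norm, ← ENNReal.toReal_add hf.2.ne hg.2.ne]
  exact ENNReal.toReal_mono (ENNReal.add_ne_top.2 ⟨hf.2.ne, hg.2.ne⟩)
    (eLpNorm_add_le hf.1 hg.1 (by norm_num))

theorem l2norm_const_mul (c : ℂ) (f : ℝ → ℂ) : l2norm (fun x => c * f x) = ‖c‖ * l2norm f := by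
  have := eLpNorm_const_smul c f 2 mu0
  rw [l2norm, l2norm, show (fun x => c * f x) = c • f from rfl, this, ENNReal.toReal_mul]
  simp

/-- The true factor is √π, rounded up to 2. -/
theorem l2norm_le_of_bound {f : ℝ → ℂ} {M : ℝ} (hM : 0 ≤ M)
    (h : ∀ x ∈ Icc 0 Real.pi, ‖f x‖ ≤ M) : l2norm f ≤ 2 * M := by
  have h1 : ∀ᵐ x ∂mu0, ‖f x‖ ≤ M := (ae_restrict_iff' measurableSet_Icc).2 (.of_forall h)
  have h2 := eLpNorm_le_of_ae_bound (p := 2) h1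
  have h3 : mu0 univ = ENNReal.ofReal Real.pi := by simp
  rw [h3] at h2
  refine (ENNReal.toReal_mono (by finiteness) h2).trans ?_
  rw [ENNReal.toReal_mul, ← ENNReal.toReal_rpow, ENNReal.toReal_ofReal Real.pi_pos.le,
    ENNReal.toReal_ofReal hM]
  refine mul_le_mul_of_nonneg_right ?_ hM
  norm_num
  rw [← Real.sqrt_eq_rpow, Real.sqrt_le_left (by norm_num)]
  linarith [Real.pi_le_four]

theorem memLp_of_continuousOn {f : ℝ → ℂ} (h : ContinuousOn f (Icc 0 Real.pi)) :
    MemLp f 2 mu0 := by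
  obtain ⟨M, hM⟩ := isCompact_Icc.exists_bound_of_continuousOn h
  exact MemLp.of_bound (h.aestronglyMeasurable measurableSet_Icc) M
    ((ae_restrict_iff' measurableSet_Icc).2 (.of_forall hM))

theorem integrableOn_of_memLp {f : ℝ → ℂ} (h : MemLp f 2 mu0) : IntegrableOn f (Icc 0 Real.pi) :=
  h.integrable (by norm_num)

theorem integral_norm_mul_le {f g : ℝ → ℂ} (hf : MemLp f 2 mu0) (hg : MemLp g 2 mu0) :
    ∫ t in Icc 0 Real.pi, ‖f t‖ * ‖g t‖ ≤ l2norm f * l2norm g := by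
  have h := integral_mul_norm_le_Lp_mul_Lq (μ := mu0) Real.HolderConjugate.two_two
    (f := f) (g := g) (by simpa using hf) (by simpa using hg)
  have e : ∀ {u : ℝ → ℂ}, MemLp u 2 mu0 → (∫ a, ‖u a‖ ^ (2 : ℝ) ∂mu0) ^ (1 / (2 : ℝ)) = l2norm u := by
    intro u hu
    rw [← Real.sqrt_eq_rpow, ← Real.sqrt_sq (l2norm_nonneg u), l2norm_sq hu]
    simp
  rwa [e hf, e hg] at h

theorem integral_norm_le_l2norm {f : ℝ → ℂ} (hf : MemLp f 2 mu0) :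
    ∫ t in Icc 0 Real.pi, ‖f t‖ ≤ 2 * l2norm f := by
  have h := integral_norm_mul_le hf (memLp_of_continuousOn (f := fun _ => (1 : ℂ)) continuousOn_const)
  have h1 : l2norm (fun _ => (1 : ℂ)) ≤ 2 * 1 := l2norm_le_of_bound zero_le_one (by simp)
  simp only [norm_one, mul_one] at h
  nlinarith [l2norm_nonneg f]

theorem memLp_mul_continuousOn {f g : ℝ → ℂ} (hf : MemLp f 2 mu0)
    (hg : ContinuousOn g (Icc 0 Real.pi)) : MemLp (fun x => f x * g x) 2 mu0 := by
  obtain ⟨M, hM⟩ := isCompact_Icc.exists_bound_of_continuousOn hg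
  exact MemLp.of_le_mul hf (c := M) (hf.1.mul (hg.aestronglyMeasurable measurableSet_Icc))
    ((ae_restrict_iff' measurableSet_Icc).2 (.of_forall fun x hx => by
      rw [norm_mul, mul_comm]; exact mul_le_mul_of_nonneg_right (hM x hx) (norm_nonneg _)))

/-! ### Representatives of Sobolev functions -/

section Rep

variable {m : ℕ}

theorem rep_spec (σ : Sobolev m) {i : ℕ} (hi : i < m) :
    HasACDeriv (rep σ i) (σ.1 (Fin.succ ⟨i, hi⟩)) ∧
      σ.1 (Fin.castSucc ⟨i, hi⟩) =ᵐ[mu0] rep σ i := by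
  rw [rep, dif_pos hi]
  exact (σ.2 ⟨i, hi⟩).choose_spec

theorem hasACDeriv_rep (σ : Sobolev m) {i : ℕ} (hi : i + 1 < m) :
    HasACDeriv (rep σ i) (rep σ (i + 1)) :=
  (rep_spec σ (Nat.lt_of_succ_lt hi)).1.congr (rep_spec σ hi).2

theorem hasACDeriv_rep_last (σ : Sobolev m) {i : ℕ} (hi : i + 1 = m) :
    HasACDeriv (rep σ i) (topDeriv σ) := by
  subst hi
  exact (rep_spec σ (Nat.lt_succ_self i)).1

theorem memLp_topDeriv (σ : Sobolev m) : MemLp (topDeriv σ) 2 mu0 := Lp.memLp _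

theorem norm_le_potentialNorm (σ : Sobolev m) (j : Fin m) : ‖σ.1 j.succ‖ ≤ potentialNorm σ := by
  refine Real.le_sqrt_of_sq_le ?_
  exact Finset.single_le_sum (f := fun j : Fin m => ‖σ.1 j.succ‖ ^ 2) (fun _ _ => by positivity)
    (Finset.mem_univ j)

theorem potentialNorm_nonneg (σ : Sobolev m) : 0 ≤ potentialNorm σ := Real.sqrt_nonneg _

theorem potentialNorm_le (σ : Sobolev m) : potentialNorm σ ≤ ‖σ‖ := by
  rw [← Submodule.norm_coe, PiLp.norm_eq_of_L2]
  refine Real.sqrt_le_sqrt ?_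
  rw [Fin.sum_univ_succ (fun j : Fin (m + 1) => ‖σ.1 j‖ ^ 2)]
  linarith [sq_nonneg ‖σ.1 0‖]

theorem norm_apply_le (σ : Sobolev m) (j : Fin (m + 1)) : ‖σ.1 j‖ ≤ ‖σ‖ :=
  PiLp.norm_apply_le σ.1 j

theorem norm_topDeriv_le (hm : 0 < m) (σ : Sobolev m) : l2norm (topDeriv σ) ≤ potentialNorm σ := by
  obtain ⟨k, rfl⟩ := Nat.exists_eq_succ_of_ne_zero hm.ne'
  rw [l2norm_coe]
  exact norm_le_potentialNorm σ (Fin.last k)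

/-- The two derivatives are kept apart so that for positive order only derivatives of q occur, and
`norm_rep_succ_le` can use `potentialNorm` alone. -/
theorem norm_rep_le_add (σ : Sobolev m) {i : ℕ} (hi : i < m) {x : ℝ} (hx : x ∈ Icc 0 Real.pi) :
    ‖rep σ i x‖ ≤ ‖σ.1 (Fin.castSucc ⟨i, hi⟩)‖ + 4 * ‖σ.1 (Fin.succ ⟨i, hi⟩)‖ := by
  obtain ⟨h1, h2⟩ := rep_spec σ hi
  have a := h1.norm_le hx
  have b := integral_norm_le_l2norm (memLp_of_continuousOn h1.continuousOn)
  have c := integral_norm_le_l2norm (Lp.memLp (σ.1 (Fin.succ ⟨i, hi⟩)))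
  rw [← l2norm_congr h2, l2norm_coe] at b
  rw [l2norm_coe] at c
  have hp := Real.pi_gt_three
  have h3 : Real.pi * ‖rep σ i x‖ ≤
      Real.pi * (‖σ.1 (Fin.castSucc ⟨i, hi⟩)‖ + 4 * ‖σ.1 (Fin.succ ⟨i, hi⟩)‖) := by
    nlinarith [norm_nonneg (σ.1 (Fin.castSucc ⟨i, hi⟩)), norm_nonneg (σ.1 (Fin.succ ⟨i, hi⟩))]
  exact le_of_mul_le_mul_left h3 Real.pi_pos

theorem norm_rep_le (σ : Sobolev m) {i : ℕ} (hi : i < m) {x : ℝ} (hx : x ∈ Icc 0 Real.pi) :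
    ‖rep σ i x‖ ≤ 5 * ‖σ‖ := by
  linarith [norm_rep_le_add σ hi hx, norm_apply_le σ (Fin.castSucc ⟨i, hi⟩),
    norm_apply_le σ (Fin.succ ⟨i, hi⟩)]

theorem norm_rep_succ_le (σ : Sobolev m) {i : ℕ} (hi : i + 1 < m) {x : ℝ}
    (hx : x ∈ Icc 0 Real.pi) : ‖rep σ (i + 1) x‖ ≤ 5 * potentialNorm σ := by
  linarith [norm_rep_le_add σ hi hx, norm_le_potentialNorm σ ⟨i, Nat.lt_of_succ_lt hi⟩,
    norm_le_potentialNorm σ ⟨i + 1, hi⟩,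
    show ‖σ.1 (Fin.castSucc ⟨i + 1, hi⟩)‖ = ‖σ.1 (Fin.succ ⟨i, Nat.lt_of_succ_lt hi⟩)‖ from rfl]

theorem continuousOn_rep (σ : Sobolev m) {i : ℕ} (hi : i < m) :
    ContinuousOn (rep σ i) (Icc 0 Real.pi) := (rep_spec σ hi).1.continuousOn

/-- The representative is an arbitrary choice, but continuous functions that agree almost everywhere
agree on the whole interval, so the choice is linear there. -/
theorem rep_add (σ τ : Sobolev m) {i : ℕ} (hi : i < m) {x : ℝ} (hx : x ∈ Icc 0 Real.pi) :
    rep (σ + τ) i x = rep σ i x + rep τ i x := by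
  refine eqOn_of_ae_eq (continuousOn_rep _ hi)
    ((continuousOn_rep σ hi).add (continuousOn_rep τ hi)) ?_ hx
  filter_upwards [(rep_spec σ hi).2, (rep_spec τ hi).2, (rep_spec (σ + τ) hi).2,
    Lp.coeFn_add (σ.1 (Fin.castSucc ⟨i, hi⟩)) (τ.1 (Fin.castSucc ⟨i, hi⟩))] with x h1 h2 h3 h4
  simp only [Pi.add_apply] at h4 ⊢
  rw [← h3, ← h1, ← h2, ← h4]
  rfl

theorem rep_smul (c : ℂ) (σ : Sobolev m) {i : ℕ} (hi : i < m) {x : ℝ} (hx : x ∈ Icc 0 Real.pi) :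
    rep (c • σ) i x = c * rep σ i x := by
  refine eqOn_of_ae_eq (continuousOn_rep _ hi)
    (continuousOn_const.mul (continuousOn_rep σ hi)) ?_ hx
  filter_upwards [(rep_spec σ hi).2, (rep_spec (c • σ) hi).2,
    Lp.coeFn_smul c (σ.1 (Fin.castSucc ⟨i, hi⟩))] with x h1 h3 h4
  simp only [Pi.smul_apply, smul_eq_mul, Pi.mul_apply] at h4 ⊢
  rw [← h3, ← h1, ← h4]
  rfl

end Rep

end SturmLiouville

end

noncomputable section

namespace SturmLiouville

open Set intervalIntegral

/-! ### Volterra operators on `C[0, π]` -/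

/-- The space `C[0, π]`. -/
def CI : Type := C(Icc (0 : ℝ) Real.pi, ℂ)

instance : NormedCommRing CI := inferInstanceAs (NormedCommRing C(Icc (0 : ℝ) Real.pi, ℂ))

instance : NormedAlgebra ℂ CI := inferInstanceAs (NormedAlgebra ℂ C(Icc (0 : ℝ) Real.pi, ℂ))

instance : CompleteSpace CI := inferInstanceAs (CompleteSpace C(Icc (0 : ℝ) Real.pi, ℂ))

/-- Extension of a function from `[0, π]` to the line by constants. -/
def ext (Y : CI) : ℝ → ℂ := IccExtend Real.pi_pos.le (ContinuousMap.toFun Y)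

theorem continuous_ext (Y : CI) : Continuous (ext Y) :=
  (ContinuousMap.continuous Y).Icc_extend'

theorem ext_apply (Y : CI) {x : ℝ} (hx : x ∈ Icc 0 Real.pi) : ext Y x = ContinuousMap.toFun Y ⟨x, hx⟩ :=
  IccExtend_of_mem _ _ hx

theorem norm_ext_le (Y : CI) (x : ℝ) : ‖ext Y x‖ ≤ ‖Y‖ :=
  ContinuousMap.norm_coe_le_norm (E := ℂ) (α := Icc (0 : ℝ) Real.pi) Y _

theorem norm_le_of_ext {Y : CI} {C : ℝ} (hC : 0 ≤ C)
    (h : ∀ x ∈ Icc 0 Real.pi, ‖ext Y x‖ ≤ C) : ‖Y‖ ≤ C := by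
  refine (ContinuousMap.norm_le (E := ℂ) (α := Icc (0 : ℝ) Real.pi) Y hC).2 ?_
  rintro ⟨x, hx⟩
  have := h x hx
  rwa [ext_apply Y hx] at this

@[simp] theorem ext_mul (Y Z : CI) (x : ℝ) : ext (Y * Z) x = ext Y x * ext Z x := rfl
@[simp] theorem ext_add (Y Z : CI) (x : ℝ) : ext (Y + Z) x = ext Y x + ext Z x := rfl
@[simp] theorem ext_sub (Y Z : CI) (x : ℝ) : ext (Y - Z) x = ext Y x - ext Z x := rfl
@[simp] theorem ext_smul (c : ℂ) (Y : CI) (x : ℝ) : ext (c • Y) x = c * ext Y x := rfl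
@[simp] theorem ext_one (x : ℝ) : ext 1 x = 1 := rfl
@[simp] theorem ext_zero (x : ℝ) : ext 0 x = 0 := rfl

theorem ext_injective {Y Z : CI} (h : EqOn (ext Y) (ext Z) (Icc 0 Real.pi)) : Y = Z := by
  refine ContinuousMap.ext (X := Icc (0 : ℝ) Real.pi) (Y := ℂ) ?_
  rintro ⟨x, hx⟩
  have := h hx
  rwa [ext_apply Y hx, ext_apply Z hx] at this

/-- Restriction to `[0, π]` of a function continuous there. -/
def restr (F : ℝ → ℂ) (hF : ContinuousOn F (Icc 0 Real.pi)) : CI :=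
  ⟨fun x => F x, continuousOn_iff_continuous_domRestrict.1 hF⟩

theorem ext_restr {F : ℝ → ℂ} (hF : ContinuousOn F (Icc 0 Real.pi)) {x : ℝ}
    (hx : x ∈ Icc 0 Real.pi) : ext (restr F hF) x = F x := ext_apply _ hx

theorem integrableOn_mul_ext {p : ℝ → ℂ} (hp : IntegrableOn p (Icc 0 Real.pi)) (Y : CI) :
    IntegrableOn (fun t => p t * ext Y t) (Icc 0 Real.pi) :=
  hp.mul_continuousOn (continuous_ext Y).continuousOn isCompact_Icc

/-- The Volterra operator `Y ↦ ∫₀ˣ p Y`. -/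
def volt {p : ℝ → ℂ} (hp : IntegrableOn p (Icc 0 Real.pi)) : CI →L[ℂ] CI :=
  LinearMap.mkContinuous
    { toFun := fun Y => restr _ (continuousOn_integral (integrableOn_mul_ext hp Y))
      map_add' := fun Y Z => by
        refine ext_injective fun x hx => ?_
        rw [ext_add, ext_restr _ hx, ext_restr _ hx, ext_restr _ hx,
          ← intervalIntegral.integral_add
          (intervalIntegrable_of_integrableOn (integrableOn_mul_ext hp Y) hx)
          (intervalIntegrable_of_integrableOn (integrableOn_mul_ext hp Z) hx)]
        exact integral_congr fun t _ => by simp only [ext_add]; ring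
      map_smul' := fun c Y => by
        refine ext_injective fun x hx => ?_
        rw [RingHom.id_apply, ext_smul, ext_restr _ hx, ext_restr _ hx,
          ← intervalIntegral.integral_const_mul]
        exact integral_congr fun t _ => by simp only [ext_smul]; ring }
    (∫ t in Icc 0 Real.pi, ‖p t‖) fun Y => by
      refine norm_le_of_ext (by positivity) fun x hx => ?_
      rw [LinearMap.coe_mk, AddHom.coe_mk, ext_restr _ hx]
      refine (norm_integral_le_of_mem (integrableOn_mul_ext hp Y) hx).trans ?_
      rw [← MeasureTheory.integral_mul_const]
      refine MeasureTheory.integral_mono (integrableOn_mul_ext hp Y).norm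
        (hp.norm.mul_const _) fun t => ?_
      simp only [norm_mul]
      exact mul_le_mul_of_nonneg_left (norm_ext_le _ _) (norm_nonneg _)

theorem ext_volt {p : ℝ → ℂ} (hp : IntegrableOn p (Icc 0 Real.pi)) (Y : CI) {x : ℝ}
    (hx : x ∈ Icc 0 Real.pi) : ext (volt hp Y) x = ∫ t in (0 : ℝ)..x, p t * ext Y t :=
  ext_restr (continuousOn_integral (integrableOn_mul_ext hp Y)) hx

theorem hasACDeriv_volt {p : ℝ → ℂ} (hp : IntegrableOn p (Icc 0 Real.pi)) (Y : CI) :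
    HasACDeriv (ext (volt hp Y)) (fun t => p t * ext Y t) :=
  ⟨integrableOn_mul_ext hp Y, fun x hx => by
    rw [ext_volt hp Y hx, ext_volt hp Y zero_mem_Icc_pi]; simp⟩

theorem ext_volt_zero {p : ℝ → ℂ} (hp : IntegrableOn p (Icc 0 Real.pi)) (Y : CI) :
    ext (volt hp Y) 0 = 0 := by rw [ext_volt hp Y zero_mem_Icc_pi]; simp

/-- Cauchy–Schwarz: the L₂ norm of e^{ct} on [0, x] is at most e^{cx}/√(2c). Hence Volterra
operators are small in a norm weighted by e^{-cx} with large c. -/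
theorem norm_volt_le_exp {p : ℝ → ℂ} (hp : MemLp p 2 mu0) {Y : CI} {A c : ℝ} (hc : 0 < c)
    (hA : 0 ≤ A) (h : ∀ t ∈ Icc 0 Real.pi, ‖ext Y t‖ ≤ A * Real.exp (c * t)) :
    ∀ x ∈ Icc 0 Real.pi, ‖ext (volt (integrableOn_of_memLp hp) Y) x‖ ≤
      A * (l2norm p / √(2 * c)) * Real.exp (c * x) := by
  intro x hx
  have hsub : Ioc 0 x ⊆ Icc 0 Real.pi := fun t ht => ⟨ht.1.le, ht.2.trans hx.2⟩
  set g : ℝ → ℂ := (Ioc 0 x).indicator fun t => ((A * Real.exp (c * t) : ℝ) : ℂ) with hg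
  have hgm : MemLp g 2 mu0 := by
    refine MemLp.indicator measurableSet_Ioc (memLp_of_continuousOn ?_)
    fun_prop
  have hgn : l2norm g ≤ A * (1 / √(2 * c)) * Real.exp (c * x) := by
    refine abs_le_of_sq_le_sq' ?_ (by positivity) |>.2
    rw [l2norm_sq hgm]
    have e1 : ∫ t in Icc 0 Real.pi, ‖g t‖ ^ 2 = ∫ t in (0 : ℝ)..x, A ^ 2 * Real.exp (2 * c * t) := by
      rw [integral_of_le hx.1, ← Measure.restrict_restrict_of_subset hsub,
        ← MeasureTheory.integral_indicator measurableSet_Ioc]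
      congr 1; ext t
      by_cases ht : t ∈ Ioc 0 x
      · simp only [hg, indicator_of_mem ht, Complex.norm_real, norm_mul, Real.norm_eq_abs,
          abs_of_nonneg hA, Real.abs_exp, mul_pow, ← Real.exp_nat_mul]
        congr 2; push_cast; ring
      · simp [hg, indicator_of_notMem ht]
    rw [e1, intervalIntegral.integral_const_mul, integral_comp_mul_left (fun t => Real.exp t)
      (by positivity), integral_exp]
    have : (A * (1 / √(2 * c)) * Real.exp (c * x)) ^ 2
        = A ^ 2 * ((2 * c)⁻¹ * Real.exp (2 * c * x)) := by
      rw [mul_pow, mul_pow, div_pow, Real.sq_sqrt (by positivity), ← Real.exp_nat_mul]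
      push_cast
      rw [show 2 * (c * x) = 2 * c * x by ring]; ring
    rw [this, smul_eq_mul]
    gcongr
    simp
  rw [ext_volt _ _ hx, integral_of_le hx.1]
  refine (MeasureTheory.norm_integral_le_integral_norm _).trans ?_
  have e2 : ∫ t in Ioc 0 x, ‖p t * ext Y t‖ ≤ ∫ t in Icc 0 Real.pi, ‖p t‖ * ‖g t‖ := by
    have i1 : Integrable (fun t => ‖p t‖ * ‖g t‖) mu0 := by
      have := (hp.integrable_mul hgm).norm
      refine this.congr (.of_forall fun t => by simp)
    refine le_trans ?_ (setIntegral_mono_set i1 (.of_forall fun t => by positivity)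
      (.of_forall hsub))
    refine setIntegral_mono_on ?_ (IntegrableOn.mono_set i1 hsub) measurableSet_Ioc fun t ht => ?_
    · exact ((integrableOn_mul_ext (integrableOn_of_memLp hp) Y).mono_set hsub).norm
    · rw [norm_mul]
      refine mul_le_mul_of_nonneg_left ?_ (norm_nonneg _)
      rw [hg, indicator_of_mem ht, Complex.norm_real, Real.norm_eq_abs, abs_of_nonneg (by positivity)]
      exact h t (hsub ht)
  refine e2.trans ((integral_norm_mul_le hp hgm).trans ?_)
  calc l2norm p * l2norm g ≤ l2norm p * (A * (1 / √(2 * c)) * Real.exp (c * x)) :=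
        mul_le_mul_of_nonneg_left hgn (l2norm_nonneg p)
    _ = _ := by ring

theorem memLp_one : MemLp (fun _ : ℝ => (1 : ℂ)) 2 mu0 := memLp_of_continuousOn continuousOn_const

/-- Integration `Y ↦ ∫₀ˣ Y`. -/
def prim : CI →L[ℂ] CI := volt (integrableOn_of_memLp memLp_one)

theorem hasACDeriv_prim (Y : CI) : HasACDeriv (ext (prim Y)) (ext Y) :=
  (hasACDeriv_volt _ Y).congr_right fun x _ => by simp

theorem ext_prim_zero (Y : CI) : ext (prim Y) 0 = 0 := ext_volt_zero _ Y

theorem norm_prim_le_exp {Y : CI} {A c : ℝ} (hc : 0 < c)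
    (hA : 0 ≤ A) (h : ∀ t ∈ Icc 0 Real.pi, ‖ext Y t‖ ≤ A * Real.exp (c * t)) :
    ∀ x ∈ Icc 0 Real.pi, ‖ext (prim Y) x‖ ≤ A * (2 / √(2 * c)) * Real.exp (c * x) := by
  intro x hx
  refine (norm_volt_le_exp memLp_one hc hA h x hx).trans ?_
  have : l2norm (fun _ : ℝ => (1 : ℂ)) ≤ 2 * 1 := l2norm_le_of_bound zero_le_one (by simp)
  gcongr
  linarith

/-! ### Solutions of -y'' + qy - zy = g -/

section Equation

variable {q : ℝ → ℂ} (hq : MemLp q 2 mu0)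

/-- The operator `Y ↦ ∫₀ˣ (q - z) Y`. -/
def voltSub (z : ℂ) : CI →L[ℂ] CI := volt (integrableOn_of_memLp hq) - z • prim

theorem hasACDeriv_voltSub (z : ℂ) (Y : CI) :
    HasACDeriv (ext (voltSub hq z Y)) (fun x => (q x - z) * ext Y x) := by
  have h := (hasACDeriv_volt (integrableOn_of_memLp hq) Y).sub ((hasACDeriv_prim Y).const_mul z)
  exact (h.congr_left fun x _ => rfl).congr_right fun x _ => by ring

theorem ext_voltSub_zero (z : ℂ) (Y : CI) : ext (voltSub hq z Y) 0 = 0 := by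
  have : ext (voltSub hq z Y) 0
      = ext (volt (integrableOn_of_memLp hq) Y) 0 - z * ext (prim Y) 0 := rfl
  rw [this, ext_volt_zero, ext_prim_zero]; simp

/-- Each of the two integrations contributes a factor 1/√(2c) in the weighted norm; c is chosen so
that one application of the composition gains at least 1/2. -/
theorem norm_pow_le_exp (z : ℂ) {c : ℝ} (hc : c = 2 * (l2norm q + 2 * ‖z‖) + 1) (n : ℕ) (Y : CI) :
    ∀ x ∈ Icc 0 Real.pi,
      ‖ext (((prim.comp (voltSub hq z)) ^ n) Y) x‖ ≤ ‖Y‖ * (1 / 2) ^ n * Real.exp (c * x) := by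
  have hl := l2norm_nonneg q
  have hz := norm_nonneg z
  have hc0 : 0 < c := by rw [hc]; positivity
  induction n with
  | zero =>
    intro x hx
    simp only [pow_zero, one_apply_eq_self, mul_one]
    refine (norm_ext_le Y x).trans (le_mul_of_one_le_right (norm_nonneg _) ?_)
    exact Real.one_le_exp (mul_nonneg hc0.le hx.1)
  | succ n ih =>
    set Z := ((prim.comp (voltSub hq z)) ^ n) Y
    have hA : 0 ≤ ‖Y‖ * (1 / 2) ^ n := by positivity
    have h1 := norm_volt_le_exp hq hc0 hA ih
    have h2 := norm_prim_le_exp hc0 hA ih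
    have h3 : ∀ x ∈ Icc 0 Real.pi, ‖ext (voltSub hq z Z) x‖ ≤
        ‖Y‖ * (1 / 2) ^ n * ((l2norm q + 2 * ‖z‖) / √(2 * c)) * Real.exp (c * x) := by
      intro x hx
      have e : ext (voltSub hq z Z) x
        = ext (volt (integrableOn_of_memLp hq) Z) x - z * ext (prim Z) x := rfl
      rw [e]
      refine (norm_sub_le _ _).trans ?_
      rw [norm_mul]
      have := h1 x hx
      have := mul_le_mul_of_nonneg_left (h2 x hx) hz
      calc _ ≤ _ := add_le_add (h1 x hx) this
        _ = _ := by ring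
    intro x hx
    rw [pow_succ']
    refine (norm_prim_le_exp hc0 (by positivity) h3 x hx).trans ?_
    refine mul_le_mul_of_nonneg_right ?_ (Real.exp_nonneg _)
    rw [pow_succ, mul_assoc, ← mul_assoc ‖Y‖]
    refine mul_le_mul_of_nonneg_left ?_ hA
    rw [div_mul_div_comm, Real.mul_self_sqrt (by positivity), div_le_div_iff₀ (by positivity)
      (by norm_num)]
    linarith

/-- Returning to the sup norm costs a factor e^{cπ}, which 2^{-n} beats for large n, so a power Tⁿ
is a contraction. Then 1 - Tⁿ is invertible, and so is its factor 1 - T. -/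
theorem isUnit_one_sub (z : ℂ) : IsUnit (1 - prim.comp (voltSub hq z) : CI →L[ℂ] CI) := by
  set T : CI →L[ℂ] CI := prim.comp (voltSub hq z) with hT
  obtain ⟨c, hc⟩ : ∃ c : ℝ, c = 2 * (l2norm q + 2 * ‖z‖) + 1 := ⟨_, rfl⟩
  have hc0 : 0 ≤ c := by
    have := l2norm_nonneg q
    rw [hc]; positivity
  obtain ⟨n, hn⟩ := exists_pow_lt_of_lt_one (Real.exp_pos (-(c * Real.pi)))
    (show (1 / 2 : ℝ) < 1 by norm_num)
  have hTn : ‖T ^ n‖ < 1 := by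
    refine lt_of_le_of_lt (ContinuousLinearMap.opNorm_le_bound _ (M := (1 / 2) ^ n *
      Real.exp (c * Real.pi)) (by positivity) fun Y => ?_) ?_
    · refine norm_le_of_ext (by positivity) fun x hx => ?_
      refine (norm_pow_le_exp hq z hc n Y x hx).trans ?_
      rw [mul_comm, mul_comm ‖Y‖, ← mul_assoc]
      gcongr ?_ * _
      rw [mul_comm]
      gcongr
      exact hx.2
    · have := mul_lt_mul_of_pos_right hn (Real.exp_pos (c * Real.pi))
      rwa [← Real.exp_add, neg_add_cancel, Real.exp_zero] at this
  have h1 : IsUnit (1 - T ^ n) := isUnit_one_sub_of_norm_lt_one (R := CI →L[ℂ] CI) (x := T ^ n) hTn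
  rw [← mul_neg_geom_sum] at h1
  exact ((Commute.isUnit_mul_iff (by
    rw [Commute, SemiconjBy, mul_neg_geom_sum, geom_sum_mul_neg])).1 h1).1

/-- The inverse of `1 - ∫₀ˣ ∫₀ᵗ (q - z)`. -/
def green (z : ℂ) : CI →L[ℂ] CI := Ring.inverse (1 - prim.comp (voltSub hq z))

theorem green_eq_iff (z : ℂ) (Y F : CI) :
    Y = green hq z F ↔ Y = F + prim (voltSub hq z Y) := by
  have hu := isUnit_one_sub hq z
  have h1 : ∀ F, green hq z (F - prim (voltSub hq z F)) = F := fun F =>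
    congrArg (fun A : CI →L[ℂ] CI => A F) (Ring.inverse_mul_cancel _ hu)
  have h2 : ∀ F, green hq z F - prim (voltSub hq z (green hq z F)) = F := fun F =>
    congrArg (fun A : CI →L[ℂ] CI => A F) (Ring.mul_inverse_cancel _ hu)
  constructor
  · rintro rfl
    exact sub_eq_iff_eq_add.1 (h2 F)
  · intro h
    conv_lhs => rw [← h1 Y]
    rw [sub_eq_iff_eq_add.2 h]

/-- The solution of `-Y'' + q Y - z Y = g`, `Y(0) = a`, `Y'(0) = b`. -/
def sol (z a b : ℂ) (g : CI) : CI := green hq z (a • 1 + b • prim 1 - prim (prim g))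

/-- The derivative of the solution `sol`. -/
def solD (z a b : ℂ) (g : CI) : CI := b • 1 + voltSub hq z (sol hq z a b g) - prim g

theorem sol_eq (z a b : ℂ) (g : CI) : sol hq z a b g = a • 1 + prim (solD hq z a b g) := by
  have h := (green_eq_iff hq z (sol hq z a b g) _).1 rfl
  rw [solD, map_sub, map_add, map_smul]
  conv_lhs => rw [h]
  abel

theorem hasACDeriv_sol (z a b : ℂ) (g : CI) :
    HasACDeriv (ext (sol hq z a b g)) (ext (solD hq z a b g)) := by
  have h := (hasACDeriv_const a).add (hasACDeriv_prim (solD hq z a b g))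
  refine (h.congr_left fun x _ => ?_).congr_right fun x _ => ?_
  · rw [sol_eq hq z a b g]; simp
  · simp

theorem hasACDeriv_solD (z a b : ℂ) (g : CI) :
    HasACDeriv (ext (solD hq z a b g))
      (fun x => (q x - z) * ext (sol hq z a b g) x - ext g x) := by
  have h := ((hasACDeriv_const b).add (hasACDeriv_voltSub hq z (sol hq z a b g))).sub
    (hasACDeriv_prim g)
  refine (h.congr_left fun x _ => ?_).congr_right fun x _ => ?_
  · rw [solD]; simp
  · simp

theorem ext_sol_zero (z a b : ℂ) (g : CI) : ext (sol hq z a b g) 0 = a := by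
  rw [sol_eq]; simp [ext_prim_zero]

theorem ext_solD_zero (z a b : ℂ) (g : CI) : ext (solD hq z a b g) 0 = b := by
  rw [solD]; simp [ext_prim_zero, ext_voltSub_zero]

/-- Any absolutely continuous solution, restricted to the interval, satisfies the Volterra equation
that characterizes `sol`. -/
theorem sol_unique {Y W : ℝ → ℂ} {z : ℂ} {g : CI} (hY : HasACDeriv Y W)
    (hW : HasACDeriv W (fun x => (q x - z) * Y x - ext g x)) :
    EqOn Y (ext (sol hq z (Y 0) (W 0) g)) (Icc 0 Real.pi) ∧
      EqOn W (ext (solD hq z (Y 0) (W 0) g)) (Icc 0 Real.pi) := by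
  set Yc := restr Y hY.continuousOn
  have hYc : EqOn (ext Yc) Y (Icc 0 Real.pi) := fun x hx => ext_restr _ hx
  have hWc : EqOn W (ext (W 0 • 1 + voltSub hq z Yc - prim g)) (Icc 0 Real.pi) := by
    have h := ((hasACDeriv_const (W 0)).add (hasACDeriv_voltSub hq z Yc)).sub (hasACDeriv_prim g)
    refine hW.eqOn_of_same (((h.congr_left fun x _ => ?_).congr_right fun x hx => ?_)) ?_
    · simp
    · simp [hYc hx]
    · simp [ext_voltSub_zero, ext_prim_zero]
  have hYc' : Yc = Y 0 • 1 + prim (W 0 • 1 + voltSub hq z Yc - prim g) := by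
    refine ext_injective ?_
    have h := (hasACDeriv_const (Y 0)).add (hasACDeriv_prim (W 0 • 1 + voltSub hq z Yc - prim g))
    have h2 := hY.eqOn_of_same (((h.congr_right (g := W) fun x hx => ?_))) ?_
    · intro x hx
      rw [hYc hx, h2 hx]; simp
    · rw [hWc hx]; simp
    · simp [ext_prim_zero]
  have hY' : Yc = sol hq z (Y 0) (W 0) g := by
    refine (green_eq_iff hq z _ _).2 ?_
    conv_lhs => rw [hYc']
    rw [map_sub, map_add, map_smul]
    abel
  refine ⟨fun x hx => by rw [← hY', hYc hx], fun x hx => ?_⟩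
  rw [hWc hx, solD, ← hY']

theorem eqOn_of_hasACDeriv {F f g : ℝ → ℂ} (hf : HasACDeriv F f) (hg : HasACDeriv F g)
    (cf : ContinuousOn f (Icc 0 Real.pi)) (cg : ContinuousOn g (Icc 0 Real.pi)) :
    EqOn f g (Icc 0 Real.pi) := by
  refine eqOn_of_ae_eq cf cg ?_
  rw [mu0, ← Measure.restrict_congr_set Ioo_ae_eq_Icc]
  exact (ae_restrict_iff' measurableSet_Ioo).2 (.of_forall fun x hx =>
    (hf.hasDerivAt cf hx).unique (hg.hasDerivAt cg hx))

/-- The initial slope and the right-hand side can be read off the solution by differentiating;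
iterated, this gives the linear independence of the root functions. -/
theorem eq_zero_of_sol_eq_zero {z a b : ℂ} {g : CI} (h : sol hq z a b g = 0) : b = 0 ∧ g = 0 := by
  have hz : ∀ {c : ℂ}, HasACDeriv (ext (c • (0 : CI))) (ext (0 : CI)) := fun {c} =>
    ((hasACDeriv_const 0).congr_right fun x _ => by simp).congr_left fun x _ => by simp
  have h1 := hasACDeriv_sol hq z a b g
  rw [h] at h1
  have h2 : solD hq z a b g = 0 := ext_injective <| eqOn_of_hasACDeriv
    (h1.congr_left fun x _ => by simp) (hz (c := 0)) (continuous_ext _).continuousOn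
    (continuous_ext _).continuousOn
  have h3 := hasACDeriv_solD hq z a b g
  rw [h, h2] at h3
  refine ⟨?_, ?_⟩
  · rw [← ext_solD_zero hq z a b g, h2, ext_zero]
  · have h4 := eqOn_of_hasACDeriv ((h3.const_mul (-1)).congr_right (g := ext g) fun x _ => by simp)
      ((hz (c := 0)).congr_left fun x _ => by simp) (continuous_ext _).continuousOn
      (continuous_ext _).continuousOn
    exact ext_injective h4

/-! ### The characteristic function and its Taylor coefficients -/

/-- `g ↦ Y`, where `-Y'' + q Y - z Y = g`, `Y(0) = Y'(0) = 0`. -/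
def chain (z : ℂ) : CI →L[ℂ] CI := -(green hq z).comp (prim.comp prim)

theorem chain_apply (z : ℂ) (g : CI) : chain hq z g = sol hq z 0 0 g := by
  simp [chain, sol]

theorem sol_linear (z a b : ℂ) (g : CI) :
    sol hq z a b g = a • sol hq z 1 0 0 + b • sol hq z 0 1 0 + chain hq z g := by
  simp [chain_apply, sol, sub_eq_add_neg]

/-- Derivative of `chain`. -/
def chainD (z : ℂ) : CI →L[ℂ] CI := (voltSub hq z).comp (chain hq z) - prim

theorem solD_linear (z b : ℂ) (g : CI) :
    solD hq z 0 b g = b • solD hq z 0 1 0 + chainD hq z g := by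
  have h : sol hq z 0 b g = b • sol hq z 0 1 0 + chain hq z g := by
    rw [sol_linear, zero_smul, zero_add]
  rw [solD, h, solD, chainD, map_add, map_smul, map_zero, sub_zero, smul_add,
    sub_apply, ContinuousLinearMap.comp_apply, one_smul]
  abel

/-- Evaluation at `π`. -/
def evalPi : CI →L[ℂ] ℂ :=
  LinearMap.mkContinuous
    { toFun := fun Y => ext Y Real.pi
      map_add' := fun _ _ => rfl
      map_smul' := fun _ _ => rfl } 1 fun Y => (norm_ext_le Y Real.pi).trans (one_mul _).ge

theorem evalPi_apply (Y : CI) : evalPi Y = ext Y Real.pi := rfl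

/-- The characteristic function `b₀ y(π, z) + b₁ y'(π, z)`, where `-y'' + q y = z y`, `y(0) = 0`,
`y'(0) = 1`. -/
def charFun (b₀ b₁ : ℂ) (z : ℂ) : ℂ :=
  b₀ * evalPi (sol hq z 0 1 0) + b₁ * evalPi (solD hq z 0 1 0)

/-- The boundary functional on solutions with zero initial data. -/
def chainBdry (b₀ b₁ : ℂ) (z : ℂ) : CI →L[ℂ] ℂ :=
  b₀ • evalPi.comp (chain hq z) + b₁ • evalPi.comp (chainD hq z)

/-- `green` is the inverse of an operator that is affine in z. -/
theorem differentiable_sol : Differentiable ℂ fun z => sol hq z 0 1 0 := by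
  intro z
  have h1 : DifferentiableAt ℂ (fun z => (1 - prim.comp (voltSub hq z) : CI →L[ℂ] CI)) z := by
    have e : (fun z => (1 - prim.comp (voltSub hq z) : CI →L[ℂ] CI)) = fun z =>
        (1 - prim.comp (volt (integrableOn_of_memLp hq)) + z • prim.comp prim : CI →L[ℂ] CI) := by
      funext z
      ext1 Y
      simp [voltSub]
      abel
    rw [e]
    fun_prop
  have h2 : DifferentiableAt ℂ (fun z => green hq z) z :=
    DifferentiableAt.fun_comp' (g := Ring.inverse) z
      (differentiableAt_inverse (𝕜 := ℂ) (isUnit_one_sub hq z)) h1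
  have h3 : (fun z => sol hq z 0 1 0) = fun z => green hq z (prim 1) := by
    funext z; simp [sol]
  rw [h3]
  exact h2.clm_apply (differentiableAt_const _)

/-- The solution at w solves the equation at z with the right-hand side (w - z) times itself.
Iteration yields finite Taylor expansions with exact remainder. -/
theorem sol_eq_add_chain (z w : ℂ) :
    sol hq w 0 1 0 = sol hq z 0 1 0 + (w - z) • chain hq z (sol hq w 0 1 0) ∧
    solD hq w 0 1 0 = solD hq z 0 1 0 + (w - z) • chainD hq z (sol hq w 0 1 0) := by
  have h := sol_unique hq (z := z) (g := (w - z) • sol hq w 0 1 0) (hasACDeriv_sol hq w 0 1 0)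
    ((hasACDeriv_solD hq w 0 1 0).congr_right fun x _ => by
      simp only [ext_smul, ext_zero]; ring)
  rw [ext_sol_zero, ext_solD_zero] at h
  constructor
  · have h1 := ext_injective h.1
    rwa [sol_linear hq z, zero_smul, zero_add, one_smul, map_smul] at h1
  · rw [ext_injective h.2, solD_linear]; simp

theorem charFun_eq (b₀ b₁ z w : ℂ) :
    charFun hq b₀ b₁ w =
      charFun hq b₀ b₁ z + (w - z) * chainBdry hq b₀ b₁ z (sol hq w 0 1 0) := by
  obtain ⟨h1, h2⟩ := sol_eq_add_chain hq z w
  rw [charFun, h2]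
  conv_lhs => enter [1]; rw [h1]
  simp [charFun, chainBdry]
  ring

theorem differentiable_charFun (b₀ b₁ : ℂ) : Differentiable ℂ (charFun hq b₀ b₁) := by
  have e : charFun hq b₀ b₁ = fun w => charFun hq b₀ b₁ 0 +
      (w - 0) * chainBdry hq b₀ b₁ 0 (sol hq w 0 1 0) := by
    funext w; exact charFun_eq hq b₀ b₁ 0 w
  rw [e]
  have := differentiable_sol hq
  fun_prop

/-- The normalized derivatives of the solution with respect to the spectral parameter. -/
def rootFun (z : ℂ) (j : ℕ) : CI := ((chain hq z) ^ j) (sol hq z 0 1 0)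

/-- Taylor coefficients of the characteristic function. -/
def taylorCoeff (b₀ b₁ z : ℂ) : ℕ → ℂ
  | 0 => charFun hq b₀ b₁ z
  | j + 1 => chainBdry hq b₀ b₁ z (rootFun hq z j)

theorem sol_eq_sum (z w : ℂ) (p : ℕ) :
    sol hq w 0 1 0 = ∑ j ∈ Finset.range p, (w - z) ^ j • rootFun hq z j +
      (w - z) ^ p • ((chain hq z) ^ p) (sol hq w 0 1 0) := by
  induction p with
  | zero => simp
  | succ p ih =>
    rw [Finset.sum_range_succ]
    conv_lhs => rw [ih]
    conv_lhs => enter [2]; rw [(sol_eq_add_chain hq z w).1]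
    rw [add_assoc, map_add, smul_add, map_smul, smul_smul, ← pow_succ, pow_succ (chain hq z),
      rootFun]
    rfl

theorem charFun_eq_sum (b₀ b₁ z w : ℂ) (p : ℕ) :
    charFun hq b₀ b₁ w = ∑ j ∈ Finset.range (p + 1), (w - z) ^ j * taylorCoeff hq b₀ b₁ z j +
      (w - z) ^ (p + 1) * chainBdry hq b₀ b₁ z (((chain hq z) ^ p) (sol hq w 0 1 0)) := by
  rw [charFun_eq hq b₀ b₁ z w, Finset.sum_range_succ', sol_eq_sum hq z w p, map_add, map_sum, ← sol_eq_sum hq z w p]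
  simp only [map_smul, smul_eq_mul, taylorCoeff, mul_add, Finset.mul_sum, pow_succ, pow_zero,
    one_mul]
  have : ∀ j ∈ Finset.range p, (w - z) * ((w - z) ^ j * chainBdry hq b₀ b₁ z (rootFun hq z j)) =
    (w - z) ^ j * (w - z) * chainBdry hq b₀ b₁ z (rootFun hq z j) := fun j _ => by ring
  rw [Finset.sum_congr rfl this]
  ring

theorem analyticOrderAt_charFun {b₀ b₁ z : ℂ} {p : ℕ}
    (h0 : ∀ j < p, taylorCoeff hq b₀ b₁ z j = 0) (hp : taylorCoeff hq b₀ b₁ z p ≠ 0) :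
    analyticOrderAt (charFun hq b₀ b₁) z = p := by
  have ha : AnalyticAt ℂ (charFun hq b₀ b₁) z := (differentiable_charFun hq b₀ b₁).analyticAt z
  rw [ha.analyticOrderAt_eq_natCast]
  refine ⟨fun w => taylorCoeff hq b₀ b₁ z p +
    (w - z) * chainBdry hq b₀ b₁ z (((chain hq z) ^ p) (sol hq w 0 1 0)), ?_, by simpa using hp, ?_⟩
  · refine Differentiable.analyticAt ?_ z
    have := differentiable_sol hq
    fun_prop
  · refine .of_forall fun w => ?_
    rw [charFun_eq_sum hq b₀ b₁ z w p, Finset.sum_range_succ, Finset.sum_eq_zero fun j hj => by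
      rw [h0 j (Finset.mem_range.1 hj), mul_zero], smul_eq_mul]
    ring

theorem charFun_eq_zero_of_taylorCoeff {b₀ b₁ z : ℂ} (h : ∀ j, taylorCoeff hq b₀ b₁ z j = 0) :
    charFun hq b₀ b₁ = 0 := by
  have ha : AnalyticOnNhd ℂ (charFun hq b₀ b₁) univ := fun x _ =>
    (differentiable_charFun hq b₀ b₁).analyticAt x
  have h1 : ∀ n : ℕ, (n : ℕ∞) ≤ analyticOrderAt (charFun hq b₀ b₁) z := fun n => by
    rw [natCast_le_analyticOrderAt (ha z trivial)]
    refine ⟨fun w => chainBdry hq b₀ b₁ z (((chain hq z) ^ n) (sol hq w 0 1 0)) * (w - z), ?_,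
      .of_forall fun w => ?_⟩
    · refine Differentiable.analyticAt ?_ z
      have := differentiable_sol hq
      fun_prop
    · rw [charFun_eq_sum hq b₀ b₁ z w n, Finset.sum_eq_zero fun j hj => by rw [h j, mul_zero],
        smul_eq_mul]
      ring
  have h2 : analyticOrderAt (charFun hq b₀ b₁) z = ⊤ := ENat.eq_top_iff_forall_ge.2 h1
  funext w
  exact ha.eqOn_zero_of_preconnected_of_eventuallyEq_zero isPreconnected_univ (mem_univ z)
    (analyticOrderAt_eq_top.1 h2) (mem_univ w)

end Equation

end SturmLiouville

end

noncomputable section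

namespace SturmLiouville

open Set intervalIntegral

/-! ### Root subspaces -/

/-- The class in `L₂[0, π]` of a continuous function. -/
def toL2 : CI →ₗ[ℂ] L2 where
  toFun Y := (memLp_of_continuousOn (continuous_ext Y).continuousOn).toLp (ext Y)
  map_add' Y Z := MemLp.toLp_add (memLp_of_continuousOn (continuous_ext Y).continuousOn)
    (memLp_of_continuousOn (continuous_ext Z).continuousOn)
  map_smul' c Y := MemLp.toLp_const_smul c (memLp_of_continuousOn (continuous_ext Y).continuousOn)

theorem coeFn_toL2 (Y : CI) : toL2 Y =ᵐ[mu0] ext Y :=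
  (memLp_of_continuousOn (continuous_ext Y).continuousOn).coeFn_toLp

theorem toL2_injective : Function.Injective toL2 := fun Y Z h =>
  ext_injective <| eqOn_of_ae_eq (continuous_ext Y).continuousOn (continuous_ext Z).continuousOn <|
    (coeFn_toL2 Y).symm.trans ((by rw [h] : toL2 Y =ᵐ[mu0] toL2 Z).trans (coeFn_toL2 Z))

theorem eq_toL2 {y : L2} {Y : CI} (h : y =ᵐ[mu0] ext Y) : y = toL2 Y :=
  Lp.ext (h.trans (coeFn_toL2 Y).symm)

section

variable {σ q : ℝ → ℂ} (hq : MemLp q 2 mu0) (hσ : HasACDeriv σ q)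
  {B : Submodule ℂ (ℂ × ℂ)} {b₀ b₁ : ℂ}
  (hB : ∀ y w : ℂ, (y, w - σ Real.pi * y) ∈ B ↔ b₀ * y + b₁ * w = 0)

include hσ hB in
/-- In terms of the usual derivative, the operator is `-y'' + q y`. -/
theorem mem_slGraph_iff {p : L2 × L2} :
    p ∈ slGraph σ B ↔ ∃ Y W : ℝ → ℂ, p.1 =ᵐ[mu0] Y ∧ HasACDeriv Y W ∧
      HasACDeriv W (fun x => q x * Y x - p.2 x) ∧ Y 0 = 0 ∧
      b₀ * Y Real.pi + b₁ * W Real.pi = 0 := by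
  constructor
  · rintro ⟨Y, Z, h1, h2, h3, h4, h5⟩
    refine ⟨Y, fun x => Z x + σ x * Y x, h1, h2, ?_, h4, ?_⟩
    · refine (h3.add (hσ.mul h2)).congr_right fun x _ => ?_
      simp only [Pi.add_apply]; ring
    · rw [← hB]; simpa using h5
  · rintro ⟨Y, W, h1, h2, h3, h4, h5⟩
    refine ⟨Y, fun x => W x - σ x * Y x, h1, h2.congr_right fun x _ => by ring, ?_, h4,
      (hB _ _).2 h5⟩
    refine (h3.sub (hσ.mul h2)).congr_right fun x _ => ?_
    simp only; ring

/-- Linear combinations of root functions. -/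
def rootComb (z : ℂ) (k : ℕ) (a : ℕ → ℂ) : CI := ∑ j ∈ Finset.range k, a j • rootFun hq z j

theorem chain_rootFun (z : ℂ) (j : ℕ) : chain hq z (rootFun hq z j) = rootFun hq z (j + 1) := by
  rw [rootFun, rootFun, pow_succ']; rfl

/-- As `chain` raises the index of a root function by one, subtracting z from the differential
expression shifts the coefficients. -/
theorem rootComb_succ (z : ℂ) (k : ℕ) (a : ℕ → ℂ) :
    rootComb hq z (k + 1) a =
      sol hq z 0 (a 0) (rootComb hq z k fun j => a (j + 1)) := by
  rw [sol_linear, zero_smul, zero_add, rootComb, Finset.sum_range_succ', rootComb, map_sum, add_comm]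
  simp only [map_smul, chain_rootFun]
  rfl

/-- The boundary condition sees a combination of root functions only through the Taylor coefficients
of the characteristic function. This is the link between Jordan chains and the order of the zero. -/
theorem bdry_rootComb (z : ℂ) (k : ℕ) (a : ℕ → ℂ) :
    b₀ * ext (sol hq z 0 (a 0) (rootComb hq z k fun j => a (j + 1))) Real.pi +
      b₁ * ext (solD hq z 0 (a 0) (rootComb hq z k fun j => a (j + 1))) Real.pi =
    ∑ j ∈ Finset.range (k + 1), a j * taylorCoeff hq b₀ b₁ z j := by
  have h : ∀ (a : ℂ) (g : CI), b₀ * ext (sol hq z 0 a g) Real.pi + b₁ * ext (solD hq z 0 a g) Real.pi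
      = a * charFun hq b₀ b₁ z + chainBdry hq b₀ b₁ z g := by
    intro a g
    rw [sol_linear, solD_linear, zero_smul, zero_add]
    simp [charFun, chainBdry, evalPi_apply]
    ring
  rw [h, Finset.sum_range_succ', rootComb, map_sum, add_comm]
  simp [taylorCoeff]

theorem rootComb_injective (z : ℂ) (k : ℕ) (a : ℕ → ℂ) (h : rootComb hq z k a = 0) :
    ∀ j < k, a j = 0 := by
  induction k generalizing a with
  | zero => simp
  | succ k ih =>
    rw [rootComb_succ] at h
    obtain ⟨h1, h2⟩ := eq_zero_of_sol_eq_zero hq h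
    intro j hj
    cases j with
    | zero => exact h1
    | succ j => exact ih _ h2 j (Nat.lt_of_succ_lt_succ hj)

theorem rootComb_of_le (z : ℂ) {k l : ℕ} (hkl : k ≤ l) (a : ℕ → ℂ) :
    rootComb hq z k a = rootComb hq z l fun j => if j < k then a j else 0 := by
  rw [rootComb, rootComb]
  simp only [ite_smul, zero_smul]
  rw [← Finset.sum_filter]
  refine Finset.sum_congr ?_ fun _ _ => rfl
  ext j; simp; omega

variable {z : ℂ} {p : ℕ} (h0 : ∀ j < p, taylorCoeff hq b₀ b₁ z j = 0)
  (hp : taylorCoeff hq b₀ b₁ z p ≠ 0)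

include hσ hB h0 hp in
-- On root functions T - z acts as a shift, and a combination is in the domain iff its coefficients
-- annihilate the Taylor coefficients. Below the order p of the zero this is automatic; at index p
-- it forces the coefficient to vanish. So the kernels grow by one dimension up to p and then stop.
theorem mem_kerPow_iff (n : ℕ) (y : L2) :
    y ∈ kerPow (slGraph σ B) z n ↔ ∃ a, y = toL2 (rootComb hq z (min n p) a) := by
  induction n generalizing y with
  | zero => simp [kerPow, rootComb]
  | succ n ih =>
    rw [kerPow, Submodule.mem_map]
    constructor
    · rintro ⟨⟨y', f⟩, ⟨hΓ, hf⟩, rfl⟩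
      simp only [SetLike.mem_coe, Submodule.mem_comap, LinearMap.sub_apply, LinearMap.snd_apply,
        LinearMap.smul_apply, LinearMap.fst_apply] at hf ⊢
      obtain ⟨a, ha⟩ := (ih _).1 hf
      obtain ⟨Y, W, h1, h2, h3, h4, h5⟩ := (mem_slGraph_iff hσ hB).1 hΓ
      set g := rootComb hq z (min n p) a with hg
      have h3' : HasACDeriv W (fun x => (q x - z) * Y x - ext g x) := by
        refine h3.congr ?_
        filter_upwards [h1, coeFn_toL2 g, Lp.coeFn_sub f (z • y'), Lp.coeFn_smul z y']
          with x e1 e2 e3 e4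
        rw [← e2, ← ha, e3, Pi.sub_apply, e4, Pi.smul_apply, smul_eq_mul, e1]
        ring
      obtain ⟨hY, hW⟩ := sol_unique hq h2 h3'
      rw [h4] at hY hW
      -- The new zeroth coefficient is the initial slope; the others are those of (T - z)y, shifted.
      let a' : ℕ → ℂ := fun j => Nat.casesOn j (W 0) a
      have hY' : y' = toL2 (rootComb hq z (min n p + 1) a') := by
        rw [rootComb_succ]
        refine eq_toL2 (h1.trans ((ae_restrict_iff' measurableSet_Icc).2 (.of_forall hY)))
      have h6 := bdry_rootComb (b₀ := b₀) (b₁ := b₁) hq z (min n p) a'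
      have e1 : ext (sol hq z 0 (a' 0) (rootComb hq z (min n p) fun j => a' (j + 1))) Real.pi
        = Y Real.pi := (hY pi_mem_Icc_pi).symm
      have e2 : ext (solD hq z 0 (a' 0) (rootComb hq z (min n p) fun j => a' (j + 1))) Real.pi
        = W Real.pi := (hW pi_mem_Icc_pi).symm
      rw [e1, e2, h5] at h6
      rcases lt_or_ge n p with hn | hn
      · refine ⟨a', ?_⟩
        rw [hY', min_eq_left hn.le, min_eq_left (Nat.succ_le_of_lt hn)]
      · refine ⟨a', ?_⟩
        -- All coefficients of index below p drop out of the boundary condition, which leaves a' p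
        -- times a nonzero number.
        rw [min_eq_right hn] at h6 hY'
        rw [hY', min_eq_right (by omega)]
        rw [Finset.sum_range_succ, Finset.sum_eq_zero fun j hj => by
          rw [h0 j (Finset.mem_range.1 hj), mul_zero], zero_add] at h6
        have h7 := (mul_eq_zero.1 h6.symm).resolve_right hp
        rw [rootComb, Finset.sum_range_succ, h7, zero_smul, add_zero, rootComb]
    · rintro ⟨a, rfl⟩
      rcases Nat.eq_zero_or_pos p with rfl | hp0
      · refine ⟨0, Submodule.zero_mem _, ?_⟩
        simp [rootComb]
      obtain ⟨k, hk⟩ : ∃ k, min (n + 1) p = k + 1 := ⟨min n (p - 1), by omega⟩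
      have hkp : k + 1 ≤ p := by omega
      have hkn : k ≤ min n p := by omega
      set g := rootComb hq z k fun j => a (j + 1) with hg
      set Y := sol hq z 0 (a 0) g with hY
      refine ⟨(toL2 Y, z • toL2 Y + toL2 g), ⟨?_, ?_⟩, ?_⟩
      · refine (mem_slGraph_iff hσ hB).2 ⟨ext Y, ext (solD hq z 0 (a 0) g), coeFn_toL2 Y,
          hasACDeriv_sol .., ?_, ext_sol_zero .., ?_⟩
        · refine (hasACDeriv_solD hq z 0 (a 0) g).congr ?_
          filter_upwards [coeFn_toL2 g, coeFn_toL2 Y, Lp.coeFn_add (z • toL2 Y) (toL2 g),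
            Lp.coeFn_smul z (toL2 Y)] with x e1 e2 e3 e4
          rw [e3, Pi.add_apply, e4, Pi.smul_apply, e1, e2, smul_eq_mul]
          ring
        · rw [bdry_rootComb hq z k a]
          exact Finset.sum_eq_zero fun j hj => by
            rw [h0 j (by have := Finset.mem_range.1 hj; omega), mul_zero]
      · simp only [SetLike.mem_coe, Submodule.mem_comap, LinearMap.sub_apply, LinearMap.snd_apply,
          LinearMap.smul_apply, LinearMap.fst_apply, add_sub_cancel_left]
        exact (ih _).2 ⟨_, by rw [hg, rootComb_of_le hq z hkn]⟩
      · rw [hk, rootComb_succ]; rfl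

include hσ hB h0 hp in
-- The union of the kernels is the span of the first p root functions, which are independent also
-- after passing to classes in L₂.
theorem algMult_eq_of_taylorCoeff : algMult (slGraph σ B) z = p := by
  let Φ : (Fin p → ℂ) →ₗ[ℂ] L2 :=
    toL2.comp (Fintype.linearCombination ℂ fun j : Fin p => rootFun hq z j)
  have hΦ : ∀ a : ℕ → ℂ, Φ (fun j => a j) = toL2 (rootComb hq z p a) := fun a => by
    simp only [Φ, LinearMap.comp_apply, Fintype.linearCombination_apply, rootComb]
    rw [Fin.sum_univ_eq_sum_range (fun j => a j • rootFun hq z j)]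
  have hext : ∀ a : Fin p → ℂ, ∃ a' : ℕ → ℂ, a = fun j : Fin p => a' j := fun a =>
    ⟨fun j => if h : j < p then a ⟨j, h⟩ else 0, by ext j; simp⟩
  have hsup : (⨆ n, kerPow (slGraph σ B) z n : Submodule ℂ L2) = LinearMap.range Φ := by
    apply le_antisymm
    · refine iSup_le fun n y hy => ?_
      obtain ⟨a, rfl⟩ := (mem_kerPow_iff hq hσ hB h0 hp n y).1 hy
      rw [rootComb_of_le hq z (min_le_right n p), ← hΦ]
      exact ⟨_, rfl⟩
    · rintro _ ⟨a, rfl⟩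
      obtain ⟨a', rfl⟩ := hext a
      refine Submodule.mem_iSup_of_mem p ((mem_kerPow_iff hq hσ hB h0 hp p _).2 ⟨a', ?_⟩)
      rw [hΦ, min_self]
  have hinj : Function.Injective Φ := by
    rw [← LinearMap.ker_eq_bot, LinearMap.ker_eq_bot']
    intro a ha
    obtain ⟨a', rfl⟩ := hext a
    rw [hΦ] at ha
    have := rootComb_injective hq z p a' (toL2_injective (ha.trans (map_zero _).symm))
    ext j
    exact this j j.2
  rw [algMult, hsup, ← (LinearEquiv.ofInjective Φ hinj).rank_eq]
  simp

include hσ hB in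
/-- The algebraic multiplicity is the order of the zero of the characteristic function. -/
theorem algMult_eq (z : ℂ) (hne : charFun hq b₀ b₁ ≠ 0) :
    algMult (slGraph σ B) z = analyticOrderAt (charFun hq b₀ b₁) z := by
  by_cases h : ∀ j, taylorCoeff hq b₀ b₁ z j = 0
  · exact absurd (charFun_eq_zero_of_taylorCoeff hq h) hne
  · push Not at h
    classical
    have h1 := Nat.find_spec h
    have h2 : ∀ j < Nat.find h, taylorCoeff hq b₀ b₁ z j = 0 := fun j hj => by
      simpa using Nat.find_min h hj
    rw [algMult_eq_of_taylorCoeff hq hσ hB h2 h1, analyticOrderAt_charFun hq h2 h1]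

end

end SturmLiouville

end

noncomputable section

namespace SturmLiouville

open Set

/-! ### Counting zeros of entire functions -/

theorem exists_eq_pow_mul {f : ℂ → ℂ} (hf : Differentiable ℂ f) (hne : f ≠ 0) (a : ℂ) :
    ∃ (p : ℕ) (g : ℂ → ℂ), Differentiable ℂ g ∧ g a ≠ 0 ∧ ∀ w, f w = (w - a) ^ p * g w := by
  have ha := hf.analyticAt a
  have htop : analyticOrderAt f a ≠ ⊤ := fun h => hne <| by
    funext w
    exact AnalyticOnNhd.eqOn_zero_of_preconnected_of_eventuallyEq_zero
      (fun x _ => hf.analyticAt x) isPreconnected_univ (mem_univ a)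
      (analyticOrderAt_eq_top.1 h) (mem_univ w)
  obtain ⟨g, hg, hg0, hfg⟩ := ha.analyticOrderAt_ne_top.1 htop
  set p := analyticOrderNatAt f a
  classical
  refine ⟨p, fun w => if w = a then g a else f w / (w - a) ^ p, fun w => ?_, by simpa using hg0,
    fun w => ?_⟩
  · by_cases hw : w = a
    · subst hw
      refine hg.differentiableAt.congr_of_eventuallyEq ?_
      filter_upwards [hfg] with u hu
      by_cases huw : u = w
      · simp [huw]
      · simp only [if_neg huw]
        rw [hu, smul_eq_mul, mul_div_cancel_left₀ _ (pow_ne_zero _ (sub_ne_zero.2 huw))]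
    · have hd : DifferentiableAt ℂ (fun u => f u / (u - a) ^ p) w :=
        (hf w).div (by fun_prop) (pow_ne_zero _ (sub_ne_zero.2 hw))
      refine hd.congr_of_eventuallyEq ?_
      filter_upwards [isOpen_ne.mem_nhds hw] with u hu
      simp only [if_neg hu]
  · by_cases hw : w = a
    · subst hw
      have := hfg.self_of_nhds
      simpa using this
    · simp only [if_neg hw]
      rw [mul_div_cancel₀ _ (pow_ne_zero _ (sub_ne_zero.2 hw))]

theorem finite_zeros {f : ℂ → ℂ} (hf : Differentiable ℂ f) (hne : f ≠ 0) (r : ℝ) :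
    {w | f w = 0 ∧ w ∈ Metric.closedBall (0 : ℂ) r}.Finite := by
  by_contra hinf
  obtain ⟨a, -, ha⟩ := Set.Infinite.exists_accPt_of_subset_isCompact hinf
    (isCompact_closedBall (0 : ℂ) r) fun w hw => hw.2
  refine hne (funext fun w => ?_)
  refine AnalyticOnNhd.eqOn_zero_of_preconnected_of_frequently_eq_zero
    (fun x _ => hf.analyticAt x) isPreconnected_univ (mem_univ a) ?_ (mem_univ w)
  exact (accPt_iff_frequently_nhdsNE.1 ha).mono fun x hx => hx.1

/-- An entire function is, up to a factor without zeros in a given disc, a monic polynomial. -/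
theorem exists_factorization {f : ℂ → ℂ} (hf : Differentiable ℂ f) (hne : f ≠ 0) (r : ℝ) :
    ∃ (s : Multiset ℂ) (g : ℂ → ℂ), Differentiable ℂ g ∧
      (∀ w ∈ Metric.closedBall (0 : ℂ) r, g w ≠ 0) ∧ (∀ a ∈ s, f a = 0 ∧ ‖a‖ ≤ r) ∧
      ∀ w, f w = (s.map fun a => w - a).prod * g w := by
  -- Induction on a finite set containing the zeros in the disc: dividing out the full power of w -
  -- a removes a. The set may contain points that are not zeros, which are simply discarded.
  suffices H : ∀ Z : Finset ℂ, ∀ f : ℂ → ℂ, Differentiable ℂ f → f ≠ 0 →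
      {w | f w = 0 ∧ w ∈ Metric.closedBall (0 : ℂ) r} ⊆ Z →
      ∃ (s : Multiset ℂ) (g : ℂ → ℂ), Differentiable ℂ g ∧
        (∀ w ∈ Metric.closedBall (0 : ℂ) r, g w ≠ 0) ∧ (∀ a ∈ s, f a = 0 ∧ ‖a‖ ≤ r) ∧
        ∀ w, f w = (s.map fun a => w - a).prod * g w from
    H (finite_zeros hf hne r).toFinset f hf hne (by simp)
  intro Z
  induction Z using Finset.induction_on with
  | empty =>
    intro f hf hne hZ
    refine ⟨0, f, hf, fun w hw h => ?_, by simp, by simp⟩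
    exact absurd (hZ ⟨h, hw⟩) (by simp)
  | insert a Z ha ih =>
    intro f hf hne hZ
    by_cases haf : f a = 0 ∧ ‖a‖ ≤ r
    · obtain ⟨p, g, hg, hga, hfg⟩ := exists_eq_pow_mul hf hne a
      have hg0 : g ≠ 0 := fun h => hga (by rw [h]; rfl)
      obtain ⟨s, g', h1, h2, h3, h4⟩ := ih g hg hg0 fun w hw => by
        have hwf : f w = 0 := by rw [hfg, hw.1, mul_zero]
        have := hZ ⟨hwf, hw.2⟩
        simp only [Finset.coe_insert, mem_insert_iff] at this
        rcases this with rfl | h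
        · exact absurd hw.1 hga
        · exact h
      refine ⟨Multiset.replicate p a + s, g', h1, h2, fun b hb => ?_, fun w => ?_⟩
      · rcases Multiset.mem_add.1 hb with hb | hb
        · rw [Multiset.eq_of_mem_replicate hb]; exact haf
        · exact ⟨by rw [hfg, (h3 b hb).1, mul_zero], (h3 b hb).2⟩
      · rw [hfg, h4]
        simp [mul_assoc]
    · refine ih f hf hne fun w hw => ?_
      have := hZ hw
      simp only [Finset.coe_insert, mem_insert_iff] at this
      rcases this with rfl | h
      · exact absurd ⟨hw.1, by simpa using hw.2⟩ haf
      · exact h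

theorem analyticOrderAt_of_factorization {f g : ℂ → ℂ} {s : Multiset ℂ} (hg : Differentiable ℂ g)
    (hfg : ∀ w, f w = (s.map fun a => w - a).prod * g w) {z : ℂ} (hz : g z ≠ 0) :
    analyticOrderAt f z = s.count z := by
  induction s using Multiset.induction_on generalizing f with
  | empty =>
    have : f = g := funext fun w => by simpa using hfg w
    rw [this, (hg.analyticAt z).analyticOrderAt_eq_zero.2 hz]
    simp
  | cons a s ih =>
    have hd : ∀ s : Multiset ℂ, Differentiable ℂ fun w : ℂ => (s.map fun a => w - a).prod := by
      intro s
      induction s using Multiset.induction_on with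
      | empty => simp
      | cons b s ih => simp only [Multiset.map_cons, Multiset.prod_cons]; fun_prop
    have e : f = (fun w => w - a) * fun w => (s.map fun a => w - a).prod * g w := by
      funext w; simp [hfg, mul_assoc]
    have ha : AnalyticAt ℂ (fun w : ℂ => (s.map fun a => w - a).prod * g w) z :=
      ((hd s).mul hg).analyticAt z
    rw [e, analyticOrderAt_mul (by fun_prop) ha, ih fun w => rfl]
    by_cases hza : z = a
    · subst hza
      rw [Multiset.count_cons_self]
      have : analyticOrderAt (fun w : ℂ => w - z) z = 1 := analyticOrderAt_id_sub_const_self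
      rw [this, add_comm]; push_cast; rfl
    · rw [Multiset.count_cons_of_ne hza]
      have : analyticOrderAt (fun w : ℂ => w - a) z = 0 := analyticOrderAt_id_sub_const_of_ne hza
      rw [this, zero_add]

/-- The argument principle, by induction on the linear factors: each contributes 2πi, and the factor
without zeros contributes nothing by Cauchy's theorem. -/
theorem circleIntegral_logDeriv {f g : ℂ → ℂ} {s : Multiset ℂ} {r : ℝ} (hr : 0 < r)
    (hg : Differentiable ℂ g) (hg0 : ∀ w ∈ Metric.closedBall (0 : ℂ) r, g w ≠ 0)
    (hs : ∀ a ∈ s, ‖a‖ < r) (hfg : ∀ w, f w = (s.map fun a => w - a).prod * g w) :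
    CircleIntegrable (logDeriv f) 0 r ∧
      (∮ w in C(0, r), logDeriv f w) = 2 * Real.pi * Complex.I * s.card := by
  induction s using Multiset.induction_on generalizing f with
  | empty =>
    have : f = g := funext fun w => by simpa using hfg w
    subst this
    have hcont : ContinuousOn (logDeriv f) (Metric.closedBall 0 r) := by
      have : Continuous (deriv f) := (hg.contDiff (n := 1)).continuous_deriv le_rfl
      exact this.continuousOn.div hg.continuous.continuousOn hg0
    refine ⟨(hcont.mono Metric.sphere_subset_closedBall).circleIntegrable hr.le, ?_⟩
    rw [Complex.circleIntegral_eq_zero_of_differentiable_on_off_countable hr.le countable_empty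
      hcont]
    · simp
    · intro w hw
      exact ((hg.deriv w).div (hg w) (hg0 w (Metric.ball_subset_closedBall hw.1)))
  | cons a s ih =>
    have hd : Differentiable ℂ fun w : ℂ => (s.map fun a => w - a).prod := by
      clear ih hs hfg
      induction s using Multiset.induction_on with
      | empty => simp
      | cons b s ih => simp only [Multiset.map_cons, Multiset.prod_cons]; fun_prop
    set F : ℂ → ℂ := fun w => (s.map fun a => w - a).prod * g w with hF
    obtain ⟨h1, h2⟩ := ih (f := F) (fun b hb => hs b (Multiset.mem_cons_of_mem hb)) fun w => rfl
    have ha := hs a (Multiset.mem_cons_self a s)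
    have hF0 : ∀ w ∈ Metric.sphere (0 : ℂ) r, F w ≠ 0 := by
      intro w hw
      refine mul_ne_zero (Multiset.prod_ne_zero ?_) (hg0 w (Metric.sphere_subset_closedBall hw))
      simp only [Multiset.mem_map, not_exists, not_and]
      intro b hb h
      have := hs b (Multiset.mem_cons_of_mem hb)
      rw [sub_eq_zero.1 h.symm.symm] at hw
      simp at hw
      linarith
    have hwa : ∀ w ∈ Metric.sphere (0 : ℂ) r, w - a ≠ 0 := by
      intro w hw h
      rw [sub_eq_zero.1 h] at hw
      simp at hw; linarith
    have e : EqOn (logDeriv f) (fun w => (w - a)⁻¹ + logDeriv F w) (Metric.sphere 0 r) := by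
      intro w hw
      have : f = fun w => (w - a) * F w := by funext w; simp [hfg, hF, mul_assoc]
      rw [this, logDeriv_mul w (hwa w hw) (hF0 w hw) (by fun_prop) ((hd.mul hg) w)]
      congr 1
      simp [logDeriv_apply]
    have i1 : CircleIntegrable (fun w => (w - a)⁻¹) 0 r := by
      refine ContinuousOn.circleIntegrable hr.le ?_
      exact ContinuousOn.inv₀ (by fun_prop) hwa
    constructor
    · have h3 : (fun θ => logDeriv f (circleMap 0 r θ)) =
          fun θ => ((fun w => (w - a)⁻¹) + logDeriv F) (circleMap 0 r θ) :=
        funext fun θ => e (circleMap_mem_sphere 0 hr.le θ)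
      rw [CircleIntegrable, h3]
      exact i1.add h1
    · rw [circleIntegral.integral_congr hr.le e, circleIntegral.integral_add i1 h1, h2,
        circleIntegral.integral_sub_inv_of_mem_ball (by simpa using ha)]
      rw [Multiset.card_cons]; push_cast; ring

/-- **Rouché's theorem** for entire functions, in terms of factorizations. -/
theorem card_eq_of_norm_sub_lt {f h : ℂ → ℂ} {r : ℝ} (hr : 0 < r)
    (hfd : Differentiable ℂ f) (hhd : Differentiable ℂ h)
    (hlt : ∀ w ∈ Metric.sphere (0 : ℂ) r, ‖f w - h w‖ < ‖h w‖)
    {s t : Multiset ℂ} {g k : ℂ → ℂ} (hg : Differentiable ℂ g)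
    (hg0 : ∀ w ∈ Metric.closedBall (0 : ℂ) r, g w ≠ 0) (hs : ∀ a ∈ s, f a = 0 ∧ ‖a‖ ≤ r)
    (hfg : ∀ w, f w = (s.map fun a => w - a).prod * g w) (hk : Differentiable ℂ k)
    (hk0 : ∀ w ∈ Metric.closedBall (0 : ℂ) r, k w ≠ 0) (ht : ∀ a ∈ t, h a = 0 ∧ ‖a‖ ≤ r)
    (hhk : ∀ w, h w = (t.map fun a => w - a).prod * k w) : s.card = t.card := by
  have hh0 : ∀ w ∈ Metric.sphere (0 : ℂ) r, h w ≠ 0 := fun w hw e => by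
    have := hlt w hw
    rw [e, norm_zero] at this
    exact absurd this (norm_nonneg _).not_gt
  have hf0 : ∀ w ∈ Metric.sphere (0 : ℂ) r, f w ≠ 0 := fun w hw e => by
    have := hlt w hw
    rw [e, zero_sub, norm_neg] at this
    exact lt_irrefl _ this
  obtain ⟨i1, e1⟩ := circleIntegral_logDeriv hr hg hg0 (fun a ha => by
    refine lt_of_le_of_ne (hs a ha).2 fun e => hf0 a (by simpa using e) (hs a ha).1) hfg
  obtain ⟨i2, e2⟩ := circleIntegral_logDeriv hr hk hk0 (fun a ha => by
    refine lt_of_le_of_ne (ht a ha).2 fun e => hh0 a (by simpa using e) (ht a ha).1) hhk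
  -- On the circle f/h stays at distance less than 1 from 1, so the principal branch of log(f/h) is
  -- a primitive.
  have hz : (∮ w in C(0, r), (logDeriv f w - logDeriv h w)) = 0 := by
    refine circleIntegral.integral_eq_zero_of_hasDerivWithinAt
      (f := fun w => Complex.log (f w / h w)) hr.le fun w hw => ?_
    have hsl : f w / h w ∈ Complex.slitPlane := by
      have h1 : ‖f w / h w - 1‖ < 1 := by
        rw [div_sub_one (hh0 w hw), norm_div, div_lt_one (norm_pos_iff.2 (hh0 w hw))]
        exact hlt w hw
      have := Complex.mem_slitPlane_of_norm_lt_one h1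
      simpa using this
    have hd : HasDerivAt (fun w => f w / h w) _ w :=
      (hfd w).hasDerivAt.div (hhd w).hasDerivAt (hh0 w hw)
    have := (hd.clog hsl).hasDerivWithinAt (s := Metric.sphere 0 r)
    convert this using 1
    have := hh0 w hw
    have := hf0 w hw
    simp only [logDeriv_apply]
    field_simp
  rw [circleIntegral.integral_sub i1 i2, e1, e2, ← mul_sub] at hz
  have := (mul_eq_zero.1 hz).resolve_left (by simp [Real.pi_ne_zero])
  exact_mod_cast sub_eq_zero.1 this

end SturmLiouville

end

noncomputable section

namespace SturmLiouville

open Set intervalIntegral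

/-! ### Lower bounds for the sine -/

theorem normSq_sin (w : ℂ) :
    ‖Complex.sin w‖ ^ 2 = Real.sin w.re ^ 2 + Real.sinh w.im ^ 2 := by
  have h : Complex.sin w = ⟨Real.sin w.re * Real.cosh w.im, Real.cos w.re * Real.sinh w.im⟩ := by
    conv_lhs => rw [← Complex.re_add_im w, Complex.sin_add_mul_I]
    rw [← Complex.ofReal_sin, ← Complex.ofReal_cos, ← Complex.ofReal_sinh, ← Complex.ofReal_cosh]
    apply Complex.ext <;> simp only [Complex.add_re, Complex.add_im, Complex.mul_re, Complex.mul_im,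
      Complex.ofReal_re, Complex.ofReal_im, Complex.I_re, Complex.I_im] <;> ring
  rw [h, Complex.sq_norm, Complex.normSq_mk]
  have h1 := Real.sin_sq_add_cos_sq w.re
  have h2 := Real.cosh_sq w.im
  linear_combination (Real.sin w.re ^ 2) * h2 + (Real.sinh w.im ^ 2) * h1

theorem abs_sin_re_le (w : ℂ) : |Real.sin w.re| ≤ ‖Complex.sin w‖ := by
  refine abs_le_of_sq_le_sq (by rw [normSq_sin]; nlinarith [sq_nonneg (Real.sinh w.im)])
    (norm_nonneg _)

theorem abs_sinh_im_le (w : ℂ) : |Real.sinh w.im| ≤ ‖Complex.sin w‖ := by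
  refine abs_le_of_sq_le_sq (by rw [normSq_sin]; nlinarith [sq_nonneg (Real.sin w.re)])
    (norm_nonneg _)

theorem abs_le_abs_sinh (y : ℝ) : |y| ≤ |Real.sinh y| := by
  rw [Real.abs_sinh]
  exact Real.self_le_sinh_iff.2 (abs_nonneg y)

theorem exp_abs_le_sinh {y : ℝ} (hy : 1 ≤ |y|) : Real.exp |y| / 4 ≤ |Real.sinh y| := by
  rw [Real.abs_sinh, Real.sinh_eq]
  have h1 : Real.exp (-|y|) ≤ 1 := Real.exp_le_one_iff.2 (by linarith)
  have h2 : 2 ≤ Real.exp |y| := by linarith [Real.add_one_le_exp |y|]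
  linarith

/-- Where the sine is small compared with its growth, an integer is near. -/
theorem norm_sub_round_le {w : ℂ} {η : ℝ} (hη : η < 1 / 4)
    (h : ‖Complex.sin (Real.pi * w)‖ ≤ η * Real.exp (Real.pi * |w.im|)) :
    ‖w - (round w.re : ℤ)‖ ≤ 3 * η := by
  have him : (Real.pi * w : ℂ).im = Real.pi * w.im := by simp
  have habs : |(Real.pi * w : ℂ).im| = Real.pi * |w.im| := by
    rw [him, abs_mul, abs_of_pos Real.pi_pos]
  -- Otherwise |sinh| alone is at least a quarter of the exponential, which exceeds η times it.
  have hy : Real.pi * |w.im| < 1 := by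
    by_contra hy
    rw [← habs] at hy h
    have h1 := exp_abs_le_sinh (not_lt.1 hy)
    have h2 := abs_sinh_im_le (Real.pi * w)
    have := Real.exp_pos |(Real.pi * w : ℂ).im|
    nlinarith
  have hη0 : 0 ≤ η := by
    by_contra h0
    have := Real.exp_pos (Real.pi * |w.im|)
    nlinarith [norm_nonneg (Complex.sin (Real.pi * w))]
  have h3 : ‖Complex.sin (Real.pi * w)‖ ≤ 3 * η := by
    have : Real.exp (Real.pi * |w.im|) ≤ 3 := by
      have := Real.exp_le_exp.2 hy.le
      linarith [Real.exp_one_lt_d9]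
    nlinarith
  set n := round w.re
  have hsin : |Real.sin (Real.pi * (w.re - n))| ≤ ‖Complex.sin (Real.pi * w)‖ := by
    have h1 := abs_sin_re_le (Real.pi * w)
    have h2 : (Real.pi * w : ℂ).re = Real.pi * (w.re - n) + n * Real.pi := by simp; ring
    rw [h2, Real.sin_add_int_mul_pi, abs_mul] at h1
    simpa using h1
  have hre : |w.re - n| ≤ 1 / 2 := abs_sub_round w.re
  -- Jordan's inequality, available because the distance to the nearest integer is at most 1/2.
  have h4 : 2 * |w.re - n| ≤ |Real.sin (Real.pi * (w.re - n))| := by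
    have := Real.mul_abs_le_abs_sin (x := Real.pi * (w.re - n)) (by
      rw [abs_mul, abs_of_pos Real.pi_pos]; nlinarith [Real.pi_pos])
    rw [abs_mul, abs_of_pos Real.pi_pos] at this
    have hp := Real.pi_pos
    calc 2 * |w.re - n| = 2 / Real.pi * (Real.pi * |w.re - n|) := by field_simp
      _ ≤ _ := this
  have h5 : Real.pi * |w.im| ≤ ‖Complex.sin (Real.pi * w)‖ := by
    rw [← habs]; exact (abs_le_abs_sinh _).trans (abs_sinh_im_le _)
  have h6 := Complex.norm_le_abs_re_add_abs_im (w - (n : ℤ))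
  simp only [Complex.sub_re, Complex.intCast_re, Complex.sub_im, Complex.intCast_im, sub_zero] at h6
  have := Real.pi_gt_three
  nlinarith [abs_nonneg w.im]

/-! ### Asymptotics of the solutions with respect to the spectral parameter -/

theorem norm_cexp_I_mul_le (ρ : ℂ) {x : ℝ} (hx : 0 ≤ x) :
    ‖Complex.exp (Complex.I * ρ * x)‖ ≤ Real.exp (|ρ.im| * x) ∧
      ‖Complex.exp (-(Complex.I * ρ * x))‖ ≤ Real.exp (|ρ.im| * x) := by
  rw [Complex.norm_exp, Complex.norm_exp]
  constructor <;> refine Real.exp_le_exp.2 ?_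
  · have : (Complex.I * ρ * x).re = -ρ.im * x := by simp
    rw [this]; exact mul_le_mul_of_nonneg_right (neg_le_abs _) hx
  · have : (-(Complex.I * ρ * x)).re = ρ.im * x := by simp
    rw [this]; exact mul_le_mul_of_nonneg_right (le_abs_self _) hx

theorem hasACDeriv_cexp (c : ℂ) :
    HasACDeriv (fun x => Complex.exp (c * x)) (fun x => c * Complex.exp (c * x)) := by
  refine hasACDeriv_of_hasDerivAt (fun x => ?_) (by fun_prop)
  have := (((hasDerivAt_id (x : ℂ)).const_mul c).cexp).comp_ofReal
  simpa [mul_comm] using this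

/-- Variation of constants. -/
theorem variation_of_constants {q Y W : ℝ → ℂ} {ρ : ℂ} (hY : HasACDeriv Y W)
    (hW : HasACDeriv W (fun x => (q x - ρ ^ 2) * Y x)) {x : ℝ} (hx : x ∈ Icc 0 Real.pi) :
    W x + Complex.I * ρ * Y x = Complex.exp (Complex.I * ρ * x) * (W 0 + Complex.I * ρ * Y 0 +
      ∫ t in (0 : ℝ)..x, Complex.exp (-(Complex.I * ρ) * t) * (q t * Y t)) := by
  have h1 := (hasACDeriv_cexp (-(Complex.I * ρ))).mul (hW.add (hY.const_mul (Complex.I * ρ)))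
  have h2 := h1.congr_right (g := fun t => Complex.exp (-(Complex.I * ρ) * t) * (q t * Y t))
    fun t _ => by
      simp only [Pi.add_apply]
      linear_combination (-(ρ ^ 2) * Y t * Complex.exp (-(Complex.I * ρ) * t)) * Complex.I_sq
  have h3 := h2.integral_eq hx
  rw [h3]
  have h4 : Complex.exp (Complex.I * ρ * x) * Complex.exp (-(Complex.I * ρ) * x) = 1 := by
    rw [← Complex.exp_add]; simp
  simp only [Pi.add_apply, Complex.ofReal_zero, mul_zero, Complex.exp_zero, one_mul]
  linear_combination (-(W x + Complex.I * ρ * Y x)) * h4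

/-- The kernel e^{iρ(x-t)} grows at most like e^{|Im ρ|(x-t)}, so the growth of Y at t is carried
over to the same growth at x. -/
theorem norm_kernel_integral_le {q Y : ℝ → ℂ} {ρ : ℂ} {A M : ℝ} (hq : IntegrableOn q (Icc 0 Real.pi))
    (hYc : ContinuousOn Y (Icc 0 Real.pi))
    (hM : ∫ t in Icc 0 Real.pi, ‖q t‖ ≤ M) (hA : 0 ≤ A)
    (hY : ∀ t ∈ Icc 0 Real.pi, ‖Y t‖ ≤ A * Real.exp (|ρ.im| * t)) {x : ℝ} (hx : x ∈ Icc 0 Real.pi) :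
    ‖Complex.exp (Complex.I * ρ * x) *
      ∫ t in (0 : ℝ)..x, Complex.exp (-(Complex.I * ρ) * t) * (q t * Y t)‖ ≤
      A * M * Real.exp (|ρ.im| * x) := by
  rw [← intervalIntegral.integral_const_mul, integral_of_le hx.1]
  refine (MeasureTheory.norm_integral_le_integral_norm _).trans ?_
  have hsub : Ioc 0 x ⊆ Icc 0 Real.pi := fun t ht => ⟨ht.1.le, ht.2.trans hx.2⟩
  have hi : IntegrableOn (fun t : ℝ => Complex.exp (Complex.I * ρ * x) *
      (Complex.exp (-(Complex.I * ρ) * t) * (q t * Y t))) (Icc 0 Real.pi) := by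
    refine Integrable.const_mul ?_ _
    exact IntegrableOn.continuousOn_mul (by fun_prop) (hq.mul_continuousOn hYc isCompact_Icc)
      isCompact_Icc
  calc _ ≤ ∫ t in Ioc 0 x, ‖q t‖ * (A * Real.exp (|ρ.im| * x)) := by
        refine setIntegral_mono_on (hi.mono_set hsub).norm ((hq.mono_set hsub).norm.mul_const _)
          measurableSet_Ioc fun t ht => ?_
        have e : Complex.exp (Complex.I * ρ * x) * (Complex.exp (-(Complex.I * ρ) * t) * (q t * Y t))
            = Complex.exp (Complex.I * ρ * (x - t : ℝ)) * (q t * Y t) := by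
          rw [← mul_assoc, ← Complex.exp_add]
          congr 2; push_cast; ring
        rw [e, norm_mul, norm_mul]
        have h1 := (norm_cexp_I_mul_le ρ (sub_nonneg.2 ht.2)).1
        have h2 := hY t (hsub ht)
        calc _ ≤ Real.exp (|ρ.im| * (x - t)) * (‖q t‖ * (A * Real.exp (|ρ.im| * t))) := by gcongr
          _ = ‖q t‖ * (A * (Real.exp (|ρ.im| * (x - t)) * Real.exp (|ρ.im| * t))) := by ring
          _ = _ := by rw [← Real.exp_add]; congr 3; ring
    _ = (∫ t in Ioc 0 x, ‖q t‖) * (A * Real.exp (|ρ.im| * x)) :=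
        MeasureTheory.integral_mul_const _ _
    _ ≤ M * (A * Real.exp (|ρ.im| * x)) := by
        gcongr
        exact (setIntegral_mono_set hq.norm (.of_forall fun _ => norm_nonneg _)
          (.of_forall hsub)).trans hM
    _ = _ := by ring

/-- A bootstrap. Variation of constants for ρ and -ρ bounds both deviations by AM e^{|Im ρ|x}, where
A is the best constant in |Y| ≤ A e^{|Im ρ|x}. At the point where A is attained this gives |ρ|A ≤ 1
+ AM, hence A ≤ 2/|ρ| because M ≤ |ρ|/2. -/
theorem solution_asymptotics {q Y W : ℝ → ℂ} {ρ : ℂ} {M : ℝ} (hq : IntegrableOn q (Icc 0 Real.pi))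
    (hM : ∫ t in Icc 0 Real.pi, ‖q t‖ ≤ M) (hρ : 2 * M ≤ ‖ρ‖) (hρ0 : ρ ≠ 0)
    (hY : HasACDeriv Y W) (hW : HasACDeriv W (fun x => (q x - ρ ^ 2) * Y x))
    (hY0 : Y 0 = 0) (hW0 : W 0 = 1) {x : ℝ} (hx : x ∈ Icc 0 Real.pi) :
    ‖Y x‖ ≤ 2 / ‖ρ‖ * Real.exp (|ρ.im| * x) ∧
    ‖ρ * Y x - Complex.sin (ρ * x)‖ ≤ 2 * M / ‖ρ‖ * Real.exp (|ρ.im| * x) ∧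
    ‖W x - Complex.cos (ρ * x)‖ ≤ 2 * M / ‖ρ‖ * Real.exp (|ρ.im| * x) := by
  have hr : 0 < ‖ρ‖ := norm_pos_iff.2 hρ0
  have hM0 : 0 ≤ M := (by positivity : 0 ≤ ∫ t in Icc 0 Real.pi, ‖q t‖).trans hM
  have hI := Complex.I_ne_zero
  have key : ∀ A : ℝ, 0 ≤ A → (∀ t ∈ Icc 0 Real.pi, ‖Y t‖ ≤ A * Real.exp (|ρ.im| * t)) →
      ∀ x ∈ Icc 0 Real.pi,
        ‖ρ * Y x - Complex.sin (ρ * x)‖ ≤ A * M * Real.exp (|ρ.im| * x) ∧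
        ‖W x - Complex.cos (ρ * x)‖ ≤ A * M * Real.exp (|ρ.im| * x) := by
    intro A hA h x hx
    have v1 := variation_of_constants hY hW hx
    have v2 := variation_of_constants (ρ := -ρ) hY (by simpa using hW) hx
    have n1 := norm_kernel_integral_le hq hY.continuousOn hM hA h hx
    have n2 := norm_kernel_integral_le (ρ := -ρ) hq hY.continuousOn hM hA (by simpa using h) hx
    simp only [Complex.neg_im, abs_neg] at n2
    set J1 := Complex.exp (Complex.I * ρ * x) *
      ∫ t in (0 : ℝ)..x, Complex.exp (-(Complex.I * ρ) * t) * (q t * Y t) with hJ1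
    set J2 := Complex.exp (Complex.I * -ρ * x) *
      ∫ t in (0 : ℝ)..x, Complex.exp (-(Complex.I * -ρ) * t) * (q t * Y t) with hJ2
    rw [mul_add, ← hJ1, hY0, hW0] at v1
    rw [mul_add, ← hJ2, hY0, hW0] at v2
    have es : Complex.sin (ρ * x) = (Complex.exp (Complex.I * -ρ * x) - Complex.exp (Complex.I * ρ * x)) * Complex.I / 2 := by
      rw [Complex.sin]; congr 3 <;> ring_nf
    have ec : Complex.cos (ρ * x) = (Complex.exp (Complex.I * ρ * x) + Complex.exp (Complex.I * -ρ * x)) / 2 := by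
      rw [Complex.cos]; congr 3 <;> ring_nf
    have e1 : ρ * Y x - Complex.sin (ρ * x) = (J2 - J1) * (Complex.I / 2) := by
      rw [es]
      linear_combination (-Complex.I / 2) * v1 + (Complex.I / 2) * v2 + (ρ * Y x) * Complex.I_sq
    have e2 : W x - Complex.cos (ρ * x) = (J1 + J2) * (1 / 2) := by
      rw [ec]
      linear_combination (1 / 2) * v1 + (1 / 2) * v2
    rw [e1, e2, norm_mul, norm_mul]
    have a1 := norm_sub_le J2 J1
    have a2 := norm_add_le J1 J2
    simp only [norm_div, Complex.norm_I, norm_one, Complex.norm_ofNat]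
    constructor <;> linarith
  have hbase : ∀ t ∈ Icc 0 Real.pi, ‖Complex.sin (ρ * t)‖ ≤ Real.exp (|ρ.im| * t) := by
    intro t ht
    obtain ⟨h1, h2⟩ := norm_cexp_I_mul_le ρ ht.1
    have : Complex.sin (ρ * t) =
        (Complex.exp (-(Complex.I * ρ * t)) - Complex.exp (Complex.I * ρ * t)) * (Complex.I / 2) := by
      rw [Complex.sin, mul_div_assoc]; congr 3 <;> ring_nf
    rw [this, norm_mul]
    have := norm_sub_le (Complex.exp (-(Complex.I * ρ * t))) (Complex.exp (Complex.I * ρ * t))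
    simp only [norm_div, Complex.norm_I, Complex.norm_ofNat]
    linarith
  -- a bound for the weighted supremum
  obtain ⟨x₀, hx₀, hmax⟩ := isCompact_Icc.exists_isMaxOn (nonempty_Icc.2 Real.pi_pos.le)
    (f := fun t => ‖Y t‖ * Real.exp (-(|ρ.im| * t)))
    (hY.continuousOn.norm.mul (by fun_prop))
  set A := ‖Y x₀‖ * Real.exp (-(|ρ.im| * x₀)) with hAdef
  have hA0 : 0 ≤ A := by positivity
  have hexp : ∀ t : ℝ, Real.exp (-(|ρ.im| * t)) * Real.exp (|ρ.im| * t) = 1 := fun t => by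
    rw [← Real.exp_add]; simp
  have hA : ∀ t ∈ Icc 0 Real.pi, ‖Y t‖ ≤ A * Real.exp (|ρ.im| * t) := fun t ht => by
    have h1 := mul_le_mul_of_nonneg_right (hmax ht) (Real.exp_nonneg (|ρ.im| * t))
    rw [mul_assoc, hexp, mul_one] at h1
    exact h1
  have hA2 : A ≤ 2 / ‖ρ‖ := by
    have h1 := (key A hA0 hA x₀ hx₀).1
    have h2 := hbase x₀ hx₀
    have h3 : ‖ρ‖ * ‖Y x₀‖ ≤ (1 + A * M) * Real.exp (|ρ.im| * x₀) := by
      rw [← norm_mul]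
      calc ‖ρ * Y x₀‖ = ‖(ρ * Y x₀ - Complex.sin (ρ * x₀)) + Complex.sin (ρ * x₀)‖ := by ring_nf
        _ ≤ _ := (norm_add_le _ _).trans (by linarith)
    have h4 : ‖ρ‖ * A ≤ 1 + A * M := by
      have := mul_le_mul_of_nonneg_right h3 (Real.exp_nonneg (-(|ρ.im| * x₀)))
      rw [mul_assoc, mul_assoc (1 + A * M), mul_comm (Real.exp (|ρ.im| * x₀)), hexp, mul_one] at this
      exact this
    rw [le_div_iff₀ hr]
    nlinarith
  have hfin : ∀ t ∈ Icc 0 Real.pi, ‖Y t‖ ≤ 2 / ‖ρ‖ * Real.exp (|ρ.im| * t) := fun t ht =>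
    (hA t ht).trans (by gcongr)
  have := key (2 / ‖ρ‖) (by positivity) hfin x hx
  refine ⟨hfin x hx, ?_, ?_⟩
  · rw [show 2 * M / ‖ρ‖ = 2 / ‖ρ‖ * M by ring]; exact this.1
  · rw [show 2 * M / ‖ρ‖ = 2 / ‖ρ‖ * M by ring]; exact this.2

end SturmLiouville

end

noncomputable section

namespace SturmLiouville

open Set intervalIntegral

/-! ### Numbering of the eigenvalues -/

/-- The two kinds of boundary conditions at `π`: the exponent `e` and the shift `θ` are `1, 0`
(Dirichlet) or `0, 1/2` (Neumann). -/
def IsKind (e : ℕ) (θ : ℝ) : Prop := (e = 1 ∧ θ = 0) ∨ (e = 0 ∧ θ = 1 / 2)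

/-- An entire function `Δ` such that `ρᵉ Δ(ρ²)` is close to `sin π(ρ + θ)`. -/
structure IsCharLike (Δ : ℂ → ℂ) (e : ℕ) (θ K : ℝ) : Prop where
  kind : IsKind e θ
  diff : Differentiable ℂ Δ
  asymp : ∀ ρ : ℂ, K ≤ ‖ρ‖ → ‖ρ ^ e * Δ (ρ ^ 2) - Complex.sin (Real.pi * (ρ + θ))‖ ≤
    K / ‖ρ‖ * Real.exp (Real.pi * |ρ.im|)

/-- The unperturbed characteristic function. -/
structure IsCharModel (Δ : ℂ → ℂ) (e : ℕ) (θ : ℝ) : Prop where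
  kind : IsKind e θ
  diff : Differentiable ℂ Δ
  eq : ∀ ρ : ℂ, ρ ^ e * Δ (ρ ^ 2) = Complex.sin (Real.pi * (ρ + θ))
  zero : Δ 0 ≠ 0

theorem IsKind.bounds {e : ℕ} {θ : ℝ} (h : IsKind e θ) : 0 ≤ θ ∧ θ ≤ 1 / 2 := by
  rcases h with ⟨-, rfl⟩ | ⟨-, rfl⟩ <;> norm_num

/-- The principal square root. -/
def csqrt (z : ℂ) : ℂ := z ^ (1 / 2 : ℂ)

theorem csqrt_sq (z : ℂ) : csqrt z ^ 2 = z := by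
  rw [csqrt, ← Complex.cpow_nat_mul]; simp

theorem csqrt_re_nonneg (z : ℂ) : 0 ≤ (csqrt z).re := by
  by_cases hz : z = 0
  · simp [csqrt, hz]
  · rw [csqrt, Complex.cpow_def_of_ne_zero hz, Complex.exp_re]
    refine mul_nonneg (Real.exp_nonneg _) (Real.cos_nonneg_of_mem_Icc ?_)
    have : (Complex.log z * (1 / 2)).im = z.arg / 2 := by
      rw [show Complex.log z * (1 / 2 : ℂ) = Complex.log z / (2 : ℝ) by push_cast; ring,
        Complex.div_ofReal_im, Complex.log_im]
    rw [this]
    exact ⟨by linarith [Complex.neg_pi_lt_arg z], by linarith [Complex.arg_le_pi z]⟩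

theorem norm_csqrt_sq (z : ℂ) : ‖csqrt z‖ ^ 2 = ‖z‖ := by rw [← norm_pow, csqrt_sq]

theorem norm_csqrt_lt_iff {z : ℂ} {r : ℝ} (hr : 0 ≤ r) : ‖csqrt z‖ < r ↔ ‖z‖ < r ^ 2 := by
  rw [← norm_csqrt_sq z]
  exact (pow_lt_pow_iff_left₀ (norm_nonneg _) hr two_ne_zero).symm

/-- A zero of the sine compared with its distance to the half-way circles. -/
theorem lt_norm_sin_of_norm_eq {e : ℕ} {θ : ℝ} (hk : IsKind e θ) {n : ℕ} {ρ : ℂ}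
    (hρ : ‖ρ‖ = n + 1 / 2 - θ) :
    1 / 24 * Real.exp (Real.pi * |ρ.im|) < ‖Complex.sin (Real.pi * (ρ + θ))‖ := by
  -- If the sine were this small, ρ would lie within 1/8 of some k - θ. But every |k - θ| is at
  -- distance at least 1/2 from n + 1/2 - θ.
  by_contra h
  have h1 := norm_sub_round_le (w := ρ + θ) (η := 1 / 24) (by norm_num) (by simpa using not_lt.1 h)
  set k := round (ρ + θ : ℂ).re
  have h2 : |‖ρ‖ - abs ((k : ℝ) - θ)| ≤ 1 / 8 := by
    have h3 := abs_norm_sub_norm_le ρ ((k : ℝ) - θ : ℝ)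
    rw [Complex.norm_real, Real.norm_eq_abs] at h3
    refine h3.trans ?_
    rw [show ρ - (((k : ℝ) - θ : ℝ) : ℂ) = ρ + θ - k by push_cast; ring]
    linarith
  rw [hρ] at h2
  have h4 := abs_le.1 h2
  rcases hk with ⟨-, rfl⟩ | ⟨-, rfl⟩
  · rw [sub_zero, sub_zero] at h4
    have h5 : |(k : ℝ)| = ((|k| : ℤ) : ℝ) := by push_cast; rfl
    rw [h5] at h4
    have a : ((|k| : ℤ) : ℝ) < ((n + 1 : ℤ) : ℝ) := by push_cast at h4 ⊢; linarith
    have b : ((n : ℤ) : ℝ) < ((|k| : ℤ) : ℝ) := by push_cast at h4 ⊢; linarith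
    have := Int.cast_lt.1 a
    have := Int.cast_lt.1 b
    omega
  · rcases le_or_gt (1 : ℤ) k with hk1 | hk1
    · have : (1 : ℝ) ≤ k := by exact_mod_cast hk1
      rw [abs_of_nonneg (by linarith)] at h4
      have a : (k : ℝ) < ((n + 1 : ℤ) : ℝ) := by push_cast; linarith
      have b : ((n : ℤ) : ℝ) < (k : ℝ) := by push_cast; linarith
      have := Int.cast_lt.1 a
      have := Int.cast_lt.1 b
      omega
    · have : (k : ℝ) ≤ 0 := by exact_mod_cast (by omega : k ≤ 0)
      rw [abs_of_nonpos (by linarith)] at h4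
      have a : ((-k : ℤ) : ℝ) < ((n : ℤ) : ℝ) := by push_cast; linarith
      have b : ((n - 1 : ℤ) : ℝ) < ((-k : ℤ) : ℝ) := by push_cast; linarith
      have := Int.cast_lt.1 a
      have := Int.cast_lt.1 b
      omega

/-- Only k ≥ 1 occur: the principal root has nonnegative real part, and the value at zero is
excluded by the model. -/
theorem IsCharModel.eq_zero_iff {Δ : ℂ → ℂ} {e : ℕ} {θ : ℝ} (h : IsCharModel Δ e θ) (a : ℂ) :
    Δ a = 0 ↔ ∃ k : ℕ, 1 ≤ k ∧ a = ((k - θ : ℝ) : ℂ) ^ 2 := by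
  have hθ := h.kind.bounds
  constructor
  · intro ha
    have hρ := h.eq (csqrt a)
    rw [csqrt_sq, ha, mul_zero] at hρ
    obtain ⟨k, hk⟩ := Complex.sin_eq_zero_iff.1 hρ.symm
    have hk' : csqrt a = ((k - θ : ℝ) : ℂ) := by
      have : (Real.pi : ℂ) * (csqrt a + θ) = Real.pi * k := by rw [hk]; ring
      have := mul_left_cancel₀ (by exact_mod_cast Real.pi_ne_zero) this
      push_cast; rw [← this]; ring
    have ha0 : a ≠ 0 := fun h0 => h.zero (h0 ▸ ha)
    have hre := csqrt_re_nonneg a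
    rw [hk', Complex.ofReal_re] at hre
    have hne : (k - θ : ℝ) ≠ 0 := fun h0 => ha0 (by rw [← csqrt_sq a, hk', h0]; simp)
    have hk1 : 1 ≤ k := by
      have : (0 : ℝ) < k := by
        rcases lt_or_eq_of_le hre with h1 | h1
        · linarith
        · exact absurd h1.symm hne
      exact_mod_cast this
    refine ⟨k.toNat, by omega, ?_⟩
    have : ((k.toNat : ℕ) : ℝ) = (k : ℝ) := by
      have : ((k.toNat : ℕ) : ℤ) = k := Int.toNat_of_nonneg (by omega)
      exact_mod_cast this
    rw [this, ← hk', csqrt_sq]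
  · rintro ⟨k, hk, rfl⟩
    have h1 := h.eq ((k - θ : ℝ) : ℂ)
    have h2 : Complex.sin (Real.pi * (((k - θ : ℝ) : ℂ) + θ)) = 0 := by
      rw [show (Real.pi : ℂ) * (((k - θ : ℝ) : ℂ) + θ) = (k : ℕ) * Real.pi by push_cast; ring]
      exact Complex.sin_nat_mul_pi k
    rw [h2] at h1
    refine (mul_eq_zero.1 h1).resolve_left (pow_ne_zero _ ?_)
    have : (1 : ℝ) ≤ k := by exact_mod_cast hk
    exact_mod_cast (by linarith : (0 : ℝ) < k - θ).ne'

/-- Differentiate ρᵉ Δ(ρ²) = sin π(ρ + θ): a multiple zero would make sine and cosine vanish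
together. -/
theorem IsCharModel.order {Δ : ℂ → ℂ} {e : ℕ} {θ : ℝ} (h : IsCharModel Δ e θ) {a : ℂ}
    (ha : Δ a = 0) : analyticOrderAt Δ a = 1 := by
  obtain ⟨k, hk, rfl⟩ := (h.eq_zero_iff a).1 ha
  refine (h.diff.analyticAt _).analyticOrderAt_eq_one_of_zero_deriv_ne_zero ha fun hd => ?_
  set ρ₀ : ℂ := ((k - θ : ℝ) : ℂ)
  have h1 : HasDerivAt (fun ρ : ℂ => ρ ^ e * Δ (ρ ^ 2))
      ((e * ρ₀ ^ (e - 1)) * Δ (ρ₀ ^ 2) + ρ₀ ^ e * (deriv Δ (ρ₀ ^ 2) * (2 * ρ₀))) ρ₀ := by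
    have h2 : HasDerivAt (fun ρ : ℂ => ρ ^ 2) (2 * ρ₀) ρ₀ := by simpa using hasDerivAt_pow 2 ρ₀
    exact (hasDerivAt_pow e ρ₀).mul ((h.diff _).hasDerivAt.comp ρ₀ h2)
  rw [hd, ha] at h1
  have h3 : HasDerivAt (fun ρ : ℂ => Complex.sin (Real.pi * (ρ + θ)))
      (Complex.cos (Real.pi * (ρ₀ + θ)) * Real.pi) ρ₀ := by
    have := (((hasDerivAt_id ρ₀).add_const (θ : ℂ)).const_mul (Real.pi : ℂ)).csin
    simpa using this
  have e1 : (fun ρ : ℂ => ρ ^ e * Δ (ρ ^ 2)) = fun ρ : ℂ => Complex.sin (Real.pi * (ρ + θ)) :=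
    funext h.eq
  rw [e1] at h1
  have h4 := h1.unique h3
  have h5 : Complex.sin (Real.pi * (ρ₀ + θ)) = 0 := by rw [← h.eq, ha, mul_zero]
  have h6 := Complex.sin_sq_add_cos_sq (Real.pi * (ρ₀ + θ))
  rw [h5] at h6
  simp only [mul_zero, zero_mul, add_zero] at h4
  rcases mul_eq_zero.1 h4.symm with h7 | h7
  · rw [h7] at h6; norm_num at h6
  · exact Real.pi_ne_zero (by exact_mod_cast h7)

theorem IsCharModel.card {Δ : ℂ → ℂ} {e : ℕ} {θ : ℝ} (h : IsCharModel Δ e θ) {n : ℕ}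
    {t : Multiset ℂ} {k : ℂ → ℂ} (hk : Differentiable ℂ k)
    (hk0 : ∀ w ∈ Metric.closedBall (0 : ℂ) ((n + 1 / 2 - θ) ^ 2), k w ≠ 0)
    (ht : ∀ a ∈ t, Δ a = 0 ∧ ‖a‖ ≤ (n + 1 / 2 - θ) ^ 2)
    (hΔk : ∀ w, Δ w = (t.map fun a => w - a).prod * k w) : t.card = n := by
  have hθ := h.kind.bounds
  classical
  have hcount : ∀ a, Δ a = 0 → ‖a‖ ≤ (n + 1 / 2 - θ) ^ 2 → t.count a = 1 := fun a ha hle => by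
    have := analyticOrderAt_of_factorization hk hΔk (hk0 a (by simpa using hle))
    rw [h.order ha] at this
    exact_mod_cast this.symm
  have hnd : t.Nodup := Multiset.nodup_iff_count_le_one.2 fun a => by
    by_cases ha : a ∈ t
    · exact (hcount a (ht a ha).1 (ht a ha).2).le
    · rw [Multiset.count_eq_zero_of_notMem ha]; norm_num
  have hset : t.toFinset = (Finset.Icc 1 n).image fun k : ℕ => ((k - θ : ℝ) : ℂ) ^ 2 := by
    ext a
    rw [Multiset.mem_toFinset, Finset.mem_image]
    have hn : ∀ k : ℕ, 1 ≤ k → (‖((k - θ : ℝ) : ℂ) ^ 2‖ ≤ (n + 1 / 2 - θ) ^ 2 ↔ k ≤ n) := by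
      intro k hk
      have hk' : (1 : ℝ) ≤ k := by exact_mod_cast hk
      rw [norm_pow, Complex.norm_real, Real.norm_eq_abs, abs_of_pos (by linarith),
        pow_le_pow_iff_left₀ (by linarith) (by linarith [n.cast_nonneg (α := ℝ)]) two_ne_zero]
      constructor
      · intro h1
        have : (k : ℝ) < (n + 1 : ℕ) := by push_cast; linarith
        have := Nat.cast_lt.1 this
        omega
      · intro h1
        have : (k : ℝ) ≤ n := by exact_mod_cast h1
        linarith
    constructor
    · intro ha
      obtain ⟨k, hk, rfl⟩ := (h.eq_zero_iff a).1 (ht a ha).1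
      exact ⟨k, Finset.mem_Icc.2 ⟨hk, (hn k hk).1 (ht _ ha).2⟩, rfl⟩
    · rintro ⟨k, hk, rfl⟩
      obtain ⟨hk1, hk2⟩ := Finset.mem_Icc.1 hk
      refine Multiset.one_le_count_iff_mem.1 ?_
      rw [hcount _ ((h.eq_zero_iff _).2 ⟨k, hk1, rfl⟩) ((hn k hk1).2 hk2)]
  rw [← Multiset.toFinset_card_of_nodup hnd, hset, Finset.card_image_of_injOn, Nat.card_Icc]
  · omega
  · intro a ha b hb hab
    have ha' : (1 : ℝ) ≤ a := by exact_mod_cast (Finset.mem_Icc.1 ha).1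
    have hb' : (1 : ℝ) ≤ b := by exact_mod_cast (Finset.mem_Icc.1 hb).1
    have h1 : ((a - θ : ℝ)) ^ 2 = ((b - θ : ℝ)) ^ 2 := by
      simp only at hab; exact_mod_cast hab
    have := (pow_left_inj₀ (by linarith) (by linarith) two_ne_zero).1 h1
    exact_mod_cast (by linarith : (a : ℝ) = b)

theorem IsCharLike.ne_zero {Δ : ℂ → ℂ} {e : ℕ} {θ K : ℝ} (h : IsCharLike Δ e θ K) {n : ℕ}
    (hn : 24 * K < n) {ρ : ℂ} (hρ : ‖ρ‖ = n + 1 / 2 - θ) (hK : 1 ≤ K) : Δ (ρ ^ 2) ≠ 0 := by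
  have hθ := h.kind.bounds
  intro h0
  have h1 := h.asymp ρ (by rw [hρ]; linarith)
  rw [h0, mul_zero, zero_sub, norm_neg] at h1
  have h2 := lt_norm_sin_of_norm_eq h.kind hρ
  have h3 : K / ‖ρ‖ < 1 / 24 := by
    rw [hρ, div_lt_iff₀ (by linarith)]; linarith
  nlinarith [Real.exp_pos (Real.pi * |ρ.im|)]

/-- Zeros of large modulus are near the zeros of the model. -/
theorem IsCharLike.localize {Δ : ℂ → ℂ} {e : ℕ} {θ K : ℝ} (h : IsCharLike Δ e θ K) (hK : 1 ≤ K)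
    {n : ℕ} (hn : 24 * K < n) {a : ℂ} (ha : Δ a = 0) (hle : (n + 1 / 2 - θ) ^ 2 ≤ ‖a‖) :
    ∃ k : ℕ, n + 1 ≤ k ∧ ‖csqrt a - ((k - θ : ℝ) : ℂ)‖ ≤ 3 * (K / ‖csqrt a‖) ∧
      ‖csqrt a - ((k - θ : ℝ) : ℂ)‖ ≤ 1 / 8 := by
  have hθ := h.kind.bounds
  set ρ := csqrt a with hρ
  have hnρ : n + 1 / 2 - θ ≤ ‖ρ‖ := by
    rw [← norm_csqrt_sq] at hle
    exact (pow_le_pow_iff_left₀ (by linarith) (norm_nonneg _) two_ne_zero).1 hle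
  have hρ0 : 0 < ‖ρ‖ := by linarith
  have h1 := h.asymp ρ (by linarith)
  rw [hρ, csqrt_sq, ha, mul_zero, zero_sub, norm_neg, ← hρ] at h1
  have h3 : K / ‖ρ‖ < 1 / 24 := by
    rw [div_lt_iff₀ hρ0]; linarith
  have h4 := norm_sub_round_le (w := ρ + θ) (η := K / ‖ρ‖) (by linarith) (by simpa using h1)
  set k := round (ρ + θ : ℂ).re
  have e1 : ρ + θ - (k : ℂ) = ρ - ((k - θ : ℝ) : ℂ) := by push_cast; ring
  rw [e1] at h4
  have h5 : ‖ρ - ((k - θ : ℝ) : ℂ)‖ ≤ 1 / 8 := by linarith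
  have hre : -(1 / 8) ≤ (k - θ : ℝ) := by
    have h6 := (Complex.abs_re_le_norm (ρ - ((k - θ : ℝ) : ℂ))).trans h5
    rw [Complex.sub_re, Complex.ofReal_re] at h6
    have := csqrt_re_nonneg a
    linarith [(abs_le.1 h6).2]
  have h7 : n + 1 / 2 - θ - 1 / 8 ≤ |(k - θ : ℝ)| := by
    have h6 := (abs_norm_sub_norm_le ρ ((k - θ : ℝ) : ℂ)).trans h5
    rw [Complex.norm_real, Real.norm_eq_abs] at h6
    linarith [(abs_le.1 h6).2]
  have h8 : (n : ℝ) + 1 / 2 - θ - 1 / 8 ≤ k - θ := by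
    rcases le_or_gt 0 (k - θ : ℝ) with h9 | h9
    · rwa [abs_of_nonneg h9] at h7
    · rw [abs_of_neg h9] at h7; linarith
  have h9 : (n : ℤ) < k := by
    have : ((n : ℤ) : ℝ) < k := by push_cast; linarith
    exact_mod_cast this
  have h10 : ((k.toNat : ℕ) : ℝ) = (k : ℝ) := by
    have : ((k.toNat : ℕ) : ℤ) = k := Int.toNat_of_nonneg (by omega)
    exact_mod_cast this
  exact ⟨k.toNat, by omega, by rw [h10]; exact h4, by rw [h10]; exact h5⟩

/-! ### Position of the k-th eigenvalue -/

section Sequence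

variable {Δ Δ₀ : ℂ → ℂ} {e : ℕ} {θ K : ℝ} (h : IsCharLike Δ e θ K) (h₀ : IsCharModel Δ₀ e θ)
  (hK : 1 ≤ K) {Γ : Submodule ℂ (L2 × L2)} (hΓ : ∀ z, algMult Γ z = analyticOrderAt Δ z)
  {ev : ℕ+ → ℂ} (hev : IsEigenvalueSeq Γ ev)

include hΓ hev in
theorem eval_eq_zero (k : ℕ+) : Δ (ev k) = 0 := by
  have h1 : {l | ev l = ev k}.encard ≠ 0 := by
    rw [Ne, encard_eq_zero]
    exact Nonempty.ne_empty ⟨k, rfl⟩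
  rw [hev.2, hΓ] at h1
  exact apply_eq_zero_of_analyticOrderAt_ne_zero h1

include h h₀ hK hΓ hev in
-- Rouché against the model on a circle halfway between its zeros: there the error K/|ρ| is below
-- 1/24, the lower bound for the sine. The indices are then counted fibre by fibre, each fibre
-- having as many elements as the order of its zero.
theorem ncard_small {n : ℕ} (hn : 24 * K < n) :
    {k | ‖ev k‖ < (n + 1 / 2 - θ) ^ 2}.Finite ∧ {k | ‖ev k‖ < (n + 1 / 2 - θ) ^ 2}.ncard = n := by
  have hθ := h.kind.bounds
  set r : ℝ := n + 1 / 2 - θ with hr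
  have hr0 : 0 < r := by linarith
  have hsph : ∀ w ∈ Metric.sphere (0 : ℂ) (r ^ 2), ‖csqrt w‖ = r := fun w hw => by
    have : ‖w‖ = r ^ 2 := by simpa using hw
    rw [← norm_csqrt_sq] at this
    exact (pow_left_inj₀ (norm_nonneg _) hr0.le two_ne_zero).1 this
  have hne : Δ ≠ 0 := fun h1 => by
    have := h.ne_zero hn (ρ := (r : ℂ)) (by rw [Complex.norm_real, Real.norm_of_nonneg hr0.le]) hK
    rw [h1] at this
    exact this rfl
  have hne₀ : Δ₀ ≠ 0 := fun h1 => h₀.zero (by rw [h1]; rfl)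
  obtain ⟨s, g, hg, hg0, hs, hΔg⟩ := exists_factorization h.diff hne (r ^ 2)
  obtain ⟨t, k, hk, hk0, ht, hΔk⟩ := exists_factorization h₀.diff hne₀ (r ^ 2)
  have hcard : s.card = n := by
    rw [← h₀.card hk hk0 ht hΔk]
    refine card_eq_of_norm_sub_lt (by positivity) h.diff h₀.diff (fun w hw => ?_) hg hg0 hs hΔg
      hk hk0 ht hΔk
    set ρ := csqrt w with hρ
    have hnρ : ‖ρ‖ = r := hsph w hw
    have h1 := h.asymp ρ (by rw [hnρ]; linarith)
    rw [← h₀.eq ρ, ← mul_sub, hρ, csqrt_sq, ← hρ, norm_mul] at h1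
    have h2 := lt_norm_sin_of_norm_eq h.kind (ρ := ρ) hnρ
    rw [← h₀.eq ρ, hρ, csqrt_sq, ← hρ, norm_mul] at h2
    have h3 : K / ‖ρ‖ < 1 / 24 := by
      rw [hnρ, div_lt_iff₀ hr0]; linarith
    have h4 : ‖ρ ^ e‖ * ‖Δ w - Δ₀ w‖ < ‖ρ ^ e‖ * ‖Δ₀ w‖ := by
      nlinarith [Real.exp_pos (Real.pi * |ρ.im|)]
    exact lt_of_mul_lt_mul_left h4 (norm_nonneg _)
  classical
  have hfib : ∀ z : ℂ, ‖z‖ ≤ r ^ 2 → {k | ev k = z}.encard = s.count z := fun z hz => by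
    rw [hev.2, hΓ]
    exact analyticOrderAt_of_factorization hg hΔg (hg0 z (by simpa using hz))
  have hA : {k | ‖ev k‖ < r ^ 2} = ⋃ z ∈ s.toFinset, {k | ev k = z} := by
    ext l
    simp only [mem_ofPred_eq, mem_iUnion, exists_prop, exists_eq_right', Multiset.mem_toFinset]
    constructor
    · intro hl
      refine Multiset.one_le_count_iff_mem.1 ?_
      have h1 := hfib (ev l) hl.le
      have h2 : 1 ≤ {k | ev k = ev l}.encard := Set.one_le_encard_iff_nonempty.2 ⟨l, rfl⟩
      rw [h1] at h2
      exact_mod_cast h2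
    · intro hl
      refine lt_of_le_of_ne (hs _ hl).2 fun he => ?_
      refine h.ne_zero hn (ρ := csqrt (ev l)) (hsph _ (by simpa using he)) hK ?_
      rw [csqrt_sq]; exact (hs _ hl).1
  have hfin : ∀ z ∈ s.toFinset, {k | ev k = z}.Finite := fun z hz => by
    rw [← Set.encard_ne_top_iff, hfib z (hs z (Multiset.mem_toFinset.1 hz)).2]
    exact ENat.natCast_ne_top _
  have hAfin : {k | ‖ev k‖ < r ^ 2}.Finite := by
    rw [hA]; exact s.toFinset.finite_toSet.biUnion hfin
  refine ⟨hAfin, ?_⟩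
  rw [Set.ncard_eq_toFinset_card _ hAfin, Finset.card_eq_sum_card_fiberwise (f := ev)
    (t := s.toFinset), ← hcard, ← Multiset.toFinset_sum_count_eq]
  · refine Finset.sum_congr rfl fun z hz => ?_
    have h1 := hfib z (hs z (Multiset.mem_toFinset.1 hz)).2
    rw [(hfin z hz).encard_eq_coe_toFinset_card] at h1
    rw [← Nat.cast_inj (R := ℕ∞), ← h1]
    congr 2
    ext l
    simp only [Finset.mem_filter, Set.Finite.mem_toFinset, mem_ofPred_eq, and_iff_right_iff_imp]
    intro hl
    have : l ∈ {k | ‖ev k‖ < r ^ 2} := by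
      rw [hA]; exact mem_biUnion hz hl
    exact this
  · intro l hl
    have hl' : l ∈ {k | ‖ev k‖ < r ^ 2} := by simpa using hl
    rw [hA] at hl'
    simpa using hl'

include h h₀ hK hΓ hev in
-- Exactly n indices belong to the disc, so it suffices that they form an initial segment. For
-- numbering by modulus this is clear; for numbering by real part, a zero outside the disc lies so
-- close to the positive axis that its real part exceeds the radius.
theorem norm_lt_iff_le {n : ℕ} (hn : 24 * K < n) (k : ℕ+) :
    ‖ev k‖ < (n + 1 / 2 - θ) ^ 2 ↔ (k : ℕ) ≤ n := by
  have hθ := h.kind.bounds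
  obtain ⟨hfin, hcard⟩ := ncard_small h h₀ hK hΓ hev hn
  set A := {k | ‖ev k‖ < (n + 1 / 2 - θ) ^ 2} with hA
  have hlow : ∀ k ∈ A, ∀ l : ℕ+, l ≤ k → l ∈ A := by
    intro k hk l hlk
    by_contra hl
    have hl' : (n + 1 / 2 - θ) ^ 2 ≤ ‖ev l‖ := not_lt.1 hl
    rcases hev.1 with hmono | hmono
    · exact absurd (hmono hlk) (not_le.2 (lt_of_lt_of_le hk hl'))
    · obtain ⟨j, hj, -, hj8⟩ := h.localize hK hn (eval_eq_zero hΓ hev l) hl'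
      have h1 : (ev l).re ≤ (ev k).re := hmono hlk
      have h2 : (ev k).re < (n + 1 / 2 - θ) ^ 2 := lt_of_le_of_lt (Complex.re_le_norm _) hk
      set ρ := csqrt (ev l) with hρ
      have h3 : (ev l).re = ρ.re ^ 2 - ρ.im ^ 2 := by
        rw [← csqrt_sq (ev l), ← hρ, sq, Complex.mul_re]; ring
      have h4 := (Complex.abs_re_le_norm (ρ - ((j - θ : ℝ) : ℂ))).trans hj8
      have h5 := (Complex.abs_im_le_norm (ρ - ((j - θ : ℝ) : ℂ))).trans hj8
      rw [Complex.sub_re, Complex.ofReal_re] at h4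
      rw [Complex.sub_im, Complex.ofReal_im, sub_zero] at h5
      have h6 : ρ.im ^ 2 ≤ (1 / 8) ^ 2 := sq_le_sq' (by linarith [(abs_le.1 h5).1]) (abs_le.1 h5).2
      have h7 : (n : ℝ) + 1 ≤ j := by exact_mod_cast hj
      have h8 : n + 1 / 2 - θ + 3 / 8 ≤ ρ.re := by linarith [(abs_le.1 h4).1]
      -- With r = n + 1/2 - θ, Re ρ² ≥ (r + 3/8)² - (1/8)² > r².
      nlinarith
  have hsub : A ⊆ {k : ℕ+ | (k : ℕ) ≤ n} := by
    intro k hk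
    have h1 : Set.Icc 1 k ⊆ A := fun l hl => hlow k hk l hl.2
    have h2 := Set.ncard_le_ncard h1 hfin
    rw [hcard] at h2
    have h3 : (Set.Icc 1 k).ncard = k := by
      rw [← Finset.coe_Icc, Set.ncard_coe_finset]; simp
    rw [h3] at h2
    exact h2
  have hfin' : {k : ℕ+ | (k : ℕ) ≤ n}.Finite :=
    Set.Finite.of_injOn (f := fun k : ℕ+ => (k : ℕ)) (t := Set.Iic n) (fun k hk => hk)
      (PNat.coe_injective.injOn) (Set.finite_Iic n)
  have hle : {k : ℕ+ | (k : ℕ) ≤ n}.ncard ≤ n := by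
    have := Set.ncard_le_ncard_of_injOn (s := {k : ℕ+ | (k : ℕ) ≤ n}) (t := Set.Icc 1 n)
      (fun k : ℕ+ => (k : ℕ)) (fun k hk => ⟨k.2, hk⟩) PNat.coe_injective.injOn (Set.finite_Icc 1 n)
    rw [← Finset.coe_Icc, Set.ncard_coe_finset, Nat.card_Icc] at this
    omega
  have heq := Set.eq_of_subset_of_ncard_le hsub (by rw [hcard]; exact hle) hfin'
  exact (Set.ext_iff.1 heq k)

include h h₀ hK hΓ hev in
/-- The `k`-th eigenvalue, for large `k`, is near the `k`-th zero of the model. -/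
theorem csqrt_eigenvalue_near {N : ℕ} (hN : 24 * K < N) (k : ℕ+) :
    ((k : ℕ) ≤ N → ‖csqrt (ev k)‖ ≤ N + 1) ∧
    (N < (k : ℕ) → ‖csqrt (ev k) - ((k - θ : ℝ) : ℂ)‖ ≤ 3 * (K / ‖csqrt (ev k)‖) ∧
      ‖csqrt (ev k) - ((k - θ : ℝ) : ℂ)‖ ≤ 1 / 8) := by
  have hθ := h.kind.bounds
  constructor
  · intro hk
    have h1 := (norm_lt_iff_le h h₀ hK hΓ hev hN k).2 hk
    rw [← norm_csqrt_lt_iff (by linarith)] at h1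
    linarith
  · intro hk
    -- The eigenvalue of index n + 1 lies between the circles belonging to n and n + 1, and the only
    -- model zero there has the index n + 1.
    obtain ⟨n, hn⟩ : ∃ n : ℕ, (k : ℕ) = n + 1 := ⟨k - 1, by omega⟩
    have hNn : (N : ℝ) ≤ n := by exact_mod_cast (by omega : N ≤ n)
    have h1 : ¬ ‖ev k‖ < (n + 1 / 2 - θ) ^ 2 := fun h2 => by
      have := (norm_lt_iff_le h h₀ hK hΓ hev (by linarith) k).1 h2
      omega
    obtain ⟨j, hj, hj1, hj2⟩ := h.localize hK (n := n) (by linarith) (eval_eq_zero hΓ hev k)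
      (not_lt.1 h1)
    have h3 := (norm_lt_iff_le h h₀ hK hΓ hev (n := n + 1) (by push_cast; linarith) k).2 (by omega)
    rw [← norm_csqrt_lt_iff (by push_cast; linarith)] at h3
    have h4 := (abs_norm_sub_norm_le (csqrt (ev k)) ((j - θ : ℝ) : ℂ)).trans hj2
    have hj' : (n : ℝ) + 1 ≤ j := by exact_mod_cast hj
    rw [Complex.norm_real, Real.norm_of_nonneg (by linarith [n.cast_nonneg (α := ℝ)])] at h4
    have h5 : j < n + 2 := by
      have : (j : ℝ) < (n + 2 : ℕ) := by push_cast at h3 ⊢; linarith [(abs_le.1 h4).1]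
      exact_mod_cast this
    have h6 : j = (k : ℕ) := by omega
    rw [h6] at hj1 hj2
    exact ⟨hj1, hj2⟩

end Sequence

end SturmLiouville

end

noncomputable section

namespace SturmLiouville

open Set intervalIntegral

/-! ### The characteristic functions of the two problems -/

theorem isCharLike_dirichlet {q : ℝ → ℂ} (hq : MemLp q 2 mu0) {M : ℝ}
    (hM : ∫ t in Icc 0 Real.pi, ‖q t‖ ≤ M) : IsCharLike (charFun hq 1 0) 1 0 (2 * M + 1) := by
  have hM0 : 0 ≤ M := (by positivity : 0 ≤ ∫ t in Icc 0 Real.pi, ‖q t‖).trans hM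
  refine ⟨.inl ⟨rfl, rfl⟩, differentiable_charFun hq 1 0, fun ρ hρ => ?_⟩
  have hρ0 : 0 < ‖ρ‖ := by linarith
  have h := (solution_asymptotics (integrableOn_of_memLp hq) hM (by linarith) (norm_pos_iff.1 hρ0)
    (hasACDeriv_sol hq (ρ ^ 2) 0 1 0) ((hasACDeriv_solD hq (ρ ^ 2) 0 1 0).congr_right
      fun x _ => by simp) (ext_sol_zero ..) (ext_solD_zero ..) pi_mem_Icc_pi).2.1
  have e : ρ ^ 1 * charFun hq 1 0 (ρ ^ 2) - Complex.sin (Real.pi * (ρ + (0 : ℝ))) =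
      ρ * ext (sol hq (ρ ^ 2) 0 1 0) Real.pi - Complex.sin (ρ * Real.pi) := by
    rw [charFun, evalPi_apply, Complex.ofReal_zero, add_zero, mul_comm (Real.pi : ℂ)]
    ring
  rw [e, mul_comm Real.pi]
  refine h.trans ?_
  gcongr
  linarith

theorem isCharLike_neumann {q : ℝ → ℂ} (hq : MemLp q 2 mu0) {M : ℝ}
    (hM : ∫ t in Icc 0 Real.pi, ‖q t‖ ≤ M) {b : ℂ} (hb : ‖b‖ ≤ M) :
    IsCharLike (charFun hq (-b) 1) 0 (1 / 2) (4 * M + 1) := by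
  have hM0 : 0 ≤ M := (norm_nonneg b).trans hb
  refine ⟨.inr ⟨rfl, rfl⟩, differentiable_charFun hq (-b) 1, fun ρ hρ => ?_⟩
  have hρ0 : 0 < ‖ρ‖ := by linarith
  obtain ⟨h1, -, h2⟩ := solution_asymptotics (integrableOn_of_memLp hq) hM (by linarith)
    (norm_pos_iff.1 hρ0)
    (hasACDeriv_sol hq (ρ ^ 2) 0 1 0) ((hasACDeriv_solD hq (ρ ^ 2) 0 1 0).congr_right
      fun x _ => by simp) (ext_sol_zero ..) (ext_solD_zero ..) pi_mem_Icc_pi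
  have e : ρ ^ 0 * charFun hq (-b) 1 (ρ ^ 2) - Complex.sin (Real.pi * (ρ + (1 / 2 : ℝ))) =
      (ext (solD hq (ρ ^ 2) 0 1 0) Real.pi - Complex.cos (ρ * Real.pi)) -
        b * ext (sol hq (ρ ^ 2) 0 1 0) Real.pi := by
    rw [charFun, evalPi_apply, evalPi_apply, show (Real.pi : ℂ) * (ρ + (1 / 2 : ℝ))
      = ρ * Real.pi + Real.pi / 2 by push_cast; ring, Complex.sin_add_pi_div_two]
    ring
  rw [e, mul_comm Real.pi]
  refine (norm_sub_le _ _).trans ?_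
  rw [norm_mul]
  calc _ ≤ 2 * M / ‖ρ‖ * Real.exp (|ρ.im| * Real.pi) +
        M * (2 / ‖ρ‖ * Real.exp (|ρ.im| * Real.pi)) := by gcongr
    _ = 4 * M / ‖ρ‖ * Real.exp (|ρ.im| * Real.pi) := by ring
    _ ≤ _ := by gcongr; linarith

theorem memLp_zero_fun : MemLp (fun _ : ℝ => (0 : ℂ)) 2 mu0 := memLp_of_continuousOn continuousOn_const

theorem sol_zero_at_zero : ext (sol memLp_zero_fun 0 0 1 0) Real.pi = Real.pi ∧
    ext (solD memLp_zero_fun 0 0 1 0) Real.pi = 1 := by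
  have h1 : HasACDeriv (fun x : ℝ => (x : ℂ)) (fun _ => 1) :=
    hasACDeriv_of_hasDerivAt (fun x => Complex.ofRealCLM.hasDerivAt) continuous_const
  have h := sol_unique memLp_zero_fun (z := 0) (g := 0) h1
    ((hasACDeriv_const 1).congr_right fun x _ => by simp)
  rw [Complex.ofReal_zero] at h
  exact ⟨(h.1 pi_mem_Icc_pi).symm, (h.2 pi_mem_Icc_pi).symm⟩

/-- For q = 0 the estimates of `solution_asymptotics` hold with M = 0 and become identities. -/
theorem isCharModel_dirichlet : IsCharModel (charFun memLp_zero_fun 1 0) 1 0 := by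
  refine ⟨.inl ⟨rfl, rfl⟩, differentiable_charFun _ 1 0, fun ρ => ?_, ?_⟩
  · by_cases hρ : ρ = 0
    · simp [hρ]
    · have h := (solution_asymptotics (M := 0) (integrableOn_of_memLp memLp_zero_fun) (by simp)
        (by simp) hρ (hasACDeriv_sol memLp_zero_fun (ρ ^ 2) 0 1 0)
        ((hasACDeriv_solD memLp_zero_fun (ρ ^ 2) 0 1 0).congr_right
        fun x _ => by simp) (ext_sol_zero ..) (ext_solD_zero ..) pi_mem_Icc_pi).2.1
      rw [mul_zero, zero_div, zero_mul] at h
      have h' := sub_eq_zero.1 (norm_le_zero_iff.1 h)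
      rw [charFun, evalPi_apply, Complex.ofReal_zero, add_zero, mul_comm (Real.pi : ℂ), ← h']
      ring
  · rw [charFun, evalPi_apply, sol_zero_at_zero.1]
    simp [Real.pi_ne_zero]

theorem isCharModel_neumann : IsCharModel (charFun memLp_zero_fun 0 1) 0 (1 / 2) := by
  have h0 : charFun memLp_zero_fun 0 1 0 = 1 := by
    rw [charFun, evalPi_apply, evalPi_apply, sol_zero_at_zero.2]; ring
  refine ⟨.inr ⟨rfl, rfl⟩, differentiable_charFun _ 0 1, fun ρ => ?_, ?_⟩
  · rw [show (Real.pi : ℂ) * (ρ + (1 / 2 : ℝ)) = ρ * Real.pi + Real.pi / 2 by push_cast; ring,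
      Complex.sin_add_pi_div_two]
    by_cases hρ : ρ = 0
    · rw [hρ]; simp [h0]
    · have h := (solution_asymptotics (M := 0) (integrableOn_of_memLp memLp_zero_fun) (by simp)
        (by simp) hρ (hasACDeriv_sol memLp_zero_fun (ρ ^ 2) 0 1 0)
        ((hasACDeriv_solD memLp_zero_fun (ρ ^ 2) 0 1 0).congr_right
        fun x _ => by simp) (ext_sol_zero ..) (ext_solD_zero ..) pi_mem_Icc_pi).2.2
      rw [mul_zero, zero_div, zero_mul] at h
      have h' := sub_eq_zero.1 (norm_le_zero_iff.1 h)
      rw [charFun, evalPi_apply, evalPi_apply, ← h']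
      ring
  · rw [h0]; exact one_ne_zero

/-! ### Fourier coefficients -/

/-- `∫₀ˣ e^{2iνt} g(t) dt`. -/
def fourInt (ν : ℝ) (g : ℝ → ℂ) (x : ℝ) : ℂ :=
  ∫ t in (0 : ℝ)..x, Complex.exp (2 * Complex.I * ν * t) * g t

theorem norm_cexp_two_I (ν t : ℝ) : ‖Complex.exp (2 * Complex.I * ν * t)‖ = 1 := by
  rw [Complex.norm_exp]; simp

theorem memLp_cexp_mul (ν : ℝ) {g : ℝ → ℂ} (hg : MemLp g 2 mu0) :
    MemLp (fun t : ℝ => Complex.exp (2 * Complex.I * ν * t) * g t) 2 mu0 := by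
  have := memLp_mul_continuousOn hg (g := fun t : ℝ => Complex.exp (2 * Complex.I * ν * t))
    (by fun_prop)
  exact this.ae_eq (.of_forall fun t => mul_comm _ _)

theorem hasACDeriv_fourInt (ν : ℝ) {g : ℝ → ℂ} (hg : MemLp g 2 mu0) :
    HasACDeriv (fourInt ν g) (fun t : ℝ => Complex.exp (2 * Complex.I * ν * t) * g t) := by
  refine (hasACDeriv_integral 0 (integrableOn_of_memLp (memLp_cexp_mul ν hg))).congr_left
    fun x _ => ?_
  simp [fourInt]

theorem norm_fourInt_le (ν : ℝ) {g : ℝ → ℂ} (hg : MemLp g 2 mu0) {x : ℝ}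
    (hx : x ∈ Icc 0 Real.pi) : ‖fourInt ν g x‖ ≤ 2 * l2norm g := by
  refine (norm_integral_le_of_mem (integrableOn_of_memLp (memLp_cexp_mul ν hg)) hx).trans ?_
  simp only [norm_mul, norm_cexp_two_I, one_mul]
  exact integral_norm_le_l2norm hg

/-- An exponential as an element of `L₂[0, π]`. -/
def expL2 (ν : ℝ) : L2 :=
  (memLp_of_continuousOn (f := fun t : ℝ => ((√Real.pi : ℝ) : ℂ)⁻¹ *
    Complex.exp (2 * Complex.I * ν * t)) (by fun_prop)).toLp _

theorem inner_expL2 (ν : ℝ) {g : ℝ → ℂ} (hg : MemLp g 2 mu0) :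
    inner ℂ (expL2 (-ν)) (hg.toLp g) = ((√Real.pi : ℝ) : ℂ)⁻¹ * fourInt ν g Real.pi := by
  rw [MeasureTheory.L2.inner_def, fourInt, integral_of_le Real.pi_pos.le,
    ← integral_Icc_eq_integral_Ioc, ← MeasureTheory.integral_const_mul]
  refine integral_congr_ae ?_
  filter_upwards [hg.coeFn_toLp, MemLp.coeFn_toLp (memLp_of_continuousOn (f := fun t : ℝ =>
    ((√Real.pi : ℝ) : ℂ)⁻¹ * Complex.exp (2 * Complex.I * (-ν : ℝ) * t)) (by fun_prop))]
    with t h1 h2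
  rw [h1, expL2, h2, RCLike.inner_apply, map_mul, map_inv₀, Complex.conj_ofReal, ← Complex.exp_conj]
  simp only [map_mul, Complex.conj_ofReal, Complex.conj_I, map_ofNat]
  push_cast
  ring_nf

theorem integral_cexp_int {n : ℤ} (hn : n ≠ 0) :
    fourInt n (fun _ => 1) Real.pi = 0 := by
  have h : (2 * Complex.I * (n : ℝ) : ℂ) ≠ 0 := by
    simpa using hn
  simp only [fourInt, mul_one]
  rw [integral_exp_mul_complex h]
  have : Complex.exp (2 * Complex.I * ((n : ℤ) : ℝ) * Real.pi) = 1 := by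
    rw [show (2 * Complex.I * ((n : ℤ) : ℝ) * Real.pi : ℂ) = n * (2 * Real.pi * Complex.I) by
      push_cast; ring]
    exact Complex.exp_int_mul_two_pi_mul_I n
  rw [this]; simp

theorem inner_expL2_expL2 (ν ν' : ℝ) : inner ℂ (expL2 ν) (expL2 ν') =
    (Real.pi : ℂ)⁻¹ * fourInt (ν' - ν) (fun _ => 1) Real.pi := by
  have h := inner_expL2 (-ν) (memLp_of_continuousOn (f := fun t : ℝ => ((√Real.pi : ℝ) : ℂ)⁻¹ *
    Complex.exp (2 * Complex.I * ν' * t)) (by fun_prop))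
  rw [neg_neg] at h
  change inner ℂ (expL2 ν) (expL2 ν') = _ at h
  rw [h, fourInt, fourInt, ← intervalIntegral.integral_const_mul,
    ← intervalIntegral.integral_const_mul]
  refine integral_congr fun t _ => ?_
  have hs : ((√Real.pi : ℝ) : ℂ)⁻¹ * ((√Real.pi : ℝ) : ℂ)⁻¹ = (Real.pi : ℂ)⁻¹ := by
    rw [← mul_inv, ← Complex.ofReal_mul, Real.mul_self_sqrt Real.pi_pos.le]
  have he : Complex.exp (2 * Complex.I * (-ν : ℝ) * t) * Complex.exp (2 * Complex.I * ν' * t) =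
      Complex.exp (2 * Complex.I * (ν' - ν : ℝ) * t) := by
    rw [← Complex.exp_add]; congr 1; push_cast; ring
  simp only [mul_one]
  rw [← he, ← hs]; ring

/-- The shift θ cancels in differences of frequencies, which are integers, and e^{2int} integrates
to zero over [0, π]. The sign s covers ν and -ν. -/
theorem orthonormal_expL2 {s : ℝ} (hs : s = 1 ∨ s = -1) (θ : ℝ) :
    Orthonormal ℂ fun k : ℕ+ => expL2 (-(s * (k - θ))) := by
  classical
  rw [orthonormal_iff_ite]
  intro k l
  rw [inner_expL2_expL2]
  split_ifs with h
  · subst h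
    rw [sub_self, fourInt]
    simp [Real.pi_ne_zero]
  · obtain ⟨n, hn, hn'⟩ : ∃ n : ℤ, n ≠ 0 ∧ -(s * ((l : ℕ) - θ)) - -(s * ((k : ℕ) - θ)) = n := by
      have hkl : ((k : ℕ) : ℤ) ≠ ((l : ℕ) : ℤ) := fun e => h (PNat.coe_injective (by exact_mod_cast e))
      rcases hs with rfl | rfl
      · exact ⟨(k : ℕ) - (l : ℕ), by omega, by push_cast; ring⟩
      · exact ⟨(l : ℕ) - (k : ℕ), by omega, by push_cast; ring⟩
    rw [hn', integral_cexp_int hn, mul_zero]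

/-- **Bessel's inequality**. -/
theorem bessel {s : ℝ} (hs : s = 1 ∨ s = -1) (θ : ℝ) {g : ℝ → ℂ} (hg : MemLp g 2 mu0)
    (S : Finset ℕ+) :
    ∑ k ∈ S, ‖fourInt (s * (k - θ)) g Real.pi‖ ^ 2 ≤ Real.pi * l2norm g ^ 2 := by
  have h := (orthonormal_expL2 hs θ).sum_inner_products_le (hg.toLp g) (s := S)
  simp only [inner_expL2, norm_mul, norm_inv, Complex.norm_real, Real.norm_eq_abs,
    abs_of_nonneg (Real.sqrt_nonneg _), mul_pow, inv_pow, Real.sq_sqrt Real.pi_pos.le,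
    ← Finset.mul_sum] at h
  rw [Lp.norm_toLp, ← l2norm] at h
  have hp := Real.pi_pos
  rwa [inv_mul_le_iff₀ hp] at h

/-- Bessel's inequality for g cut off to [0, x] bounds the sum of |`fourInt`(x)|² uniformly in x;
integrate over x. -/
theorem bessel_l2norm {s : ℝ} (hs : s = 1 ∨ s = -1) (θ : ℝ) {g : ℝ → ℂ} (hg : MemLp g 2 mu0)
    (S : Finset ℕ+) :
    ∑ k ∈ S, l2norm (fourInt (s * (k - θ)) g) ^ 2 ≤ Real.pi ^ 2 * l2norm g ^ 2 := by
  have hc : ∀ ν : ℝ, ContinuousOn (fourInt ν g) (Icc 0 Real.pi) := fun ν =>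
    (hasACDeriv_fourInt ν hg).continuousOn
  have hi : ∀ ν : ℝ, IntegrableOn (fun x => ‖fourInt ν g x‖ ^ 2) (Icc 0 Real.pi) := fun ν =>
    ((hc ν).norm.pow 2).integrableOn_Icc
  have e : ∀ k ∈ S, l2norm (fourInt (s * (k - θ)) g) ^ 2 =
      ∫ x in Icc 0 Real.pi, ‖fourInt (s * (k - θ)) g x‖ ^ 2 := fun k _ =>
    l2norm_sq (memLp_of_continuousOn (hc _))
  rw [Finset.sum_congr rfl e, ← MeasureTheory.integral_finsetSum _ fun k _ => hi _]
  have key : ∀ x ∈ Icc 0 Real.pi, ∑ k ∈ S, ‖fourInt (s * (k - θ)) g x‖ ^ 2 ≤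
      Real.pi * l2norm g ^ 2 := by
    intro x hx
    have hgx : MemLp ((Ioc 0 x).indicator g) 2 mu0 := hg.indicator measurableSet_Ioc
    have h1 := bessel hs θ hgx S
    have h2 : ∀ ν : ℝ, fourInt ν ((Ioc 0 x).indicator g) Real.pi = fourInt ν g x := by
      intro ν
      rw [fourInt, fourInt, integral_of_le Real.pi_pos.le, integral_of_le hx.1]
      have : ∀ t : ℝ, Complex.exp (2 * Complex.I * ν * t) * (Ioc 0 x).indicator g t =
          (Ioc 0 x).indicator (fun t : ℝ => Complex.exp (2 * Complex.I * ν * t) * g t) t := fun t => by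
        by_cases ht : t ∈ Ioc 0 x <;> simp [ht]
      simp only [this]
      rw [setIntegral_indicator measurableSet_Ioc, inter_eq_right.2 (Ioc_subset_Ioc_right hx.2)]
    simp only [h2] at h1
    have h3 : l2norm ((Ioc 0 x).indicator g) ≤ l2norm g :=
      ENNReal.toReal_mono hg.2.ne (eLpNorm_indicator_le g)
    refine h1.trans ?_
    have := l2norm_nonneg ((Ioc 0 x).indicator g)
    gcongr
  refine (setIntegral_mono_on (integrable_finsetSum _ fun k _ => hi _) (by
    exact continuousOn_const.integrableOn_Icc) measurableSet_Icc key).trans (le_of_eq ?_)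
  simp [Real.pi_pos.le]
  ring

end SturmLiouville

end

noncomputable section

namespace SturmLiouville

open Set intervalIntegral

/-! ### Perturbation of an approximate exponential solution -/

theorem norm_integral_mul_le_sup {f g : ℝ → ℂ} {A B : ℝ} (hf : IntegrableOn f (Icc 0 Real.pi))
    (hfA : ∫ t in Icc 0 Real.pi, ‖f t‖ ≤ A) (hB : 0 ≤ B)
    (hg : ∀ x ∈ Icc 0 Real.pi, ‖g x‖ ≤ B) {x : ℝ} (hx : x ∈ Icc 0 Real.pi) :
    ‖∫ t in (0 : ℝ)..x, f t * g t‖ ≤ A * B := by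
  rw [integral_of_le hx.1]
  have hsub : Ioc 0 x ⊆ Icc 0 Real.pi := fun t ht => ⟨ht.1.le, ht.2.trans hx.2⟩
  calc ‖∫ t in Ioc 0 x, f t * g t‖ ≤ ∫ t in Ioc 0 x, ‖f t‖ * B := by
        refine norm_integral_le_of_norm_le ((hf.mono_set hsub).norm.mul_const B) ?_
        refine (ae_restrict_iff' measurableSet_Ioc).2 (.of_forall fun t ht => ?_)
        rw [norm_mul]
        exact mul_le_mul_of_nonneg_left (hg t (hsub ht)) (norm_nonneg _)
    _ ≤ ∫ t in Icc 0 Real.pi, ‖f t‖ * B :=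
        setIntegral_mono_set (hf.norm.mul_const B) (.of_forall fun t => by positivity)
          (LE.le.eventuallyLE hsub)
    _ = (∫ t in Icc 0 Real.pi, ‖f t‖) * B := MeasureTheory.integral_mul_const _ _
    _ ≤ A * B := by gcongr

theorem norm_integral_mul_le_l2norm {f g : ℝ → ℂ} (hf : MemLp f 2 mu0) (hg : MemLp g 2 mu0) :
    ‖∫ t in (0 : ℝ)..Real.pi, f t * g t‖ ≤ l2norm f * l2norm g := by
  rw [integral_of_le Real.pi_pos.le, ← integral_Icc_eq_integral_Ioc]
  refine (MeasureTheory.norm_integral_le_integral_norm _).trans ?_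
  simp only [norm_mul]
  exact integral_norm_mul_le hf hg

theorem integral_norm_le_of_bound {f : ℝ → ℂ} {B : ℝ} (hf : ContinuousOn f (Icc 0 Real.pi))
    (h : ∀ x ∈ Icc 0 Real.pi, ‖f x‖ ≤ B) : ∫ t in Icc 0 Real.pi, ‖f t‖ ≤ 4 * B := by
  have hB : 0 ≤ B := (norm_nonneg _).trans (h 0 zero_mem_Icc_pi)
  calc ∫ t in Icc 0 Real.pi, ‖f t‖ ≤ ∫ t in Icc 0 Real.pi, B :=
        setIntegral_mono_on hf.norm.integrableOn_Icc continuousOn_const.integrableOn_Icc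
          measurableSet_Icc h
    _ = Real.pi * B := by simp [Real.pi_pos.le]
    _ ≤ 4 * B := by gcongr; exact Real.pi_le_four

theorem l2norm_le_of_le_mul {f g : ℝ → ℂ} {c : ℝ} (hg : MemLp g 2 mu0)
    (h : ∀ x ∈ Icc 0 Real.pi, ‖f x‖ ≤ c * ‖g x‖) (hc : 0 ≤ c) : l2norm f ≤ c * l2norm g := by
  have h1 : eLpNorm f 2 mu0 ≤ ENNReal.ofReal c * eLpNorm g 2 mu0 :=
    eLpNorm_le_mul_eLpNorm_of_ae_le_mul
      ((ae_restrict_iff' measurableSet_Icc).2 (.of_forall h)) 2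
  have h2 := ENNReal.toReal_mono (ENNReal.mul_ne_top ENNReal.ofReal_ne_top hg.2.ne) h1
  rwa [ENNReal.toReal_mul, ENNReal.toReal_ofReal hc] at h2

/-- The data of an equation `(E u')' = E r u` with `E = exp (x / ε + 2 ∫ S)` close to `e^{2iνx}`;
here `F = 1 / E` and `p = E u'`. -/
structure OscData (ε : ℂ) (ν : ℝ) (S r E F c u p : ℝ → ℂ) (K δ : ℝ) : Prop where
  ε_ne : ε ≠ 0
  K_ge : 4 ≤ K
  -- δ is the size of the defect r; in the application it is ‖ε‖ ^ M.
  δ_nonneg : 0 ≤ δ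
  δ_le : δ ≤ 1
  -- Since K ≥ 4, powers of K absorb all numerical factors in the estimates.
  ε_le : K ^ 8 * ‖ε‖ ≤ 1
  S_cont : ContinuousOn S (Icc 0 Real.pi)
  S_le : ∀ x ∈ Icc 0 Real.pi, ‖S x‖ ≤ K * ‖ε‖
  r_memLp : MemLp r 2 mu0
  r_le : l2norm r ≤ K * δ
  E_cont : ContinuousOn E (Icc 0 Real.pi)
  E_le : ∀ x ∈ Icc 0 Real.pi, ‖E x‖ ≤ K
  F_le : ∀ x ∈ Icc 0 Real.pi, ‖F x‖ ≤ K
  F_mul_E : ∀ x ∈ Icc 0 Real.pi, F x * E x = 1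
  F_deriv : HasACDeriv F (fun x => -(1 / ε + 2 * S x) * F x)
  c_cont : ContinuousOn c (Icc 0 Real.pi)
  c_le : ∀ x ∈ Icc 0 Real.pi, ‖c x‖ ≤ K * ‖ε‖
  -- E is e^{2iνx} times a factor with logarithmic derivative c = O(ε); integrals of E r thus reduce
  -- by parts to Fourier integrals of r.
  hatE_deriv : HasACDeriv (fun x => Complex.exp (-(2 * Complex.I * ν * x)) * E x)
    (fun x => c x * (Complex.exp (-(2 * Complex.I * ν * x)) * E x))
  u_zero : u 0 = 1
  p_zero : p 0 = 0
  u_deriv : HasACDeriv u (fun x => F x * p x)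
  p_deriv : HasACDeriv p (fun x => E x * r x * u x)

/-! ### A priori bounds for u -/

namespace OscData

variable {ε : ℂ} {ν : ℝ} {S r E F c u p : ℝ → ℂ} {K δ : ℝ}
  (h : OscData ε ν S r E F c u p K δ)
include h

theorem r_int : ∫ t in Icc 0 Real.pi, ‖r t‖ ≤ K ^ 2 * δ := by
  have h1 := integral_norm_le_l2norm h.r_memLp
  have h2 := h.r_le
  nlinarith [h.K_ge, h.δ_nonneg, mul_nonneg (sub_nonneg.2 h.K_ge) h.δ_nonneg,
    mul_nonneg (sub_nonneg.2 h.K_ge) (mul_nonneg (sub_nonneg.2 h.K_ge) h.δ_nonneg)]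

theorem r_integrable : IntegrableOn r (Icc 0 Real.pi) := integrableOn_of_memLp h.r_memLp

theorem F_cont : ContinuousOn F (Icc 0 Real.pi) := h.F_deriv.continuousOn

theorem w_cont : ContinuousOn (fun x => F x * p x) (Icc 0 Real.pi) :=
  h.F_cont.mul h.p_deriv.continuousOn

/-- Here F p = u', and this is the equation u'' + u'/ε + 2Su' = ru. -/
theorem w_deriv : HasACDeriv (fun x => F x * p x)
    (fun x => r x * u x - 1 / ε * (F x * p x) - 2 * (S x * (F x * p x))) := by
  refine (h.F_deriv.mul h.p_deriv).congr_right fun x hx => ?_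
  linear_combination (r x * u x) * h.F_mul_E x hx

theorem ru_integrable : IntegrableOn (fun x => r x * u x) (Icc 0 Real.pi) :=
  h.r_integrable.mul_continuousOn h.u_deriv.continuousOn isCompact_Icc

theorem Sw_cont : ContinuousOn (fun x => S x * (F x * p x)) (Icc 0 Real.pi) :=
  h.S_cont.mul h.w_cont

/-- Integrate u'' + u'/ε + 2Su' = ru and solve for the term carrying 1/ε. Each later substitution of
this formula gains a factor ε. -/
theorem v_eq {x : ℝ} (hx : x ∈ Icc 0 Real.pi) :
    u x - 1 = ε * ((∫ t in (0 : ℝ)..x, r t * u t) - F x * p x -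
      2 * ∫ t in (0 : ℝ)..x, S t * (F t * p t)) := by
  have h1 := h.w_deriv.integral_eq hx
  have i1 := intervalIntegrable_of_integrableOn h.ru_integrable hx
  have i2 := intervalIntegrable_of_integrableOn h.w_cont.integrableOn_Icc hx
  have i3 := intervalIntegrable_of_integrableOn h.Sw_cont.integrableOn_Icc hx
  rw [integral_sub (i1.sub (i2.const_mul _)) (i3.const_mul _), integral_sub i1 (i2.const_mul _),
    intervalIntegral.integral_const_mul, intervalIntegral.integral_const_mul,
    h.u_deriv.integral_eq hx, h.p_zero, h.u_zero] at h1
  have h2 : ε * (1 / ε) = 1 := mul_one_div_cancel h.ε_ne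
  linear_combination (-ε) * h1 - (u x - 1) * h2

theorem eps_le_one : ‖ε‖ ≤ 1 := by
  have h1 : (1 : ℝ) ≤ K ^ 8 := one_le_pow₀ (by linarith [h.K_ge])
  nlinarith [h.ε_le, norm_nonneg ε]

/-- A bound for u bounds p, and then `v_eq` bounds u - 1 with a small factor. Taking B to be the
maximum of |u| closes the argument in `norm_u_le`. -/
theorem sup_bounds_of_le {B : ℝ} (hB : ∀ x ∈ Icc 0 Real.pi, ‖u x‖ ≤ B) {x : ℝ}
    (hx : x ∈ Icc 0 Real.pi) : ‖p x‖ ≤ K ^ 3 * δ * B ∧ ‖u x - 1‖ ≤ K ^ 7 * ‖ε‖ * δ * B := by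
  have hK := h.K_ge
  have hδ := h.δ_nonneg
  have hε := norm_nonneg ε
  have hB0 : 0 ≤ B := (norm_nonneg _).trans (hB x hx)
  have hp : ∀ x ∈ Icc 0 Real.pi, ‖p x‖ ≤ K ^ 3 * δ * B := by
    intro x hx
    have e : p x = ∫ t in (0 : ℝ)..x, r t * (E t * u t) := by
      have := h.p_deriv.integral_eq hx
      rw [h.p_zero, sub_zero] at this
      rw [← this]
      exact integral_congr fun t _ => by ring
    rw [e]
    refine (norm_integral_mul_le_sup h.r_integrable h.r_int (by positivity : 0 ≤ K * B)
      (fun t ht => ?_) hx).trans (le_of_eq (by ring))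
    rw [norm_mul]
    exact mul_le_mul (h.E_le t ht) (hB t ht) (norm_nonneg _) (by linarith)
  refine ⟨hp x hx, ?_⟩
  have hw : ∀ x ∈ Icc 0 Real.pi, ‖F x * p x‖ ≤ K ^ 4 * δ * B := by
    intro x hx
    rw [norm_mul]
    calc _ ≤ K * (K ^ 3 * δ * B) := mul_le_mul (h.F_le x hx) (hp x hx) (norm_nonneg _) (by linarith)
      _ = _ := by ring
  have hR := norm_integral_mul_le_sup h.r_integrable h.r_int hB0 hB hx
  have hQ := norm_integral_mul_le_sup h.S_cont.integrableOn_Icc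
    (integral_norm_le_of_bound h.S_cont h.S_le) (by positivity : 0 ≤ K ^ 4 * δ * B) hw hx
  rw [h.v_eq hx, norm_mul]
  have hε1 := h.eps_le_one
  have hX : 0 ≤ δ * B := by positivity
  calc _ ≤ ‖ε‖ * (K ^ 2 * δ * B + K ^ 4 * δ * B + 2 * (4 * (K * ‖ε‖) * (K ^ 4 * δ * B))) := by
        gcongr
        refine (norm_sub_le _ _).trans (add_le_add ((norm_sub_le _ _).trans
          (add_le_add hR (hw x hx))) ?_)
        rw [norm_mul, Complex.norm_ofNat]
        gcongr
    _ ≤ ‖ε‖ * (K ^ 2 * δ * B + K ^ 4 * δ * B + 2 * (4 * (K * 1) * (K ^ 4 * δ * B))) := by gcongr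
    _ = ‖ε‖ * (δ * B) * (K ^ 2 + K ^ 4 + 8 * K ^ 5) := by ring
    _ ≤ ‖ε‖ * (δ * B) * K ^ 7 := by
        gcongr
        have h2 : K ^ 2 ≤ K ^ 5 := pow_le_pow_right₀ (by linarith) (by norm_num)
        have h4 : K ^ 4 ≤ K ^ 5 := pow_le_pow_right₀ (by linarith) (by norm_num)
        have h5 : 0 ≤ K ^ 5 := by positivity
        have h6 : 16 * K ^ 5 ≤ K ^ 7 := by nlinarith [mul_nonneg (sub_nonneg.2 hK) h5]
        linarith
    _ = _ := by ring

theorem norm_u_le {x : ℝ} (hx : x ∈ Icc 0 Real.pi) : ‖u x‖ ≤ 2 := by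
  obtain ⟨y, hy, hmax⟩ := isCompact_Icc.exists_isMaxOn ⟨0, zero_mem_Icc_pi⟩
    h.u_deriv.continuousOn.norm
  have hB : ∀ x ∈ Icc 0 Real.pi, ‖u x‖ ≤ ‖u y‖ := fun x hx => hmax hx
  have h1 := (h.sup_bounds_of_le hB hy).2
  have hK := h.K_ge
  have h2 : K ^ 7 * ‖ε‖ * δ * ‖u y‖ ≤ 1 / 4 * ‖u y‖ := by
    have h3 : K ^ 7 * ‖ε‖ ≤ 1 / 4 := by
      have h4 : K ^ 8 * ‖ε‖ = K * (K ^ 7 * ‖ε‖) := by ring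
      have h5 : 0 ≤ K ^ 7 * ‖ε‖ := by positivity
      nlinarith [h.ε_le]
    have h6 : K ^ 7 * ‖ε‖ * δ ≤ 1 / 4 * 1 :=
      mul_le_mul h3 h.δ_le h.δ_nonneg (by norm_num)
    have := norm_nonneg (u y)
    nlinarith
  have h7 : ‖u y‖ ≤ ‖u y - 1‖ + 1 := by
    have := norm_add_le (u y - 1) 1
    simpa using this
  have := hB x hx
  linarith

theorem norm_v_le {x : ℝ} (hx : x ∈ Icc 0 Real.pi) : ‖u x - 1‖ ≤ K ^ 8 * ‖ε‖ * δ := by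
  have h1 := (h.sup_bounds_of_le (fun x hx => h.norm_u_le hx) hx).2
  have hK := h.K_ge
  have hδ := h.δ_nonneg
  have h2 : 0 ≤ K ^ 7 * ‖ε‖ * δ := by positivity
  calc _ ≤ _ := h1
    _ ≤ K ^ 7 * ‖ε‖ * δ * K := by gcongr; linarith
    _ = _ := by ring

/-! ### Gain from oscillation -/

theorem Er_integrable : IntegrableOn (fun x => E x * r x) (Icc 0 Real.pi) :=
  h.r_integrable.continuousOn_mul h.E_cont isCompact_Icc

theorem Er_int : ∫ t in Icc 0 Real.pi, ‖E t * r t‖ ≤ K ^ 3 * δ := by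
  have hK := h.K_ge
  calc _ ≤ ∫ t in Icc 0 Real.pi, K * ‖r t‖ := by
        refine setIntegral_mono_on h.Er_integrable.norm (h.r_integrable.norm.const_mul K)
          measurableSet_Icc fun t ht => ?_
        rw [norm_mul]
        exact mul_le_mul_of_nonneg_right (h.E_le t ht) (norm_nonneg _)
    _ = K * ∫ t in Icc 0 Real.pi, ‖r t‖ := MeasureTheory.integral_const_mul _ _
    _ ≤ K * (K ^ 2 * δ) := by gcongr; exact h.r_int
    _ = _ := by ring

theorem ErI_deriv : HasACDeriv (fun x => ∫ t in (0 : ℝ)..x, E t * r t) (fun x => E x * r x) :=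
  (hasACDeriv_integral 0 h.Er_integrable).congr_left fun x _ => by simp

/-- Integrate by parts in E r = Ê · (e^{2iνx} r) with Ê = e^{-2iνx} E: the remaining integral
contains Ê' = cÊ, which is O(ε). -/
theorem ErI_approx {x : ℝ} (hx : x ∈ Icc 0 Real.pi) :
    ‖(∫ t in (0 : ℝ)..x, E t * r t) -
      Complex.exp (-(2 * Complex.I * ν * x)) * E x * fourInt ν r x‖ ≤
      K ^ 3 * ‖ε‖ * l2norm (fourInt ν r) := by
  have hK := h.K_ge
  have hΨ := hasACDeriv_fourInt ν h.r_memLp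
  have h1 := (h.hatE_deriv.mul hΨ).integral_eq hx
  have hcont : ContinuousOn (fun x => c x * (Complex.exp (-(2 * Complex.I * ν * x)) * E x))
    (Icc 0 Real.pi) := h.c_cont.mul h.hatE_deriv.continuousOn
  have hle : ∀ x ∈ Icc 0 Real.pi, ‖c x * (Complex.exp (-(2 * Complex.I * ν * x)) * E x)‖ ≤
      K ^ 2 * ‖ε‖ := by
    intro x hx
    have e : ‖Complex.exp (-(2 * Complex.I * ν * x))‖ = 1 := by
      have := norm_cexp_two_I (-ν) x
      push_cast at this
      rw [← this]; congr 2; ring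
    rw [norm_mul, norm_mul, e, one_mul]
    calc _ ≤ K * ‖ε‖ * K := mul_le_mul (h.c_le x hx) (h.E_le x hx) (norm_nonneg _) (by positivity)
      _ = _ := by ring
  have e2 : ∀ t : ℝ, Complex.exp (-(2 * Complex.I * ν * t)) * E t *
      (Complex.exp (2 * Complex.I * ν * t) * r t) = E t * r t := by
    intro t
    have : Complex.exp (-(2 * Complex.I * ν * t)) * Complex.exp (2 * Complex.I * ν * t) = 1 := by
      rw [← Complex.exp_add]; simp
    linear_combination (E t * r t) * this
  simp only [e2] at h1
  rw [integral_add (f := fun t => c t * (Complex.exp (-(2 * Complex.I * ν * t)) * E t) *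
    fourInt ν r t) (intervalIntegrable_of_integrableOn
    ((hcont.mul hΨ.continuousOn).integrableOn_Icc) hx)
    (intervalIntegrable_of_integrableOn h.Er_integrable hx)] at h1
  have e3 : fourInt ν r 0 = 0 := by simp [fourInt]
  rw [e3, mul_zero, sub_zero] at h1
  rw [← h1, ← norm_neg]
  have hb := norm_integral_mul_le_sup (hΨ.continuousOn.integrableOn_Icc)
    (integral_norm_le_l2norm (memLp_of_continuousOn hΨ.continuousOn))
    (by positivity : 0 ≤ K ^ 2 * ‖ε‖) hle hx
  have e4 : (∫ t in (0 : ℝ)..x, c t * (Complex.exp (-(2 * Complex.I * ν * t)) * E t) *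
      fourInt ν r t) = ∫ t in (0 : ℝ)..x, fourInt ν r t *
      (c t * (Complex.exp (-(2 * Complex.I * ν * t)) * E t)) :=
    integral_congr fun t _ => by ring
  rw [e4]
  rw [show ∀ a b : ℂ, -(b - (a + b)) = a by intros; ring]
  refine hb.trans ?_
  have := l2norm_nonneg (fourInt ν r)
  have h3 : 0 ≤ K ^ 2 * ‖ε‖ * l2norm (fourInt ν r) := by positivity
  calc _ = K ^ 2 * ‖ε‖ * l2norm (fourInt ν r) * 2 := by ring
    _ ≤ K ^ 2 * ‖ε‖ * l2norm (fourInt ν r) * K := by gcongr; linarith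
    _ = _ := by ring

omit h in
/-- The size of the oscillatory integral. -/
def oscSize (ν : ℝ) (r : ℝ → ℂ) : ℝ := ‖fourInt ν r Real.pi‖ + l2norm (fourInt ν r)

omit h in
theorem oscSize_nonneg (ν : ℝ) (r : ℝ → ℂ) : 0 ≤ oscSize ν r :=
  add_nonneg (norm_nonneg _) (l2norm_nonneg _)

theorem eps_mul_pow_le {n : ℕ} (hn : n ≤ 8) : K ^ n * ‖ε‖ ≤ 1 := by
  refine le_trans ?_ h.ε_le
  gcongr
  linarith [h.K_ge]

theorem norm_ErI_le {x : ℝ} (hx : x ∈ Icc 0 Real.pi) :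
    ‖∫ t in (0 : ℝ)..x, E t * r t‖ ≤ K * ‖fourInt ν r x‖ + l2norm (fourInt ν r) := by
  have h1 := h.ErI_approx hx
  have h2 := h.eps_mul_pow_le (n := 3) (by norm_num)
  have h3 := l2norm_nonneg (fourInt ν r)
  have e : ‖Complex.exp (-(2 * Complex.I * ν * x))‖ = 1 := by
    have := norm_cexp_two_I (-ν) x
    push_cast at this
    rw [← this]; congr 2; ring
  have h4 : ‖Complex.exp (-(2 * Complex.I * ν * x)) * E x * fourInt ν r x‖ ≤
      K * ‖fourInt ν r x‖ := by
    rw [norm_mul, norm_mul, e, one_mul]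
    gcongr
    exact h.E_le x hx
  have h5 := norm_add_le ((∫ t in (0 : ℝ)..x, E t * r t) -
      Complex.exp (-(2 * Complex.I * ν * x)) * E x * fourInt ν r x)
      (Complex.exp (-(2 * Complex.I * ν * x)) * E x * fourInt ν r x)
  rw [sub_add_cancel] at h5
  have h6 : K ^ 3 * ‖ε‖ * l2norm (fourInt ν r) ≤ 1 * l2norm (fourInt ν r) := by gcongr
  linarith

theorem l2norm_ErI_le : l2norm (fun x => ∫ t in (0 : ℝ)..x, E t * r t) ≤ K ^ 2 * oscSize ν r := by
  have hK := h.K_ge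
  have hΨ := (hasACDeriv_fourInt ν h.r_memLp).continuousOn
  have hn := l2norm_nonneg (fourInt ν r)
  have hm : MemLp (fun x => ((K * ‖fourInt ν r x‖ : ℝ) : ℂ)) 2 mu0 :=
    memLp_of_continuousOn (Complex.continuous_ofReal.comp_continuousOn
      (continuousOn_const.mul hΨ.norm))
  have hm' : MemLp (fun x : ℝ => ((l2norm (fourInt ν r) : ℝ) : ℂ)) 2 mu0 :=
    memLp_of_continuousOn continuousOn_const
  have h1 : l2norm (fun x => ∫ t in (0 : ℝ)..x, E t * r t) ≤
      1 * l2norm (fun x => ((K * ‖fourInt ν r x‖ : ℝ) : ℂ) + ((l2norm (fourInt ν r) : ℝ) : ℂ)) := by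
    refine l2norm_le_of_le_mul (hm.add hm') (fun x hx => ?_) zero_le_one
    rw [one_mul, ← Complex.ofReal_add, Complex.norm_real, Real.norm_of_nonneg (by positivity)]
    exact h.norm_ErI_le hx
  have h2 := l2norm_add_le hm hm'
  have h3 : l2norm (fun x => ((K * ‖fourInt ν r x‖ : ℝ) : ℂ)) ≤ K * l2norm (fourInt ν r) := by
    refine l2norm_le_of_le_mul (memLp_of_continuousOn hΨ) (fun x hx => ?_) (by linarith)
    rw [Complex.norm_real, Real.norm_of_nonneg (by positivity)]
  have h4 : l2norm (fun _ : ℝ => ((l2norm (fourInt ν r) : ℝ) : ℂ)) ≤ 2 * l2norm (fourInt ν r) :=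
    l2norm_le_of_bound hn fun x _ => by
      rw [Complex.norm_real, Real.norm_of_nonneg hn]
  have h5 : (K + 2) * l2norm (fourInt ν r) ≤ K ^ 2 * oscSize ν r := by
    unfold oscSize
    have := norm_nonneg (fourInt ν r Real.pi)
    have h6 : K + 2 ≤ K ^ 2 := by nlinarith
    gcongr
    linarith
  linarith

theorem ErI_pi_le : ‖∫ t in (0 : ℝ)..Real.pi, E t * r t‖ ≤ K ^ 2 * oscSize ν r := by
  have hK := h.K_ge
  refine (h.norm_ErI_le pi_mem_Icc_pi).trans ?_
  unfold oscSize
  have h1 := norm_nonneg (fourInt ν r Real.pi)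
  have h2 := l2norm_nonneg (fourInt ν r)
  have h3 : K ≤ K ^ 2 := by nlinarith
  have h4 : 1 ≤ K ^ 2 := by nlinarith
  nlinarith [mul_le_mul_of_nonneg_right h3 h1, mul_le_mul_of_nonneg_right h4 h2]

theorem v_cont : ContinuousOn (fun x => u x - 1) (Icc 0 Real.pi) :=
  h.u_deriv.continuousOn.sub continuousOn_const

theorem p_eq {x : ℝ} (hx : x ∈ Icc 0 Real.pi) :
    p x = (∫ t in (0 : ℝ)..x, E t * r t) + ∫ t in (0 : ℝ)..x, E t * r t * (u t - 1) := by
  have h1 := h.p_deriv.integral_eq hx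
  rw [h.p_zero, sub_zero] at h1
  rw [← h1, ← integral_add (intervalIntegrable_of_integrableOn h.Er_integrable hx)
    (intervalIntegrable_of_integrableOn (h.Er_integrable.mul_continuousOn h.v_cont isCompact_Icc)
      hx)]
  exact integral_congr fun t _ => by ring

theorem Erv_le {x : ℝ} (hx : x ∈ Icc 0 Real.pi) :
    ‖∫ t in (0 : ℝ)..x, E t * r t * (u t - 1)‖ ≤ K ^ 11 * ‖ε‖ * δ := by
  have hK := h.K_ge
  have hδ := h.δ_nonneg
  refine (norm_integral_mul_le_sup h.Er_integrable h.Er_int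
    (by positivity : 0 ≤ K ^ 8 * ‖ε‖ * δ) (fun t ht => h.norm_v_le ht) hx).trans ?_
  calc _ = K ^ 11 * ‖ε‖ * δ * δ := by ring
    _ ≤ K ^ 11 * ‖ε‖ * δ * 1 := by gcongr; exact h.δ_le
    _ = _ := by ring

/-- The interior values of the Fourier integral are needed only in the L₂ mean, the quantity that
`bessel_l2norm` makes summable; hence the definition of `oscSize`. -/
theorem l2norm_p_le : l2norm p ≤ K ^ 12 * (oscSize ν r + ‖ε‖ * δ) := by
  have hK := h.K_ge
  have hδ := h.δ_nonneg
  have hκ := oscSize_nonneg ν r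
  have c1 := h.ErI_deriv.continuousOn
  have c2 := continuousOn_integral (h.Er_integrable.mul_continuousOn h.v_cont isCompact_Icc)
  have e : p =ᵐ[mu0] fun x => (∫ t in (0 : ℝ)..x, E t * r t) +
      ∫ t in (0 : ℝ)..x, E t * r t * (u t - 1) :=
    (ae_restrict_iff' measurableSet_Icc).2 (.of_forall fun x hx => h.p_eq hx)
  rw [l2norm_congr e]
  refine (l2norm_add_le (memLp_of_continuousOn c1) (memLp_of_continuousOn c2)).trans ?_
  have h1 := h.l2norm_ErI_le
  have h2 := l2norm_le_of_bound (by positivity : 0 ≤ K ^ 11 * ‖ε‖ * δ) (fun x hx => h.Erv_le hx)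
  have h3 : K ^ 2 * oscSize ν r ≤ K ^ 12 * oscSize ν r := by
    gcongr
    · linarith
    · norm_num
  have h4 : 2 * (K ^ 11 * ‖ε‖ * δ) ≤ K ^ 12 * (‖ε‖ * δ) := by
    calc _ = K ^ 11 * ‖ε‖ * δ * 2 := by ring
      _ ≤ K ^ 11 * ‖ε‖ * δ * K := by gcongr; linarith
      _ = _ := by ring
  linarith

theorem l2norm_w_le : l2norm (fun x => F x * p x) ≤ K ^ 13 * (oscSize ν r + ‖ε‖ * δ) := by
  have hK := h.K_ge
  refine (l2norm_le_of_le_mul (memLp_of_continuousOn h.p_deriv.continuousOn) (c := K)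
    (fun x hx => ?_) (by linarith)).trans ?_
  · rw [norm_mul]
    gcongr
    exact h.F_le x hx
  · calc _ ≤ K * (K ^ 12 * (oscSize ν r + ‖ε‖ * δ)) := by gcongr; exact h.l2norm_p_le
      _ = _ := by ring

theorem Q_le {x : ℝ} (hx : x ∈ Icc 0 Real.pi) :
    ‖∫ t in (0 : ℝ)..x, S t * (F t * p t)‖ ≤ K ^ 15 * ‖ε‖ * (oscSize ν r + ‖ε‖ * δ) := by
  have hK := h.K_ge
  have hδ := h.δ_nonneg
  have hT : 0 ≤ oscSize ν r + ‖ε‖ * δ := add_nonneg (oscSize_nonneg _ _) (by positivity)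
  have h1 := norm_integral_mul_le_sup h.w_cont.integrableOn_Icc
    ((integral_norm_le_l2norm (memLp_of_continuousOn h.w_cont)).trans
      (mul_le_mul_of_nonneg_left h.l2norm_w_le zero_le_two))
    (by positivity : 0 ≤ K * ‖ε‖) h.S_le hx
  have e : (∫ t in (0 : ℝ)..x, S t * (F t * p t)) = ∫ t in (0 : ℝ)..x, F t * p t * S t :=
    integral_congr fun t _ => by ring
  rw [e]
  refine h1.trans ?_
  calc _ = K ^ 14 * ‖ε‖ * (oscSize ν r + ‖ε‖ * δ) * 2 := by ring
    _ ≤ K ^ 14 * ‖ε‖ * (oscSize ν r + ‖ε‖ * δ) * K := by gcongr; linarith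
    _ = _ := by ring

theorem ruI_deriv : HasACDeriv (fun x => ∫ t in (0 : ℝ)..x, r t * u t) (fun x => r x * u x) :=
  (hasACDeriv_integral 0 h.ru_integrable).congr_left fun x _ => by simp

theorem ruI_le {x : ℝ} (hx : x ∈ Icc 0 Real.pi) : ‖∫ t in (0 : ℝ)..x, r t * u t‖ ≤ K ^ 3 := by
  have hK := h.K_ge
  refine (norm_integral_mul_le_sup h.r_integrable h.r_int zero_le_two
    (fun t ht => h.norm_u_le ht) hx).trans ?_
  have := h.δ_le
  have := h.δ_nonneg
  calc K ^ 2 * δ * 2 ≤ K ^ 2 * 1 * K := by gcongr; linarith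
    _ = _ := by ring

/-- The formula for `u - 1` integrated against a function. -/
theorem integral_mul_v {f : ℝ → ℂ} (hf : IntegrableOn f (Icc 0 Real.pi)) :
    ∫ t in (0 : ℝ)..Real.pi, f t * (u t - 1) =
      ε * ((∫ t in (0 : ℝ)..Real.pi, f t * ∫ s in (0 : ℝ)..t, r s * u s) -
        (∫ t in (0 : ℝ)..Real.pi, f t * (F t * p t)) -
        2 * ∫ t in (0 : ℝ)..Real.pi, f t * ∫ s in (0 : ℝ)..t, S s * (F s * p s)) := by
  have i : ∀ {g : ℝ → ℂ}, ContinuousOn g (Icc 0 Real.pi) →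
      IntervalIntegrable (fun t => f t * g t) volume 0 Real.pi := fun hg =>
    intervalIntegrable_of_integrableOn (hf.mul_continuousOn hg isCompact_Icc) pi_mem_Icc_pi
  have i1 := i h.ruI_deriv.continuousOn
  have i2 := i h.w_cont
  have i3 := i (continuousOn_integral h.Sw_cont.integrableOn_Icc)
  rw [← intervalIntegral.integral_const_mul, ← integral_sub i1 i2,
    ← integral_sub (i1.sub i2) (i3.const_mul 2), ← intervalIntegral.integral_const_mul]
  refine integral_congr fun t ht => ?_
  rw [uIcc_of_le Real.pi_pos.le] at ht
  rw [h.v_eq ht]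
  ring

/-! ### Values at π -/

theorem r_mul_le {g : ℝ → ℂ} {B : ℝ} (hg : ContinuousOn g (Icc 0 Real.pi))
    (hgB : l2norm g ≤ B) : ‖∫ t in (0 : ℝ)..Real.pi, r t * g t‖ ≤ K * B := by
  have hK := h.K_ge
  refine (norm_integral_mul_le_l2norm h.r_memLp (memLp_of_continuousOn hg)).trans ?_
  have h1 : l2norm r ≤ K := h.r_le.trans (by nlinarith [h.δ_le])
  exact mul_le_mul h1 hgB (l2norm_nonneg _) (by linarith)

/-- `integral_mul_v` supplies the factor ε. Each of the three integrals left is small as well: the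
first, after integration by parts, contains a primitive of E r; in the second EF = 1 leaves r p; the
third contains the integral of Su'. -/
theorem Erv_pi_le : ‖∫ t in (0 : ℝ)..Real.pi, E t * r t * (u t - 1)‖ ≤
    K ^ 20 * ‖ε‖ * (oscSize ν r + ‖ε‖ * δ) := by
  have hK := h.K_ge
  have hK0 : 0 ≤ K := by linarith
  have hδ := h.δ_nonneg
  have hκ := oscSize_nonneg ν r
  have hT : 0 ≤ oscSize ν r + ‖ε‖ * δ := add_nonneg hκ (by positivity)
  set T := oscSize ν r + ‖ε‖ * δ with hTdef
  have hκT : oscSize ν r ≤ T := by rw [hTdef]; linarith [mul_nonneg (norm_nonneg ε) hδ]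
  have hp20 : ∀ n ≤ 18, K ^ n ≤ K ^ 18 := fun n hn => pow_le_pow_right₀ (by linarith) hn
  rw [h.integral_mul_v h.Er_integrable]
  have c1 := h.ErI_deriv.continuousOn
  -- first term
  have h1 := (h.ErI_deriv.mul h.ruI_deriv).integral_eq pi_mem_Icc_pi
  rw [integral_add (f := fun t => E t * r t * ∫ s in (0 : ℝ)..t, r s * u s)
    (intervalIntegrable_of_integrableOn (h.Er_integrable.mul_continuousOn
      h.ruI_deriv.continuousOn isCompact_Icc) pi_mem_Icc_pi)
    (intervalIntegrable_of_integrableOn (h.ru_integrable.continuousOn_mul c1 isCompact_Icc)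
      pi_mem_Icc_pi)] at h1
  simp only [integral_same, zero_mul, sub_zero] at h1
  have h2 : ‖∫ t in (0 : ℝ)..Real.pi, (∫ s in (0 : ℝ)..t, E s * r s) * (r t * u t)‖ ≤
      K * (2 * (K ^ 2 * oscSize ν r)) := by
    have e : (∫ t in (0 : ℝ)..Real.pi, (∫ s in (0 : ℝ)..t, E s * r s) * (r t * u t)) =
        ∫ t in (0 : ℝ)..Real.pi, r t * (u t * ∫ s in (0 : ℝ)..t, E s * r s) :=
      integral_congr fun t _ => by ring
    rw [e]
    refine h.r_mul_le (h.u_deriv.continuousOn.mul c1) ?_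
    refine (l2norm_le_of_le_mul (memLp_of_continuousOn c1) (fun x hx => ?_) zero_le_two).trans
      (mul_le_mul_of_nonneg_left h.l2norm_ErI_le zero_le_two)
    rw [norm_mul]
    gcongr
    exact h.norm_u_le hx
  have h3 : ‖(∫ t in (0 : ℝ)..Real.pi, E t * r t) * ∫ t in (0 : ℝ)..Real.pi, r t * u t‖ ≤
      K ^ 2 * oscSize ν r * K ^ 3 := by
    rw [norm_mul]
    exact mul_le_mul h.ErI_pi_le (h.ruI_le pi_mem_Icc_pi) (norm_nonneg _) (by positivity)
  have h4 : ‖∫ t in (0 : ℝ)..Real.pi, E t * r t * ∫ s in (0 : ℝ)..t, r s * u s‖ ≤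
      4 * (K ^ 18 * T) := by
    rw [eq_sub_of_add_eq h1]
    refine (norm_sub_le _ _).trans ?_
    have a1 : K ^ 2 * oscSize ν r * K ^ 3 ≤ K ^ 18 * T := by
      calc _ = K ^ 5 * oscSize ν r := by ring
        _ ≤ _ := mul_le_mul (hp20 5 (by norm_num)) hκT hκ (by positivity)
    have a2 : K ^ 3 * oscSize ν r ≤ K ^ 18 * T :=
      mul_le_mul (hp20 3 (by norm_num)) hκT hκ (by positivity)
    have a3 : 0 ≤ K ^ 18 * T := by positivity
    nlinarith
  -- second term
  have h5 : ‖∫ t in (0 : ℝ)..Real.pi, E t * r t * (F t * p t)‖ ≤ K ^ 18 * T := by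
    have e : (∫ t in (0 : ℝ)..Real.pi, E t * r t * (F t * p t)) =
        ∫ t in (0 : ℝ)..Real.pi, r t * p t := by
      refine integral_congr fun t ht => ?_
      rw [uIcc_of_le Real.pi_pos.le] at ht
      linear_combination (r t * p t) * h.F_mul_E t ht
    rw [e]
    refine (h.r_mul_le h.p_deriv.continuousOn h.l2norm_p_le).trans ?_
    calc _ = K ^ 13 * T := by ring
      _ ≤ _ := mul_le_mul_of_nonneg_right (hp20 13 (by norm_num)) hT
  -- third term
  have h6 : ‖∫ t in (0 : ℝ)..Real.pi, E t * r t * ∫ s in (0 : ℝ)..t, S s * (F s * p s)‖ ≤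
      K ^ 18 * T := by
    refine (norm_integral_mul_le_sup h.Er_integrable h.Er_int
      (by positivity : 0 ≤ K ^ 15 * ‖ε‖ * T) (fun t ht => h.Q_le ht) pi_mem_Icc_pi).trans ?_
    have := h.δ_le
    have := h.eps_le_one
    calc _ ≤ K ^ 3 * 1 * (K ^ 15 * 1 * T) := by gcongr
      _ = _ := by ring
  rw [norm_mul]
  calc _ ≤ ‖ε‖ * (4 * (K ^ 18 * T) + K ^ 18 * T + 2 * (K ^ 18 * T)) := by
        gcongr
        refine (norm_sub_le _ _).trans (add_le_add ((norm_sub_le _ _).trans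
          (add_le_add h4 h5)) ?_)
        rw [norm_mul, Complex.norm_ofNat]
        gcongr
    _ = K ^ 18 * ‖ε‖ * T * 7 := by ring
    _ ≤ K ^ 18 * ‖ε‖ * T * K ^ 2 := by gcongr; nlinarith
    _ = _ := by ring

/-- The derivative at `π`. -/
theorem norm_w_sub_le : ‖F Real.pi * p Real.pi -
    Complex.exp (-(2 * Complex.I * ν * Real.pi)) * fourInt ν r Real.pi‖ ≤
    K ^ 22 * ‖ε‖ * (oscSize ν r + ‖ε‖ * δ) := by
  have hK := h.K_ge
  have hδ := h.δ_nonneg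
  have hκ := oscSize_nonneg ν r
  have hT : 0 ≤ oscSize ν r + ‖ε‖ * δ := add_nonneg hκ (by positivity)
  have e := h.F_mul_E Real.pi pi_mem_Icc_pi
  have e2 := h.p_eq pi_mem_Icc_pi
  have h1 := h.ErI_approx pi_mem_Icc_pi
  have h2 := h.Erv_pi_le
  have e3 : F Real.pi * p Real.pi -
      Complex.exp (-(2 * Complex.I * ν * Real.pi)) * fourInt ν r Real.pi =
      F Real.pi * (((∫ t in (0 : ℝ)..Real.pi, E t * r t) -
      Complex.exp (-(2 * Complex.I * ν * Real.pi)) * E Real.pi * fourInt ν r Real.pi) +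
      ∫ t in (0 : ℝ)..Real.pi, E t * r t * (u t - 1)) := by
    rw [e2]
    linear_combination (Complex.exp (-(2 * Complex.I * ν * Real.pi)) * fourInt ν r Real.pi) * e
  rw [e3, norm_mul]
  have h3 : l2norm (fourInt ν r) ≤ oscSize ν r + ‖ε‖ * δ := by
    unfold oscSize
    have := norm_nonneg (fourInt ν r Real.pi)
    have : 0 ≤ ‖ε‖ * δ := by positivity
    linarith
  have h4 : K ^ 3 ≤ K ^ 20 := pow_le_pow_right₀ (by linarith) (by norm_num)
  calc _ ≤ K * (K ^ 20 * ‖ε‖ * (oscSize ν r + ‖ε‖ * δ) +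
        K ^ 20 * ‖ε‖ * (oscSize ν r + ‖ε‖ * δ)) := by
        refine mul_le_mul (h.F_le _ pi_mem_Icc_pi) ((norm_add_le _ _).trans (add_le_add
          (h1.trans ?_) h2)) (norm_nonneg _) (by linarith)
        have := l2norm_nonneg (fourInt ν r)
        gcongr
    _ = K ^ 21 * ‖ε‖ * (oscSize ν r + ‖ε‖ * δ) * 2 := by ring
    _ ≤ K ^ 21 * ‖ε‖ * (oscSize ν r + ‖ε‖ * δ) * K := by gcongr; linarith
    _ = _ := by ring

omit h in
theorem integral_mul_primitive {f : ℝ → ℂ} (hf : IntegrableOn f (Icc 0 Real.pi)) :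
    ∫ t in (0 : ℝ)..Real.pi, f t * ∫ s in (0 : ℝ)..t, f s =
      (∫ t in (0 : ℝ)..Real.pi, f t) ^ 2 / 2 := by
  have h1 : HasACDeriv (fun x => ∫ t in (0 : ℝ)..x, f t) f :=
    (hasACDeriv_integral 0 hf).congr_left fun x _ => by simp
  have h2 := (h1.mul h1).integral_eq pi_mem_Icc_pi
  simp only [integral_same, zero_mul, sub_zero] at h2
  have h3 : (∫ t in (0 : ℝ)..Real.pi, (f t * (∫ s in (0 : ℝ)..t, f s) +
      (∫ s in (0 : ℝ)..t, f s) * f t)) =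
      2 * ∫ t in (0 : ℝ)..Real.pi, f t * ∫ s in (0 : ℝ)..t, f s := by
    rw [← intervalIntegral.integral_const_mul]
    exact integral_congr fun t _ => by ring
  rw [h3] at h2
  linear_combination h2 / 2

/-- The part of `integral_mul_v` with u replaced by 1 in the inner integral does not oscillate. It
equals (∫r)²/2 and must be kept, because for M = 0 it is not small; the logarithm will cancel it. -/
theorem rv_pi_le : ‖(∫ t in (0 : ℝ)..Real.pi, r t * (u t - 1)) -
    ε * ((∫ t in (0 : ℝ)..Real.pi, r t) ^ 2 / 2)‖ ≤ K ^ 19 * ‖ε‖ * (oscSize ν r + ‖ε‖ * δ) := by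
  have hK := h.K_ge
  have hδ := h.δ_nonneg
  have hδ1 := h.δ_le
  have hε1 := h.eps_le_one
  have hκ := oscSize_nonneg ν r
  have hT : 0 ≤ oscSize ν r + ‖ε‖ * δ := add_nonneg hκ (by positivity)
  set T := oscSize ν r + ‖ε‖ * δ with hTdef
  have hεT : ‖ε‖ * δ ≤ T := by rw [hTdef]; linarith
  rw [h.integral_mul_v h.r_integrable]
  have cR2 := continuousOn_integral (h.r_integrable.mul_continuousOn h.v_cont isCompact_Icc)
  have hR : (∫ t in (0 : ℝ)..Real.pi, r t * ∫ s in (0 : ℝ)..t, r s * u s) =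
      (∫ t in (0 : ℝ)..Real.pi, r t) ^ 2 / 2 +
      ∫ t in (0 : ℝ)..Real.pi, r t * ∫ s in (0 : ℝ)..t, r s * (u s - 1) := by
    rw [← integral_mul_primitive h.r_integrable, ← integral_add
      (intervalIntegrable_of_integrableOn (h.r_integrable.mul_continuousOn
        (continuousOn_integral h.r_integrable) isCompact_Icc) pi_mem_Icc_pi)
      (intervalIntegrable_of_integrableOn (h.r_integrable.mul_continuousOn cR2 isCompact_Icc)
        pi_mem_Icc_pi)]
    refine integral_congr fun t ht => ?_
    rw [uIcc_of_le Real.pi_pos.le] at ht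
    rw [← mul_add, ← integral_add (intervalIntegrable_of_integrableOn h.r_integrable ht)
      (intervalIntegrable_of_integrableOn (h.r_integrable.mul_continuousOn h.v_cont isCompact_Icc)
        ht)]
    congr 1
    exact integral_congr fun s _ => by ring
  rw [hR, ← mul_sub, norm_mul]
  have hp : ∀ n ≤ 17, K ^ n ≤ K ^ 17 := fun n hn => pow_le_pow_right₀ (by linarith) hn
  have h1 : ‖∫ t in (0 : ℝ)..Real.pi, r t * ∫ s in (0 : ℝ)..t, r s * (u s - 1)‖ ≤ K ^ 17 * T := by
    have hb : ∀ x ∈ Icc 0 Real.pi, ‖∫ s in (0 : ℝ)..x, r s * (u s - 1)‖ ≤ K ^ 10 * T := by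
      intro x hx
      refine (norm_integral_mul_le_sup h.r_integrable h.r_int
        (by positivity : 0 ≤ K ^ 8 * ‖ε‖ * δ) (fun t ht => h.norm_v_le ht) hx).trans ?_
      calc _ = K ^ 10 * δ * (‖ε‖ * δ) := by ring
        _ ≤ K ^ 10 * 1 * T := by gcongr
        _ = _ := by ring
    refine (norm_integral_mul_le_sup h.r_integrable h.r_int (by positivity) hb
      pi_mem_Icc_pi).trans ?_
    calc _ = K ^ 12 * δ * T := by ring
      _ ≤ K ^ 17 * 1 * T := by
        gcongr ?_ * ?_ * T
        exact hp 12 (by norm_num)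
      _ = _ := by ring
  have h2 : ‖∫ t in (0 : ℝ)..Real.pi, r t * (F t * p t)‖ ≤ K ^ 17 * T := by
    refine (h.r_mul_le h.w_cont h.l2norm_w_le).trans ?_
    calc _ = K ^ 14 * T := by ring
      _ ≤ _ := mul_le_mul_of_nonneg_right (hp 14 (by norm_num)) hT
  have h3 : ‖∫ t in (0 : ℝ)..Real.pi, r t * ∫ s in (0 : ℝ)..t, S s * (F s * p s)‖ ≤
      K ^ 17 * T := by
    refine (norm_integral_mul_le_sup h.r_integrable h.r_int
      (by positivity : 0 ≤ K ^ 15 * ‖ε‖ * T) (fun t ht => h.Q_le ht) pi_mem_Icc_pi).trans ?_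
    calc _ ≤ K ^ 2 * 1 * (K ^ 15 * 1 * T) := by gcongr
      _ = _ := by ring
  rw [show ∀ a b c d : ℂ, a + b - c - 2 * d - a = b - c - 2 * d by intros; ring]
  calc _ ≤ ‖ε‖ * (K ^ 17 * T + K ^ 17 * T + 2 * (K ^ 17 * T)) := by
        gcongr
        refine (norm_sub_le _ _).trans (add_le_add ((norm_sub_le _ _).trans
          (add_le_add h1 h2)) ?_)
        rw [norm_mul, Complex.norm_ofNat]
        gcongr
    _ = K ^ 17 * ‖ε‖ * T * 4 := by ring
    _ ≤ K ^ 17 * ‖ε‖ * T * K ^ 2 := by gcongr; nlinarith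
    _ = _ := by ring

theorem v_pi_approx : ‖u Real.pi - 1 - ε * ((∫ t in (0 : ℝ)..Real.pi, r t) -
      Complex.exp (-(2 * Complex.I * ν * Real.pi)) * fourInt ν r Real.pi) -
      ε ^ 2 * ((∫ t in (0 : ℝ)..Real.pi, r t) ^ 2 / 2)‖ ≤
    K ^ 23 * ‖ε‖ ^ 2 * (oscSize ν r + ‖ε‖ * δ) := by
  have hK := h.K_ge
  have hδ := h.δ_nonneg
  have hκ := oscSize_nonneg ν r
  have hT : 0 ≤ oscSize ν r + ‖ε‖ * δ := add_nonneg hκ (by positivity)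
  set T := oscSize ν r + ‖ε‖ * δ with hTdef
  have h1 := h.rv_pi_le
  have h2 := h.norm_w_sub_le
  have h3 := h.Q_le pi_mem_Icc_pi
  have e : (∫ t in (0 : ℝ)..Real.pi, r t * u t) = (∫ t in (0 : ℝ)..Real.pi, r t) +
      ∫ t in (0 : ℝ)..Real.pi, r t * (u t - 1) := by
    rw [← integral_add (intervalIntegrable_of_integrableOn h.r_integrable pi_mem_Icc_pi)
      (intervalIntegrable_of_integrableOn (h.r_integrable.mul_continuousOn h.v_cont isCompact_Icc)
        pi_mem_Icc_pi)]
    exact integral_congr fun s _ => by ring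
  rw [h.v_eq pi_mem_Icc_pi, e]
  generalize (∫ t in (0 : ℝ)..Real.pi, r t * (u t - 1)) = a at *
  generalize (∫ t in (0 : ℝ)..Real.pi, r t) = b at *
  generalize (∫ t in (0 : ℝ)..Real.pi, S t * (F t * p t)) = d at *
  generalize Complex.exp (-(2 * Complex.I * ν * Real.pi)) * fourInt ν r Real.pi = f at *
  rw [show ε * (b + a - F Real.pi * p Real.pi - 2 * d) - ε * (b - f) - ε ^ 2 * (b ^ 2 / 2) =
    ε * ((a - ε * (b ^ 2 / 2)) - (F Real.pi * p Real.pi - f) - 2 * d) by ring, norm_mul]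
  have hp : ∀ n ≤ 22, K ^ n * ‖ε‖ * T ≤ K ^ 22 * ‖ε‖ * T := fun n hn => by
    gcongr
    linarith
  calc _ ≤ ‖ε‖ * (K ^ 22 * ‖ε‖ * T + K ^ 22 * ‖ε‖ * T + 2 * (K ^ 22 * ‖ε‖ * T)) := by
        gcongr
        refine (norm_sub_le _ _).trans (add_le_add ((norm_sub_le _ _).trans
          (add_le_add (h1.trans (hp 19 (by norm_num))) h2)) ?_)
        rw [norm_mul, Complex.norm_ofNat]
        gcongr
        exact h3.trans (hp 15 (by norm_num))
    _ = K ^ 22 * ‖ε‖ ^ 2 * T * 4 := by ring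
    _ ≤ K ^ 22 * ‖ε‖ ^ 2 * T * K := by gcongr
    _ = _ := by ring

omit h in
theorem norm_log_one_add_sub_le {v : ℂ} (hv : ‖v‖ ≤ 1 / 2) :
    ‖Complex.log (1 + v) - (v - v ^ 2 / 2)‖ ≤ ‖v‖ ^ 3 := by
  have h1 := Complex.norm_log_sub_logTaylor_le 2 (hv.trans_lt (by norm_num))
  have e : Complex.logTaylor (2 + 1) v = v - v ^ 2 / 2 := by
    simp only [Complex.logTaylor_succ, Complex.logTaylor_zero, Pi.add_apply]
    norm_num
    ring
  rw [e] at h1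
  refine h1.trans ?_
  have h2 : (1 - ‖v‖)⁻¹ ≤ 2 := by
    rw [inv_le_comm₀ (by linarith) (by norm_num)]; linarith
  have h3 : 0 ≤ ‖v‖ ^ 3 := by positivity
  rw [show (2 : ℕ) + 1 = 3 from rfl]
  push_cast
  have h4 : ‖v‖ ^ 3 * (1 - ‖v‖)⁻¹ ≤ ‖v‖ ^ 3 * 2 := by gcongr
  linarith

theorem norm_v_pi_le_half (hε : K ^ 9 * ‖ε‖ ≤ 1) : ‖u Real.pi - 1‖ ≤ 1 / 2 := by
  have hK := h.K_ge
  have h1 := h.norm_v_le pi_mem_Icc_pi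
  have h2 : K ^ 8 * ‖ε‖ * δ ≤ K ^ 8 * ‖ε‖ * 1 := by gcongr; exact h.δ_le
  have h3 : K ^ 9 * ‖ε‖ = K * (K ^ 8 * ‖ε‖) := by ring
  have h4 : 0 ≤ K ^ 8 * ‖ε‖ := by positivity
  nlinarith

/-- The logarithm of `u(π)`. -/
theorem log_u_pi_approx (hε : K ^ 9 * ‖ε‖ ≤ 1) :
    ‖Complex.log (u Real.pi) - ε * ((∫ t in (0 : ℝ)..Real.pi, r t) -
      Complex.exp (-(2 * Complex.I * ν * Real.pi)) * fourInt ν r Real.pi)‖ ≤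
    K ^ 35 * ‖ε‖ ^ 2 * (oscSize ν r + ‖ε‖ * δ) := by
  have hK := h.K_ge
  have hδ := h.δ_nonneg
  have hδ1 := h.δ_le
  have hκ := oscSize_nonneg ν r
  have hT : 0 ≤ oscSize ν r + ‖ε‖ * δ := add_nonneg hκ (by positivity)
  have h1 := h.v_pi_approx
  have h2 := norm_log_one_add_sub_le (h.norm_v_pi_le_half hε)
  rw [add_sub_cancel] at h2
  have h3 := h.norm_v_le pi_mem_Icc_pi
  have ha : ‖∫ t in (0 : ℝ)..Real.pi, r t‖ ≤ K ^ 2 * δ :=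
    (norm_integral_le_of_mem h.r_integrable pi_mem_Icc_pi).trans h.r_int
  have hb : ‖Complex.exp (-(2 * Complex.I * ν * Real.pi)) * fourInt ν r Real.pi‖ ≤ oscSize ν r := by
    have e : ‖Complex.exp (-(2 * Complex.I * ν * Real.pi))‖ = 1 := by
      have := norm_cexp_two_I (-ν) Real.pi
      push_cast at this
      rw [← this]; congr 2; ring
    rw [norm_mul, e, one_mul, oscSize]
    linarith [l2norm_nonneg (fourInt ν r)]
  have hεδT : ‖ε‖ * δ ≤ oscSize ν r + ‖ε‖ * δ := by linarith
  have hκT : oscSize ν r ≤ oscSize ν r + ‖ε‖ * δ := by linarith [mul_nonneg (norm_nonneg ε) hδ]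
  have hε1 := h.eps_le_one
  set T := oscSize ν r + ‖ε‖ * δ with hTdef
  generalize Complex.log (u Real.pi) = l at *
  generalize u Real.pi - 1 = v at *
  generalize (∫ t in (0 : ℝ)..Real.pi, r t) = a at *
  generalize Complex.exp (-(2 * Complex.I * ν * Real.pi)) * fourInt ν r Real.pi = b at *
  have hv3 : ‖v‖ ^ 3 ≤ K ^ 24 * ‖ε‖ ^ 2 * T := by
    calc _ ≤ (K ^ 8 * ‖ε‖ * δ) ^ 3 := by gcongr
      _ = K ^ 24 * ‖ε‖ ^ 2 * (‖ε‖ * δ) * (δ * δ) := by ring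
      _ ≤ K ^ 24 * ‖ε‖ ^ 2 * T * (1 * 1) := by gcongr
      _ = _ := by ring
  have hva : ‖v - ε * a‖ ≤ K ^ 25 * ‖ε‖ * T := by
    have hd : ‖ε * b‖ ≤ ‖ε‖ * T := by rw [norm_mul]; gcongr; exact hb.trans hκT
    have h5 : ‖ε ^ 2 * (a ^ 2 / 2)‖ ≤ K ^ 4 * ‖ε‖ * T := by
      rw [norm_mul, norm_div, norm_pow, norm_pow, Complex.norm_ofNat]
      calc ‖ε‖ ^ 2 * (‖a‖ ^ 2 / 2) ≤ ‖ε‖ ^ 2 * ((K ^ 2 * δ) ^ 2 / 1) := by gcongr; norm_num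
        _ = K ^ 4 * ‖ε‖ * (‖ε‖ * δ) * δ := by ring
        _ ≤ K ^ 4 * ‖ε‖ * T * 1 := by gcongr
        _ = _ := by ring
    have h6 : K ^ 23 * ‖ε‖ ^ 2 * T ≤ K ^ 23 * ‖ε‖ * T := by
      gcongr
      nlinarith [norm_nonneg ε]
    have h7 : ‖ε‖ * T ≤ K ^ 23 * ‖ε‖ * T := by
      have : (1 : ℝ) ≤ K ^ 23 := one_le_pow₀ (by linarith)
      nlinarith [mul_nonneg (norm_nonneg ε) hT]
    have h8 : K ^ 4 * ‖ε‖ * T ≤ K ^ 23 * ‖ε‖ * T := by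
      gcongr
      · linarith
      · norm_num
    have h9 : K ^ 23 * ‖ε‖ * T * 3 ≤ K ^ 25 * ‖ε‖ * T := by
      calc _ ≤ K ^ 23 * ‖ε‖ * T * K ^ 2 := by gcongr; nlinarith
        _ = _ := by ring
    have e : v - ε * a = (v - ε * (a - b) - ε ^ 2 * (a ^ 2 / 2)) - ε * b +
        ε ^ 2 * (a ^ 2 / 2) := by ring
    rw [e]
    have := norm_add_le (v - ε * (a - b) - ε ^ 2 * (a ^ 2 / 2) - ε * b) (ε ^ 2 * (a ^ 2 / 2))
    have := norm_sub_le (v - ε * (a - b) - ε ^ 2 * (a ^ 2 / 2)) (ε * b)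
    linarith
  have hva' : ‖v + ε * a‖ ≤ K ^ 9 * ‖ε‖ := by
    refine (norm_add_le _ _).trans ?_
    rw [norm_mul]
    calc ‖v‖ + ‖ε‖ * ‖a‖ ≤ K ^ 8 * ‖ε‖ * δ + ‖ε‖ * (K ^ 2 * δ) := by gcongr
      _ ≤ K ^ 8 * ‖ε‖ * 1 + ‖ε‖ * (K ^ 8 * 1) := by
        gcongr
        · linarith
        · norm_num
      _ = K ^ 8 * ‖ε‖ * 2 := by ring
      _ ≤ K ^ 8 * ‖ε‖ * K := by gcongr; linarith
      _ = _ := by ring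
  have hprod : ‖(v - ε * a) * (v + ε * a) / 2‖ ≤ K ^ 34 * ‖ε‖ ^ 2 * T := by
    rw [norm_div, norm_mul, Complex.norm_ofNat]
    calc ‖v - ε * a‖ * ‖v + ε * a‖ / 2 ≤ K ^ 25 * ‖ε‖ * T * (K ^ 9 * ‖ε‖) / 1 := by
          gcongr; norm_num
      _ = _ := by ring
  have hp : ∀ n ≤ 34, K ^ n * ‖ε‖ ^ 2 * T ≤ K ^ 34 * ‖ε‖ ^ 2 * T := fun n hn => by
    gcongr
    linarith
  -- The second-order term ε²a²/2 of v cancels against v²/2 from the logarithm, up to the product (v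
  -- - εa)(v + εa)/2.
  have e : l - ε * (a - b) = (l - (v - v ^ 2 / 2)) +
      (v - ε * (a - b) - ε ^ 2 * (a ^ 2 / 2)) - (v - ε * a) * (v + ε * a) / 2 := by ring
  rw [e]
  calc _ ≤ K ^ 34 * ‖ε‖ ^ 2 * T + K ^ 34 * ‖ε‖ ^ 2 * T + K ^ 34 * ‖ε‖ ^ 2 * T :=
        (norm_sub_le _ _).trans (add_le_add ((norm_add_le _ _).trans (add_le_add
          (h2.trans (hv3.trans (hp 24 (by norm_num)))) (h1.trans (hp 23 (by norm_num))))) hprod)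
    _ = K ^ 34 * ‖ε‖ ^ 2 * T * 3 := by ring
    _ ≤ K ^ 34 * ‖ε‖ ^ 2 * T * K := by gcongr; linarith
    _ = _ := by ring

end OscData

end SturmLiouville

end

noncomputable section

namespace SturmLiouville

open Set intervalIntegral

/-! ### Exponential solutions -/

/-- The constant of the estimates for exponential solutions. -/
def expConst (M : ℝ) : ℝ := Real.exp (16 * M) + 4

theorem expConst_ge (M : ℝ) : 4 ≤ expConst M := by
  have := Real.exp_pos (16 * M)
  unfold expConst; linarith

theorem le_expConst {M : ℝ} (hM : 0 ≤ M) : 4 * M ≤ expConst M := by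
  have := Real.add_one_le_exp (16 * M)
  unfold expConst; linarith

theorem norm_cexp_le_expConst {z : ℂ} {M : ℝ} (h : z.re ≤ 16 * M) : ‖Complex.exp z‖ ≤ expConst M := by
  rw [Complex.norm_exp, expConst]
  have := Real.exp_le_exp.2 h
  linarith

section ExpSol

variable {q S S' f g : ℝ → ℂ} {ρ ε : ℂ} {ν M δ : ℝ}

/-- With f = u exp(iρx + ∫S) the equation for f becomes (E u')' = E r u, where r is the Riccati
defect of S. The prescribed initial slope means u'(0) = 0. -/
theorem oscData_of_solution (hε : 2 * Complex.I * ρ * ε = 1) (hM : 0 ≤ M) (hδ : 0 ≤ δ)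
    (hδ1 : δ ≤ 1) (hεK : expConst M ^ 8 * ‖ε‖ ≤ 1) (hS : HasACDeriv S S')
    (hSM : ∀ x ∈ Icc 0 Real.pi, ‖S x‖ ≤ M * ‖ε‖)
    (hr : MemLp (fun x => q x - S' x - 2 * Complex.I * ρ * S x - S x ^ 2) 2 mu0)
    (hrM : l2norm (fun x => q x - S' x - 2 * Complex.I * ρ * S x - S x ^ 2) ≤ M * δ)
    (hρν : ‖ρ - ν‖ ≤ M * ‖ε‖) (hf : HasACDeriv f g)
    (hg : HasACDeriv g (fun x => (q x - ρ ^ 2) * f x)) (hf0 : f 0 = 1)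
    (hg0 : g 0 = Complex.I * ρ + S 0) :
    OscData ε ν S (fun x => q x - S' x - 2 * Complex.I * ρ * S x - S x ^ 2)
      (fun x => Complex.exp (2 * (Complex.I * ρ * x + ∫ t in (0 : ℝ)..x, S t)))
      (fun x => Complex.exp (-2 * (Complex.I * ρ * x + ∫ t in (0 : ℝ)..x, S t)))
      (fun x => 2 * Complex.I * (ρ - ν) + 2 * S x)
      (fun x => f x * Complex.exp (-1 * (Complex.I * ρ * x + ∫ t in (0 : ℝ)..x, S t)))
      (fun x => (g x - (Complex.I * ρ + S x) * f x) *
        Complex.exp (1 * (Complex.I * ρ * x + ∫ t in (0 : ℝ)..x, S t)))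
      (expConst M) δ := by
  have hK := expConst_ge M
  have hKM := le_expConst hM
  have hMK : M ≤ expConst M := by linarith
  have hε0 : ε ≠ 0 := by rintro rfl; simp at hε
  have hε1 : ‖ε‖ ≤ 1 := by
    have h1 : (1 : ℝ) ≤ expConst M ^ 8 := one_le_pow₀ (by linarith)
    nlinarith [norm_nonneg ε]
  have hSc := hS.continuousOn
  have hid : HasACDeriv (fun x : ℝ => (x : ℂ)) (fun _ => 1) :=
    hasACDeriv_of_hasDerivAt (fun x => Complex.ofRealCLM.hasDerivAt) continuous_const
  have hG : HasACDeriv (fun x : ℝ => Complex.I * ρ * x + ∫ t in (0 : ℝ)..x, S t)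
      (fun x => Complex.I * ρ + S x) := by
    refine ((hid.const_mul (Complex.I * ρ)).add (hasACDeriv_integral 0
      hSc.integrableOn_Icc)).congr_left (fun x _ => by simp) |>.congr_right fun x _ => by simp
  have hexp : ∀ c : ℂ, HasACDeriv
      (fun x => Complex.exp (c * (Complex.I * ρ * x + ∫ t in (0 : ℝ)..x, S t)))
      (fun x => Complex.exp (c * (Complex.I * ρ * x + ∫ t in (0 : ℝ)..x, S t)) *
        (c * (Complex.I * ρ + S x))) := fun c =>
    (hG.const_mul c).cexp (by fun_prop)
  have h1ε : 1 / ε = 2 * Complex.I * ρ := (eq_div_of_mul_eq hε0 hε).symm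
  -- |Im ρ|x and |∫S| are at most 4M each, since π ≤ 4 and ‖ε‖ ≤ 1. Doubling the exponent explains
  -- the 16 in `expConst`.
  have hre : ∀ x ∈ Icc 0 Real.pi,
      |(Complex.I * ρ * x + ∫ t in (0 : ℝ)..x, S t).re| ≤ 8 * M := by
    intro x hx
    have h1 : ‖∫ t in (0 : ℝ)..x, S t‖ ≤ 4 * (M * ‖ε‖) :=
      (norm_integral_le_of_mem hSc.integrableOn_Icc hx).trans (integral_norm_le_of_bound hSc hSM)
    have h2 : |(Complex.I * ρ * x).re| ≤ M * ‖ε‖ * 4 := by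
      have e : (Complex.I * ρ * x).re = -(ρ - ν).im * x := by simp
      rw [e, abs_mul, abs_neg, abs_of_nonneg hx.1]
      exact mul_le_mul ((Complex.abs_im_le_norm _).trans hρν) (hx.2.trans Real.pi_le_four) hx.1
        (by positivity)
    rw [Complex.add_re]
    have h3 := Complex.abs_re_le_norm (∫ t in (0 : ℝ)..x, S t)
    have h4 := abs_add_le (Complex.I * ρ * x).re (∫ t in (0 : ℝ)..x, S t).re
    nlinarith
  have hre2 : ∀ c : ℝ, |c| ≤ 2 → ∀ x ∈ Icc 0 Real.pi,
      ((c : ℂ) * (Complex.I * ρ * x + ∫ t in (0 : ℝ)..x, S t)).re ≤ 16 * M := by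
    intro c hc x hx
    rw [Complex.re_ofReal_mul]
    refine (le_abs_self _).trans ?_
    rw [abs_mul]
    have := hre x hx
    have := abs_nonneg (Complex.I * ρ * x + ∫ t in (0 : ℝ)..x, S t).re
    nlinarith [abs_nonneg c]
  refine ⟨hε0, hK, hδ, hδ1, hεK, hSc, fun x hx => (hSM x hx).trans (by gcongr), hr,
    hrM.trans (by gcongr), (hexp 2).continuousOn, fun x hx => norm_cexp_le_expConst ?_,
    fun x hx => norm_cexp_le_expConst ?_, fun x hx => ?_, (hexp (-2)).congr_right fun x _ => ?_,
    by fun_prop, fun x hx => ?_, ?_, ?_, ?_, ?_, ?_⟩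
  · simpa using hre2 2 (by norm_num) x hx
  · simpa using hre2 (-2) (by norm_num) x hx
  · rw [← Complex.exp_add, ← Complex.exp_zero]; congr 1; ring
  · rw [h1ε]; ring
  · have h1 : ‖2 * Complex.I * (ρ - ν) + 2 * S x‖ ≤ 2 * ‖ρ - ν‖ + 2 * ‖S x‖ := by
      refine (norm_add_le _ _).trans ?_
      simp
    have h2 := hSM x hx
    nlinarith [norm_nonneg ε]
  · have h1 := (hasACDeriv_cexp (-(2 * Complex.I * ν))).mul (hexp 2)
    refine (h1.congr_left fun x _ => ?_).congr_right fun x _ => ?_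
    · ring_nf
    · simp only
      rw [show -(2 * Complex.I * (ν : ℂ)) * (x : ℂ) = -(2 * Complex.I * ν * x) by ring]; ring
  · simp [hf0]
  · simp [hf0, hg0]
  · refine (hf.mul (hexp (-1))).congr_right fun x _ => ?_
    have : Complex.exp (-2 * (Complex.I * ρ * x + ∫ t in (0 : ℝ)..x, S t)) *
        Complex.exp (1 * (Complex.I * ρ * x + ∫ t in (0 : ℝ)..x, S t)) =
        Complex.exp (-1 * (Complex.I * ρ * x + ∫ t in (0 : ℝ)..x, S t)) := by
      rw [← Complex.exp_add]; congr 1; ring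
    simp only
    linear_combination (-(g x - (Complex.I * ρ + S x) * f x)) * this
  · have h1 := (hg.sub ((((hasACDeriv_const (Complex.I * ρ)).add hS)).mul hf)).mul (hexp 1)
    refine (h1.congr_left fun x _ => ?_).congr_right fun x _ => ?_
    · simp
    · have : Complex.exp (2 * (Complex.I * ρ * x + ∫ t in (0 : ℝ)..x, S t)) *
        Complex.exp (-1 * (Complex.I * ρ * x + ∫ t in (0 : ℝ)..x, S t)) =
        Complex.exp (1 * (Complex.I * ρ * x + ∫ t in (0 : ℝ)..x, S t)) := by
        rw [← Complex.exp_add]; congr 1; ring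
      simp only [Pi.add_apply]
      linear_combination (-(q x - S' x - 2 * Complex.I * ρ * S x - S x ^ 2) * f x) * this -
        f x * ρ ^ 2 * Complex.exp (1 * (Complex.I * ρ * x + ∫ t in (0 : ℝ)..x, S t)) * Complex.I_sq

/-- The values at `π` of an exponential solution. -/
theorem exponential_solution (hε : 2 * Complex.I * ρ * ε = 1) (hM : 0 ≤ M) (hδ : 0 ≤ δ)
    (hδ1 : δ ≤ 1) (hεK : expConst M ^ 9 * ‖ε‖ ≤ 1) (hS : HasACDeriv S S')
    (hSM : ∀ x ∈ Icc 0 Real.pi, ‖S x‖ ≤ M * ‖ε‖)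
    (hr : MemLp (fun x => q x - S' x - 2 * Complex.I * ρ * S x - S x ^ 2) 2 mu0)
    (hrM : l2norm (fun x => q x - S' x - 2 * Complex.I * ρ * S x - S x ^ 2) ≤ M * δ)
    (hρν : ‖ρ - ν‖ ≤ M * ‖ε‖) (hf : HasACDeriv f g)
    (hg : HasACDeriv g (fun x => (q x - ρ ^ 2) * f x)) (hf0 : f 0 = 1)
    (hg0 : g 0 = Complex.I * ρ + S 0) :
    ∃ l w : ℂ,
      f Real.pi = Complex.exp (Complex.I * ρ * Real.pi + (∫ t in (0 : ℝ)..Real.pi, S t) + l) ∧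
      g Real.pi = f Real.pi * (Complex.I * ρ + S Real.pi + w) ∧
      ‖l - ε * ((∫ t in (0 : ℝ)..Real.pi, (q t - S' t - 2 * Complex.I * ρ * S t - S t ^ 2)) -
        Complex.exp (-(2 * Complex.I * ν * Real.pi)) *
          fourInt ν (fun x => q x - S' x - 2 * Complex.I * ρ * S x - S x ^ 2) Real.pi)‖ ≤
        expConst M ^ 35 * ‖ε‖ ^ 2 *
          (OscData.oscSize ν (fun x => q x - S' x - 2 * Complex.I * ρ * S x - S x ^ 2) + ‖ε‖ * δ) ∧
      ‖w - Complex.exp (-(2 * Complex.I * ν * Real.pi)) *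
          fourInt ν (fun x => q x - S' x - 2 * Complex.I * ρ * S x - S x ^ 2) Real.pi‖ ≤
        expConst M ^ 32 * ‖ε‖ *
          (OscData.oscSize ν (fun x => q x - S' x - 2 * Complex.I * ρ * S x - S x ^ 2) + ‖ε‖ * δ) := by
  have hK := expConst_ge M
  have h := oscData_of_solution (q := q) hε hM hδ hδ1 (le_trans (by gcongr <;> linarith) hεK)
    hS hSM hr hrM hρν hf hg hf0 hg0
  set r : ℝ → ℂ := fun x => q x - S' x - 2 * Complex.I * ρ * S x - S x ^ 2
  set K := expConst M
  set G := Complex.I * ρ * Real.pi + (∫ t in (0 : ℝ)..Real.pi, S t) with hGdef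
  have h1 := h.log_u_pi_approx hεK
  have h2 := h.norm_w_sub_le
  have h3 := h.norm_v_pi_le_half hεK
  have h4 := h.norm_v_le pi_mem_Icc_pi
  have hε1 := h.eps_le_one
  have hfG : f Real.pi = f Real.pi * Complex.exp (-1 * G) * Complex.exp G := by
    rw [mul_assoc, ← Complex.exp_add]; simp
  simp only [← hGdef] at h1 h2 h3 h4
  set U := f Real.pi * Complex.exp (-1 * G) with hU
  set W := Complex.exp (-2 * G) * ((g Real.pi - (Complex.I * ρ + S Real.pi) * f Real.pi) *
    Complex.exp (1 * G)) with hW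
  have hU12 : 1 / 2 ≤ ‖U‖ := by
    have := norm_sub_norm_le (1 : ℂ) (1 - U)
    rw [norm_one, sub_sub_cancel, norm_sub_rev] at this
    linarith
  have hU0 : U ≠ 0 := norm_pos_iff.1 (by linarith)
  have hκ := OscData.oscSize_nonneg ν r
  -- U and W are u(π) and u'(π): the logarithmic derivative of f is iρ + S + u'/u.
  refine ⟨Complex.log U, W / U, ?_, ?_, h1, ?_⟩
  · rw [Complex.exp_add, Complex.exp_log hU0, hfG]; ring
  · have e : W * Complex.exp G = g Real.pi - (Complex.I * ρ + S Real.pi) * f Real.pi := by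
      have : Complex.exp (-2 * G) * Complex.exp (1 * G) * Complex.exp G = 1 := by
        rw [← Complex.exp_add, ← Complex.exp_add, show -2 * G + 1 * G + G = 0 by ring,
          Complex.exp_zero]
      rw [hW]
      linear_combination (g Real.pi - (Complex.I * ρ + S Real.pi) * f Real.pi) * this
    have e2 : f Real.pi * (W / U) = W * Complex.exp G := by
      rw [hfG]; field_simp
    rw [mul_add, e2, e]; ring
  · set T := OscData.oscSize ν r + ‖ε‖ * δ with hT
    have hT0 : 0 ≤ T := by positivity
    set b := Complex.exp (-(2 * Complex.I * ν * Real.pi)) * fourInt ν r Real.pi with hb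
    have hbT : ‖b‖ ≤ T := by
      have e : ‖Complex.exp (-(2 * Complex.I * ν * Real.pi))‖ = 1 := by
        have := norm_cexp_two_I (-ν) Real.pi
        push_cast at this
        rw [← this]; congr 2; ring
      rw [hb, norm_mul, e, one_mul, hT, OscData.oscSize]
      have := l2norm_nonneg (fourInt ν r)
      have : 0 ≤ ‖ε‖ * δ := by positivity
      linarith
    have hWT : ‖W‖ ≤ K ^ 23 * T := by
      have h5 := norm_add_le (W - b) b
      rw [sub_add_cancel] at h5
      have h6 : K ^ 22 * ‖ε‖ * T ≤ K ^ 22 * 1 * T := by gcongr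
      have h7 : T ≤ K ^ 22 * 1 * T := by
        have : (1 : ℝ) ≤ K ^ 22 := one_le_pow₀ (by linarith)
        nlinarith
      have h8 : K ^ 22 * 1 * T * 2 ≤ K ^ 22 * 1 * T * K := by gcongr; linarith
      calc _ ≤ K ^ 22 * 1 * T * 2 := by linarith
        _ ≤ _ := h8
        _ = _ := by ring
    have h5 : ‖W / U - W‖ ≤ K ^ 31 * ‖ε‖ * T * 2 := by
      have e : W / U - W = -(W * (U - 1) / U) := by field_simp; ring
      rw [e, norm_neg, norm_div, norm_mul, div_le_iff₀ (by linarith)]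
      calc ‖W‖ * ‖U - 1‖ ≤ K ^ 23 * T * (K ^ 8 * ‖ε‖ * δ) := by gcongr
        _ ≤ K ^ 23 * T * (K ^ 8 * ‖ε‖ * 1) := by gcongr
        _ = K ^ 31 * ‖ε‖ * T * 2 * (1 / 2) := by ring
        _ ≤ _ := by gcongr
    have h6 := norm_add_le (W / U - W) (W - b)
    rw [sub_add_sub_cancel] at h6
    have h7 : K ^ 22 * ‖ε‖ * T ≤ K ^ 31 * ‖ε‖ * T := by
      gcongr
      · linarith
      · norm_num
    calc _ ≤ K ^ 31 * ‖ε‖ * T * 3 := by linarith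
      _ ≤ K ^ 31 * ‖ε‖ * T * K := by gcongr; linarith
      _ = _ := by ring

end ExpSol

end SturmLiouville

end

noncomputable section

namespace SturmLiouville

open Set intervalIntegral

/-! ### Differential polynomials of the WKB expansion -/

/-- The derivation of differential polynomials, `X i` standing for the `i`-th derivative. -/
def polyD : Derivation ℂ (MvPolynomial ℕ ℂ) (MvPolynomial ℕ ℂ) :=
  MvPolynomial.mkDerivation ℂ fun i => MvPolynomial.X (i + 1)

/-- The linear part of a coefficient of the WKB expansion. -/
def wkbLin (n : ℕ) : MvPolynomial ℕ ℂ := (-1) ^ n * MvPolynomial.X n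

/-- The nonlinear part of a coefficient of the WKB expansion. -/
def wkbRest : ℕ → MvPolynomial ℕ ℂ
  | 0 => 0
  | n + 1 => -polyD (wkbRest n) - ∑ i : Fin n,
      (wkbLin i + wkbRest i) * (wkbLin (n - 1 - i) + wkbRest (n - 1 - i))
decreasing_by all_goals omega

/-- The coefficients of the WKB expansion `S = ∑ εⁿ⁺¹ wkb n` of the solution of the Riccati
equation `S' + S / ε + S ^ 2 = X 0`. -/
def wkb (n : ℕ) : MvPolynomial ℕ ℂ := wkbLin n + wkbRest n

theorem wkbRest_zero : wkbRest 0 = 0 := by rw [wkbRest]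

/-- Comparison of powers of ε in S' + S/ε + S² = q, after splitting off the linear terms, which
satisfy the recursion without its quadratic part. -/
theorem wkbRest_succ (n : ℕ) : wkbRest (n + 1) =
    -polyD (wkbRest n) - ∑ i ∈ Finset.range n, wkb i * wkb (n - 1 - i) := by
  rw [wkbRest, Finset.sum_range]
  rfl

/-- Polynomials in the first `n` variables. -/
abbrev firstVars (n : ℕ) : Subalgebra ℂ (MvPolynomial ℕ ℂ) := MvPolynomial.supported ℂ {i | i < n}

theorem firstVars_mono {n k : ℕ} (h : n ≤ k) : firstVars n ≤ firstVars k :=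
  MvPolynomial.supported_mono fun _ hi => lt_of_lt_of_le hi h

theorem polyD_mem {n : ℕ} {P : MvPolynomial ℕ ℂ} (h : P ∈ firstVars n) :
    polyD P ∈ firstVars (n + 1) := by
  have hle := firstVars_mono (Nat.le_succ n)
  refine Algebra.adjoin_induction (p := fun P _ => polyD P ∈ firstVars (n + 1)) ?_ ?_ ?_ ?_ h
  · rintro _ ⟨i, hi, rfl⟩
    rw [polyD, MvPolynomial.mkDerivation_X]
    exact MvPolynomial.X_mem_supported.2 (Nat.succ_lt_succ hi)
  · intro r
    rw [Derivation.map_algebraMap]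
    exact zero_mem _
  · intro P Q _ _ hP hQ
    rw [map_add]
    exact add_mem hP hQ
  · intro P Q hP' hQ' hP hQ
    rw [Derivation.leibniz, smul_eq_mul, smul_eq_mul]
    exact add_mem (mul_mem (hle hP') hQ) (mul_mem (hle hQ') hP)

theorem wkbLin_mem (n : ℕ) : wkbLin n ∈ firstVars (n + 1) :=
  mul_mem (pow_mem (neg_mem (one_mem _)) _) (MvPolynomial.X_mem_supported.2 (Nat.lt_succ_self n))

/-- The nonlinear part needs two derivatives fewer than the linear one. So for q with M derivatives
`wkbRest M` can still be used in S, and `wkbRest (M + 1)` in the defect. -/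
theorem wkbRest_mem (n : ℕ) : wkbRest n ∈ firstVars (n - 1) := by
  induction n using Nat.strong_induction_on with
  | _ n ih =>
    rcases n with _ | n
    · rw [wkbRest_zero]; exact zero_mem _
    · rw [wkbRest_succ]
      refine sub_mem (neg_mem ?_) (sum_mem fun i hi => ?_)
      · rcases n with _ | n
        · rw [wkbRest_zero, map_zero]; exact zero_mem _
        · exact polyD_mem (ih (n + 1) (Nat.lt_succ_self _))
      · have hi' := Finset.mem_range.1 hi
        have : ∀ k < n, wkb k ∈ firstVars n := fun k hk =>
          add_mem (firstVars_mono hk (wkbLin_mem k))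
            (firstVars_mono (by omega) (ih k (by omega)))
        exact mul_mem (this i hi') (this _ (by omega))

/-- The polynomials without free term. -/
abbrev augIdeal : Ideal (MvPolynomial ℕ ℂ) := RingHom.ker (MvPolynomial.constantCoeff (R := ℂ) (σ := ℕ))

theorem X_mem_augIdeal (i : ℕ) : (MvPolynomial.X i : MvPolynomial ℕ ℂ) ∈ augIdeal := by
  rw [RingHom.mem_ker, MvPolynomial.constantCoeff_X]

theorem polyD_mem_augIdeal (P : MvPolynomial ℕ ℂ) : polyD P ∈ augIdeal := by
  induction P using MvPolynomial.induction_on with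
  | C a =>
    have : polyD (MvPolynomial.C a) = 0 := polyD.map_algebraMap a
    rw [this]; exact zero_mem _
  | add P Q hP hQ => rw [map_add]; exact add_mem hP hQ
  | mul_X P i hP =>
    rw [Derivation.leibniz, smul_eq_mul, smul_eq_mul]
    refine add_mem (Ideal.mul_mem_left _ _ ?_) (Ideal.mul_mem_right _ _ (X_mem_augIdeal i))
    rw [polyD, MvPolynomial.mkDerivation_X]
    exact X_mem_augIdeal _

theorem polyD_mem_augIdeal_mul {P : MvPolynomial ℕ ℂ} (h : P ∈ augIdeal * augIdeal) :
    polyD P ∈ augIdeal * augIdeal := by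
  refine Submodule.mul_induction_on h (fun P hP Q hQ => ?_) fun P Q hP hQ => ?_
  · rw [Derivation.leibniz, smul_eq_mul, smul_eq_mul]
    exact add_mem (Ideal.mul_mem_mul hP (polyD_mem_augIdeal Q))
      (Ideal.mul_mem_mul hQ (polyD_mem_augIdeal P))
  · rw [map_add]; exact add_mem hP hQ

/-- The recursion never produces terms of degree below 2, so these polynomials contribute nothing to
Fréchet derivatives at zero. -/
theorem wkbRest_mem_augIdeal_mul (n : ℕ) : wkbRest n ∈ augIdeal * augIdeal := by
  induction n using Nat.strong_induction_on with
  | _ n ih =>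
    rcases n with _ | n
    · rw [wkbRest_zero]; exact zero_mem _
    · rw [wkbRest_succ]
      refine sub_mem (neg_mem (polyD_mem_augIdeal_mul (ih n (Nat.lt_succ_self _))))
        (sum_mem fun i hi => ?_)
      have hi' := Finset.mem_range.1 hi
      have : ∀ k < n, wkb k ∈ augIdeal := fun k hk =>
        add_mem (Ideal.mul_mem_left _ _ (X_mem_augIdeal k)) (Ideal.mul_le_left (ih k (by omega)))
      exact Ideal.mul_mem_mul (this i hi') (this _ (by omega))

/-! ### The truncated expansion and its defect -/

open Polynomial in
/-- The WKB expansion truncated for potentials with `M` derivatives, a polynomial in `ε`. -/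
def wkbSum (M : ℕ) : Polynomial (MvPolynomial ℕ ℂ) :=
  -- The last term omits `wkbLin M`, that is, the derivative of order M of q, which is only in L₂
  -- and cannot be differentiated.
  ∑ n ∈ Finset.range M, C (wkb n) * X ^ (n + 1) + C (wkbRest M) * X ^ (M + 1)

open Polynomial in
theorem wkbSum_coeff (M d : ℕ) : (wkbSum M).coeff d =
    if d = 0 then 0 else if d ≤ M then wkb (d - 1) else if d = M + 1 then wkbRest M else 0 := by
  rw [wkbSum, coeff_add, finsetSum_coeff]
  simp only [coeff_C_mul, coeff_X_pow, mul_ite, mul_one, mul_zero]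
  rcases d with _ | d
  · simp
  · simp only [Nat.succ_ne_zero, if_false, Nat.add_right_cancel_iff, Finset.sum_ite_eq,
      Finset.mem_range, Nat.add_sub_cancel]
    by_cases h1 : d < M
    · rw [if_pos h1, if_neg (by omega), if_pos (by omega), add_zero]
    · rw [if_neg h1, if_neg (show ¬ d + 1 ≤ M by omega), zero_add]

open Polynomial in
/-- The square of the truncated expansion agrees with the sums of the recursion. -/
theorem wkbSum_sq (M : ℕ) : ∃ Z : Polynomial (MvPolynomial ℕ ℂ),
    wkbSum M ^ 2 = ∑ n ∈ Finset.range (M + 1),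
      C (∑ i ∈ Finset.range n, wkb i * wkb (n - 1 - i)) * X ^ (n + 1) + X ^ (M + 2) * Z := by
  have h : X ^ (M + 2) ∣ wkbSum M ^ 2 - ∑ n ∈ Finset.range (M + 1),
      C (∑ i ∈ Finset.range n, wkb i * wkb (n - 1 - i)) * X ^ (n + 1) := by
    -- Since the expansion has no constant term, coefficients of the square up to order M + 1 use
    -- only factors of order at most M, where the truncation is exact.
    rw [X_pow_dvd_iff]
    intro d hd
    rw [coeff_sub, sub_eq_zero, finsetSum_coeff, sq, coeff_mul]
    simp only [coeff_C_mul, coeff_X_pow, mul_ite, mul_one, mul_zero]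
    rcases d with _ | d
    · simp [wkbSum_coeff]
    · simp only [Nat.add_right_cancel_iff, Finset.sum_ite_eq, Finset.mem_range]
      rw [if_pos (by omega), Finset.Nat.sum_antidiagonal_eq_sum_range_succ_mk, Finset.sum_range_succ,
        Finset.sum_range_succ']
      simp only [wkbSum_coeff, Nat.sub_self, Nat.sub_zero, if_true, mul_zero, zero_mul, add_zero]
      refine Finset.sum_congr rfl fun i hi => ?_
      have hi' := Finset.mem_range.1 hi
      rw [if_neg (by omega), if_pos (by omega), if_neg (by omega), if_pos (by omega)]
      congr 2
      omega
  obtain ⟨Z, hZ⟩ := h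
  exact ⟨Z, by rw [← hZ]; ring⟩

/-! ### Evaluation on Sobolev functions -/

variable {m : ℕ}

/-- This default makes `evP` total; it also removes the boundary term from the phase coefficient of
index m. -/
theorem rep_of_le (σ : Sobolev m) {i : ℕ} (hi : m ≤ i) : rep σ i = 0 := by
  rw [rep, dif_neg (by omega)]

theorem continuousOn_rep' (σ : Sobolev m) (i : ℕ) : ContinuousOn (rep σ i) (Icc 0 Real.pi) := by
  by_cases hi : i < m
  · exact continuousOn_rep σ hi
  · rw [rep_of_le σ (by omega)]; exact continuousOn_const

/-- The `i`-th derivative as a continuous function. -/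
def repL (i : ℕ) : Sobolev m →L[ℂ] CI :=
  LinearMap.mkContinuous
    { toFun := fun σ => restr (rep σ i) (continuousOn_rep' σ i)
      map_add' := fun σ τ => by
        refine ext_injective fun x hx => ?_
        rw [ext_add, ext_restr _ hx, ext_restr _ hx, ext_restr _ hx]
        by_cases hi : i < m
        · exact rep_add σ τ hi hx
        · simp [rep_of_le _ (not_lt.1 hi)]
      map_smul' := fun c σ => by
        refine ext_injective fun x hx => ?_
        rw [RingHom.id_apply, ext_smul, ext_restr _ hx, ext_restr _ hx]
        by_cases hi : i < m
        · exact rep_smul c σ hi hx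
        · simp [rep_of_le _ (not_lt.1 hi)] }
    5 fun σ => by
      refine norm_le_of_ext (by positivity) fun x hx => ?_
      rw [LinearMap.coe_mk, AddHom.coe_mk, ext_restr _ hx]
      by_cases hi : i < m
      · exact norm_rep_le σ hi hx
      · rw [rep_of_le _ (not_lt.1 hi)]
        simp

theorem ext_repL (σ : Sobolev m) (i : ℕ) {x : ℝ} (hx : x ∈ Icc 0 Real.pi) :
    ext (repL i σ) x = rep σ i x := ext_restr (continuousOn_rep' σ i) hx

theorem norm_repL_succ_le (σ : Sobolev m) (i : ℕ) : ‖repL (i + 1) σ‖ ≤ 5 * potentialNorm σ := by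
  have h0 := potentialNorm_nonneg σ
  refine norm_le_of_ext (by positivity) fun x hx => ?_
  rw [ext_repL σ _ hx]
  by_cases hi : i + 1 < m
  · exact norm_rep_succ_le σ hi hx
  · rw [rep_of_le _ (not_lt.1 hi)]
    simpa using h0

/-- Evaluation of differential polynomials at the potential. -/
def evP (σ : Sobolev m) : MvPolynomial ℕ ℂ →ₐ[ℂ] CI :=
  MvPolynomial.aeval fun i => repL (i + 1) σ

theorem evP_X (σ : Sobolev m) (i : ℕ) : evP σ (MvPolynomial.X i) = repL (i + 1) σ :=
  MvPolynomial.aeval_X _ _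

theorem evP_C (σ : Sobolev m) (a : ℂ) : evP σ (MvPolynomial.C a) = algebraMap ℂ CI a :=
  (evP σ).commutes a

theorem ext_algebraMap (a : ℂ) (x : ℝ) : ext (algebraMap ℂ CI a) x = a := by
  rw [Algebra.algebraMap_eq_smul_one, ext_smul, ext_one, mul_one]

/-- The variables stand for derivatives of q, never for σ itself, so `potentialNorm` suffices. -/
theorem exists_norm_evP_le (P : MvPolynomial ℕ ℂ) (R : ℝ) :
    ∃ C : ℝ, ∀ σ : Sobolev m, potentialNorm σ ≤ R → ‖evP σ P‖ ≤ C := by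
  induction P using MvPolynomial.induction_on with
  | C a => exact ⟨‖algebraMap ℂ CI a‖, fun σ _ => by rw [evP_C]⟩
  | add P Q hP hQ =>
    obtain ⟨C, hC⟩ := hP
    obtain ⟨C', hC'⟩ := hQ
    exact ⟨C + C', fun σ hσ => by
      rw [map_add]; exact (norm_add_le _ _).trans (add_le_add (hC σ hσ) (hC' σ hσ))⟩
  | mul_X P i hP =>
    obtain ⟨C, hC⟩ := hP
    refine ⟨C * (5 * R), fun σ hσ => ?_⟩
    rw [map_mul, evP_X]
    refine (norm_mul_le _ _).trans (mul_le_mul (hC σ hσ) ((norm_repL_succ_le σ i).trans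
      (by linarith)) (norm_nonneg _) ((norm_nonneg _).trans (hC σ hσ)))

theorem differentiable_evP (P : MvPolynomial ℕ ℂ) :
    Differentiable ℂ fun σ : Sobolev m => evP σ P := by
  induction P using MvPolynomial.induction_on with
  | C a => simp only [evP_C]; exact differentiable_const _
  | add P Q hP hQ => simp only [map_add]; exact hP.add hQ
  | mul_X P i hP => simp only [map_mul, evP_X]; exact hP.mul (repL (i + 1)).differentiable

theorem evP_zero (P : MvPolynomial ℕ ℂ) :
    evP (0 : Sobolev m) P = algebraMap ℂ CI (MvPolynomial.constantCoeff P) := by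
  induction P using MvPolynomial.induction_on with
  | C a => rw [evP_C, MvPolynomial.constantCoeff_C]
  | add P Q hP hQ => rw [map_add, map_add, map_add, hP, hQ]
  | mul_X P i hP => rw [map_mul, map_mul, evP_X, map_zero, mul_zero, MvPolynomial.constantCoeff_X,
      mul_zero, map_zero]

theorem evP_zero_of_mem {P : MvPolynomial ℕ ℂ} (hP : P ∈ augIdeal) : evP (0 : Sobolev m) P = 0 := by
  rw [evP_zero, (RingHom.mem_ker).1 hP, map_zero]

theorem hasFDerivAt_evP {P : MvPolynomial ℕ ℂ} (hP : P ∈ augIdeal * augIdeal) :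
    HasFDerivAt (fun σ : Sobolev m => evP σ P) (0 : Sobolev m →L[ℂ] CI) 0 := by
  refine Submodule.mul_induction_on hP (fun P hP Q hQ => ?_) fun P Q hP hQ => ?_
  · have h := (differentiable_evP (m := m) P 0).hasFDerivAt.mul
      (differentiable_evP (m := m) Q 0).hasFDerivAt
    simp only [map_mul]
    refine h.congr_fderiv ?_
    rw [evP_zero_of_mem hP, evP_zero_of_mem hQ]
    ext σ
    simp
  · simp only [map_add]
    have := hP.add hQ
    rwa [add_zero] at this

/-- The condition on n keeps the derivative of every variable among those with a continuous
representative. -/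
theorem hasACDeriv_evP (σ : Sobolev m) {n : ℕ} (hn : ∀ i < n, i + 2 < m) {P : MvPolynomial ℕ ℂ}
    (hP : P ∈ firstVars n) : HasACDeriv (ext (evP σ P)) (ext (evP σ (polyD P))) := by
  refine Algebra.adjoin_induction
    (p := fun P _ => HasACDeriv (ext (evP σ P)) (ext (evP σ (polyD P)))) ?_ ?_ ?_ ?_ hP
  · rintro _ ⟨i, hi, rfl⟩
    rw [polyD, MvPolynomial.mkDerivation_X, evP_X, evP_X]
    exact ((hasACDeriv_rep σ (hn i hi)).congr_left fun x hx => (ext_repL σ _ hx).symm).congr_right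
      fun x hx => (ext_repL σ _ hx).symm
  · intro a
    rw [Derivation.map_algebraMap, map_zero]
    refine ((hasACDeriv_const a).congr_left fun x _ => ?_).congr_right fun x _ => ?_
    · exact ((congrArg (ext · x) (evP_C σ a)).trans (ext_algebraMap a x)).symm
    · simp
  · intro P Q _ _ hP hQ
    rw [map_add, map_add, map_add]
    exact hP.add hQ
  · intro P Q _ _ hP hQ
    rw [Derivation.leibniz, smul_eq_mul, smul_eq_mul, map_mul, map_add, map_mul, map_mul]
    refine (hP.mul hQ).congr_right fun x _ => ?_
    simp only [ext_add, ext_mul]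
    ring

end SturmLiouville

end

noncomputable section

namespace SturmLiouville

open Set intervalIntegral

/-! ### The approximate solution of the Riccati equation -/

/-- Uniformity over a family of homomorphisms lets one estimate serve all potentials of a ball. -/
theorem exists_norm_eval₂_le {B E ι : Type*} [CommRing B] [NormedCommRing E] [NormedAlgebra ℂ E]
    (φ : ι → B →+* E) (hφ : ∀ b, ∃ C : ℝ, ∀ i, ‖φ i b‖ ≤ C) (p : Polynomial B) :
    ∃ C : ℝ, ∀ i, ∀ z : ℂ, ‖z‖ ≤ 1 → ‖p.eval₂ (φ i) (algebraMap ℂ E z)‖ ≤ C := by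
  induction p using Polynomial.induction_on' with
  | add p q hp hq =>
    obtain ⟨C, hC⟩ := hp
    obtain ⟨C', hC'⟩ := hq
    exact ⟨C + C', fun i z hz => by
      rw [Polynomial.eval₂_add]
      exact (norm_add_le _ _).trans (add_le_add (hC i z hz) (hC' i z hz))⟩
  | monomial n b =>
    obtain ⟨C, hC⟩ := hφ b
    refine ⟨C * ‖(1 : E)‖, fun i z hz => ?_⟩
    have hC0 : 0 ≤ C := (norm_nonneg _).trans (hC i)
    rw [Polynomial.eval₂_monomial, ← map_pow, ← Algebra.commutes, Algebra.algebraMap_eq_smul_one,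
      smul_mul_assoc, one_mul, norm_smul, norm_pow]
    have h1 : ‖z‖ ^ n ≤ 1 := pow_le_one₀ (norm_nonneg _) hz
    by_cases h : ‖(1 : E)‖ = 0
    · have : ‖φ i b‖ = 0 := by
        have := norm_mul_le (1 : E) (φ i b)
        rw [one_mul, h, zero_mul] at this
        exact le_antisymm this (norm_nonneg _)
      rw [this, h]; simp
    · have h2 : 1 ≤ ‖(1 : E)‖ := by
        have h3 := norm_mul_le (1 : E) 1
        rw [one_mul] at h3
        have h4 : 0 < ‖(1 : E)‖ := lt_of_le_of_ne (norm_nonneg _) (Ne.symm h)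
        nlinarith
      calc ‖z‖ ^ n * ‖φ i b‖ ≤ 1 * C := by gcongr; exact hC i
        _ = C * 1 := by ring
        _ ≤ _ := by gcongr

theorem HasACDeriv.sum {ι : Type*} (s : Finset ι) {F f : ι → ℝ → ℂ}
    (h : ∀ i ∈ s, HasACDeriv (F i) (f i)) :
    HasACDeriv (fun x => ∑ i ∈ s, F i x) (fun x => ∑ i ∈ s, f i x) := by
  classical
  induction s using Finset.induction_on with
  | empty => simpa using hasACDeriv_const 0
  | insert a s ha ih =>
    simp only [Finset.sum_insert ha]
    exact (h a (Finset.mem_insert_self _ _)).add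
      (ih fun i hi => h i (Finset.mem_insert_of_mem hi))

/-- Telescoping of the defect of the Riccati equation. -/
theorem riccati_telescope (e : ℂ) (H G DG Q : ℕ → ℂ) (hG0 : G 0 = 0)
    (hG : ∀ n, G (n + 1) = -DG n - Q n) (k : ℕ) :
    H 0 - ∑ n ∈ Finset.range k, (e ^ (n + 1) * ((-1) ^ n * H (n + 1) + DG n) +
      e ^ n * ((-1) ^ n * H n + G n) + Q n * e ^ (n + 1)) =
      e ^ k * ((-1) ^ k * H k) + e ^ k * G k := by
  induction k with
  | zero => simp [hG0]
  | succ k ih =>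
    rw [Finset.sum_range_succ, ← sub_sub, ih, hG k]
    ring

variable {M : ℕ}

/-- The `n`-th derivative of the potential, for `n ≤ M`. -/
def derivPot (σ : Sobolev (M + 1)) (n : ℕ) : ℝ → ℂ := if n < M then rep σ (n + 1) else topDeriv σ

theorem derivPot_of_lt (σ : Sobolev (M + 1)) {n : ℕ} (hn : n < M) : derivPot σ n = rep σ (n + 1) :=
  if_pos hn

theorem derivPot_last (σ : Sobolev (M + 1)) : derivPot σ M = topDeriv σ := if_neg (lt_irrefl M)

theorem hasACDeriv_derivPot (σ : Sobolev (M + 1)) {n : ℕ} (hn : n ≤ M) :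
    HasACDeriv (rep σ n) (derivPot σ n) := by
  rcases hn.lt_or_eq with h | rfl
  · rw [derivPot_of_lt σ h]; exact hasACDeriv_rep σ (by omega)
  · rw [derivPot_last]; exact hasACDeriv_rep_last σ rfl

theorem memLp_derivPot (σ : Sobolev (M + 1)) {n : ℕ} : MemLp (derivPot σ n) 2 mu0 := by
  rw [derivPot]
  split_ifs with h
  · exact memLp_of_continuousOn (continuousOn_rep σ (by omega))
  · exact memLp_topDeriv σ

theorem l2norm_derivPot_le (σ : Sobolev (M + 1)) {n : ℕ} :
    l2norm (derivPot σ n) ≤ 10 * potentialNorm σ := by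
  have h0 := potentialNorm_nonneg σ
  rw [derivPot]
  split_ifs with h
  · refine (l2norm_le_of_bound (by positivity : 0 ≤ 5 * potentialNorm σ) fun x hx => ?_).trans
      (by linarith)
    exact norm_rep_succ_le σ (by omega) hx
  · exact (norm_topDeriv_le (Nat.succ_pos M) σ).trans (by linarith)

/-- The truncated WKB expansion. -/
def wkbS (σ : Sobolev (M + 1)) (ε : ℂ) : CI :=
  (wkbSum M).eval₂ (evP σ : MvPolynomial ℕ ℂ →+* CI) (algebraMap ℂ CI ε)

theorem ext_finset_sum {ι : Type*} (s : Finset ι) (F : ι → CI) (x : ℝ) :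
    ext (∑ i ∈ s, F i) x = ∑ i ∈ s, ext (F i) x := by
  classical
  induction s using Finset.induction_on with
  | empty => simp
  | insert a s ha ih => rw [Finset.sum_insert ha, Finset.sum_insert ha, ext_add, ih]

theorem ext_wkbS (σ : Sobolev (M + 1)) (ε : ℂ) (x : ℝ) : ext (wkbS σ ε) x =
    ∑ n ∈ Finset.range M, ε ^ (n + 1) * ext (evP σ (wkb n)) x +
      ε ^ (M + 1) * ext (evP σ (wkbRest M)) x := by
  simp only [wkbS, wkbSum, Polynomial.eval₂_add, Polynomial.eval₂_finsetSum, Polynomial.eval₂_mul,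
    Polynomial.eval₂_C, Polynomial.eval₂_pow, Polynomial.eval₂_X, ← map_pow, ext_add,
    ext_finset_sum, ext_mul, ext_algebraMap, RingHom.coe_coe]
  congr 1
  · exact Finset.sum_congr rfl fun n _ => mul_comm _ _
  · exact mul_comm _ _

/-- The derivative of the truncated WKB expansion. -/
def wkbS' (σ : Sobolev (M + 1)) (ε : ℂ) (x : ℝ) : ℂ :=
  ∑ n ∈ Finset.range M, ε ^ (n + 1) * ((-1) ^ n * derivPot σ (n + 1) x +
    ext (evP σ (polyD (wkbRest n))) x) + ε ^ (M + 1) * ext (evP σ (polyD (wkbRest M))) x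

theorem ext_evP_wkb (σ : Sobolev (M + 1)) {n : ℕ} (hn : n < M) {x : ℝ} (hx : x ∈ Icc 0 Real.pi) :
    ext (evP σ (wkb n)) x = (-1) ^ n * derivPot σ n x + ext (evP σ (wkbRest n)) x := by
  have h : evP σ ((-1) ^ n : MvPolynomial ℕ ℂ) = algebraMap ℂ CI ((-1) ^ n) := by
    rw [map_pow, map_neg, map_one, map_pow, map_neg, map_one]
  rw [wkb, wkbLin, map_add, map_mul, h, evP_X, ext_add, ext_mul, ext_algebraMap, ext_repL σ _ hx,
    derivPot_of_lt σ hn]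

theorem hasACDeriv_evP_wkbRest (σ : Sobolev (M + 1)) {n : ℕ} (hn : n ≤ M) :
    HasACDeriv (ext (evP σ (wkbRest n))) (ext (evP σ (polyD (wkbRest n)))) :=
  hasACDeriv_evP σ (fun i hi => by omega) (wkbRest_mem n)

theorem hasACDeriv_wkbS (σ : Sobolev (M + 1)) (ε : ℂ) :
    HasACDeriv (ext (wkbS σ ε)) (wkbS' σ ε) := by
  have h1 := HasACDeriv.sum (Finset.range M) (F := fun n x => ε ^ (n + 1) * ((-1) ^ n * rep σ (n + 1) x +
      ext (evP σ (wkbRest n)) x)) (f := fun n x => ε ^ (n + 1) * ((-1) ^ n * derivPot σ (n + 1) x +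
      ext (evP σ (polyD (wkbRest n))) x)) fun n hn => by
    have hn' := Finset.mem_range.1 hn
    exact (((hasACDeriv_derivPot σ hn').const_mul _).add
      (hasACDeriv_evP_wkbRest σ hn'.le)).const_mul _
  have h2 := h1.add ((hasACDeriv_evP_wkbRest σ le_rfl).const_mul (ε ^ (M + 1)))
  refine (h2.congr_left fun x hx => ?_).congr_right fun x _ => rfl
  rw [ext_wkbS, Pi.add_apply]
  congr 1
  refine Finset.sum_congr rfl fun n hn => ?_
  have hn' := Finset.mem_range.1 hn
  rw [ext_evP_wkb σ hn' hx, derivPot_of_lt σ hn']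

/-- The remainder in the square of the truncated expansion. -/
def wkbZ (M : ℕ) : Polynomial (MvPolynomial ℕ ℂ) := (wkbSum_sq M).choose

theorem ext_wkbS_sq (σ : Sobolev (M + 1)) (ε : ℂ) (x : ℝ) : ext (wkbS σ ε) x ^ 2 =
    ∑ n ∈ Finset.range (M + 1), (∑ i ∈ Finset.range n, ext (evP σ (wkb i)) x *
      ext (evP σ (wkb (n - 1 - i))) x) * ε ^ (n + 1) +
      ε ^ (M + 2) * ext ((wkbZ M).eval₂ (evP σ : MvPolynomial ℕ ℂ →+* CI) (algebraMap ℂ CI ε)) x := by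
  have h := congrArg (fun p => ext (p.eval₂ (evP σ : MvPolynomial ℕ ℂ →+* CI) (algebraMap ℂ CI ε)) x)
    (wkbSum_sq M).choose_spec
  rw [← wkbZ] at h
  simp only [Polynomial.eval₂_add, Polynomial.eval₂_finsetSum, Polynomial.eval₂_mul,
    Polynomial.eval₂_C, Polynomial.eval₂_pow, Polynomial.eval₂_X, ← map_pow, ext_add,
    ext_finset_sum, ext_mul, ext_algebraMap, RingHom.coe_coe, map_sum, map_mul] at h
  rw [← h, sq, ← ext_mul, ← sq, wkbS]

/-- The defect of the truncated expansion. -/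
def wkbDefect (σ : Sobolev (M + 1)) (ε : ℂ) (x : ℝ) : ℂ :=
  ε ^ M * ((-1) ^ M * topDeriv σ x) + ε ^ (M + 1) * ext (evP σ (wkbRest (M + 1))) x +
    ε ^ (M + 2) * -ext ((wkbZ M).eval₂ (evP σ : MvPolynomial ℕ ℂ →+* CI) (algebraMap ℂ CI ε)) x

/-- The recursion makes the sum telescope. What survives is the linear term of order M left out of
the truncation, the next nonlinear coefficient, and the tail of S². -/
theorem wkb_riccati (σ : Sobolev (M + 1)) {ε ρ : ℂ} (hε : 2 * Complex.I * ρ * ε = 1) {x : ℝ}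
    (hx : x ∈ Icc 0 Real.pi) :
    derivPot σ 0 x - wkbS' σ ε x - 2 * Complex.I * ρ * ext (wkbS σ ε) x - ext (wkbS σ ε) x ^ 2 =
      wkbDefect σ ε x := by
  have ht := riccati_telescope ε (fun n => derivPot σ n x) (fun n => ext (evP σ (wkbRest n)) x)
    (fun n => ext (evP σ (polyD (wkbRest n))) x)
    (fun n => ∑ i ∈ Finset.range n, ext (evP σ (wkb i)) x * ext (evP σ (wkb (n - 1 - i))) x)
    (by simp [wkbRest_zero]) (fun n => by
      rw [wkbRest_succ]
      simp only [map_sub, map_neg, map_sum, map_mul, ext_sub, ext_finset_sum, ext_mul]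
      congr 1) M
  have hM : ext (evP σ (wkbRest (M + 1))) x = -ext (evP σ (polyD (wkbRest M))) x -
      ∑ i ∈ Finset.range M, ext (evP σ (wkb i)) x * ext (evP σ (wkb (M - 1 - i))) x := by
    rw [wkbRest_succ]
    simp only [map_sub, map_neg, map_sum, map_mul, ext_sub, ext_finset_sum, ext_mul]
    congr 1
  have hS : 2 * Complex.I * ρ * ext (wkbS σ ε) x = ∑ n ∈ Finset.range M, ε ^ n *
      ((-1) ^ n * derivPot σ n x + ext (evP σ (wkbRest n)) x) +
      ε ^ M * ext (evP σ (wkbRest M)) x := by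
    rw [ext_wkbS, mul_add, Finset.mul_sum]
    congr 1
    · refine Finset.sum_congr rfl fun n hn => ?_
      rw [ext_evP_wkb σ (Finset.mem_range.1 hn) hx]
      linear_combination (ε ^ n * ((-1) ^ n * derivPot σ n x + ext (evP σ (wkbRest n)) x)) * hε
    · linear_combination (ε ^ M * ext (evP σ (wkbRest M)) x) * hε
  rw [hS, ext_wkbS_sq, Finset.sum_range_succ, wkbS', wkbDefect, hM, ← derivPot_last]
  simp only [Finset.sum_add_distrib] at ht
  linear_combination ht

end SturmLiouville

end

noncomputable section

namespace SturmLiouville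

open Set intervalIntegral

/-! ### Asymptotics of the exponential solutions -/

/-- Integration over `[0, π]`. -/
def intL : CI →L[ℂ] ℂ := evalPi.comp prim

theorem intL_apply (Y : CI) : intL Y = ∫ t in (0 : ℝ)..Real.pi, ext Y t := by
  rw [(hasACDeriv_prim Y).integral_eq pi_mem_Icc_pi, ext_prim_zero, sub_zero]
  rfl

theorem norm_intL_le (Y : CI) : ‖intL Y‖ ≤ 4 * ‖Y‖ := by
  have hc := (continuous_ext Y).continuousOn (s := Icc 0 Real.pi)
  rw [intL_apply]
  exact (norm_integral_le_of_mem hc.integrableOn_Icc pi_mem_Icc_pi).trans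
    (integral_norm_le_of_bound hc fun x _ => norm_ext_le Y x)

theorem memLp_ext (Y : CI) : MemLp (ext Y) 2 mu0 :=
  memLp_of_continuousOn (continuous_ext Y).continuousOn

theorem l2norm_ext_le (Y : CI) : l2norm (ext Y) ≤ 2 * ‖Y‖ :=
  l2norm_le_of_bound (norm_nonneg _) fun x _ => norm_ext_le Y x

theorem fourInt_congr (ν : ℝ) {f g : ℝ → ℂ} (h : EqOn f g (Icc 0 Real.pi)) {x : ℝ}
    (hx : x ∈ Icc 0 Real.pi) : fourInt ν f x = fourInt ν g x := by
  refine integral_congr fun t ht => ?_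
  rw [uIcc_of_le hx.1] at ht
  rw [h ⟨ht.1, ht.2.trans hx.2⟩]

theorem l2norm_congr_on {f g : ℝ → ℂ} (h : EqOn f g (Icc 0 Real.pi)) : l2norm f = l2norm g :=
  l2norm_congr ((ae_restrict_iff' measurableSet_Icc).2 (.of_forall h))

theorem oscSize_congr (ν : ℝ) {f g : ℝ → ℂ} (h : EqOn f g (Icc 0 Real.pi)) :
    OscData.oscSize ν f = OscData.oscSize ν g := by
  rw [OscData.oscSize, OscData.oscSize, fourInt_congr ν h pi_mem_Icc_pi,
    l2norm_congr_on fun x hx => fourInt_congr ν h hx]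

theorem oscSize_le (ν : ℝ) {f : ℝ → ℂ} (hf : MemLp f 2 mu0) :
    OscData.oscSize ν f ≤ 6 * l2norm f := by
  have h1 := norm_fourInt_le ν hf pi_mem_Icc_pi
  have h2 := l2norm_le_of_bound (by have := l2norm_nonneg f; positivity : 0 ≤ 2 * l2norm f)
    fun x hx => norm_fourInt_le ν hf hx
  rw [OscData.oscSize]
  linarith

/-! ### Oscillatory size of linear combinations -/

section Combination

variable {f g h : ℝ → ℂ} (hf : MemLp f 2 mu0) (hg : MemLp g 2 mu0) (hh : MemLp h 2 mu0) (a b c : ℂ)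
include hf hg hh

theorem memLp_combination : MemLp (fun x => a * f x + b * g x + c * h x) 2 mu0 :=
  ((hf.const_mul a).add (hg.const_mul b)).add (hh.const_mul c)

theorem l2norm_combination_le : l2norm (fun x => a * f x + b * g x + c * h x) ≤
    ‖a‖ * l2norm f + ‖b‖ * l2norm g + ‖c‖ * l2norm h := by
  have h1 := l2norm_add_le ((hf.const_mul a).add (hg.const_mul b)) (hh.const_mul c)
  have h2 := l2norm_add_le (hf.const_mul a) (hg.const_mul b)
  rw [l2norm_const_mul, l2norm_const_mul] at h2
  rw [l2norm_const_mul] at h1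
  exact h1.trans (add_le_add_left h2 _)

theorem integral_combination {x : ℝ} (hx : x ∈ Icc 0 Real.pi) :
    ∫ t in (0 : ℝ)..x, (a * f t + b * g t + c * h t) =
      a * (∫ t in (0 : ℝ)..x, f t) + b * (∫ t in (0 : ℝ)..x, g t) + c * ∫ t in (0 : ℝ)..x, h t := by
  have i1 := intervalIntegrable_of_integrableOn (integrableOn_of_memLp hf) hx
  have i2 := intervalIntegrable_of_integrableOn (integrableOn_of_memLp hg) hx
  have i3 := intervalIntegrable_of_integrableOn (integrableOn_of_memLp hh) hx
  rw [integral_add ((i1.const_mul a).add (i2.const_mul b)) (i3.const_mul c),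
    integral_add (i1.const_mul a) (i2.const_mul b), intervalIntegral.integral_const_mul,
    intervalIntegral.integral_const_mul, intervalIntegral.integral_const_mul]

theorem fourInt_combination (ν : ℝ) {x : ℝ} (hx : x ∈ Icc 0 Real.pi) :
    fourInt ν (fun x => a * f x + b * g x + c * h x) x =
      a * fourInt ν f x + b * fourInt ν g x + c * fourInt ν h x := by
  rw [fourInt, fourInt, fourInt, fourInt, ← integral_combination (memLp_cexp_mul ν hf)
    (memLp_cexp_mul ν hg) (memLp_cexp_mul ν hh) a b c hx]
  exact integral_congr fun t _ => by ring

theorem oscSize_combination_le (ν : ℝ) : OscData.oscSize ν (fun x => a * f x + b * g x + c * h x) ≤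
    ‖a‖ * OscData.oscSize ν f + ‖b‖ * OscData.oscSize ν g + ‖c‖ * OscData.oscSize ν h := by
  have hc : ∀ {f : ℝ → ℂ}, MemLp f 2 mu0 → MemLp (fourInt ν f) 2 mu0 := fun hf =>
    memLp_of_continuousOn (hasACDeriv_fourInt ν hf).continuousOn
  have h1 := l2norm_combination_le (hc hf) (hc hg) (hc hh) a b c
  have h2 := l2norm_congr_on fun x hx => fourInt_combination hf hg hh a b c ν hx
  rw [OscData.oscSize, OscData.oscSize, OscData.oscSize, OscData.oscSize, h2,
    fourInt_combination hf hg hh a b c ν pi_mem_Icc_pi]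
  have h3 : ‖a * fourInt ν f Real.pi + b * fourInt ν g Real.pi + c * fourInt ν h Real.pi‖ ≤
      ‖a‖ * ‖fourInt ν f Real.pi‖ + ‖b‖ * ‖fourInt ν g Real.pi‖ + ‖c‖ * ‖fourInt ν h Real.pi‖ := by
    rw [← norm_mul, ← norm_mul, ← norm_mul]
    exact norm_add₃_le
  linarith

end Combination

variable {M : ℕ}

/-- The leading part of the defect. -/
def leadPot (σ : Sobolev (M + 1)) (x : ℝ) : ℂ := (-1) ^ M * topDeriv σ x

theorem memLp_leadPot (σ : Sobolev (M + 1)) : MemLp (leadPot σ) 2 mu0 :=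
  (memLp_topDeriv σ).const_mul _

theorem l2norm_leadPot (σ : Sobolev (M + 1)) : l2norm (leadPot σ) = l2norm (topDeriv σ) := by
  have := l2norm_const_mul ((-1) ^ M) (topDeriv σ)
  rw [norm_pow, norm_neg, norm_one, one_pow, one_mul] at this
  exact this

/-- The size of the oscillatory terms in the asymptotics. -/
def wkbOsc (σ : Sobolev (M + 1)) (ν : ℝ) : ℝ :=
  OscData.oscSize ν (leadPot σ) + OscData.oscSize ν (ext (evP σ (wkbRest (M + 1))))

theorem wkbOsc_nonneg (σ : Sobolev (M + 1)) (ν : ℝ) : 0 ≤ wkbOsc σ ν :=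
  add_nonneg (OscData.oscSize_nonneg _ _) (OscData.oscSize_nonneg _ _)

/-- The coefficients of the phase at `π`. -/
def phaseCoeff {m : ℕ} (j : ℕ) (σ : Sobolev m) : ℂ :=
  (-1) ^ j * (rep σ j Real.pi - rep σ j 0) + intL (evP σ (wkbRest j))

theorem wkbS_eq (σ : Sobolev (M + 1)) (ε : ℂ) : wkbS σ ε =
    ∑ n ∈ Finset.range M, ε ^ (n + 1) • evP σ (wkb n) + ε ^ (M + 1) • evP σ (wkbRest M) := by
  refine ext_injective fun x _ => ?_
  rw [ext_wkbS, ext_add, ext_finset_sum]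
  simp only [ext_smul]

/-- The remainder of the defect. -/
def wkbZev (σ : Sobolev (M + 1)) (ε : ℂ) : CI :=
  -(wkbZ M).eval₂ (evP σ : MvPolynomial ℕ ℂ →+* CI) (algebraMap ℂ CI ε)

theorem wkbDefect_eq (σ : Sobolev (M + 1)) (ε : ℂ) (x : ℝ) : wkbDefect σ ε x =
    ε ^ M * leadPot σ x + ε ^ (M + 1) * ext (evP σ (wkbRest (M + 1))) x +
      ε ^ (M + 2) * ext (wkbZev σ ε) x := rfl

/-- The integral of the derivative of order j of q is the jump of σ^(j). For j < M it comes from S;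
for j = M it comes from ε times the leading part of the defect, which supplies what the truncation
omitted; for j = M + 1 it is zero by the convention for `rep`. -/
theorem integral_phase (σ : Sobolev (M + 1)) (ε : ℂ) :
    (∫ t in (0 : ℝ)..Real.pi, ext (wkbS σ ε) t) + ε * ∫ t in (0 : ℝ)..Real.pi, wkbDefect σ ε t =
      ∑ j ∈ Finset.range (M + 2), phaseCoeff j σ * ε ^ (j + 1) + ε ^ (M + 3) * intL (wkbZev σ ε) := by
  have hpot : ∀ n ≤ M, ∫ t in (0 : ℝ)..Real.pi, derivPot σ n t = rep σ n Real.pi - rep σ n 0 :=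
    fun n hn => (hasACDeriv_derivPot σ hn).integral_eq pi_mem_Icc_pi
  have hlead : ∫ t in (0 : ℝ)..Real.pi, leadPot σ t =
      (-1) ^ M * (rep σ M Real.pi - rep σ M 0) := by
    rw [← hpot M le_rfl, derivPot_last, ← intervalIntegral.integral_const_mul]
    rfl
  have hn : ∀ n < M, intL (evP σ (wkb n)) = phaseCoeff n σ := by
    intro n hn
    rw [phaseCoeff, ← hpot n hn.le, intL_apply, intL_apply, ← intervalIntegral.integral_const_mul,
      ← integral_add ((intervalIntegrable_of_integrableOn (integrableOn_of_memLp (memLp_derivPot σ))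
        pi_mem_Icc_pi).const_mul _) ((continuous_ext _).intervalIntegrable _ _)]
    refine integral_congr fun x hx => ?_
    rw [uIcc_of_le Real.pi_pos.le] at hx
    exact ext_evP_wkb σ hn hx
  simp only [wkbDefect_eq]
  rw [integral_combination (memLp_leadPot σ) (memLp_ext _) (memLp_ext _) _ _ _ pi_mem_Icc_pi,
    ← intL_apply, ← intL_apply, ← intL_apply, hlead, wkbS_eq, map_add, map_sum, map_smul,
    Finset.sum_range_succ, Finset.sum_range_succ, phaseCoeff, phaseCoeff, rep_of_le σ le_rfl]
  have : ∑ n ∈ Finset.range M, intL (ε ^ (n + 1) • evP σ (wkb n)) =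
      ∑ n ∈ Finset.range M, phaseCoeff n σ * ε ^ (n + 1) := by
    refine Finset.sum_congr rfl fun n hn' => ?_
    rw [map_smul, hn n (Finset.mem_range.1 hn'), smul_eq_mul, mul_comm]
  rw [this]
  simp only [Pi.zero_apply, smul_eq_mul]
  ring

theorem exists_norm_wkbS_le (M : ℕ) (R : ℝ) : ∃ C : ℝ, 0 ≤ C ∧ ∀ σ : Sobolev (M + 1),
    potentialNorm σ ≤ R → ∀ ε : ℂ, ‖ε‖ ≤ 1 → ‖wkbS σ ε‖ ≤ C * ‖ε‖ ∧ ‖wkbZev σ ε‖ ≤ C ∧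
      ‖evP σ (wkbRest (M + 1))‖ ≤ C := by
  have hφ : ∀ b : MvPolynomial ℕ ℂ, ∃ C : ℝ, ∀ i : {σ : Sobolev (M + 1) // potentialNorm σ ≤ R},
      ‖(evP i.1 : MvPolynomial ℕ ℂ →+* CI) b‖ ≤ C := fun b => by
    obtain ⟨C, hC⟩ := exists_norm_evP_le (m := M + 1) b R
    exact ⟨C, fun i => hC i.1 i.2⟩
  -- S has no constant term in ε, which yields the factor ‖ε‖ in its bound.
  obtain ⟨W, hW⟩ : Polynomial.X ∣ wkbSum M := Polynomial.X_dvd_iff.2 (by rw [wkbSum_coeff, if_pos rfl])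
  obtain ⟨C₁, h₁⟩ := exists_norm_eval₂_le _ hφ W
  obtain ⟨C₂, h₂⟩ := exists_norm_eval₂_le _ hφ (wkbZ M)
  obtain ⟨C₃, h₃⟩ := hφ (wkbRest (M + 1))
  refine ⟨|C₁| + |C₂| + |C₃|, by positivity, fun σ hσ ε hε => ⟨?_, ?_, ?_⟩⟩
  · rw [wkbS, hW, Polynomial.eval₂_mul, Polynomial.eval₂_X, Algebra.algebraMap_eq_smul_one,
      smul_mul_assoc, one_mul, norm_smul, mul_comm, ← Algebra.algebraMap_eq_smul_one]
    gcongr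
    have := h₁ ⟨σ, hσ⟩ ε hε
    have := le_abs_self C₁
    have := abs_nonneg C₂
    have := abs_nonneg C₃
    linarith
  · rw [wkbZev, norm_neg]
    have := h₂ ⟨σ, hσ⟩ ε hε
    have := le_abs_self C₂
    have := abs_nonneg C₁
    have := abs_nonneg C₃
    linarith
  · have h : ‖evP σ (wkbRest (M + 1))‖ ≤ C₃ := h₃ ⟨σ, hσ⟩
    have := le_abs_self C₃
    have := abs_nonneg C₁
    have := abs_nonneg C₂
    linarith

theorem norm_cexp_neg_two_I (ν t : ℝ) : ‖Complex.exp (-(2 * Complex.I * ν * t))‖ = 1 := by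
  have := norm_cexp_two_I (-ν) t
  push_cast at this
  rw [← this]; congr 2; ring

set_option maxHeartbeats 1000000 in
/-- The values at `π` of the solution that is close to `e^{iρx}`. -/
theorem wkb_exponential (M : ℕ) {R B : ℝ} (hB : 0 ≤ B) : ∃ C : ℝ, 1 ≤ C ∧
    ∀ σ : Sobolev (M + 1), potentialNorm σ ≤ R → ∀ (ρ ε : ℂ) (ν : ℝ) (f g : ℝ → ℂ),
      2 * Complex.I * ρ * ε = 1 → C * ‖ε‖ ≤ 1 → ‖ρ - ν‖ ≤ B * ‖ε‖ → HasACDeriv f g →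
      HasACDeriv g (fun x => (derivPot σ 0 x - ρ ^ 2) * f x) → f 0 = 1 →
      g 0 = Complex.I * ρ + ext (wkbS σ ε) 0 →
      ∃ θ w : ℂ, f Real.pi = Complex.exp (Complex.I * ρ * Real.pi + θ) ∧
        g Real.pi = f Real.pi * (Complex.I * ρ + ext (wkbS σ ε) Real.pi + w) ∧
        ‖θ - (∑ j ∈ Finset.range (M + 2), phaseCoeff j σ * ε ^ (j + 1) -
          ε ^ (M + 1) * (Complex.exp (-(2 * Complex.I * ν * Real.pi)) *
            fourInt ν (leadPot σ) Real.pi))‖ ≤ C * ‖ε‖ ^ (M + 2) * (wkbOsc σ ν + ‖ε‖) ∧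
        ‖w - ε ^ M * (Complex.exp (-(2 * Complex.I * ν * Real.pi)) *
            fourInt ν (leadPot σ) Real.pi)‖ ≤ C * ‖ε‖ ^ (M + 1) * (wkbOsc σ ν + ‖ε‖) := by
  obtain ⟨c, hc0, hc⟩ := exists_norm_wkbS_le M R
  set L : ℝ := 10 * |R| + 5 * c + B with hL
  have hL0 : 0 ≤ L := by positivity
  set K := expConst L with hK
  have hK4 := expConst_ge L
  have hK1 : 1 ≤ K := by linarith
  have hKp : ∀ n ≤ 35, K ^ n ≤ K ^ 35 := fun n hn => pow_le_pow_right₀ hK1 hn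
  have hK35 : 1 ≤ K ^ 35 := one_le_pow₀ hK1
  refine ⟨K ^ 35 * (2 + 12 * c) + 1 + 16 * c, by nlinarith [mul_nonneg (by linarith : 0 ≤ K ^ 35) hc0], ?_⟩
  set C := K ^ 35 * (2 + 12 * c) + 1 + 16 * c with hC
  intro σ hσ ρ ε ν f g hε hCε hρν hf hg hf0 hg0
  have hC35 : K ^ 35 ≤ C := by nlinarith [mul_nonneg (by linarith : 0 ≤ K ^ 35) hc0]
  have hε0 := norm_nonneg ε
  have hεK : K ^ 9 * ‖ε‖ ≤ 1 := by
    refine le_trans ?_ hCε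
    gcongr
    exact (hKp 9 (by norm_num)).trans hC35
  have hε1 : ‖ε‖ ≤ 1 := by
    have : 1 ≤ C := hK35.trans hC35
    nlinarith
  obtain ⟨b1, b2, b3⟩ := hc σ hσ ε hε1
  have hδ1 : ‖ε‖ ^ M ≤ 1 := pow_le_one₀ hε0 hε1
  have hEq : EqOn (fun x => derivPot σ 0 x - wkbS' σ ε x - 2 * Complex.I * ρ * ext (wkbS σ ε) x -
      ext (wkbS σ ε) x ^ 2) (wkbDefect σ ε) (Icc 0 Real.pi) := fun x hx => wkb_riccati σ hε hx
  have hml := memLp_leadPot σ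
  have hmg := memLp_ext (evP σ (wkbRest (M + 1)))
  have hmz := memLp_ext (wkbZev σ ε)
  have hdm : MemLp (wkbDefect σ ε) 2 mu0 := memLp_combination hml hmg hmz _ _ _
  have hp1 : ‖ε‖ ^ (M + 1) ≤ ‖ε‖ ^ M := pow_le_pow_of_le_one hε0 hε1 (by omega)
  have hp2 : ‖ε‖ ^ (M + 2) ≤ ‖ε‖ ^ M := pow_le_pow_of_le_one hε0 hε1 (by omega)
  have hdl : l2norm (wkbDefect σ ε) ≤ L * ‖ε‖ ^ M := by
    have h1 : l2norm (wkbDefect σ ε) ≤ _ :=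
      l2norm_combination_le hml hmg hmz (ε ^ M) (ε ^ (M + 1)) (ε ^ (M + 2))
    rw [norm_pow, norm_pow, norm_pow, l2norm_leadPot] at h1
    have h2 := (norm_topDeriv_le (Nat.succ_pos M) σ).trans (hσ.trans (le_abs_self R))
    have h3 := l2norm_ext_le (evP σ (wkbRest (M + 1)))
    have h4 := l2norm_ext_le (wkbZev σ ε)
    calc _ ≤ _ := h1
      _ ≤ ‖ε‖ ^ M * |R| + ‖ε‖ ^ M * (2 * c) + ‖ε‖ ^ M * (2 * c) := by
        gcongr
        · exact l2norm_nonneg _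
        · linarith
        · exact l2norm_nonneg _
        · linarith
      _ = ‖ε‖ ^ M * (|R| + 4 * c) := by ring
      _ ≤ ‖ε‖ ^ M * L := by gcongr; rw [hL]; nlinarith [abs_nonneg R]
      _ = _ := by ring
  obtain ⟨l, w, e1, e2, e3, e4⟩ := exponential_solution (q := derivPot σ 0) (δ := ‖ε‖ ^ M)
    (ν := ν) hε hL0 (by positivity) hδ1 hεK (hasACDeriv_wkbS σ ε)
    (fun x _ => (norm_ext_le _ x).trans (b1.trans (by
      gcongr; rw [hL]; nlinarith [abs_nonneg R])))
    (hdm.ae_eq ((ae_restrict_iff' measurableSet_Icc).2 (.of_forall fun x hx => (hEq hx).symm)))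
    (by rw [l2norm_congr_on hEq]; exact hdl)
    (hρν.trans (by gcongr; rw [hL]; nlinarith [abs_nonneg R])) hf hg hf0 hg0
  have hintegral : ∫ t in (0 : ℝ)..Real.pi, (derivPot σ 0 t - wkbS' σ ε t -
      2 * Complex.I * ρ * ext (wkbS σ ε) t - ext (wkbS σ ε) t ^ 2) =
      ∫ t in (0 : ℝ)..Real.pi, wkbDefect σ ε t := integral_congr fun t ht => by
    rw [uIcc_of_le Real.pi_pos.le] at ht
    exact hEq ht
  rw [oscSize_congr ν hEq, fourInt_congr ν hEq pi_mem_Icc_pi] at e3 e4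
  rw [hintegral] at e3
  -- Oscillation is used only for the parts of order M and M + 1; the last part is small enough to
  -- be estimated by its norm.
  have hosc : OscData.oscSize ν (wkbDefect σ ε) ≤ ‖ε‖ ^ M * (wkbOsc σ ν + 12 * c * ‖ε‖) := by
    have h1 : OscData.oscSize ν (wkbDefect σ ε) ≤ _ :=
      oscSize_combination_le hml hmg hmz (ε ^ M) (ε ^ (M + 1)) (ε ^ (M + 2)) ν
    rw [norm_pow, norm_pow, norm_pow] at h1
    have h2 : OscData.oscSize ν (ext (wkbZev σ ε)) ≤ 12 * c := by
      linarith [oscSize_le ν hmz, l2norm_ext_le (wkbZev σ ε)]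
    have h3 := OscData.oscSize_nonneg ν (ext (evP σ (wkbRest (M + 1))))
    have h4 : ‖ε‖ ^ (M + 2) ≤ ‖ε‖ ^ M * ‖ε‖ := by
      rw [← pow_succ]; exact pow_le_pow_of_le_one hε0 hε1 (by omega)
    calc _ ≤ _ := h1
      _ ≤ ‖ε‖ ^ M * OscData.oscSize ν (leadPot σ) +
          ‖ε‖ ^ M * OscData.oscSize ν (ext (evP σ (wkbRest (M + 1)))) +
          ‖ε‖ ^ M * ‖ε‖ * (12 * c) := by
        gcongr
        exact OscData.oscSize_nonneg _ _
      _ = _ := by rw [wkbOsc]; ring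
  have hκ := wkbOsc_nonneg σ ν
  have hT : OscData.oscSize ν (wkbDefect σ ε) + ‖ε‖ * ‖ε‖ ^ M ≤
      ‖ε‖ ^ M * ((1 + 12 * c) * (wkbOsc σ ν + ‖ε‖)) := by
    calc _ ≤ ‖ε‖ ^ M * (wkbOsc σ ν + 12 * c * ‖ε‖) + ‖ε‖ * ‖ε‖ ^ M := by gcongr
      _ = ‖ε‖ ^ M * (wkbOsc σ ν + 12 * c * ‖ε‖ + ‖ε‖) := by ring
      _ ≤ _ := by
        gcongr
        nlinarith [mul_nonneg hc0 hκ]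
  have hfour : fourInt ν (wkbDefect σ ε) Real.pi = ε ^ M * fourInt ν (leadPot σ) Real.pi +
      ε ^ (M + 1) * fourInt ν (ext (evP σ (wkbRest (M + 1)))) Real.pi +
      ε ^ (M + 2) * fourInt ν (ext (wkbZev σ ε)) Real.pi :=
    fourInt_combination hml hmg hmz _ _ _ ν pi_mem_Icc_pi
  have hfg : ‖fourInt ν (ext (evP σ (wkbRest (M + 1)))) Real.pi‖ ≤ wkbOsc σ ν := by
    rw [wkbOsc, OscData.oscSize, OscData.oscSize]
    have := norm_nonneg (fourInt ν (leadPot σ) Real.pi)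
    have := l2norm_nonneg (fourInt ν (leadPot σ))
    have := l2norm_nonneg (fourInt ν (ext (evP σ (wkbRest (M + 1)))))
    linarith
  have hfz : ‖fourInt ν (ext (wkbZev σ ε)) Real.pi‖ ≤ 4 * c := by
    linarith [norm_fourInt_le ν hmz pi_mem_Icc_pi, l2norm_ext_le (wkbZev σ ε)]
  have hiz : ‖intL (wkbZev σ ε)‖ ≤ 4 * c := by linarith [norm_intL_le (wkbZev σ ε)]
  have hE := norm_cexp_neg_two_I ν Real.pi
  have hrem : ‖Complex.exp (-(2 * Complex.I * ν * Real.pi)) *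
      (fourInt ν (ext (evP σ (wkbRest (M + 1)))) Real.pi +
      ε * fourInt ν (ext (wkbZev σ ε)) Real.pi)‖ ≤ (1 + 4 * c) * (wkbOsc σ ν + ‖ε‖) := by
    rw [norm_mul, hE, one_mul]
    refine (norm_add_le _ _).trans ?_
    rw [norm_mul]
    calc _ ≤ wkbOsc σ ν + ‖ε‖ * (4 * c) := by gcongr
      _ ≤ _ := by nlinarith [mul_nonneg hc0 hκ]
  have hX : 0 ≤ wkbOsc σ ν + ‖ε‖ := by positivity
  have hph := integral_phase σ ε
  have hKε : 0 ≤ K ^ 35 * ‖ε‖ ^ 2 := by positivity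
  have hKε' : 0 ≤ K ^ 32 * ‖ε‖ := by positivity
  -- The phase is ∫S + log u(π); by `integral_phase` the main terms of the two add up to the phase
  -- coefficients.
  refine ⟨(∫ t in (0 : ℝ)..Real.pi, ext (wkbS σ ε) t) + l, w, by rw [e1, add_assoc], e2, ?_, ?_⟩
  · rw [hfour] at e3
    set E := Complex.exp (-(2 * Complex.I * ν * Real.pi))
    set Φ := fourInt ν (leadPot σ) Real.pi
    set G := fourInt ν (ext (evP σ (wkbRest (M + 1)))) Real.pi
    set Zf := fourInt ν (ext (wkbZev σ ε)) Real.pi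
    set I₁ := ∫ t in (0 : ℝ)..Real.pi, ext (wkbS σ ε) t
    set I₂ := ∫ t in (0 : ℝ)..Real.pi, wkbDefect σ ε t
    set P := ∑ j ∈ Finset.range (M + 2), phaseCoeff j σ * ε ^ (j + 1)
    have e : I₁ + l - (P - ε ^ (M + 1) * (E * Φ)) =
        (l - ε * (I₂ - E * (ε ^ M * Φ + ε ^ (M + 1) * G + ε ^ (M + 2) * Zf))) +
        ε ^ (M + 3) * intL (wkbZev σ ε) - ε ^ (M + 2) * (E * (G + ε * Zf)) := by
      linear_combination hph
    rw [e]
    have h1 : ‖ε ^ (M + 3) * intL (wkbZev σ ε)‖ ≤ ‖ε‖ ^ (M + 2) * (4 * c * (wkbOsc σ ν + ‖ε‖)) := by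
      rw [norm_mul, norm_pow]
      calc ‖ε‖ ^ (M + 3) * ‖intL (wkbZev σ ε)‖ ≤ ‖ε‖ ^ (M + 3) * (4 * c) := by gcongr
        _ = ‖ε‖ ^ (M + 2) * (4 * c * (0 + ‖ε‖)) := by ring
        _ ≤ _ := by gcongr
    have h2 : ‖ε ^ (M + 2) * (E * (G + ε * Zf))‖ ≤
        ‖ε‖ ^ (M + 2) * ((1 + 4 * c) * (wkbOsc σ ν + ‖ε‖)) := by
      rw [norm_mul, norm_pow]; gcongr
    calc _ ≤ K ^ 35 * ‖ε‖ ^ 2 * (‖ε‖ ^ M * ((1 + 12 * c) * (wkbOsc σ ν + ‖ε‖))) +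
          ‖ε‖ ^ (M + 2) * (4 * c * (wkbOsc σ ν + ‖ε‖)) +
          ‖ε‖ ^ (M + 2) * ((1 + 4 * c) * (wkbOsc σ ν + ‖ε‖)) :=
          (norm_sub_le _ _).trans (add_le_add ((norm_add_le _ _).trans
            (add_le_add (e3.trans (mul_le_mul_of_nonneg_left hT hKε)) h1)) h2)
      _ = ‖ε‖ ^ (M + 2) * (wkbOsc σ ν + ‖ε‖) * (K ^ 35 * (1 + 12 * c) + 1 + 8 * c) := by ring
      _ ≤ ‖ε‖ ^ (M + 2) * (wkbOsc σ ν + ‖ε‖) * C := by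
        gcongr
        rw [hC]; nlinarith
      _ = _ := by ring
  · rw [hfour] at e4
    set E := Complex.exp (-(2 * Complex.I * ν * Real.pi))
    set Φ := fourInt ν (leadPot σ) Real.pi
    set G := fourInt ν (ext (evP σ (wkbRest (M + 1)))) Real.pi
    set Zf := fourInt ν (ext (wkbZev σ ε)) Real.pi
    have e : w - ε ^ M * (E * Φ) =
        (w - E * (ε ^ M * Φ + ε ^ (M + 1) * G + ε ^ (M + 2) * Zf)) +
        ε ^ (M + 1) * (E * (G + ε * Zf)) := by ring
    rw [e]
    have h2 : ‖ε ^ (M + 1) * (E * (G + ε * Zf))‖ ≤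
        ‖ε‖ ^ (M + 1) * ((1 + 4 * c) * (wkbOsc σ ν + ‖ε‖)) := by
      rw [norm_mul, norm_pow]; gcongr
    calc _ ≤ K ^ 32 * ‖ε‖ * (‖ε‖ ^ M * ((1 + 12 * c) * (wkbOsc σ ν + ‖ε‖))) +
          ‖ε‖ ^ (M + 1) * ((1 + 4 * c) * (wkbOsc σ ν + ‖ε‖)) :=
          (norm_add_le _ _).trans (add_le_add (e4.trans (mul_le_mul_of_nonneg_left hT hKε')) h2)
      _ = ‖ε‖ ^ (M + 1) * (wkbOsc σ ν + ‖ε‖) * (K ^ 32 * (1 + 12 * c) + 1 + 4 * c) := by ring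
      _ ≤ ‖ε‖ ^ (M + 1) * (wkbOsc σ ν + ‖ε‖) * C := by
        gcongr
        have h3 := hKp 32 (by norm_num)
        rw [hC]; nlinarith [mul_le_mul_of_nonneg_right h3 (by linarith : 0 ≤ 1 + 12 * c)]
      _ = _ := by ring

end SturmLiouville

end

noncomputable section

namespace SturmLiouville

open Set intervalIntegral

/-! ### An algebra of functionals -/

variable {m : ℕ}

/-- The differentiable functionals bounded in terms of the size `N`. -/
def niceSubalg (N : Sobolev m → ℝ) : Subalgebra ℂ (Sobolev m → ℂ) where
  carrier := {f | Differentiable ℂ f ∧ ∀ R : ℝ, ∃ C : ℝ, ∀ σ, N σ ≤ R → ‖f σ‖ ≤ C}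
  mul_mem' := by
    rintro f g ⟨hf, hf'⟩ ⟨hg, hg'⟩
    refine ⟨hf.mul hg, fun R => ?_⟩
    obtain ⟨C, hC⟩ := hf' R
    obtain ⟨C', hC'⟩ := hg' R
    refine ⟨C * C', fun σ hσ => ?_⟩
    rw [Pi.mul_apply, norm_mul]
    exact mul_le_mul (hC σ hσ) (hC' σ hσ) (norm_nonneg _) ((norm_nonneg _).trans (hC σ hσ))
  add_mem' := by
    rintro f g ⟨hf, hf'⟩ ⟨hg, hg'⟩
    refine ⟨hf.add hg, fun R => ?_⟩
    obtain ⟨C, hC⟩ := hf' R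
    obtain ⟨C', hC'⟩ := hg' R
    exact ⟨C + C', fun σ hσ => (norm_add_le _ _).trans (add_le_add (hC σ hσ) (hC' σ hσ))⟩
  algebraMap_mem' := fun a => ⟨differentiable_const a, fun _ => ⟨‖a‖, fun _ _ => le_rfl⟩⟩

/-- The algebra of the differentiable functionals bounded in terms of `N`. -/
def niceAlg (N : Sobolev m → ℝ) : Type := niceSubalg N

instance (N : Sobolev m → ℝ) : CommRing (niceAlg N) := inferInstanceAs (CommRing (niceSubalg N))

instance (N : Sobolev m → ℝ) : Algebra ℂ (niceAlg N) := inferInstanceAs (Algebra ℂ (niceSubalg N))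

variable {N : Sobolev m → ℝ}

/-- A functional as an element of the algebra. -/
def toNice {f : Sobolev m → ℂ} (hf : f ∈ niceSubalg N) : niceAlg N := ⟨f, hf⟩

/-- Evaluation of functionals. -/
def evA (σ : Sobolev m) : niceAlg N →ₐ[ℂ] ℂ := (Pi.evalAlgHom ℂ _ σ).comp (niceSubalg N).val

/-- The functionals that vanish at zero. -/
abbrev vanIdeal (N : Sobolev m → ℝ) : Ideal (niceAlg N) :=
  RingHom.ker (evA (N := N) 0 : niceAlg N →+* ℂ)

/-- The functionals that vanish at zero together with the derivative. -/
def flatIdeal (N : Sobolev m → ℝ) : Ideal (niceAlg N) where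
  carrier := {f | f.1 0 = 0 ∧ HasFDerivAt f.1 (0 : Sobolev m →L[ℂ] ℂ) 0}
  zero_mem' := ⟨rfl, hasFDerivAt_const (0 : ℂ) _⟩
  add_mem' := by
    rintro f g ⟨hf, hf'⟩ ⟨hg, hg'⟩
    refine ⟨?_, ?_⟩
    · change f.1 0 + g.1 0 = 0
      rw [hf, hg, add_zero]
    · have := hf'.add hg'
      rwa [add_zero] at this
  smul_mem' := by
    rintro f g ⟨hg, hg'⟩
    refine ⟨?_, ?_⟩
    · change f.1 0 * g.1 0 = 0
      rw [hg, mul_zero]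
    · have := (f.2.1 0).hasFDerivAt.mul hg'
      refine this.congr_fderiv ?_
      rw [hg]
      ext σ
      simp

/-- The product rule at a common zero. It turns computing Fréchet derivatives into algebra modulo an
ideal. -/
theorem vanIdeal_mul_le : vanIdeal N * vanIdeal N ≤ flatIdeal N := by
  rw [Ideal.mul_le]
  intro f hf g hg
  have hf0 : f.1 0 = 0 := hf
  have hg0 : g.1 0 = 0 := hg
  refine ⟨?_, ?_⟩
  · change f.1 0 * g.1 0 = 0
    rw [hf0, zero_mul]
  · refine ((f.2.1 0).hasFDerivAt.mul (g.2.1 0).hasFDerivAt).congr_fderiv ?_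
    rw [hf0, hg0]
    ext σ
    simp

theorem exists_evA_le (N : Sobolev m → ℝ) (R : ℝ) (b : niceAlg N) : ∃ C : ℝ,
    ∀ i : {σ : Sobolev m // N σ ≤ R}, ‖(evA (N := N) i.1 : niceAlg N →+* ℂ) b‖ ≤ C := by
  obtain ⟨C, hC⟩ := b.2.2 R
  exact ⟨C, fun i => hC i.1 i.2⟩

/-- Evaluation of polynomials over the algebra of functionals. -/
def evAX (p : Polynomial (niceAlg N)) (σ : Sobolev m) (z : ℂ) : ℂ :=
  p.eval₂ (evA (N := N) σ : niceAlg N →+* ℂ) z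

theorem exists_evAX_le (p : Polynomial (niceAlg N)) (R : ℝ) : ∃ C : ℝ, 0 ≤ C ∧
    ∀ σ, N σ ≤ R → ∀ z : ℂ, ‖z‖ ≤ 1 → ‖evAX p σ z‖ ≤ C := by
  obtain ⟨C, hC⟩ := exists_norm_eval₂_le _ (exists_evA_le N R) p
  exact ⟨|C|, abs_nonneg C, fun σ hσ z hz => (hC ⟨σ, hσ⟩ z hz).trans (le_abs_self C)⟩

open Polynomial in
theorem exists_eq_sum_add_X_pow_mul {B : Type*} [CommRing B] (p : Polynomial B) (n : ℕ) :
    ∃ q : Polynomial B, p = ∑ j ∈ Finset.range n, C (p.coeff j) * X ^ j + X ^ n * q := by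
  have h : X ^ n ∣ p - ∑ j ∈ Finset.range n, C (p.coeff j) * X ^ j := by
    rw [X_pow_dvd_iff]
    intro d hd
    rw [coeff_sub, finsetSum_coeff, sub_eq_zero]
    simp [coeff_X_pow, hd]
  obtain ⟨q, hq⟩ := h
  exact ⟨q, by rw [← hq]; ring⟩

theorem exists_evAX_sub_le (p : Polynomial (niceAlg N)) (n : ℕ) (R : ℝ) : ∃ C : ℝ, 0 ≤ C ∧
    ∀ σ, N σ ≤ R → ∀ z : ℂ, ‖z‖ ≤ 1 →
      ‖evAX p σ z - ∑ j ∈ Finset.range n, (p.coeff j).1 σ * z ^ j‖ ≤ C * ‖z‖ ^ n := by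
  obtain ⟨q, hq⟩ := exists_eq_sum_add_X_pow_mul p n
  obtain ⟨C, hC0, hC⟩ := exists_evAX_le q R
  refine ⟨C, hC0, fun σ hσ z hz => ?_⟩
  have e : evAX p σ z = ∑ j ∈ Finset.range n, (p.coeff j).1 σ * z ^ j + z ^ n * evAX q σ z := by
    conv_lhs => rw [evAX, hq]
    simp only [Polynomial.eval₂_add, Polynomial.eval₂_finsetSum, Polynomial.eval₂_mul,
      Polynomial.eval₂_C, Polynomial.eval₂_pow, Polynomial.eval₂_X]
    rfl
  rw [e, add_sub_cancel_left, norm_mul, norm_pow, mul_comm]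
  gcongr
  exact hC σ hσ z hz

/-! ### The functionals of the phase -/

/-- Evaluation at a point of the interval. -/
def evalAt (x : ℝ) : CI →ₐ[ℂ] ℂ where
  toFun Y := ext Y x
  map_one' := rfl
  map_mul' _ _ := rfl
  map_zero' := rfl
  map_add' _ _ := rfl
  commutes' a := ext_algebraMap a x

theorem evalAt_apply (x : ℝ) (Y : CI) : evalAt x Y = ext Y x := rfl

/-- Evaluation at a point as a continuous functional. -/
def evalAtL (x : ℝ) : CI →L[ℂ] ℂ :=
  LinearMap.mkContinuous (evalAt x).toLinearMap 1 fun Y => (norm_ext_le Y x).trans (one_mul _).ge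

/-- A derivative of the potential evaluated at a point. -/
def repAt (j : ℕ) (x : ℝ) : Sobolev m →L[ℂ] ℂ := (evalAtL x).comp (repL j)

theorem repAt_apply (j : ℕ) {x : ℝ} (hx : x ∈ Icc 0 Real.pi) (σ : Sobolev m) :
    repAt j x σ = rep σ j x := ext_repL σ j hx

/-- A jump is the integral of the next derivative, so even for j = 0 it is controlled by q. Hence
the Dirichlet estimates need no bound on σ(π). -/
theorem norm_rep_sub_le (σ : Sobolev m) (j : ℕ) :
    ‖rep σ j Real.pi - rep σ j 0‖ ≤ 2 * potentialNorm σ := by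
  by_cases hj : j < m
  · have h := (rep_spec σ hj).1
    have hm : MemLp (σ.1 (Fin.succ ⟨j, hj⟩)) 2 mu0 := Lp.memLp _
    rw [← h.integral_eq pi_mem_Icc_pi]
    refine (norm_integral_le_of_mem h.1 pi_mem_Icc_pi).trans
      ((integral_norm_le_l2norm hm).trans ?_)
    rw [l2norm_coe]
    linarith [norm_le_potentialNorm σ ⟨j, hj⟩]
  · rw [rep_of_le σ (not_lt.1 hj)]
    simpa using potentialNorm_nonneg σ

/-- A continuous functional of the values of a differential polynomial. -/
theorem comp_evP_mem (hN : ∀ σ, potentialNorm σ ≤ N σ) (l : CI →L[ℂ] ℂ) (P : MvPolynomial ℕ ℂ) :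
    (fun σ => l (evP σ P)) ∈ niceSubalg N := by
  refine ⟨l.differentiable.comp (differentiable_evP P), fun R => ?_⟩
  obtain ⟨C, hC⟩ := exists_norm_evP_le (m := m) P R
  exact ⟨‖l‖ * C, fun σ hσ => (l.le_opNorm _).trans
    (mul_le_mul_of_nonneg_left (hC σ ((hN σ).trans hσ)) (norm_nonneg _))⟩

theorem comp_evP_mem_flatIdeal (hN : ∀ σ, potentialNorm σ ≤ N σ) (l : CI →L[ℂ] ℂ)
    {P : MvPolynomial ℕ ℂ} (hP : P ∈ augIdeal * augIdeal) :
    toNice (comp_evP_mem hN l P) ∈ flatIdeal N := by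
  refine ⟨?_, ?_⟩
  · change l (evP 0 P) = 0
    rw [evP_zero_of_mem (Ideal.mul_le_left hP), map_zero]
  · have h := l.hasFDerivAt.comp (0 : Sobolev m) (hasFDerivAt_evP hP)
    rw [ContinuousLinearMap.comp_zero] at h
    exact h

/-- The linear functionals `(-1)ʲ (σ⁽ʲ⁾(π) - σ⁽ʲ⁾(0))`. -/
def jumpLin (j : ℕ) : Sobolev m →L[ℂ] ℂ := (-1 : ℂ) ^ j • (repAt j Real.pi - repAt j 0)

theorem jumpLin_apply (j : ℕ) (σ : Sobolev m) :
    jumpLin j σ = (-1) ^ j * (rep σ j Real.pi - rep σ j 0) := by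
  rw [jumpLin, smul_apply, sub_apply,
    repAt_apply j pi_mem_Icc_pi, repAt_apply j zero_mem_Icc_pi, smul_eq_mul]

theorem jumpLin_mem (hN : ∀ σ, potentialNorm σ ≤ N σ) (j : ℕ) :
    (jumpLin j : Sobolev m → ℂ) ∈ niceSubalg N := by
  refine ⟨(jumpLin j).differentiable, fun R => ⟨2 * R, fun σ hσ => ?_⟩⟩
  rw [jumpLin_apply, norm_mul, norm_pow, norm_neg, norm_one, one_pow, one_mul]
  linarith [norm_rep_sub_le σ j, hN σ]

/-- The phase coefficients as elements of the algebra. -/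
def phaseEl (hN : ∀ σ, potentialNorm σ ≤ N σ) (j : ℕ) : niceAlg N :=
  toNice (jumpLin_mem hN j) + toNice (comp_evP_mem hN intL (wkbRest j))

theorem phaseEl_apply (hN : ∀ σ, potentialNorm σ ≤ N σ) (j : ℕ) (σ : Sobolev m) :
    (phaseEl hN j).1 σ = phaseCoeff j σ := by
  rw [phaseCoeff, ← jumpLin_apply]
  rfl

open Polynomial in
/-- The phase of the Dirichlet problem as a polynomial in `ε`. -/
def phaseD (hN : ∀ σ, potentialNorm σ ≤ N σ) : Polynomial (niceAlg N) :=
  ∑ j ∈ Finset.range (m + 1), C (phaseEl hN j) * X ^ (j + 1)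

theorem evAX_phaseD (hN : ∀ σ, potentialNorm σ ≤ N σ) (σ : Sobolev m) (ε : ℂ) :
    evAX (phaseD hN) σ ε = ∑ j ∈ Finset.range (m + 1), phaseCoeff j σ * ε ^ (j + 1) := by
  simp only [evAX, phaseD, Polynomial.eval₂_finsetSum, Polynomial.eval₂_mul,
      Polynomial.eval₂_C, Polynomial.eval₂_pow, Polynomial.eval₂_X]
  exact Finset.sum_congr rfl fun j _ => congrArg (· * ε ^ (j + 1)) (phaseEl_apply hN j σ)

open Polynomial in
theorem coeff_phaseD (hN : ∀ σ, potentialNorm σ ≤ N σ) {j : ℕ} (hj : j ≤ m) :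
    (phaseD hN).coeff (j + 1) = phaseEl hN j := by
  rw [phaseD, finsetSum_coeff]
  simp [coeff_X_pow, Nat.lt_succ_of_le hj]

end SturmLiouville

end

noncomputable section

namespace SturmLiouville

open Set intervalIntegral

/-! ### The phase relations -/

variable {M : ℕ}

theorem sol_sub_sol {q : ℝ → ℂ} (hq : MemLp q 2 mu0) (z a b b' : ℂ) :
    sol hq z a b 0 - sol hq z a b' 0 = (b - b') • sol hq z 0 1 0 := by
  rw [sol_linear hq z a b, sol_linear hq z a b', sub_smul]
  abel

theorem solD_sub_solD {q : ℝ → ℂ} (hq : MemLp q 2 mu0) (z a b b' : ℂ) :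
    solD hq z a b 0 - solD hq z a b' 0 = (b - b') • solD hq z 0 1 0 := by
  have h := sol_sub_sol hq z a b b'
  have h' : voltSub hq z (sol hq z a b 0) - voltSub hq z (sol hq z a b' 0) =
      (b - b') • voltSub hq z (sol hq z 0 1 0) := by rw [← map_sub, h, map_smul]
  rw [solD, solD, solD, map_zero, sub_zero, sub_zero, sub_zero, one_smul, smul_add, ← h', sub_smul]
  abel

/-- The two exponential solutions and the solution that vanishes at zero. -/
theorem two_exponentials (M : ℕ) {R B : ℝ} (hB : 0 ≤ B) : ∃ C : ℝ, 1 ≤ C ∧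
    ∀ σ : Sobolev (M + 1), potentialNorm σ ≤ R → ∀ (ρ ε : ℂ) (ν : ℝ),
      2 * Complex.I * ρ * ε = 1 → C * ‖ε‖ ≤ 1 → ‖ρ - ν‖ ≤ B * ‖ε‖ →
      ∃ c θ w θ' w' : ℂ,
        c * ext (sol (memLp_derivPot σ (n := 0)) (ρ ^ 2) 0 1 0) Real.pi =
          Complex.exp (Complex.I * ρ * Real.pi + θ) - Complex.exp (-(Complex.I * ρ * Real.pi) + θ') ∧
        c * ext (solD (memLp_derivPot σ (n := 0)) (ρ ^ 2) 0 1 0) Real.pi =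
          Complex.exp (Complex.I * ρ * Real.pi + θ) *
            (Complex.I * ρ + ext (wkbS σ ε) Real.pi + w) -
          Complex.exp (-(Complex.I * ρ * Real.pi) + θ') *
            (-(Complex.I * ρ) + ext (wkbS σ (-ε)) Real.pi + w') ∧
        ‖θ - (∑ j ∈ Finset.range (M + 2), phaseCoeff j σ * ε ^ (j + 1) -
          ε ^ (M + 1) * (Complex.exp (-(2 * Complex.I * ν * Real.pi)) *
            fourInt ν (leadPot σ) Real.pi))‖ ≤ C * ‖ε‖ ^ (M + 2) * (wkbOsc σ ν + ‖ε‖) ∧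
        ‖w - ε ^ M * (Complex.exp (-(2 * Complex.I * ν * Real.pi)) *
            fourInt ν (leadPot σ) Real.pi)‖ ≤ C * ‖ε‖ ^ (M + 1) * (wkbOsc σ ν + ‖ε‖) ∧
        ‖θ' - (∑ j ∈ Finset.range (M + 2), phaseCoeff j σ * (-ε) ^ (j + 1) -
          (-ε) ^ (M + 1) * (Complex.exp (-(2 * Complex.I * (-ν : ℝ) * Real.pi)) *
            fourInt (-ν) (leadPot σ) Real.pi))‖ ≤ C * ‖ε‖ ^ (M + 2) * (wkbOsc σ (-ν) + ‖ε‖) ∧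
        ‖w' - (-ε) ^ M * (Complex.exp (-(2 * Complex.I * (-ν : ℝ) * Real.pi)) *
            fourInt (-ν) (leadPot σ) Real.pi)‖ ≤ C * ‖ε‖ ^ (M + 1) * (wkbOsc σ (-ν) + ‖ε‖) := by
  obtain ⟨C, hC1, hC⟩ := wkb_exponential M (R := R) hB
  refine ⟨C, hC1, fun σ hσ ρ ε ν hε hCε hρν => ?_⟩
  have hq := memLp_derivPot σ (n := 0)
  have hsol : ∀ b, HasACDeriv (ext (solD hq (ρ ^ 2) 1 b 0))
      (fun x => (derivPot σ 0 x - ρ ^ 2) * ext (sol hq (ρ ^ 2) 1 b 0) x) := fun b =>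
    (hasACDeriv_solD hq (ρ ^ 2) 1 b 0).congr_right fun x _ => by simp
  obtain ⟨θ, w, a1, a2, a3, a4⟩ := hC σ hσ ρ ε ν _ _ hε hCε hρν
    (hasACDeriv_sol hq (ρ ^ 2) 1 (Complex.I * ρ + ext (wkbS σ ε) 0) 0) (hsol _)
    (ext_sol_zero ..) (ext_solD_zero ..)
  -- The equation contains only ρ², so the same result applies to -ρ, with ε and ν changing sign
  -- too.
  obtain ⟨θ', w', b1, b2, b3, b4⟩ := hC σ hσ (-ρ) (-ε) (-ν) _ _ (by rw [← hε]; ring)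
    (by rwa [norm_neg]) (by
      rw [norm_neg, show -ρ - ((-ν : ℝ) : ℂ) = -(ρ - ν) by push_cast; ring, norm_neg]; exact hρν)
    (hasACDeriv_sol hq (ρ ^ 2) 1 (Complex.I * -ρ + ext (wkbS σ (-ε)) 0) 0)
    ((hsol _).congr_right fun x _ => by rw [neg_sq])
    (ext_sol_zero ..) (ext_solD_zero ..)
  rw [norm_neg] at b3 b4
  rw [show Complex.I * -ρ * Real.pi = -(Complex.I * ρ * Real.pi) by ring] at b1
  rw [show Complex.I * -ρ + ext (wkbS σ (-ε)) Real.pi + w' =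
    -(Complex.I * ρ) + ext (wkbS σ (-ε)) Real.pi + w' by ring] at b2
  -- Both solutions have value 1 at zero, so their difference is the difference of slopes times the
  -- solution with data 0, 1.
  refine ⟨(Complex.I * ρ + ext (wkbS σ ε) 0) - (Complex.I * -ρ + ext (wkbS σ (-ε)) 0),
    θ, w, θ', w', ?_, ?_, a3, a4, b3, b4⟩
  · rw [← ext_smul, ← sol_sub_sol hq (ρ ^ 2) 1, ext_sub, a1, b1]
  · rw [← ext_smul, ← solD_sub_solD hq (ρ ^ 2) 1, ext_sub, a2, b2, a1, b1]

/-- The asymptotic relation for the square roots of the zeros of a characteristic function. -/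
def PhaseRel {N : Sobolev (M + 1) → ℝ} (Θ : Polynomial (niceAlg N)) (Δ : Sobolev (M + 1) → ℂ → ℂ)
    (θ₀ : ℝ) : Prop :=
  ∀ R B : ℝ, 0 ≤ B → ∃ C : ℝ, 1 ≤ C ∧ ∀ σ, N σ ≤ R → ∀ (k : ℕ+) (ρ ε : ℂ) (ν : ℝ), ν = k - θ₀ →
    2 * Complex.I * ρ * ε = 1 → C * ‖ε‖ ≤ 1 → ‖ρ - ν‖ ≤ B * ‖ε‖ → Δ σ (ρ ^ 2) = 0 →
    ∃ θ θ' : ℂ, Complex.exp (2 * Complex.I * ρ * Real.pi + θ - θ') =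
        Complex.exp (2 * Complex.I * ν * Real.pi) ∧
      ‖θ - (evAX Θ σ ε - ε ^ (M + 1) * fourInt ν (leadPot σ) Real.pi)‖ ≤
        C * ‖ε‖ ^ (M + 2) * (wkbOsc σ ν + ‖ε‖) ∧
      ‖θ' - (evAX Θ σ (-ε) - (-ε) ^ (M + 1) * fourInt (-ν) (leadPot σ) Real.pi)‖ ≤
        C * ‖ε‖ ^ (M + 2) * (wkbOsc σ (-ν) + ‖ε‖)

theorem exp_two_pi_nat (k : ℕ+) : Complex.exp (2 * Complex.I * ((k : ℝ) : ℂ) * Real.pi) = 1 := by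
  have := Complex.exp_nat_mul_two_pi_mul_I k
  rw [← this]; congr 1; push_cast; ring

theorem exp_two_pi_half (k : ℕ+) :
    Complex.exp (2 * Complex.I * ((k - 1 / 2 : ℝ) : ℂ) * Real.pi) = -1 := by
  rw [show (2 * Complex.I * ((k - 1 / 2 : ℝ) : ℂ) * Real.pi : ℂ) =
    2 * Complex.I * ((k : ℝ) : ℂ) * Real.pi - Real.pi * Complex.I by push_cast; ring,
    Complex.exp_sub, exp_two_pi_nat, Complex.exp_pi_mul_I]
  norm_num

/-- If y(π) = 0, the two exponential solutions coincide at π. For integer ν the factors e^{±2iνπ} in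
the oscillatory terms are 1. -/
theorem phaseRel_dirichlet :
    PhaseRel (M := M) (phaseD (N := potentialNorm) fun _ => le_rfl)
      (fun σ => charFun (memLp_derivPot σ (n := 0)) 1 0) 0 := by
  intro R B hB
  obtain ⟨C, hC1, hC⟩ := two_exponentials M (R := R) hB
  refine ⟨C, hC1, fun σ hσ k ρ ε ν hν hε hCε hρν h0 => ?_⟩
  obtain ⟨c, θ, w, θ', w', h1, -, h3, -, h5, -⟩ := hC σ hσ ρ ε ν hε hCε hρν
  simp only [charFun, evalPi_apply, one_mul, zero_mul, add_zero] at h0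
  rw [h0, mul_zero] at h1
  have hE : Complex.exp (2 * Complex.I * ν * Real.pi) = 1 := by
    rw [hν, sub_zero]; exact exp_two_pi_nat k
  have hE' : Complex.exp (-(2 * Complex.I * ν * Real.pi)) = 1 := by
    rw [Complex.exp_neg, hE, inv_one]
  have hE'' : Complex.exp (-(2 * Complex.I * (-ν : ℝ) * Real.pi)) = 1 := by
    rw [show -(2 * Complex.I * ((-ν : ℝ) : ℂ) * Real.pi) = 2 * Complex.I * ν * Real.pi by
      push_cast; ring, hE]
  rw [hE', one_mul] at h3
  rw [hE'', one_mul] at h5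
  refine ⟨θ, θ', ?_, ?_, ?_⟩
  · rw [hE, show 2 * Complex.I * ρ * Real.pi + θ - θ' =
      (Complex.I * ρ * Real.pi + θ) - (-(Complex.I * ρ * Real.pi) + θ') by ring, Complex.exp_sub,
      ← sub_eq_zero.1 h1.symm, div_self (Complex.exp_ne_zero _)]
  · rw [evAX_phaseD]; exact h3
  · rw [evAX_phaseD]; exact h5

/-! ### The logarithmic term of the Dirichlet–Neumann problem -/

/-- The size of the data of the Dirichlet–Neumann problem. -/
def sizeDN {m : ℕ} (σ : Sobolev m) : ℝ := max (potentialNorm σ) ‖rep σ 0 Real.pi‖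

theorem le_sizeDN {m : ℕ} (σ : Sobolev m) : potentialNorm σ ≤ sizeDN σ := le_max_left _ _

/-- Values at `π` of differential polynomials. -/
def piHom (m : ℕ) : MvPolynomial ℕ ℂ →+* niceAlg (sizeDN (m := m)) where
  toFun P := toNice (comp_evP_mem le_sizeDN (evalAtL Real.pi) P)
  map_one' := Subtype.ext (funext fun σ => by
    change ext (evP σ 1) Real.pi = 1
    rw [map_one, ext_one])
  map_mul' P Q := Subtype.ext (funext fun σ => by
    change ext (evP σ (P * Q)) Real.pi = ext (evP σ P) Real.pi * ext (evP σ Q) Real.pi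
    rw [map_mul, ext_mul])
  map_zero' := Subtype.ext (funext fun σ => by
    change ext (evP σ 0) Real.pi = 0
    rw [map_zero, ext_zero])
  map_add' P Q := Subtype.ext (funext fun σ => by
    change ext (evP σ (P + Q)) Real.pi = ext (evP σ P) Real.pi + ext (evP σ Q) Real.pi
    rw [map_add, ext_add])

theorem piHom_apply {m : ℕ} (P : MvPolynomial ℕ ℂ) (σ : Sobolev m) :
    (piHom m P).1 σ = ext (evP σ P) Real.pi := rfl

/-- The value `σ(π)` as an element of the algebra. -/
def sigmaPi (m : ℕ) : niceAlg (sizeDN (m := m)) :=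
  toNice (f := repAt 0 Real.pi) ⟨(repAt 0 Real.pi).differentiable, fun R => ⟨R, fun σ hσ => by
    rw [repAt_apply 0 pi_mem_Icc_pi]; exact (le_max_right _ _).trans hσ⟩⟩

theorem sigmaPi_apply {m : ℕ} (σ : Sobolev m) : (sigmaPi m).1 σ = rep σ 0 Real.pi :=
  repAt_apply 0 pi_mem_Icc_pi σ

open Polynomial in
/-- The argument of the logarithm. -/
def bdryPoly (M : ℕ) : Polynomial (niceAlg (sizeDN (m := M + 1))) :=
  X * (C 2 * ((wkbSum M).map (piHom (M + 1)) - C (sigmaPi (M + 1))))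

theorem evAX_bdryPoly (σ : Sobolev (M + 1)) (ε : ℂ) : evAX (bdryPoly M) σ ε =
    ε * (2 * (ext (wkbS σ ε) Real.pi - rep σ 0 Real.pi)) := by
  have h : (wkbSum M).eval₂ ((evA (N := sizeDN (m := M + 1)) σ : niceAlg (sizeDN (m := M + 1)) →+* ℂ).comp (piHom (M + 1))) ε =
      ext (wkbS σ ε) Real.pi := by
    rw [← evalAt_apply, wkbS]
    have h1 := Polynomial.hom_eval₂ (wkbSum M) (evP σ : MvPolynomial ℕ ℂ →+* CI)
      (evalAt Real.pi : CI →+* ℂ) (algebraMap ℂ CI ε)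
    have h2 : (evalAt Real.pi : CI →+* ℂ) (algebraMap ℂ CI ε) = ε := ext_algebraMap ε Real.pi
    rw [h2] at h1
    exact h1.symm
  simp only [evAX, bdryPoly, Polynomial.eval₂_mul, Polynomial.eval₂_X, Polynomial.eval₂_C,
    Polynomial.eval₂_sub, Polynomial.eval₂_map, h]
  have e1 : (evA (N := sizeDN (m := M + 1)) σ : niceAlg (sizeDN (m := M + 1)) →+* ℂ) 2 = 2 := map_ofNat _ 2
  have e2 : (evA (N := sizeDN (m := M + 1)) σ : niceAlg (sizeDN (m := M + 1)) →+* ℂ) (sigmaPi (M + 1)) = rep σ 0 Real.pi :=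
    sigmaPi_apply σ
  rw [e1, e2]

open Polynomial in
/-- The phase of the Dirichlet–Neumann problem. -/
def phaseDN (M : ℕ) : Polynomial (niceAlg (sizeDN (m := M + 1))) :=
  -- The Taylor polynomial of log(1 + z); the term i = 0 vanishes because division by zero gives
  -- zero. The argument is O(ε), so the omitted terms are O(ε^(M + 3)).
  phaseD le_sizeDN + ∑ i ∈ Finset.range (M + 3),
    C (algebraMap ℂ _ ((-1) ^ (i + 1) / i)) * bdryPoly M ^ i

theorem evAX_phaseDN (σ : Sobolev (M + 1)) (ε : ℂ) : evAX (phaseDN M) σ ε =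
    ∑ j ∈ Finset.range (M + 2), phaseCoeff j σ * ε ^ (j + 1) +
      Complex.logTaylor (M + 3) (evAX (bdryPoly M) σ ε) := by
  rw [← evAX_phaseD le_sizeDN]
  simp only [evAX, phaseDN, Polynomial.eval₂_add, Polynomial.eval₂_finsetSum, Polynomial.eval₂_mul,
    Polynomial.eval₂_C, Polynomial.eval₂_pow, Complex.logTaylor]
  congr 1
  refine Finset.sum_congr rfl fun i _ => ?_
  rw [RingHom.coe_coe, AlgHom.commutes]
  simp only [Algebra.algebraMap_self, RingHom.id_apply]
  ring

theorem exists_wkbOsc_le (M : ℕ) (R : ℝ) : ∃ C : ℝ, 0 ≤ C ∧ ∀ σ : Sobolev (M + 1),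
    potentialNorm σ ≤ R → ∀ ν, wkbOsc σ ν ≤ C := by
  obtain ⟨c, hc0, hc⟩ := exists_norm_wkbS_le M R
  refine ⟨6 * |R| + 12 * c, by positivity, fun σ hσ ν => ?_⟩
  have h1 := oscSize_le ν (memLp_leadPot σ)
  have h2 := oscSize_le ν (memLp_ext (evP σ (wkbRest (M + 1))))
  have h3 := l2norm_ext_le (evP σ (wkbRest (M + 1)))
  have h4 := (hc σ hσ 0 (by simp)).2.2
  have h5 := (norm_topDeriv_le (Nat.succ_pos M) σ).trans (hσ.trans (le_abs_self R))
  rw [l2norm_leadPot] at h1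
  rw [wkbOsc]
  linarith

theorem norm_fourInt_leadPot_le (σ : Sobolev (M + 1)) (ν : ℝ) :
    ‖fourInt ν (leadPot σ) Real.pi‖ ≤ wkbOsc σ ν := by
  rw [wkbOsc, OscData.oscSize]
  have := OscData.oscSize_nonneg ν (ext (evP σ (wkbRest (M + 1))))
  have := l2norm_nonneg (fourInt ν (leadPot σ))
  linarith

theorem norm_log_one_add_sub_self_le_sq {z : ℂ} (hz : ‖z‖ ≤ 1 / 2) :
    ‖Complex.log (1 + z) - z‖ ≤ ‖z‖ ^ 2 := by
  have h1 := Complex.norm_log_one_add_sub_self_le (hz.trans_lt (by norm_num))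
  have h2 : (1 - ‖z‖)⁻¹ ≤ 2 := by
    rw [inv_le_comm₀ (by linarith) (by norm_num)]; linarith
  have h3 : ‖z‖ ^ 2 * (1 - ‖z‖)⁻¹ ≤ ‖z‖ ^ 2 * 2 := by gcongr
  linarith

theorem norm_log_one_add_sub_logTaylor_le {z : ℂ} (hz : ‖z‖ ≤ 1 / 2) (n : ℕ) :
    ‖Complex.log (1 + z) - Complex.logTaylor (n + 1) z‖ ≤ 2 * ‖z‖ ^ (n + 1) := by
  have h1 := Complex.norm_log_sub_logTaylor_le n (hz.trans_lt (by norm_num))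
  have h2 : (1 - ‖z‖)⁻¹ ≤ 2 := by
    rw [inv_le_comm₀ (by linarith) (by norm_num)]; linarith
  refine h1.trans ?_
  calc _ ≤ ‖z‖ ^ (n + 1) * 2 / 1 := by
        gcongr
        have : (0 : ℝ) ≤ n := Nat.cast_nonneg n
        linarith
    _ = _ := by ring

theorem one_add_ne_zero {z : ℂ} (hz : ‖z‖ ≤ 1 / 2) : 1 + z ≠ 0 ∧ 1 / 2 ≤ ‖1 + z‖ := by
  have h1 := norm_sub_norm_le (1 : ℂ) (-z)
  rw [norm_one, norm_neg, sub_neg_eq_add] at h1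
  exact ⟨norm_pos_iff.1 (by linarith), by linarith⟩

/-- A logarithm of `1 + a + b`, for `b` much smaller than `a`. -/
theorem exists_log_add {a b : ℂ} (ha : ‖a‖ ≤ 1 / 4) (hb : ‖b‖ ≤ 1 / 8) (n : ℕ) :
    ∃ l : ℂ, Complex.exp l = 1 + a + b ∧ ‖l - (Complex.logTaylor (n + 1) a + b)‖ ≤
      2 * ‖a‖ ^ (n + 1) + 4 * ‖b‖ ^ 2 + 2 * (‖a‖ * ‖b‖) := by
  obtain ⟨h0, h1⟩ := one_add_ne_zero (ha.trans (by norm_num))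
  set b' := b / (1 + a) with hb'
  have hbb : ‖b'‖ ≤ 2 * ‖b‖ := by
    rw [hb', norm_div, div_le_iff₀ (by linarith)]
    nlinarith [norm_nonneg b]
  obtain ⟨h2, -⟩ := one_add_ne_zero (z := b') (by linarith)
  refine ⟨Complex.log (1 + a) + Complex.log (1 + b'), ?_, ?_⟩
  · rw [Complex.exp_add, Complex.exp_log h0, Complex.exp_log h2, hb']
    field_simp
  · have e1 := norm_log_one_add_sub_logTaylor_le (ha.trans (by norm_num : (1 / 4 : ℝ) ≤ 1 / 2)) n
    have e2 := norm_log_one_add_sub_self_le_sq (z := b') (by linarith)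
    have e3 : b' - b = -(b' * a) := by
      linear_combination div_mul_cancel₀ b h0
    have e4 : ‖b' - b‖ ≤ 2 * (‖a‖ * ‖b‖) := by
      rw [e3, norm_neg, norm_mul]
      nlinarith [norm_nonneg a]
    have e5 : ‖b'‖ ^ 2 ≤ 4 * ‖b‖ ^ 2 := by
      calc ‖b'‖ ^ 2 ≤ (2 * ‖b‖) ^ 2 := by gcongr
        _ = _ := by ring
    rw [show Complex.log (1 + a) + Complex.log (1 + b') - (Complex.logTaylor (n + 1) a + b) =
      (Complex.log (1 + a) - Complex.logTaylor (n + 1) a) + (Complex.log (1 + b') - b') +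
        (b' - b) by ring]
    exact norm_add₃_le.trans (by linarith)

/-- The argument of the logarithm is 1 + a + b with a polynomial part a = O(ε), expanded up to order
M + 2, and b = 2εw = O(ε^(M + 1)), of which only the linear term matters. -/
theorem log_term (M : ℕ) (R : ℝ) {C : ℝ} (hC : 1 ≤ C) : ∃ C' : ℝ, C ≤ C' ∧
    ∀ σ : Sobolev (M + 1), sizeDN σ ≤ R → ∀ (ε : ℂ) (ν : ℝ) (w E : ℂ), ‖E‖ = 1 → C' * ‖ε‖ ≤ 1 →
      ‖w - ε ^ M * (E * fourInt ν (leadPot σ) Real.pi)‖ ≤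
        C * ‖ε‖ ^ (M + 1) * (wkbOsc σ ν + ‖ε‖) →
      ∃ l : ℂ, Complex.exp l = 1 + 2 * ε * (ext (wkbS σ ε) Real.pi - rep σ 0 Real.pi + w) ∧
        ‖l - (Complex.logTaylor (M + 3) (evAX (bdryPoly M) σ ε) +
          2 * ε ^ (M + 1) * (E * fourInt ν (leadPot σ) Real.pi))‖ ≤
          C' * ‖ε‖ ^ (M + 2) * (wkbOsc σ ν + ‖ε‖) := by
  obtain ⟨c, hc0, hc⟩ := exists_norm_wkbS_le M R
  obtain ⟨d, hd0, hd⟩ := exists_wkbOsc_le M R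
  set A := 2 * (c + |R|) with hA
  have hA0 : 0 ≤ A := by positivity
  -- The first two summands force a and b to be small; the other four are the constants of the error
  -- terms `t1` to `t4` below.
  refine ⟨4 * A + 32 * (d + 1) + 2 * A ^ (M + 3) + 64 * (d + 1) + 8 * A + 2 * C, by
    have : 0 ≤ A ^ (M + 3) := by positivity
    linarith, ?_⟩
  set C' := 4 * A + 32 * (d + 1) + 2 * A ^ (M + 3) + 64 * (d + 1) + 8 * A + 2 * C with hC'
  intro σ hσ ε ν w E hE hCε hw
  have hAM : 0 ≤ A ^ (M + 3) := by positivity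
  have hε0 := norm_nonneg ε
  have k1 : C * ‖ε‖ ≤ 1 := le_trans (by gcongr; linarith) hCε
  have k2 : 4 * A * ‖ε‖ ≤ 1 := le_trans (by gcongr; linarith) hCε
  have k3 : 32 * (d + 1) * ‖ε‖ ≤ 1 := le_trans (by gcongr; linarith) hCε
  have hε1 : ‖ε‖ ≤ 1 := by nlinarith
  have hσ' : potentialNorm σ ≤ R := (le_sizeDN σ).trans hσ
  obtain ⟨b1, -, -⟩ := hc σ hσ' ε hε1
  have hκ0 := wkbOsc_nonneg σ ν
  have hκ := hd σ hσ' ν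
  set X := wkbOsc σ ν + ‖ε‖ with hX
  have hX0 : 0 ≤ X := by positivity
  have hXd : X ≤ d + 1 := by linarith
  have hΦ : ‖E * fourInt ν (leadPot σ) Real.pi‖ ≤ X := by
    rw [norm_mul, hE, one_mul]; linarith [norm_fourInt_leadPot_le σ ν]
  set Φ := E * fourInt ν (leadPot σ) Real.pi with hΦdef
  have hwX : ‖w‖ ≤ 2 * ‖ε‖ ^ M * X := by
    have h1 := norm_add_le (w - ε ^ M * Φ) (ε ^ M * Φ)
    rw [sub_add_cancel, norm_mul, norm_pow] at h1
    have h2 : ‖ε‖ ^ M * ‖Φ‖ ≤ ‖ε‖ ^ M * X := by gcongr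
    have h3 : C * ‖ε‖ ^ (M + 1) * X ≤ 1 * (‖ε‖ ^ M * X) := by
      calc C * ‖ε‖ ^ (M + 1) * X = C * ‖ε‖ * (‖ε‖ ^ M * X) := by ring
        _ ≤ _ := by gcongr
    linarith
  set a := evAX (bdryPoly M) σ ε with ha
  have haA : ‖a‖ ≤ A * ‖ε‖ := by
    rw [ha, evAX_bdryPoly, norm_mul, norm_mul, Complex.norm_ofNat]
    have h1 := norm_sub_le (ext (wkbS σ ε) Real.pi) (rep σ 0 Real.pi)
    have h2 := (norm_ext_le (wkbS σ ε) Real.pi).trans b1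
    have h3 : ‖rep σ 0 Real.pi‖ ≤ |R| := (le_max_right _ _).trans (hσ.trans (le_abs_self R))
    have h4 : ‖ext (wkbS σ ε) Real.pi - rep σ 0 Real.pi‖ ≤ c + |R| := by nlinarith
    calc _ ≤ ‖ε‖ * (2 * (c + |R|)) := by gcongr
      _ = _ := by rw [hA]; ring
  have hb : ‖2 * ε * w‖ ≤ 4 * ‖ε‖ ^ (M + 1) * X := by
    rw [norm_mul, norm_mul, Complex.norm_ofNat]
    calc _ ≤ 2 * ‖ε‖ * (2 * ‖ε‖ ^ M * X) := by gcongr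
      _ = _ := by ring
  have hp : ‖ε‖ ^ (M + 1) ≤ ‖ε‖ := by
    have := pow_le_pow_of_le_one hε0 hε1 (show 1 ≤ M + 1 by omega)
    rwa [pow_one] at this
  have hb8 : ‖2 * ε * w‖ ≤ 1 / 8 := by
    have : 4 * ‖ε‖ ^ (M + 1) * X ≤ 4 * ‖ε‖ * (d + 1) := by gcongr
    linarith
  obtain ⟨l, hl, hl'⟩ := exists_log_add (a := a) (b := 2 * ε * w) (by linarith) hb8 (M + 2)
  rw [show M + 2 + 1 = M + 3 from rfl] at hl'
  refine ⟨l, ?_, ?_⟩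
  · rw [hl, ha, evAX_bdryPoly]; ring
  · rw [show l - (Complex.logTaylor (M + 3) a + 2 * ε ^ (M + 1) * Φ) =
      (l - (Complex.logTaylor (M + 3) a + 2 * ε * w)) + 2 * ε * (w - ε ^ M * Φ) by ring]
    have t1 : 2 * ‖a‖ ^ (M + 3) ≤ 2 * A ^ (M + 3) * (‖ε‖ ^ (M + 2) * X) := by
      calc 2 * ‖a‖ ^ (M + 3) ≤ 2 * (A * ‖ε‖) ^ (M + 3) := by gcongr
        _ = 2 * A ^ (M + 3) * (‖ε‖ ^ (M + 2) * ‖ε‖) := by ring_nf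
        _ ≤ _ := by gcongr; linarith
    have t2 : 4 * ‖2 * ε * w‖ ^ 2 ≤ 64 * (d + 1) * (‖ε‖ ^ (M + 2) * X) := by
      calc 4 * ‖2 * ε * w‖ ^ 2 ≤ 4 * (4 * ‖ε‖ ^ (M + 1) * X) ^ 2 := by gcongr
        _ = 64 * X * (‖ε‖ ^ (M + 2) * ‖ε‖ ^ M * X) := by ring
        _ ≤ 64 * (d + 1) * (‖ε‖ ^ (M + 2) * 1 * X) := by
          gcongr
          exact pow_le_one₀ hε0 hε1
        _ = _ := by ring
    have t3 : 2 * (‖a‖ * ‖2 * ε * w‖) ≤ 8 * A * (‖ε‖ ^ (M + 2) * X) := by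
      calc 2 * (‖a‖ * ‖2 * ε * w‖) ≤ 2 * (A * ‖ε‖ * (4 * ‖ε‖ ^ (M + 1) * X)) := by gcongr
        _ = _ := by ring
    have t4 : ‖2 * ε * (w - ε ^ M * Φ)‖ ≤ 2 * C * (‖ε‖ ^ (M + 2) * X) := by
      rw [norm_mul, norm_mul, Complex.norm_ofNat]
      calc _ ≤ 2 * ‖ε‖ * (C * ‖ε‖ ^ (M + 1) * X) := by gcongr
        _ = _ := by ring
    have hY : 0 ≤ ‖ε‖ ^ (M + 2) * X := by positivity
    refine (norm_add_le _ _).trans ?_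
    have t5 : (4 * A + 32 * (d + 1)) * (‖ε‖ ^ (M + 2) * X) ≥ 0 := by positivity
    rw [mul_assoc C', hC']
    linarith

/-- The condition y'(π) = σ(π)y(π), divided by iρ = 1/(2ε), says that the two exponentials become
opposite once the factors 1 ± 2ε(…) are absorbed into them as e^l and e^{l'}; and -1 = e^{2iνπ} for
half-integer ν. The oscillatory term enters θ with the sign + and l with the factor -2, so the total
is the same as in the Dirichlet case. -/
theorem phaseRel_neumann :
    PhaseRel (M := M) (phaseDN M)
      (fun σ => charFun (memLp_derivPot σ (n := 0)) (-rep σ 0 Real.pi) 1) (1 / 2) := by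
  intro R B hB
  obtain ⟨C, hC1, hC⟩ := two_exponentials M (R := R) hB
  obtain ⟨C', hCC', hC'⟩ := log_term M R hC1
  refine ⟨2 * C', by linarith, fun σ hσ k ρ ε ν hν hε hCε hρν h0 => ?_⟩
  have hε0 := norm_nonneg ε
  have hCε1 : C' * ‖ε‖ ≤ 1 := by nlinarith
  obtain ⟨c, θ, w, θ', w', h1, h2, h3, h4, h5, h6⟩ := hC σ ((le_sizeDN σ).trans hσ) ρ ε ν hε
    (le_trans (by gcongr) hCε1) hρν
  simp only [charFun, evalPi_apply, one_mul] at h0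
  have hE : Complex.exp (2 * Complex.I * ν * Real.pi) = -1 := by
    rw [hν]; exact exp_two_pi_half k
  have hE' : Complex.exp (-(2 * Complex.I * ν * Real.pi)) = -1 := by
    rw [Complex.exp_neg, hE]; norm_num
  have hE'' : Complex.exp (-(2 * Complex.I * (-ν : ℝ) * Real.pi)) = -1 := by
    rw [show -(2 * Complex.I * ((-ν : ℝ) : ℂ) * Real.pi) = 2 * Complex.I * ν * Real.pi by
      push_cast; ring, hE]
  rw [hE'] at h3 h4
  rw [hE''] at h5 h6
  obtain ⟨l, hl, hl'⟩ := hC' σ hσ ε ν w (-1) (by simp) hCε1 h4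
  obtain ⟨l', hm, hm'⟩ := hC' σ hσ (-ε) (-ν) w' (-1) (by simp) (by rwa [norm_neg])
    (by rwa [norm_neg])
  rw [norm_neg] at hm'
  refine ⟨θ + l, θ' + l', ?_, ?_, ?_⟩
  · have hρ0 : ρ ≠ 0 := by rintro rfl; simp at hε
    have key : Complex.exp (Complex.I * ρ * Real.pi + θ) * Complex.exp l =
        -(Complex.exp (-(Complex.I * ρ * Real.pi) + θ') * Complex.exp l') := by
      have hIρ : Complex.I * ρ ≠ 0 := mul_ne_zero Complex.I_ne_zero hρ0
      refine mul_left_cancel₀ hIρ ?_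
      rw [hl, hm]
      set F := Complex.exp (Complex.I * ρ * Real.pi + θ)
      set F' := Complex.exp (-(Complex.I * ρ * Real.pi) + θ')
      set σπ := rep σ 0 Real.pi
      linear_combination -h2 + σπ * h1 + c * h0 +
        (F * (ext (wkbS σ ε) Real.pi - σπ + w) -
        F' * (ext (wkbS σ (-ε)) Real.pi - σπ + w')) * hε
    rw [hE, show 2 * Complex.I * ρ * Real.pi + (θ + l) - (θ' + l') =
      (Complex.I * ρ * Real.pi + θ + l) - (-(Complex.I * ρ * Real.pi) + θ' + l') by ring,
      Complex.exp_sub, Complex.exp_add _ l, Complex.exp_add _ l', key, neg_div, div_self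
      (mul_ne_zero (Complex.exp_ne_zero _) (Complex.exp_ne_zero _))]
  · rw [evAX_phaseDN]
    set Φ := fourInt ν (leadPot σ) Real.pi
    set P := ∑ j ∈ Finset.range (M + 2), phaseCoeff j σ * ε ^ (j + 1)
    rw [show θ + l - (P + Complex.logTaylor (M + 3) (evAX (bdryPoly M) σ ε) - ε ^ (M + 1) * Φ) =
      (θ - (P - ε ^ (M + 1) * (-1 * Φ))) + (l - (Complex.logTaylor (M + 3)
        (evAX (bdryPoly M) σ ε) + 2 * ε ^ (M + 1) * (-1 * Φ))) by ring]
    refine (norm_add_le _ _).trans ((add_le_add h3 hl').trans ?_)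
    have hX : 0 ≤ wkbOsc σ ν + ‖ε‖ := add_nonneg (wkbOsc_nonneg _ _) hε0
    calc _ ≤ C' * ‖ε‖ ^ (M + 2) * (wkbOsc σ ν + ‖ε‖) + C' * ‖ε‖ ^ (M + 2) * (wkbOsc σ ν + ‖ε‖) := by
          gcongr
      _ = _ := by ring
  · rw [evAX_phaseDN]
    set Φ := fourInt (-ν) (leadPot σ) Real.pi
    set P := ∑ j ∈ Finset.range (M + 2), phaseCoeff j σ * (-ε) ^ (j + 1)
    rw [show θ' + l' - (P + Complex.logTaylor (M + 3) (evAX (bdryPoly M) σ (-ε)) -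
      (-ε) ^ (M + 1) * Φ) =
      (θ' - (P - (-ε) ^ (M + 1) * (-1 * Φ))) + (l' - (Complex.logTaylor (M + 3)
        (evAX (bdryPoly M) σ (-ε)) + 2 * (-ε) ^ (M + 1) * (-1 * Φ))) by ring]
    refine (norm_add_le _ _).trans ((add_le_add h5 hm').trans ?_)
    have hX : 0 ≤ wkbOsc σ (-ν) + ‖ε‖ := add_nonneg (wkbOsc_nonneg _ _) hε0
    calc _ ≤ C' * ‖ε‖ ^ (M + 2) * (wkbOsc σ (-ν) + ‖ε‖) +
          C' * ‖ε‖ ^ (M + 2) * (wkbOsc σ (-ν) + ‖ε‖) := by gcongr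
      _ = _ := by ring

end SturmLiouville

end

noncomputable section

namespace SturmLiouville

open Set intervalIntegral

/-! ### Polynomials over a ring modulo the square of an ideal -/

section CommRing

open Polynomial

variable {A : Type*} [CommRing A] {V F : Ideal A}

theorem X_mul_sub_mem {B : Type*} [CommRing B] {S : Polynomial B} {f : B →+* A} {t : A}
    (hS : ∀ n, f (S.coeff n) ∈ V) (ht : t ∈ V) : X * (C 2 * (S.map f - C t)) ∈ V.map C := by
  refine Ideal.mul_mem_left _ _ (Ideal.mul_mem_left _ _ (sub_mem ?_ (Ideal.mem_map_of_mem C ht)))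
  rw [Ideal.mem_map_C_iff]
  intro n
  rw [coeff_map]
  exact hS n

theorem coeff_X_mul_sub {B : Type*} [CommRing B] (S : Polynomial B) (f : B →+* A) (t : A) (j : ℕ) :
    (X * (C 2 * (S.map f - C t))).coeff (j + 1) = 2 * (f (S.coeff j) - if j = 0 then t else 0) := by
  rw [coeff_X_mul, coeff_C_mul, coeff_sub, coeff_map, coeff_C]

/-- Powers of p from the second on have coefficients in V · V, and the zeroth power affects only the
constant term. -/
theorem coeff_sum_pow_sub_mem (hVF : V * V ≤ F) {p : Polynomial A} (hp : p ∈ V.map C) (a : ℕ → A)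
    (n j : ℕ) : (∑ i ∈ Finset.range (n + 2), C (a i) * p ^ i).coeff (j + 1) -
      a 1 * p.coeff (j + 1) ∈ F := by
  rw [Finset.sum_range_succ', Finset.sum_range_succ', coeff_add, coeff_add, finsetSum_coeff,
    pow_zero, mul_one, coeff_C_succ, zero_add, pow_one, coeff_C_mul, add_zero, add_sub_cancel_right]
  refine sum_mem fun i _ => Ideal.mem_map_C_iff.1 (Ideal.mul_mem_left _ _ ?_) (j + 1)
  rw [pow_succ, pow_succ, mul_assoc]
  refine Ideal.mul_mem_left _ _ (Ideal.map_mono hVF ?_)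
  rw [Ideal.map_mul]
  exact Ideal.mul_mem_mul hp hp

theorem two_mul_sub_add_mem (t : A) : 2 * (0 - t) + 2 * (-1) ^ 0 * t ∈ F := by
  convert zero_mem F using 1
  ring

theorem two_mul_add_mem {B : Type*} [CommRing B] (f : B →+* A) (a : B) {b : B} (hb : f b ∈ F)
    (i : ℕ) : 2 * f ((-1) ^ i * a + b) + 2 * (-1) ^ (i + 1) * f a ∈ F := by
  convert F.mul_mem_left 2 hb using 1
  rw [map_add, map_mul, map_pow, map_neg, map_one]
  ring

theorem coeff_add_sum_pow_sub_mem (hVF : V * V ≤ F) {p q : Polynomial A} (hp : p ∈ V.map C)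
    (a : ℕ → A) (n j : ℕ) {b f : A} (hq : q.coeff (j + 1) - b ∈ F) (ha : a 1 = 1)
    (hf : p.coeff (j + 1) + f ∈ F) :
    (q + ∑ i ∈ Finset.range (n + 2), C (a i) * p ^ i).coeff (j + 1) - (b - f) ∈ F := by
  rw [coeff_add]
  convert F.add_mem (F.add_mem hq (coeff_sum_pow_sub_mem hVF hp a n j)) hf using 1
  rw [ha]
  ring

/-- The truncated geometric series for `1/(1 + 2XT)`. -/
def geomInv (s : ℕ) (T : Polynomial A) : Polynomial A :=
  ∑ i ∈ Finset.range (s + 1), (-(2 * X * T)) ^ i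

/-- Successive approximations to the solution of `T = ∑ cₗ Xˡ (1 + 2XT)^(-2l-1)`. -/
def approx (c : ℕ → A) (s : ℕ) : ℕ → Polynomial A
  | 0 => 0
  | n + 1 => ∑ l ∈ Finset.range (s + 1), C (c l) * X ^ l * geomInv s (approx c s n) ^ (2 * l + 1)

variable {c : ℕ → A} {s : ℕ}

theorem approx_mem (h : ∀ l ≤ s, c l ∈ V) (n : ℕ) : approx c s n ∈ V.map C := by
  cases n with
  | zero => exact zero_mem _
  | succ n =>
    refine sum_mem fun l hl => ?_
    rw [mul_assoc]
    exact Ideal.mul_mem_right _ _ (Ideal.mem_map_of_mem C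
      (h l (Nat.lt_succ_iff.1 (Finset.mem_range.1 hl))))

/-- `geomInv` differs from 1 by coefficients in V, and it is multiplied by c l in V; so modulo V · V
all its powers may be replaced by 1. -/
theorem coeff_approx_sub_mem (hVF : V * V ≤ F) (h : ∀ l ≤ s, c l ∈ V) (n : ℕ) {l : ℕ}
    (hl : l ≤ s) : (approx c s (n + 1)).coeff l - c l ∈ F := by
  have h1 : geomInv s (approx c s n) - 1 ∈ V.map C := by
    rw [geomInv, Finset.sum_range_succ', pow_zero, add_sub_cancel_right]
    refine sum_mem fun i _ => ?_
    rw [pow_succ]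
    exact Ideal.mul_mem_left _ _ (neg_mem (Ideal.mul_mem_left _ _ (approx_mem h n)))
  have h2 : approx c s (n + 1) - ∑ l ∈ Finset.range (s + 1), C (c l) * X ^ l ∈ F.map C := by
    rw [approx, ← Finset.sum_sub_distrib]
    refine sum_mem fun l hl => Ideal.map_mono hVF ?_
    rw [Ideal.map_mul, ← mul_sub_one]
    refine Ideal.mul_mem_mul (Ideal.mul_mem_right _ _ (Ideal.mem_map_of_mem C
      (h l (Nat.lt_succ_iff.1 (Finset.mem_range.1 hl))))) ?_
    have := Ideal.mul_mem_right (∑ i ∈ Finset.range (2 * l + 1), geomInv s (approx c s n) ^ i) _ h1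
    rwa [mul_comm, geom_sum_mul] at this
  have h3 := Ideal.mem_map_C_iff.1 h2 l
  rw [coeff_sub, finsetSum_coeff] at h3
  simpa [coeff_X_pow, Nat.lt_succ_iff.2 hl] using h3

end CommRing

/-! ### Linear parts of the phase coefficients -/

section LinearParts

open Polynomial

variable {m M : ℕ} {N : Sobolev m → ℝ}

theorem phaseEl_sub_mem (hN : ∀ σ, potentialNorm σ ≤ N σ) (j : ℕ) :
    phaseEl hN j - toNice (jumpLin_mem hN j) ∈ flatIdeal N := by
  rw [phaseEl, add_sub_cancel_left]
  exact comp_evP_mem_flatIdeal hN intL (wkbRest_mem_augIdeal_mul j)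

theorem mem_vanIdeal {f : niceAlg N} : f ∈ vanIdeal N ↔ f.1 0 = 0 := Iff.rfl

theorem flatIdeal_le_vanIdeal : flatIdeal N ≤ vanIdeal N := fun _ hf => hf.1

theorem piHom_mem_vanIdeal {P : MvPolynomial ℕ ℂ} (hP : P ∈ augIdeal) :
    piHom m P ∈ vanIdeal (sizeDN (m := m)) := by
  rw [mem_vanIdeal, piHom_apply, evP_zero_of_mem hP, ext_zero]

theorem piHom_mem_flatIdeal {P : MvPolynomial ℕ ℂ} (hP : P ∈ augIdeal * augIdeal) :
    piHom m P ∈ flatIdeal (sizeDN (m := m)) := comp_evP_mem_flatIdeal le_sizeDN _ hP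

/-- The values `σ⁽ʲ⁾(π)` as elements of the algebra. -/
def repPi (m j : ℕ) : niceAlg (sizeDN (m := m)) :=
  if j = 0 then sigmaPi m else piHom m (MvPolynomial.X (j - 1))

theorem repPi_apply (j : ℕ) (σ : Sobolev m) : (repPi m j).1 σ = rep σ j Real.pi := by
  rw [repPi]
  split_ifs with h
  · rw [h, sigmaPi_apply]
  · rw [piHom_apply, evP_X, Nat.sub_add_cancel (Nat.pos_of_ne_zero h), ext_repL σ j pi_mem_Icc_pi]

theorem repPi_self (m : ℕ) : repPi m m = 0 :=
  Subtype.ext (_root_.funext fun σ => by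
    rw [repPi_apply, rep_of_le σ le_rfl]; rfl)

theorem wkb_mem_augIdeal (n : ℕ) : wkb n ∈ augIdeal :=
  add_mem (Ideal.mul_mem_left _ _ (X_mem_augIdeal n))
    (Ideal.mul_le_left (wkbRest_mem_augIdeal_mul n))

theorem wkbSum_coeff_mem (M d : ℕ) : (wkbSum M).coeff d ∈ augIdeal := by
  rw [wkbSum_coeff]
  split_ifs
  · exact zero_mem _
  · exact wkb_mem_augIdeal _
  · exact Ideal.mul_le_left (wkbRest_mem_augIdeal_mul M)
  · exact zero_mem _

theorem sigmaPi_mem_vanIdeal : sigmaPi m ∈ vanIdeal (sizeDN (m := m)) :=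
  (repAt 0 Real.pi : Sobolev m →L[ℂ] ℂ).map_zero

theorem bdryPoly_mem : bdryPoly M ∈ (vanIdeal (sizeDN (m := M + 1))).map C :=
  X_mul_sub_mem (fun n => piHom_mem_vanIdeal (wkbSum_coeff_mem M n)) sigmaPi_mem_vanIdeal

theorem coeff_bdryPoly (j : ℕ) : (bdryPoly M).coeff (j + 1) =
    2 * (piHom (M + 1) ((wkbSum M).coeff j) - if j = 0 then sigmaPi (M + 1) else 0) :=
  coeff_X_mul_sub _ _ _ j

theorem repPi_zero : repPi m 0 = sigmaPi m := if_pos rfl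

theorem repPi_succ (i : ℕ) : repPi m (i + 1) = piHom m (MvPolynomial.X i) :=
  if_neg (Nat.succ_ne_zero i)

theorem coeff_wkbSum_of_lt {i : ℕ} (hi : i < M) :
    (wkbSum M).coeff (i + 1) = (-1) ^ i * MvPolynomial.X i + wkbRest i := by
  rw [wkbSum_coeff, if_neg i.succ_ne_zero, if_pos (Nat.succ_le_of_lt hi), Nat.add_sub_cancel, wkb, wkbLin]

theorem coeff_wkbSum_self : (wkbSum M).coeff (M + 1) = wkbRest M := by
  rw [wkbSum_coeff, if_neg M.succ_ne_zero, if_neg (Nat.not_succ_le_self M), if_pos rfl]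

theorem coeff_bdryPoly_zero_mem : (bdryPoly M).coeff (0 + 1) + 2 * (-1) ^ 0 * repPi (M + 1) 0 ∈
    flatIdeal (sizeDN (m := M + 1)) := by
  rw [coeff_bdryPoly, wkbSum_coeff, if_pos rfl, if_pos rfl, map_zero, repPi_zero]
  exact two_mul_sub_add_mem _

theorem coeff_bdryPoly_succ (i : ℕ) : (bdryPoly M).coeff (i + 1 + 1) =
    2 * piHom (M + 1) ((wkbSum M).coeff (i + 1)) := by
  rw [coeff_bdryPoly, if_neg i.succ_ne_zero, sub_zero]

theorem coeff_bdryPoly_succ_mem {i : ℕ} (hi : i < M) :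
    (bdryPoly M).coeff (i + 1 + 1) + 2 * (-1) ^ (i + 1) * repPi (M + 1) (i + 1) ∈
      flatIdeal (sizeDN (m := M + 1)) := by
  have h0 : piHom (M + 1) (wkbRest i) ∈ flatIdeal (sizeDN (m := M + 1)) :=
    piHom_mem_flatIdeal (wkbRest_mem_augIdeal_mul i)
  have h := @two_mul_add_mem (niceAlg (sizeDN (m := M + 1))) inferInstance (flatIdeal sizeDN)
    (MvPolynomial ℕ ℂ) inferInstance (piHom (M + 1)) (MvPolynomial.X i) (wkbRest i) h0 i
  rwa [← coeff_wkbSum_of_lt hi, ← repPi_succ, ← coeff_bdryPoly_succ] at h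

theorem coeff_bdryPoly_self_mem :
    (bdryPoly M).coeff (M + 1 + 1) + 2 * (-1) ^ (M + 1) * repPi (M + 1) (M + 1) ∈
      flatIdeal (sizeDN (m := M + 1)) := by
  rw [coeff_bdryPoly_succ, coeff_wkbSum_self, repPi_self, mul_zero, add_zero]
  exact Ideal.mul_mem_left _ 2 (piHom_mem_flatIdeal (wkbRest_mem_augIdeal_mul M))

/-- The linear part of 2ε(S(π) - σ(π)): index 0 comes from -σ(π), the indices 1 to M from the linear
WKB terms at π. At M + 1 there is neither a linear WKB term nor a representative. -/
theorem coeff_bdryPoly_mem {j : ℕ} (hj : j ≤ M + 1) :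
    (bdryPoly M).coeff (j + 1) + 2 * (-1) ^ j * repPi (M + 1) j ∈
      flatIdeal (sizeDN (m := M + 1)) := by
  cases j with
  | zero => exact coeff_bdryPoly_zero_mem
  | succ i =>
    rcases (Nat.le_of_succ_le_succ hj).eq_or_lt with h | h
    · rw [h]
      exact coeff_bdryPoly_self_mem
    · exact coeff_bdryPoly_succ_mem h

/-- The linear functionals `(-1)ʲ⁺¹ (σ⁽ʲ⁾(π) + σ⁽ʲ⁾(0))`. -/
def sumLin (j : ℕ) : Sobolev m →L[ℂ] ℂ := (-1 : ℂ) ^ (j + 1) • (repAt j Real.pi + repAt j 0)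

theorem sumLin_apply (j : ℕ) (σ : Sobolev m) :
    sumLin j σ = (-1) ^ (j + 1) * (rep σ j Real.pi + rep σ j 0) := by
  rw [sumLin, smul_apply, add_apply,
    repAt_apply j pi_mem_Icc_pi, repAt_apply j zero_mem_Icc_pi, smul_eq_mul]

theorem sumLin_eq (j : ℕ) (σ : Sobolev m) : sumLin j σ =
    ((toNice (N := sizeDN) (jumpLin_mem le_sizeDN j) - 2 * (-1) ^ j * repPi m j).1) σ := by
  change _ = jumpLin j σ - 2 * (-1) ^ j * (repPi m j).1 σ
  rw [repPi_apply, jumpLin_apply, sumLin_apply]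
  ring

theorem sumLin_mem (j : ℕ) : (sumLin j : Sobolev m → ℂ) ∈ niceSubalg (sizeDN (m := m)) := by
  rw [funext (sumLin_eq j)]
  exact Subtype.prop _

/-- To first order the logarithm subtracts 2(-1)ʲσ^(j)(π) from the jump, which turns the difference
of boundary values into minus their sum; its higher powers are flat at zero. -/
theorem coeff_phaseDN_sub_mem {j : ℕ} (hj : j ≤ M + 1) :
    (phaseDN M).coeff (j + 1) - toNice (sumLin_mem j) ∈ flatIdeal (sizeDN (m := M + 1)) := by
  have e : toNice (N := sizeDN (m := M + 1)) (sumLin_mem j) =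
      toNice (jumpLin_mem le_sizeDN j) - 2 * (-1) ^ j * repPi (M + 1) j :=
    Subtype.ext (_root_.funext (sumLin_eq j))
  have h1 : (phaseD le_sizeDN).coeff (j + 1) - toNice (jumpLin_mem le_sizeDN j) ∈
      flatIdeal (sizeDN (m := M + 1)) := by
    rw [coeff_phaseD le_sizeDN hj]
    exact phaseEl_sub_mem le_sizeDN j
  have h3 := coeff_bdryPoly_mem hj
  rw [e]
  exact coeff_add_sum_pow_sub_mem vanIdeal_mul_le (bdryPoly_mem (M := M)) _ (M + 1) j h1
    (by rw [Nat.cast_one, div_one, neg_one_pow_two, map_one]) h3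

end LinearParts

/-! ### Inversion of the asymptotic relation -/

section Inversion

open Polynomial

variable {m : ℕ} {N : Sobolev m → ℝ} (Θ : Polynomial (niceAlg N)) (s : ℕ)

/-- The coefficients of the asymptotic relation in powers of `1/(2ρ)`. -/
def relCoeff (l : ℕ) : niceAlg N := algebraMap ℂ _ ((-1) ^ l / Real.pi) * Θ.coeff (2 * l + 1)

/-- The coefficients of the asymptotic expansion. -/
def rootCoeff (l : ℕ) : niceAlg N := (approx (relCoeff Θ) s (s + 1)).coeff l

variable {Θ s}

theorem relCoeff_mem (h : ∀ l ≤ s, Θ.coeff (2 * l + 1) ∈ vanIdeal N) {l : ℕ} (hl : l ≤ s) :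
    relCoeff Θ l ∈ vanIdeal N := Ideal.mul_mem_left _ _ (h l hl)

theorem rootCoeff_sub_mem (h : ∀ l ≤ s, Θ.coeff (2 * l + 1) ∈ vanIdeal N) {l : ℕ} (hl : l ≤ s) :
    rootCoeff Θ s l - relCoeff Θ l ∈ flatIdeal N :=
  coeff_approx_sub_mem vanIdeal_mul_le (fun _ => relCoeff_mem h) s hl

theorem norm_pow_sub_pow_le {a b : ℂ} {K : ℝ} (ha : ‖a‖ ≤ K) (hb : ‖b‖ ≤ K) (n : ℕ) :
    ‖a ^ (n + 1) - b ^ (n + 1)‖ ≤ (n + 1) * K ^ n * ‖a - b‖ := by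
  have hK : 0 ≤ K := (norm_nonneg a).trans ha
  rw [← geom_sum₂_mul, norm_mul]
  gcongr
  refine (norm_sum_le _ _).trans ((Finset.sum_le_card_nsmul _ _ (K ^ n) fun i hi => ?_).trans ?_)
  · have hi' := Finset.mem_range.1 hi
    rw [norm_mul, norm_pow, norm_pow]
    calc ‖a‖ ^ i * ‖b‖ ^ (n + 1 - 1 - i) ≤ K ^ i * K ^ (n + 1 - 1 - i) := by gcongr
      _ = K ^ n := by rw [← pow_add]; congr 1; omega
  · rw [Finset.card_range, nsmul_eq_mul]; push_cast; exact le_rfl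

theorem evAX_geomInv (T : Polynomial (niceAlg N)) (σ : Sobolev m) (x : ℂ) :
    evAX (geomInv s T) σ x = ∑ i ∈ Finset.range (s + 1), (-(2 * x * evAX T σ x)) ^ i := by
  simp only [evAX, geomInv, eval₂_finsetSum, eval₂_pow, eval₂_neg, eval₂_mul, eval₂_X,
    eval₂_ofNat]

theorem evAX_approx_succ (n : ℕ) (σ : Sobolev m) (x : ℂ) : evAX (approx (relCoeff Θ) s (n + 1)) σ x =
    ∑ l ∈ Finset.range (s + 1), (relCoeff Θ l).1 σ * x ^ l *
      evAX (geomInv s (approx (relCoeff Θ) s n)) σ x ^ (2 * l + 1) := by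
  simp only [evAX, approx, eval₂_finsetSum, eval₂_pow, eval₂_mul, eval₂_X, eval₂_C]
  rfl

/-- One step of the successive approximations. -/
theorem exists_step_le (T : Polynomial (niceAlg N)) (R : ℝ) : ∃ C : ℝ, 0 ≤ C ∧
    ∀ σ, N σ ≤ R → ∀ x τ w : ℂ, ‖x‖ ≤ 1 → ‖w‖ ≤ 2 → w * (1 + 2 * x * τ) = 1 →
      ‖∑ l ∈ Finset.range (s + 1), (relCoeff Θ l).1 σ * x ^ l * w ^ (2 * l + 1) -
        ∑ l ∈ Finset.range (s + 1), (relCoeff Θ l).1 σ * x ^ l *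
          evAX (geomInv s T) σ x ^ (2 * l + 1)‖ ≤ C * (‖x‖ * ‖τ - evAX T σ x‖ + ‖x‖ ^ (s + 1)) := by
  obtain ⟨K, hK0, hK⟩ := exists_evAX_le T R
  obtain ⟨L, hL0, hL⟩ := exists_evAX_le (geomInv s T) R
  choose c hc using fun l => (relCoeff Θ l).2.2 R
  set D : ℝ := 2 * (2 * L + (2 * K) ^ (s + 1)) with hD
  have hD0 : 0 ≤ D := by positivity
  refine ⟨∑ l ∈ Finset.range (s + 1), |c l| * ((2 * l + 1) * (L + 2) ^ (2 * l) * D),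
    Finset.sum_nonneg fun l _ => by positivity, fun σ hσ x τ w hx hw hwτ => ?_⟩
  set t := evAX T σ x
  set u := evAX (geomInv s T) σ x with hu
  have ht : ‖t‖ ≤ K := hK σ hσ x hx
  have hu' : ‖u‖ ≤ L := hL σ hσ x hx
  set E := ‖x‖ * ‖τ - t‖ + ‖x‖ ^ (s + 1) with hE
  have hgeom : (1 + 2 * x * t) * u = 1 - (-(2 * x * t)) ^ (s + 1) := by
    have := mul_neg_geom_sum (-(2 * x * t)) (s + 1)
    rw [sub_neg_eq_add] at this
    rw [hu, evAX_geomInv]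
    exact this
  -- w is the exact inverse of 1 + 2xτ and u the truncated inverse of 1 + 2xt; their difference
  -- carries either x(τ - t) or the truncation error.
  have hwu : w - u = w * (2 * x * (t - τ) * u + (-(2 * x * t)) ^ (s + 1)) := by
    linear_combination u * hwτ - w * hgeom
  have hwu' : ‖w - u‖ ≤ D * E := by
    rw [hwu, norm_mul]
    have e1 : ‖2 * x * (t - τ) * u‖ ≤ 2 * L * (‖x‖ * ‖τ - t‖) := by
      rw [norm_mul, norm_mul, norm_mul, norm_sub_rev t τ, Complex.norm_ofNat]
      calc 2 * ‖x‖ * ‖τ - t‖ * ‖u‖ ≤ 2 * ‖x‖ * ‖τ - t‖ * L := by gcongr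
        _ = _ := by ring
    have e2 : ‖(-(2 * x * t)) ^ (s + 1)‖ ≤ (2 * K) ^ (s + 1) * ‖x‖ ^ (s + 1) := by
      rw [norm_pow, norm_neg, norm_mul, norm_mul, Complex.norm_ofNat, ← mul_pow]
      refine pow_le_pow_left₀ (by positivity) ?_ _
      calc 2 * ‖x‖ * ‖t‖ ≤ 2 * ‖x‖ * K := by gcongr
        _ = _ := by ring
    have e3 : 0 ≤ ‖x‖ * ‖τ - t‖ := by positivity
    have e4 : 0 ≤ ‖x‖ ^ (s + 1) := by positivity
    have e5 : 0 ≤ (2 * K) ^ (s + 1) := by positivity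
    calc ‖w‖ * _ ≤ 2 * (2 * L * (‖x‖ * ‖τ - t‖) + (2 * K) ^ (s + 1) * ‖x‖ ^ (s + 1)) := by
          gcongr
          exact (norm_add_le _ _).trans (add_le_add e1 e2)
      _ ≤ D * E := by rw [hD, hE]; nlinarith [mul_nonneg hL0 e4, mul_nonneg e5 e3]
  have hE0 : 0 ≤ E := by positivity
  rw [← Finset.sum_sub_distrib, Finset.sum_mul]
  refine (norm_sum_le _ _).trans (Finset.sum_le_sum fun l _ => ?_)
  rw [← mul_sub, norm_mul, norm_mul, norm_pow]
  have h1 := norm_pow_sub_pow_le (a := w) (b := u) (K := L + 2) (by linarith) (by linarith) (2 * l)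
  push_cast at h1
  calc ‖(relCoeff Θ l).1 σ‖ * ‖x‖ ^ l * ‖w ^ (2 * l + 1) - u ^ (2 * l + 1)‖
      ≤ |c l| * 1 * ((2 * l + 1) * (L + 2) ^ (2 * l) * (D * E)) := by
        gcongr
        · exact (hc l σ hσ).trans (le_abs_self _)
        · exact pow_le_one₀ (norm_nonneg _) hx
        · exact h1.trans (by gcongr)
    _ = _ := by ring

/-- The unknown enters the right-hand side of the fixed-point equation only multiplied by x, so each
iteration gains a power of x, up to the truncation order s + 1 of `geomInv`. For the same reason δ
influences the error only through xδ. -/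
theorem exists_approx_le (Θ : Polynomial (niceAlg N)) (s n : ℕ) (hn : n ≤ s + 1) (R K : ℝ) :
    ∃ C : ℝ, 0 ≤ C ∧
    ∀ σ, N σ ≤ R → ∀ x τ w δ : ℂ, ‖x‖ ≤ 1 → ‖w‖ ≤ 2 → w * (1 + 2 * x * τ) = 1 → ‖τ - δ‖ ≤ K →
      τ = ∑ l ∈ Finset.range (s + 1), (relCoeff Θ l).1 σ * x ^ l * w ^ (2 * l + 1) + δ →
      ‖τ - δ - evAX (approx (relCoeff Θ) s n) σ x‖ ≤ C * (‖x‖ ^ n + ‖x‖ * ‖δ‖) := by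
  induction n with
  | zero =>
    refine ⟨|K|, abs_nonneg K, fun σ hσ x τ w δ hx hw hwτ hK _ => ?_⟩
    have e : evAX (approx (relCoeff Θ) s 0) σ x = 0 := by simp [evAX, approx]
    rw [e, sub_zero, pow_zero]
    have : 0 ≤ |K| * (‖x‖ * ‖δ‖) := by positivity
    linarith [le_abs_self K]
  | succ n ih =>
    obtain ⟨C, hC0, hC⟩ := ih (by omega)
    obtain ⟨D, hD0, hD⟩ := exists_step_le (s := s) (Θ := Θ) (approx (relCoeff Θ) s n) R
    refine ⟨D * (C + 2), by positivity, fun σ hσ x τ w δ hx hw hwτ hK hτ => ?_⟩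
    have h1 := hC σ hσ x τ w δ hx hw hwτ hK hτ
    have h2 := hD σ hσ x τ w hx hw hwτ
    rw [← evAX_approx_succ, ← sub_eq_iff_eq_add.2 hτ] at h2
    refine h2.trans ?_
    rw [mul_assoc]
    gcongr
    have h3 : ‖τ - evAX (approx (relCoeff Θ) s n) σ x‖ ≤ C * (‖x‖ ^ n + ‖x‖ * ‖δ‖) + ‖δ‖ := by
      rw [show τ - evAX (approx (relCoeff Θ) s n) σ x = (τ - δ - evAX (approx (relCoeff Θ) s n) σ x) + δ by ring]
      exact (norm_add_le _ _).trans (by gcongr)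
    have h4 : ‖x‖ ^ (s + 1) ≤ ‖x‖ ^ (n + 1) := pow_le_pow_of_le_one (norm_nonneg _) hx hn
    have h5 : ‖x‖ * (C * (‖x‖ ^ n + ‖x‖ * ‖δ‖) + ‖δ‖) ≤
        C * (‖x‖ ^ (n + 1) + ‖x‖ * ‖δ‖) + ‖x‖ * ‖δ‖ := by
      have h6 : ‖x‖ * (‖x‖ * ‖δ‖) ≤ ‖x‖ * ‖δ‖ := mul_le_of_le_one_left (by positivity) hx
      rw [pow_succ]
      nlinarith [mul_le_mul_of_nonneg_left h6 hC0]
    have h7 := mul_le_mul_of_nonneg_left h3 (norm_nonneg x)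
    have h8 : 0 ≤ ‖x‖ * ‖δ‖ := by positivity
    have h9 : 0 ≤ ‖x‖ ^ (n + 1) := by positivity
    linarith

end Inversion

end SturmLiouville

end

noncomputable section

namespace SturmLiouville

open Set intervalIntegral

/-! ### Asymptotics of the square roots of the zeros -/

theorem sum_odd_part (a : ℕ → ℂ) (z : ℂ) (s : ℕ) :
    ∑ j ∈ Finset.range (2 * s + 3), a j * z ^ j - ∑ j ∈ Finset.range (2 * s + 3), a j * (-z) ^ j =
      2 * ∑ l ∈ Finset.range (s + 1), a (2 * l + 1) * z ^ (2 * l + 1) := by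
  induction s with
  | zero => simp [Finset.sum_range_succ]; ring
  | succ s ih =>
    rw [show 2 * (s + 1) + 3 = 2 * s + 3 + 1 + 1 by ring, Finset.sum_range_succ,
      Finset.sum_range_succ, Finset.sum_range_succ (fun j => a j * (-z) ^ j),
      Finset.sum_range_succ (fun j => a j * (-z) ^ j), Finset.sum_range_succ _ (s + 1), mul_add,
      ← ih, show 2 * s + 3 + 1 = 2 * (s + 2) by ring, show 2 * s + 3 = 2 * (s + 1) + 1 by ring,
      (even_two_mul (s + 2)).neg_pow, (odd_two_mul_add_one (s + 1)).neg_pow]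
    ring

variable {M : ℕ} {N : Sobolev (M + 1) → ℝ} {Θ : Polynomial (niceAlg N)}
  {Δ : Sobolev (M + 1) → ℂ → ℂ} {θ₀ : ℝ}

theorem exists_odd_part_le (Θ : Polynomial (niceAlg N)) (s : ℕ) (R : ℝ) : ∃ C : ℝ, 0 ≤ C ∧
    ∀ σ, N σ ≤ R → ∀ z : ℂ, ‖z‖ ≤ 1 →
      ‖evAX Θ σ z - evAX Θ σ (-z) -
        2 * ∑ l ∈ Finset.range (s + 1), (Θ.coeff (2 * l + 1)).1 σ * z ^ (2 * l + 1)‖ ≤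
        C * ‖z‖ ^ (2 * s + 3) := by
  obtain ⟨C, hC0, hC⟩ := exists_evAX_sub_le Θ (2 * s + 3) R
  refine ⟨2 * C, by positivity, fun σ hσ z hz => ?_⟩
  have h1 := hC σ hσ z hz
  have h2 := hC σ hσ (-z) (by rwa [norm_neg])
  rw [norm_neg] at h2
  rw [← sum_odd_part (fun j => (Θ.coeff j).1 σ)]
  have h3 := norm_sub_le (evAX Θ σ z - ∑ j ∈ Finset.range (2 * s + 3), (Θ.coeff j).1 σ * z ^ j)
    (evAX Θ σ (-z) - ∑ j ∈ Finset.range (2 * s + 3), (Θ.coeff j).1 σ * (-z) ^ j)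
  rw [sub_sub_sub_comm] at h3
  linarith

/-- The oscillatory term of the phase. -/
def oscTerm (σ : Sobolev (M + 1)) (ν : ℝ) (ε : ℂ) : ℂ :=
  ε ^ (M + 1) * fourInt ν (leadPot σ) Real.pi - (-ε) ^ (M + 1) * fourInt (-ν) (leadPot σ) Real.pi

/-- The size of the oscillatory terms at `ν` and `-ν`. -/
def pairOsc (σ : Sobolev (M + 1)) (ν : ℝ) : ℝ := wkbOsc σ ν + wkbOsc σ (-ν)

theorem pairOsc_nonneg (σ : Sobolev (M + 1)) (ν : ℝ) : 0 ≤ pairOsc σ ν :=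
  add_nonneg (wkbOsc_nonneg _ _) (wkbOsc_nonneg _ _)

theorem norm_oscTerm_sub_le (σ : Sobolev (M + 1)) (ν : ℝ) (a b : ℂ) :
    ‖oscTerm σ ν a - oscTerm σ ν b‖ ≤ ‖a ^ (M + 1) - b ^ (M + 1)‖ * pairOsc σ ν := by
  have e : oscTerm σ ν a - oscTerm σ ν b = (a ^ (M + 1) - b ^ (M + 1)) *
      (fourInt ν (leadPot σ) Real.pi - (-1) ^ (M + 1) * fourInt (-ν) (leadPot σ) Real.pi) := by
    rw [oscTerm, oscTerm, neg_pow a, neg_pow b]; ring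
  rw [e, norm_mul]
  gcongr
  refine (norm_sub_le _ _).trans (add_le_add (norm_fourInt_leadPot_le σ ν) ?_)
  rw [norm_mul, norm_pow, norm_neg, norm_one, one_pow, one_mul]
  exact norm_fourInt_leadPot_le σ (-ν)

theorem norm_oscTerm_le (σ : Sobolev (M + 1)) (ν : ℝ) (a : ℂ) :
    ‖oscTerm σ ν a‖ ≤ ‖a‖ ^ (M + 1) * pairOsc σ ν := by
  have h := norm_oscTerm_sub_le σ ν a 0
  have e : oscTerm σ ν 0 = 0 := by simp [oscTerm]
  rwa [e, sub_zero, zero_pow M.succ_ne_zero, sub_zero, norm_pow] at h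

theorem eq_of_exp_eq_of_norm_lt {a b : ℂ} (h : Complex.exp a = Complex.exp b)
    (hlt : ‖a - b‖ < 2 * Real.pi) : a = b := by
  obtain ⟨n, hn⟩ := Complex.exp_eq_exp_iff_exists_int.1 h
  rw [hn, add_sub_cancel_left, norm_mul] at hlt
  have h1 : ‖(2 * Real.pi * Complex.I : ℂ)‖ = 2 * Real.pi := by
    simp [abs_of_pos Real.pi_pos]
  rw [h1, Complex.norm_intCast] at hlt
  have h2 : |(n : ℝ)| < 1 := by
    by_contra! h3
    nlinarith [Real.pi_pos]
  have h3 : n = 0 := by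
    rw [← Int.abs_lt_one_iff]; exact_mod_cast h2
  rw [hn, h3]; simp

theorem norm_eps_le {ρ ε : ℂ} {ν : ℝ} (hν : 1 ≤ ν) (hρ : ‖ρ - ν‖ ≤ 1 / 8)
    (hε : 2 * Complex.I * ρ * ε = 1) : ‖ρ‖ * ‖ε‖ = 1 / 2 ∧ ν / 2 ≤ ‖ρ‖ ∧ ‖ε‖ ≤ ν⁻¹ := by
  have h1 : ‖ρ‖ * ‖ε‖ = 1 / 2 := by
    have := congrArg norm hε
    rw [norm_mul, norm_mul, norm_mul, Complex.norm_ofNat, Complex.norm_I, norm_one] at this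
    linarith
  have h2 : ν / 2 ≤ ‖ρ‖ := by
    have := norm_sub_norm_le (ν : ℂ) ρ
    rw [Complex.norm_real, Real.norm_of_nonneg (by linarith), norm_sub_rev] at this
    linarith
  refine ⟨h1, h2, ?_⟩
  rw [← one_div, le_div_iff₀ (by linarith)]
  nlinarith [norm_nonneg ε]

/-- The phase relation determines the exponent modulo 2πi. As |ρ - ν| ≤ 1/8 and |θ - θ'| ≤ 1, the
two exponents differ by less than 2π and are equal. In D = θ - θ' the even powers of ε cancel. -/
theorem exists_phase_equation (hN : ∀ σ, potentialNorm σ ≤ N σ) (hrel : PhaseRel Θ Δ θ₀) {s : ℕ}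
    (hs : M ≤ 2 * s) (R : ℝ) {B : ℝ} (hB : 0 ≤ B) : ∃ C : ℝ, 1 ≤ C ∧ ∀ σ, N σ ≤ R →
    ∀ (k : ℕ+) (ρ ε : ℂ) (ν : ℝ), ν = k - θ₀ → C ≤ ν → ‖ρ - ν‖ ≤ 1 / 8 → ‖ρ - ν‖ ≤ B / ‖ρ‖ →
      2 * Complex.I * ρ * ε = 1 → Δ σ (ρ ^ 2) = 0 → ∃ D : ℂ,
        2 * Real.pi * Complex.I * (ρ - ν) = -D ∧
        ‖D - (2 * ∑ l ∈ Finset.range (s + 1), (Θ.coeff (2 * l + 1)).1 σ * ε ^ (2 * l + 1) -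
          oscTerm σ ν ε)‖ ≤ C * ν⁻¹ ^ (M + 2) * (pairOsc σ ν + ν⁻¹) := by
  obtain ⟨C₀, hC₀1, hC₀⟩ := hrel R (2 * B) (by positivity)
  obtain ⟨C₁, hC₁0, hC₁⟩ := exists_odd_part_le Θ s R
  obtain ⟨K, hK0, hK⟩ := exists_wkbOsc_le M R
  choose c hc using fun l => (Θ.coeff (2 * l + 1)).2.2 R
  set S : ℝ := 2 * ∑ l ∈ Finset.range (s + 1), |c l| with hS
  have hS0 : 0 ≤ S := by positivity
  set Q : ℝ := S + 2 * K + (2 * C₀ + C₁) * (2 * K + 1) with hQ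
  have hQ0 : 0 ≤ Q := by positivity
  refine ⟨2 * C₀ + C₁ + Q, by linarith, fun σ hσ k ρ ε ν hν hCν h8 hBρ hε h0 => ?_⟩
  have hν1 : 1 ≤ ν := by linarith
  obtain ⟨hρε, hρ2, hεν⟩ := norm_eps_le hν1 h8 hε
  set e := ν⁻¹ with he
  have he0 : 0 < e := by positivity
  have he1 : e ≤ 1 := inv_le_one_of_one_le₀ hν1
  have hCe : (2 * C₀ + C₁ + Q) * e ≤ 1 := by
    rw [he, ← div_eq_mul_inv, div_le_one (by linarith)]; exact hCν
  have hρ0 : 0 < ‖ρ‖ := by linarith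
  obtain ⟨θ, θ', h1, h2, h3⟩ := hC₀ σ hσ k ρ ε ν hν hε
    (by nlinarith [norm_nonneg ε]) (hBρ.trans_eq (by
      rw [div_eq_iff hρ0.ne']; linear_combination (-2 * B) * hρε)) h0
  have h4 := hC₁ σ hσ ε (hεν.trans he1)
  set P := 2 * ∑ l ∈ Finset.range (s + 1), (Θ.coeff (2 * l + 1)).1 σ * ε ^ (2 * l + 1) with hP
  have hκ := pairOsc_nonneg σ ν
  have hX : 0 ≤ pairOsc σ ν + e := by linarith
  have hκ1 := wkbOsc_nonneg σ ν
  have hκ2 := wkbOsc_nonneg σ (-ν)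
  have hκK : pairOsc σ ν ≤ 2 * K := by
    have a1 := hK σ ((hN σ).trans hσ) ν
    have a2 := hK σ ((hN σ).trans hσ) (-ν)
    rw [pairOsc]; linarith
  have hD : ‖θ - θ' - (P - oscTerm σ ν ε)‖ ≤ (2 * C₀ + C₁) * e ^ (M + 2) * (pairOsc σ ν + e) := by
    have e1 : θ - θ' - (P - oscTerm σ ν ε) =
        (θ - (evAX Θ σ ε - ε ^ (M + 1) * fourInt ν (leadPot σ) Real.pi)) -
        (θ' - (evAX Θ σ (-ε) - (-ε) ^ (M + 1) * fourInt (-ν) (leadPot σ) Real.pi)) +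
        (evAX Θ σ ε - evAX Θ σ (-ε) - P) := by
      rw [oscTerm]; ring
    rw [e1]
    refine (norm_add_le _ _).trans ((add_le_add ((norm_sub_le _ _).trans (add_le_add h2 h3))
      h4).trans ?_)
    have b1 : C₀ * ‖ε‖ ^ (M + 2) * (wkbOsc σ ν + ‖ε‖) ≤ C₀ * e ^ (M + 2) * (pairOsc σ ν + e) := by
      gcongr
      rw [pairOsc]; linarith
    have b2 : C₀ * ‖ε‖ ^ (M + 2) * (wkbOsc σ (-ν) + ‖ε‖) ≤
        C₀ * e ^ (M + 2) * (pairOsc σ ν + e) := by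
      gcongr
      rw [pairOsc]; linarith
    have b3 : C₁ * ‖ε‖ ^ (2 * s + 3) ≤ C₁ * e ^ (M + 2) * (pairOsc σ ν + e) := by
      rw [mul_assoc]
      gcongr
      calc ‖ε‖ ^ (2 * s + 3) ≤ e ^ (2 * s + 3) := by gcongr
        _ ≤ e ^ (M + 3) := pow_le_pow_of_le_one he0.le he1 (by omega)
        _ = e ^ (M + 2) * e := pow_succ e (M + 2)
        _ ≤ _ := by gcongr; linarith
    linarith
  have hPle : ‖P‖ ≤ S * e := by
    rw [hP, hS, norm_mul, Complex.norm_ofNat, mul_assoc, Finset.sum_mul]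
    gcongr
    refine (norm_sum_le _ _).trans (Finset.sum_le_sum fun l _ => ?_)
    rw [norm_mul, norm_pow]
    gcongr
    · exact (hc l σ hσ).trans (le_abs_self _)
    · calc ‖ε‖ ^ (2 * l + 1) ≤ ‖ε‖ ^ 1 :=
          pow_le_pow_of_le_one (norm_nonneg _) (hεν.trans he1) (by omega)
        _ ≤ e := by rwa [pow_one]
  have hGle : ‖oscTerm σ ν ε‖ ≤ 2 * K * e := by
    refine (norm_oscTerm_le σ ν ε).trans ?_
    calc ‖ε‖ ^ (M + 1) * pairOsc σ ν ≤ ‖ε‖ ^ 1 * (2 * K) := by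
          refine mul_le_mul (pow_le_pow_of_le_one (norm_nonneg _) (hεν.trans he1) (by omega)) hκK hκ
            (by positivity)
      _ ≤ _ := by rw [pow_one, mul_comm]; gcongr
  have hDle : ‖θ - θ'‖ ≤ 1 := by
    have b1 : (2 * C₀ + C₁) * e ^ (M + 2) * (pairOsc σ ν + e) ≤
        (2 * C₀ + C₁) * e ^ 1 * (2 * K + 1) := by
      refine mul_le_mul (mul_le_mul_of_nonneg_left
        (pow_le_pow_of_le_one he0.le he1 (by omega)) (by positivity)) (by linarith) hX
        (by positivity)
    rw [show θ - θ' = θ - θ' - (P - oscTerm σ ν ε) + (P - oscTerm σ ν ε) by ring]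
    refine (norm_add_le _ _).trans ((add_le_add (hD.trans b1) ((norm_sub_le _ _).trans
      (add_le_add hPle hGle))).trans ?_)
    rw [pow_one]
    calc _ = Q * e := by rw [hQ]; ring
      _ ≤ (2 * C₀ + C₁ + Q) * e := by gcongr; linarith
      _ ≤ 1 := hCe
  refine ⟨θ - θ', ?_, hD.trans ?_⟩
  · have e1 : 2 * Complex.I * ρ * Real.pi + θ - θ' - 2 * Complex.I * ν * Real.pi =
        2 * Real.pi * Complex.I * (ρ - ν) + (θ - θ') := by ring
    have e2 : ‖(2 * Real.pi * Complex.I * (ρ - ν) : ℂ)‖ ≤ 2 * Real.pi * (1 / 8) := by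
      rw [norm_mul, norm_mul, norm_mul, Complex.norm_ofNat, Complex.norm_I, Complex.norm_real,
        Real.norm_of_nonneg Real.pi_pos.le, mul_one]
      gcongr
    have e3 := eq_of_exp_eq_of_norm_lt h1 (by
      rw [e1]
      refine (norm_add_le _ _).trans_lt ?_
      linarith [Real.pi_gt_three])
    linear_combination e3
  · rw [mul_assoc, mul_assoc]
    exact mul_le_mul_of_nonneg_right (by linarith) (by positivity)

/-- The leading oscillatory term of the asymptotics. -/
def leadTerm (σ : Sobolev (M + 1)) (ν : ℝ) : ℂ :=
  (2 * Real.pi * Complex.I)⁻¹ * oscTerm σ ν (2 * Complex.I * ν)⁻¹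

/-- Rewrites powers of ε = 1/(2iρ) through ν and ν/ρ, the form required by `exists_approx_le`; the
powers of i produce the sign in `relCoeff`. -/
theorem relCoeff_mul (σ : Sobolev (M + 1)) {ρ ε ν : ℂ} (hν : ν ≠ 0) (hρ : ρ ≠ 0)
    (hε : 2 * Complex.I * ρ * ε = 1) (l : ℕ) :
    (relCoeff Θ l).1 σ * ((2 * ν) ^ 2)⁻¹ ^ l * (ν / ρ) ^ (2 * l + 1) =
      -(2 * ν) * (2 * Real.pi * Complex.I)⁻¹ *
        (2 * ((Θ.coeff (2 * l + 1)).1 σ * ε ^ (2 * l + 1))) := by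
  have h1 : (relCoeff Θ l).1 σ = (-1) ^ l / Real.pi * (Θ.coeff (2 * l + 1)).1 σ := rfl
  have h2 : ν / ρ = 2 * ν * Complex.I * ε := by
    rw [div_eq_iff hρ]; linear_combination (-ν) * hε
  have h3 : (Complex.I) ^ (2 * l + 1) = (-1) ^ l * Complex.I := by
    rw [pow_succ, pow_mul, Complex.I_sq]
  have h4 : (Complex.I)⁻¹ = -Complex.I := Complex.inv_I
  have h5 : ((-1 : ℂ) ^ l) * (-1) ^ l = 1 := by rw [← mul_pow]; norm_num
  have h6 : ((2 * ν) ^ 2)⁻¹ ^ l * (2 * ν) ^ (2 * l + 1) = 2 * ν := by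
    have h7 : ((2 * ν) ^ 2) ^ l ≠ 0 := pow_ne_zero _ (pow_ne_zero _ (mul_ne_zero two_ne_zero hν))
    rw [pow_succ _ (2 * l), pow_mul, inv_pow, ← mul_assoc, inv_mul_cancel₀ h7, one_mul]
  have hpi : (Real.pi : ℂ) ≠ 0 := Complex.ofReal_ne_zero.2 Real.pi_ne_zero
  rw [h1]
  generalize (Θ.coeff (2 * l + 1)).1 σ = t
  rw [h2, mul_pow (2 * ν * Complex.I), mul_pow (2 * ν), h3, mul_inv, mul_inv, h4]
  calc _ = ((-1) ^ l * (-1) ^ l) * (((2 * ν) ^ 2)⁻¹ ^ l * (2 * ν) ^ (2 * l + 1)) *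
        (t * Complex.I * ε ^ (2 * l + 1) / Real.pi) := by ring
    _ = _ := by rw [h5, h6]; field_simp

set_option maxHeartbeats 800000 in
/-- The asymptotics of the square roots of the zeros of a characteristic function. -/
theorem exists_root_asymptotics (hN : ∀ σ, potentialNorm σ ≤ N σ) (hrel : PhaseRel Θ Δ θ₀) {s : ℕ}
    (hs : M ≤ 2 * s) (R : ℝ) {B : ℝ} (hB : 0 ≤ B) : ∃ C : ℝ, 1 ≤ C ∧ ∀ σ, N σ ≤ R →
    ∀ (k : ℕ+) (ρ : ℂ) (ν : ℝ), ν = k - θ₀ → C ≤ ν → ‖ρ - ν‖ ≤ 1 / 8 → ‖ρ - ν‖ ≤ B / ‖ρ‖ →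
      Δ σ (ρ ^ 2) = 0 →
      ‖ρ - ν - ∑ l ∈ Finset.range (s + 1), (rootCoeff Θ s l).1 σ / (2 * ν) ^ (2 * l + 1) -
        leadTerm σ ν‖ ≤ C * ν⁻¹ ^ (M + 2) * (pairOsc σ ν + ν⁻¹) := by
  obtain ⟨C₀, hC₀1, hC₀⟩ := exists_phase_equation hN hrel hs R hB
  choose c hc using fun l => (relCoeff Θ l).2.2 R
  set K : ℝ := ∑ l ∈ Finset.range (s + 1), |c l| * 2 ^ (2 * l + 1) with hK
  obtain ⟨C₁, hC₁0, hC₁⟩ := exists_approx_le Θ s (s + 1) le_rfl R K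
  obtain ⟨C₂, hC₂0, hC₂⟩ := exists_evAX_sub_le (approx (relCoeff Θ) s (s + 1)) (s + 1) R
  have hM0 : (0 : ℝ) ≤ 4 * B * (M + 1) := by positivity
  have hC₁0' : 0 ≤ C₁ * (2 + C₀) := mul_nonneg hC₁0 (by linarith)
  refine ⟨C₁ * (2 + C₀) + C₂ + 4 * B * (M + 1) + C₀, by linarith,
    fun σ hσ k ρ ν hν hCν h8 hBρ h0 => ?_⟩
  have hν1 : 1 ≤ ν := by linarith
  have hνc : (ν : ℂ) ≠ 0 := Complex.ofReal_ne_zero.2 (by linarith)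
  have hρ2' : ρ ≠ 0 := by
    rintro rfl
    rw [zero_sub, norm_neg, Complex.norm_real, Real.norm_of_nonneg (by linarith)] at h8
    linarith
  set ε : ℂ := (2 * Complex.I * ρ)⁻¹ with hε'
  have hε : 2 * Complex.I * ρ * ε = 1 := mul_inv_cancel₀ (by simp [hρ2'])
  obtain ⟨hρε, hρ2, hεν⟩ := norm_eps_le hν1 h8 hε
  set ε₀ : ℂ := (2 * Complex.I * ν)⁻¹ with hε₀'
  have hε₀ : 2 * Complex.I * ν * ε₀ = 1 := mul_inv_cancel₀ (by simp [hνc])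
  obtain ⟨-, -, hε₀ν⟩ := norm_eps_le hν1 (by simp) hε₀
  obtain ⟨D, hD1, hD2⟩ := hC₀ σ hσ k ρ ε ν hν (by linarith) h8 hBρ hε h0
  set P := ∑ l ∈ Finset.range (s + 1), (Θ.coeff (2 * l + 1)).1 σ * ε ^ (2 * l + 1) with hP
  set err := D - (2 * P - oscTerm σ ν ε) with herr
  set e := ν⁻¹ with he
  have he0 : 0 < e := by positivity
  have he1 : e ≤ 1 := inv_le_one_of_one_le₀ hν1
  have hνe : ν * e = 1 := mul_inv_cancel₀ (by linarith)
  have hκ := pairOsc_nonneg σ ν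
  set X := pairOsc σ ν + e with hX
  have hX0 : 0 ≤ X := by linarith
  set a : ℂ := (2 * Real.pi * Complex.I)⁻¹ with ha
  have hpi : (2 * Real.pi * Complex.I : ℂ) ≠ 0 := Complex.two_pi_I_ne_zero
  have ha1 : ‖a‖ ≤ 1 := by
    rw [ha, norm_inv]
    refine inv_le_one_of_one_le₀ ?_
    rw [norm_mul, norm_mul, Complex.norm_ofNat, Complex.norm_I, Complex.norm_real,
      Real.norm_of_nonneg Real.pi_pos.le]
    linarith [Real.pi_gt_three]
  have hDa : (ρ - ν : ℂ) = -(a * D) := by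
    rw [ha, ← neg_eq_iff_eq_neg.2 hD1, mul_neg, neg_neg, inv_mul_cancel_left₀ hpi]
  -- In the variables x = 1/(2ν)² and τ = 2ν(ρ - ν) one has ν/ρ = 1/(1 + 2xτ), and the phase
  -- equation is the fixed-point equation of `approx` with error δ.
  set x : ℂ := ((2 * (ν : ℂ)) ^ 2)⁻¹ with hx
  set τ : ℂ := 2 * ν * (ρ - ν) with hτ
  set δ : ℂ := τ - ∑ l ∈ Finset.range (s + 1), (relCoeff Θ l).1 σ * x ^ l * (ν / ρ) ^ (2 * l + 1)
    with hδ
  have hδ' : δ = 2 * ν * a * (oscTerm σ ν ε - err) := by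
    have e1 : ∑ l ∈ Finset.range (s + 1), (relCoeff Θ l).1 σ * x ^ l * (ν / ρ) ^ (2 * l + 1) =
        -(2 * ν) * a * (2 * P) := by
      rw [hP, Finset.mul_sum, Finset.mul_sum]
      exact Finset.sum_congr rfl fun l _ => relCoeff_mul σ hνc hρ2' hε l
    rw [hδ, e1, hτ, herr, hDa]
    ring
  have hxn : ‖x‖ ≤ e ^ 2 := by
    rw [hx, he, norm_inv, norm_pow, norm_mul, Complex.norm_ofNat, Complex.norm_real,
      Real.norm_of_nonneg (by linarith), inv_pow]
    refine inv_anti₀ (by positivity) ?_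
    rw [mul_pow]
    linarith [sq_nonneg ν]
  have he2 : e ^ 2 ≤ 1 := pow_le_one₀ he0.le he1
  have hx1 : ‖x‖ ≤ 1 := hxn.trans he2
  have hw2 : ‖(ν / ρ : ℂ)‖ ≤ 2 := by
    rw [norm_div, Complex.norm_real, Real.norm_of_nonneg (by linarith), div_le_iff₀ (by linarith)]
    linarith
  have hwτ : (ν / ρ : ℂ) * (1 + 2 * x * τ) = 1 := by
    rw [hx, hτ]
    field_simp
    ring
  have hτδ : ‖τ - δ‖ ≤ K := by
    rw [hδ, sub_sub_cancel, hK]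
    refine (norm_sum_le _ _).trans (Finset.sum_le_sum fun l _ => ?_)
    rw [norm_mul, norm_mul, norm_pow, norm_pow]
    calc _ ≤ |c l| * 1 * 2 ^ (2 * l + 1) := by
          gcongr
          · exact (hc l σ hσ).trans (le_abs_self _)
          · exact pow_le_one₀ (norm_nonneg _) hx1
      _ = _ := by rw [mul_one]
  have h1 := hC₁ σ hσ x τ (ν / ρ) δ hx1 hw2 hwτ hτδ (by rw [hδ]; ring)
  have h2 := hC₂ σ hσ x hx1
  set T := evAX (approx (relCoeff Θ) s (s + 1)) σ x with hT
  have hsum : ∑ l ∈ Finset.range (s + 1), (rootCoeff Θ s l).1 σ / (2 * (ν : ℂ)) ^ (2 * l + 1) =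
      (2 * (ν : ℂ))⁻¹ * ∑ l ∈ Finset.range (s + 1), (rootCoeff Θ s l).1 σ * x ^ l := by
    rw [Finset.mul_sum]
    refine Finset.sum_congr rfl fun l _ => ?_
    rw [hx, inv_pow, ← pow_mul, pow_succ, div_eq_mul_inv, mul_inv]
    ring
  set H := ∑ l ∈ Finset.range (s + 1), (rootCoeff Θ s l).1 σ * x ^ l with hH
  have h2' : ‖T - H‖ ≤ C₂ * ‖x‖ ^ (s + 1) := h2
  have key : ρ - ν - (2 * (ν : ℂ))⁻¹ * H - leadTerm σ ν =
      (2 * (ν : ℂ))⁻¹ * ((τ - δ - T) + (T - H)) +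
        a * (oscTerm σ ν ε - oscTerm σ ν ε₀ - err) := by
    have e1 : (2 * (ν : ℂ))⁻¹ * τ = ρ - ν := by rw [hτ]; field_simp
    have e2 : (2 * (ν : ℂ))⁻¹ * δ = a * (oscTerm σ ν ε - err) := by rw [hδ']; field_simp
    rw [leadTerm]
    linear_combination e2 - e1
  have hosc : ‖oscTerm σ ν ε‖ ≤ e ^ (M + 1) * X := by
    refine (norm_oscTerm_le σ ν ε).trans ?_
    gcongr
    linarith
  have hδn : ‖δ‖ ≤ 2 * (1 + C₀) * (ν * e ^ (M + 1) * X) := by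
    have b1 : ‖err‖ ≤ C₀ * (e ^ (M + 1) * X) := by
      refine hD2.trans ?_
      rw [mul_assoc]
      gcongr ?_ * (?_ * ?_)
      exact pow_le_pow_of_le_one he0.le he1 (by omega)
    rw [hδ', norm_mul, norm_mul, norm_mul, Complex.norm_ofNat, Complex.norm_real,
      Real.norm_of_nonneg (by linarith)]
    calc 2 * ν * ‖a‖ * ‖oscTerm σ ν ε - err‖ ≤ 2 * ν * 1 * (e ^ (M + 1) * X +
          C₀ * (e ^ (M + 1) * X)) := by
          gcongr
          exact (norm_sub_le _ _).trans (add_le_add hosc b1)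
      _ = _ := by ring
  have hxs : ‖x‖ ^ (s + 1) ≤ e ^ (M + 2) := by
    calc ‖x‖ ^ (s + 1) ≤ (e ^ 2) ^ (s + 1) := by gcongr
      _ = e ^ (2 * s + 2) := by rw [← pow_mul]; rfl
      _ ≤ _ := pow_le_pow_of_le_one he0.le he1 (by omega)
  have hxe : e * ‖x‖ ^ (s + 1) ≤ e ^ (M + 2) * X := by
    rw [mul_comm]
    gcongr
    linarith
  have hxδ : e * (‖x‖ * ‖δ‖) ≤ 2 * (1 + C₀) * (e ^ (M + 2) * X) := by
    calc e * (‖x‖ * ‖δ‖) ≤ e * (e ^ 2 * (2 * (1 + C₀) * (ν * e ^ (M + 1) * X))) := by gcongr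
      _ = 2 * (1 + C₀) * (e * ((ν * e) * e ^ (M + 2) * X)) := by ring
      _ ≤ 2 * (1 + C₀) * (1 * ((ν * e) * e ^ (M + 2) * X)) := by gcongr
      _ = _ := by rw [hνe]; ring
  -- Replacing ρ by ν in the oscillatory term gains another factor 1/ν, because ε - ε₀ = 2iεε₀(ν -
  -- ρ) with ν - ρ bounded.
  have hG : ‖oscTerm σ ν ε - oscTerm σ ν ε₀‖ ≤ 4 * B * (M + 1) * (e ^ (M + 2) * X) := by
    have b1 : ε - ε₀ = 2 * Complex.I * ε * ε₀ * (ν - ρ) := by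
      linear_combination ε₀ * hε - ε * hε₀
    have b2 : ‖ε - ε₀‖ ≤ 4 * B * e ^ 2 := by
      have b3 : ‖(ν - ρ : ℂ)‖ ≤ 2 * B := by
        rw [norm_sub_rev]
        refine hBρ.trans ?_
        rw [div_le_iff₀ (by linarith)]
        calc B = 2 * B * (1 / 2) := by ring
          _ ≤ 2 * B * ‖ρ‖ := by gcongr; linarith
      rw [b1, norm_mul, norm_mul, norm_mul, norm_mul, Complex.norm_ofNat, Complex.norm_I]
      calc 2 * 1 * ‖ε‖ * ‖ε₀‖ * ‖(ν - ρ : ℂ)‖ ≤ 2 * 1 * e * e * (2 * B) := by gcongr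
        _ = _ := by ring
    refine (norm_oscTerm_sub_le σ ν ε ε₀).trans ?_
    calc _ ≤ ((M + 1) * e ^ M * (4 * B * e ^ 2)) * X := by
          gcongr
          · exact (norm_pow_sub_pow_le hεν hε₀ν M).trans (by gcongr)
          · linarith
      _ = _ := by ring
  rw [hsum, key]
  have hn2 : ‖(2 * (ν : ℂ))⁻¹‖ = e / 2 := by
    rw [norm_inv, norm_mul, Complex.norm_ofNat, Complex.norm_real,
      Real.norm_of_nonneg (by linarith), he, mul_inv]
    ring
  refine (norm_add_le _ _).trans ?_
  rw [norm_mul, norm_mul, hn2]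
  have f1 : e / 2 * ‖τ - δ - T + (T - H)‖ ≤
      e / 2 * (C₁ * (‖x‖ ^ (s + 1) + ‖x‖ * ‖δ‖) + C₂ * ‖x‖ ^ (s + 1)) := by
    gcongr
    exact (norm_add_le _ _).trans (add_le_add h1 h2')
  have f2 : ‖a‖ * ‖oscTerm σ ν ε - oscTerm σ ν ε₀ - err‖ ≤
      1 * (4 * B * (M + 1) * (e ^ (M + 2) * X) + C₀ * e ^ (M + 2) * X) := by
    gcongr
    exact (norm_sub_le _ _).trans (add_le_add hG hD2)
  have hY : 0 ≤ e ^ (M + 2) * X := by positivity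
  have f3 := mul_le_mul_of_nonneg_left hxe hC₁0
  have f4 := mul_le_mul_of_nonneg_left hxδ hC₁0
  have f5 := mul_le_mul_of_nonneg_left hxe hC₂0
  have f6 : 0 ≤ C₁ * (e ^ (M + 2) * X) := mul_nonneg hC₁0 hY
  have f7 : 0 ≤ C₂ * (e ^ (M + 2) * X) := mul_nonneg hC₂0 hY
  linarith

end SturmLiouville

end

noncomputable section

namespace SturmLiouville

open Set intervalIntegral

/-! ### Summability of the remainder -/

theorem sum_add_sq_le {ι : Type*} (S : Finset ι) {f g : ι → ℝ} {a b : ℝ}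
    (hf : ∑ k ∈ S, f k ^ 2 ≤ a) (hg : ∑ k ∈ S, g k ^ 2 ≤ b) :
    ∑ k ∈ S, (f k + g k) ^ 2 ≤ 2 * a + 2 * b := by
  calc ∑ k ∈ S, (f k + g k) ^ 2 ≤ ∑ k ∈ S, (2 * f k ^ 2 + 2 * g k ^ 2) :=
        Finset.sum_le_sum fun k _ => by nlinarith [sq_nonneg (f k - g k)]
    _ = 2 * ∑ k ∈ S, f k ^ 2 + 2 * ∑ k ∈ S, g k ^ 2 := by
        rw [Finset.sum_add_distrib, Finset.mul_sum, Finset.mul_sum]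
    _ ≤ _ := by linarith

theorem sum_oscSize_sq_le {s : ℝ} (hs : s = 1 ∨ s = -1) (θ : ℝ) {g : ℝ → ℂ} (hg : MemLp g 2 mu0)
    (S : Finset ℕ+) : ∑ k ∈ S, OscData.oscSize (s * (k - θ)) g ^ 2 ≤
      2 * (Real.pi * l2norm g ^ 2) + 2 * (Real.pi ^ 2 * l2norm g ^ 2) :=
  sum_add_sq_le S (bessel hs θ hg S) (bessel_l2norm hs θ hg S)

variable {M : ℕ}

/-- Both forms of Bessel's inequality, applied to the leading defect and to the next coefficient, at
the frequencies ν and -ν. -/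
theorem exists_sum_pairOsc_sq_le (M : ℕ) (θ R : ℝ) : ∃ C : ℝ, ∀ σ : Sobolev (M + 1),
    potentialNorm σ ≤ R → ∀ S : Finset ℕ+, ∑ k ∈ S, pairOsc σ (k - θ) ^ 2 ≤ C := by
  obtain ⟨c, hc0, hc⟩ := exists_norm_wkbS_le M R
  obtain ⟨A, hA⟩ : ∃ A, A = 2 * (Real.pi * |R| ^ 2) + 2 * (Real.pi ^ 2 * |R| ^ 2) := ⟨_, rfl⟩
  obtain ⟨A', hA'⟩ : ∃ A', A' = 2 * (Real.pi * (2 * c) ^ 2) + 2 * (Real.pi ^ 2 * (2 * c) ^ 2) :=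
    ⟨_, rfl⟩
  refine ⟨2 * (2 * A + 2 * A') + 2 * (2 * A + 2 * A'), fun σ hσ S => ?_⟩
  have h : ∀ s : ℝ, s = 1 ∨ s = -1 → ∑ k ∈ S, wkbOsc σ (s * (k - θ)) ^ 2 ≤ 2 * A + 2 * A' := by
    intro s hs
    have hpi := Real.pi_pos
    refine sum_add_sq_le S ((sum_oscSize_sq_le hs θ (memLp_leadPot σ) S).trans ?_)
      ((sum_oscSize_sq_le hs θ (memLp_ext (evP σ (wkbRest (M + 1)))) S).trans ?_)
    · have h1 : l2norm (leadPot σ) ≤ |R| := by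
        rw [l2norm_leadPot]
        exact (norm_topDeriv_le (Nat.succ_pos M) σ).trans (hσ.trans (le_abs_self R))
      have h2 := l2norm_nonneg (leadPot σ)
      rw [hA]
      gcongr
    · have h1 : l2norm (ext (evP σ (wkbRest (M + 1)))) ≤ 2 * c :=
        (l2norm_ext_le _).trans (by linarith [(hc σ hσ 0 (by simp)).2.2])
      have h2 := l2norm_nonneg (ext (evP σ (wkbRest (M + 1))))
      rw [hA']
      gcongr
  have h1 := h 1 (Or.inl rfl)
  have h2 := h (-1) (Or.inr rfl)
  simp only [one_mul] at h1
  simp only [neg_one_mul] at h2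
  exact sum_add_sq_le S h1 h2

theorem exists_sum_inv_sq_le : ∃ C : ℝ, ∀ S : Finset ℕ+, ∑ k ∈ S, ((k : ℝ)⁻¹) ^ 2 ≤ C := by
  have h : Summable fun k : ℕ+ => ((k : ℝ)⁻¹) ^ 2 := by
    have h1 : Summable fun n : ℕ => ((n : ℝ)⁻¹) ^ 2 := by
      simp only [inv_pow]
      exact Real.summable_nat_pow_inv.2 one_lt_two
    exact h1.comp_injective PNat.coe_injective
  exact ⟨_, fun S => h.sum_le_tsum S fun k _ => by positivity⟩

variable {N : Sobolev (M + 1) → ℝ} {Θ : Polynomial (niceAlg N)} {Δ : Sobolev (M + 1) → ℂ → ℂ}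
  {Δ₀ : ℂ → ℂ} {e : ℕ} {θ₀ : ℝ}

/-- Beyond an index n that depends only on R the asymptotics apply. For k ≤ n every term is bounded
crudely, which costs a factor n^(M + 3) but keeps the constant uniform on the ball. -/
theorem exists_remainder_le (hN : ∀ σ, potentialNorm σ ≤ N σ) (hrel : PhaseRel Θ Δ θ₀) {s : ℕ}
    (hs : M ≤ 2 * s) (h₀ : IsCharModel Δ₀ e θ₀)
    (hchar : ∀ R : ℝ, ∃ K : ℝ, 1 ≤ K ∧ ∀ σ, N σ ≤ R → IsCharLike (Δ σ) e θ₀ K)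
    {Γ : Sobolev (M + 1) → Submodule ℂ (L2 × L2)}
    (hΓ : ∀ σ z, algMult (Γ σ) z = analyticOrderAt (Δ σ) z) (R : ℝ) :
    ∃ A : ℝ, 0 ≤ A ∧ ∀ σ, N σ ≤ R → ∀ ev : ℕ+ → ℂ, IsEigenvalueSeq (Γ σ) ev → ∀ k : ℕ+,
      ‖csqrt (ev k) - ((k - θ₀ : ℝ) : ℂ) - ∑ l ∈ Finset.range (s + 1),
        (rootCoeff Θ s l).1 σ / (2 * ((k - θ₀ : ℝ) : ℂ)) ^ (2 * l + 1) - leadTerm σ (k - θ₀)‖ *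
        (k : ℝ) ^ (M + 2) ≤ A * (pairOsc σ (k - θ₀) + (k : ℝ)⁻¹) := by
  obtain ⟨K, hK1, hK⟩ := hchar R
  obtain ⟨C, hC1, hC⟩ := exists_root_asymptotics hN hrel hs R (B := 3 * K) (by positivity)
  obtain ⟨L, hL0, hL⟩ := exists_wkbOsc_le M R
  choose c hc using fun l => (rootCoeff Θ s l).2.2 R
  obtain ⟨n, hn⟩ := exists_nat_gt (24 * K + C + 1)
  have hθ := h₀.kind.bounds
  set D : ℝ := (n + 1) + n + ∑ l ∈ Finset.range (s + 1), |c l| + 2 * L with hD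
  have hD0 : 0 ≤ D := by positivity
  have hA1 : 0 ≤ C * 2 ^ (M + 3) := by positivity
  have hA2 : 0 ≤ D * (n : ℝ) ^ (M + 3) := by positivity
  refine ⟨C * 2 ^ (M + 3) + D * n ^ (M + 3), by positivity, fun σ hσ ev hev k => ?_⟩
  have hk1 : (1 : ℝ) ≤ k := by exact_mod_cast k.pos
  obtain ⟨hle, hgt⟩ := csqrt_eigenvalue_near (hK σ hσ) h₀ hK1 (hΓ σ) hev (N := n) (by linarith) k
  have hκ := pairOsc_nonneg σ (k - θ₀)
  set ν : ℝ := k - θ₀ with hν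
  have hνk : (k : ℝ) / 2 ≤ ν := by linarith [hθ.2]
  have hki : 0 < (k : ℝ)⁻¹ := by positivity
  rcases lt_or_ge n k with hnk | hnk
  · obtain ⟨h1, h2⟩ := hgt hnk
    have hnk' : (n : ℝ) < k := by exact_mod_cast hnk
    have h3 := hC σ hσ k (csqrt (ev k)) ν hν (by linarith [hθ.2]) h2
      (by rw [mul_div_assoc]; exact h1) (by rw [csqrt_sq]; exact eval_eq_zero (hΓ σ) hev k)
    have h4 : ν⁻¹ ≤ 2 * (k : ℝ)⁻¹ := by
      rw [show 2 * (k : ℝ)⁻¹ = ((k : ℝ) / 2)⁻¹ by rw [inv_div]; rfl]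
      exact inv_anti₀ (by positivity) hνk
    have h5 : 0 ≤ ν⁻¹ := inv_nonneg.2 (by linarith)
    calc _ ≤ C * ν⁻¹ ^ (M + 2) * (pairOsc σ ν + ν⁻¹) * (k : ℝ) ^ (M + 2) := by gcongr
      _ ≤ C * (2 * (k : ℝ)⁻¹) ^ (M + 2) * (2 * (pairOsc σ ν + (k : ℝ)⁻¹)) * (k : ℝ) ^ (M + 2) := by
          gcongr
          linarith
      _ = C * 2 ^ (M + 3) * (pairOsc σ ν + (k : ℝ)⁻¹) * ((k : ℝ)⁻¹ * k) ^ (M + 2) := by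
          rw [mul_pow, mul_pow]; ring
      _ = C * 2 ^ (M + 3) * (pairOsc σ ν + (k : ℝ)⁻¹) := by
          rw [inv_mul_cancel₀ (by linarith), one_pow, mul_one]
      _ ≤ _ := by gcongr; linarith
  · have hkn : (k : ℝ) ≤ n := by exact_mod_cast hnk
    have hn1 : (1 : ℝ) ≤ n := hk1.trans hkn
    have h1 := hle hnk
    have h2ν : 1 ≤ ‖(2 * (ν : ℂ))‖ := by
      rw [norm_mul, Complex.norm_ofNat, Complex.norm_real, Real.norm_of_nonneg (by linarith)]
      linarith
    have b1 : ‖(ν : ℂ)‖ ≤ n := by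
      rw [Complex.norm_real, Real.norm_of_nonneg (by linarith)]
      linarith [hθ.1]
    have b2 : ‖∑ l ∈ Finset.range (s + 1), (rootCoeff Θ s l).1 σ / (2 * (ν : ℂ)) ^ (2 * l + 1)‖ ≤
        ∑ l ∈ Finset.range (s + 1), |c l| := by
      refine (norm_sum_le _ _).trans (Finset.sum_le_sum fun l _ => ?_)
      rw [norm_div, norm_pow]
      exact (div_le_self (norm_nonneg _) (one_le_pow₀ h2ν)).trans
        ((hc l σ hσ).trans (le_abs_self _))
    have b3 : ‖leadTerm σ ν‖ ≤ 2 * L := by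
      have c1 : ‖(2 * Real.pi * Complex.I : ℂ)⁻¹‖ ≤ 1 := by
        rw [norm_inv]
        refine inv_le_one_of_one_le₀ ?_
        rw [norm_mul, norm_mul, Complex.norm_ofNat, Complex.norm_I, Complex.norm_real,
          Real.norm_of_nonneg Real.pi_pos.le]
        linarith [Real.pi_gt_three]
      have c2 : ‖(2 * Complex.I * ν : ℂ)⁻¹‖ ≤ 1 := by
        rw [norm_inv]
        refine inv_le_one_of_one_le₀ ?_
        rw [mul_right_comm, norm_mul, Complex.norm_I, mul_one]
        exact h2ν
      have c3 : pairOsc σ ν ≤ 2 * L := by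
        have a1 := hL σ ((hN σ).trans hσ) ν
        have a2 := hL σ ((hN σ).trans hσ) (-ν)
        rw [pairOsc]; linarith
      rw [leadTerm, norm_mul]
      calc _ ≤ 1 * (1 ^ (M + 1) * (2 * L)) := by
            gcongr
            refine (norm_oscTerm_le σ ν _).trans ?_
            gcongr
        _ = _ := by rw [one_pow, one_mul, one_mul]
    have b4 : ∀ a b c d : ℂ, ‖a - b - c - d‖ ≤ ‖a‖ + ‖b‖ + ‖c‖ + ‖d‖ := fun a b c d => by
      linarith [norm_sub_le (a - b - c) d, norm_sub_le (a - b) c, norm_sub_le a b]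
    have b5 : (1 : ℝ) ≤ n * (k : ℝ)⁻¹ := by
      rw [← div_eq_mul_inv, le_div_iff₀ (by linarith)]; linarith
    calc _ ≤ D * (n : ℝ) ^ (M + 2) := by
          gcongr
          refine (b4 _ _ _ _).trans ?_
          rw [hD]
          linarith
      _ ≤ D * (n : ℝ) ^ (M + 2) * (n * (k : ℝ)⁻¹) := le_mul_of_one_le_right (by positivity) b5
      _ = D * (n : ℝ) ^ (M + 3) * (k : ℝ)⁻¹ := by ring
      _ ≤ _ := by
          refine mul_le_mul (by linarith) (by linarith) hki.le (by positivity)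

/-- The remainder of the asymptotics of the square roots of the eigenvalues is in `ℓ₂`. -/
theorem exists_lp_remainder (hN : ∀ σ, potentialNorm σ ≤ N σ) (hrel : PhaseRel Θ Δ θ₀) {s : ℕ}
    (hs : M ≤ 2 * s) (h₀ : IsCharModel Δ₀ e θ₀)
    (hchar : ∀ R : ℝ, ∃ K : ℝ, 1 ≤ K ∧ ∀ σ, N σ ≤ R → IsCharLike (Δ σ) e θ₀ K)
    {Γ : Sobolev (M + 1) → Submodule ℂ (L2 × L2)}
    (hΓ : ∀ σ z, algMult (Γ σ) z = analyticOrderAt (Δ σ) z) (R : ℝ) :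
    ∃ C : ℝ, ∀ σ, N σ ≤ R → ∀ ev : ℕ+ → ℂ, IsEigenvalueSeq (Γ σ) ev →
      ∃ α : lp (fun _ : ℕ+ => ℂ) 2, ‖α‖ ≤ C ∧ ∀ k : ℕ+,
        csqrt (ev k) = ((k - θ₀ : ℝ) : ℂ) + ∑ l ∈ Finset.range (s + 1),
          (rootCoeff Θ s l).1 σ / (2 * ((k - θ₀ : ℝ) : ℂ)) ^ (2 * l + 1) + leadTerm σ (k - θ₀) +
          α k / (k : ℂ) ^ (M + 2) := by
  obtain ⟨A, hA0, hA⟩ := exists_remainder_le hN hrel hs h₀ hchar hΓ R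
  obtain ⟨C₁, hC₁⟩ := exists_sum_pairOsc_sq_le M θ₀ R
  obtain ⟨C₂, hC₂⟩ := exists_sum_inv_sq_le
  set C : ℝ := A ^ 2 * (2 * C₁ + 2 * C₂) with hC
  refine ⟨√C, fun σ hσ ev hev => ?_⟩
  set β : ℕ+ → ℂ := fun k => (csqrt (ev k) - ((k - θ₀ : ℝ) : ℂ) - ∑ l ∈ Finset.range (s + 1),
    (rootCoeff Θ s l).1 σ / (2 * ((k - θ₀ : ℝ) : ℂ)) ^ (2 * l + 1) - leadTerm σ (k - θ₀)) *
      (k : ℂ) ^ (M + 2) with hβ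
  have hβn : ∀ k, ‖β k‖ ≤ A * (pairOsc σ (k - θ₀) + (k : ℝ)⁻¹) := fun k => by
    rw [hβ, norm_mul, norm_pow, Complex.norm_natCast]
    exact hA σ hσ ev hev k
  have hsum : ∀ S : Finset ℕ+, ∑ k ∈ S, ‖β k‖ ^ (2 : ENNReal).toReal ≤ C := fun S => by
    rw [ENNReal.toReal_ofNat]
    simp only [Real.rpow_ofNat]
    calc ∑ k ∈ S, ‖β k‖ ^ 2 ≤ ∑ k ∈ S, A ^ 2 * (pairOsc σ (k - θ₀) + (k : ℝ)⁻¹) ^ 2 :=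
          Finset.sum_le_sum fun k _ => by
            rw [← mul_pow]
            exact pow_le_pow_left₀ (norm_nonneg _) (hβn k) 2
      _ ≤ C := by
          rw [← Finset.mul_sum, hC]
          gcongr
          exact sum_add_sq_le S (hC₁ σ ((hN σ).trans hσ) S) (hC₂ S)
  have hC0 : 0 ≤ C := by simpa using hsum ∅
  refine ⟨⟨β, memℓp_gen' hsum⟩, lp.norm_le_of_forall_sum_le (by simp) (Real.sqrt_nonneg _)
    fun S => (hsum S).trans_eq ?_, fun k => ?_⟩
  · rw [ENNReal.toReal_ofNat, Real.rpow_ofNat, Real.sq_sqrt hC0]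
  · have hk : (k : ℂ) ^ (M + 2) ≠ 0 := pow_ne_zero _ (by exact_mod_cast k.ne_zero)
    change _ = _ + β k / _
    rw [hβ]
    simp only [mul_div_cancel_right₀ _ hk]
    ring

end SturmLiouville

end

noncomputable section

namespace SturmLiouville

open Set intervalIntegral

/-! ### The leading term through Fourier coefficients -/

section LeadTerm

variable {M : ℕ}

theorem fourInt_add_fourInt_neg {g : ℝ → ℂ} (hg : MemLp g 2 mu0) (ν : ℝ) :
    fourInt ν g Real.pi + fourInt (-ν) g Real.pi = Real.pi * cosCoeff g (2 * ν) := by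
  have hi : ∀ ν : ℝ, IntervalIntegrable (fun t : ℝ => Complex.exp (2 * Complex.I * ν * t) * g t)
      volume 0 Real.pi := fun ν => by
    rw [intervalIntegrable_iff_integrableOn_Icc_of_le Real.pi_pos.le]
    exact integrableOn_of_memLp (memLp_cexp_mul ν hg)
  have hpi : (Real.pi : ℂ) ≠ 0 := Complex.ofReal_ne_zero.2 Real.pi_ne_zero
  rw [fourInt, fourInt, ← integral_add (hi ν) (hi (-ν)), cosCoeff, ← mul_assoc,
    mul_div_cancel₀ _ hpi, ← intervalIntegral.integral_const_mul]
  congr 1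
  ext t
  rw [Complex.ofReal_cos, Complex.cos,
    show (2 * Complex.I * ν * t : ℂ) = ((2 * ν * t : ℝ) : ℂ) * Complex.I by push_cast; ring,
    show (2 * Complex.I * (-ν : ℝ) * t : ℂ) = -((2 * ν * t : ℝ) : ℂ) * Complex.I by
      push_cast; ring]
  ring

theorem fourInt_sub_fourInt_neg {g : ℝ → ℂ} (hg : MemLp g 2 mu0) (ν : ℝ) :
    fourInt ν g Real.pi - fourInt (-ν) g Real.pi =
      Complex.I * Real.pi * sinCoeff g (2 * ν) := by
  have hi : ∀ ν : ℝ, IntervalIntegrable (fun t : ℝ => Complex.exp (2 * Complex.I * ν * t) * g t)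
      volume 0 Real.pi := fun ν => by
    rw [intervalIntegrable_iff_integrableOn_Icc_of_le Real.pi_pos.le]
    exact integrableOn_of_memLp (memLp_cexp_mul ν hg)
  have hpi : (Real.pi : ℂ) ≠ 0 := Complex.ofReal_ne_zero.2 Real.pi_ne_zero
  rw [fourInt, fourInt, ← integral_sub (hi ν) (hi (-ν)), sinCoeff, ← mul_assoc,
    mul_assoc Complex.I, mul_div_cancel₀ _ hpi, ← intervalIntegral.integral_const_mul]
  congr 1
  ext t
  rw [Complex.ofReal_sin, Complex.sin,
    show (2 * Complex.I * ν * t : ℂ) = ((2 * ν * t : ℝ) : ℂ) * Complex.I by push_cast; ring,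
    show (2 * Complex.I * (-ν : ℝ) * t : ℂ) = -((2 * ν * t : ℝ) : ℂ) * Complex.I by
      push_cast; ring]
  linear_combination (g t * (Complex.exp (((2 * ν * t : ℝ) : ℂ) * Complex.I) -
    Complex.exp (-((2 * ν * t : ℝ) : ℂ) * Complex.I))) * Complex.I_sq

theorem fourInt_leadPot (σ : Sobolev (M + 1)) (ν : ℝ) :
    fourInt ν (leadPot σ) Real.pi = (-1) ^ M * fourInt ν (topDeriv σ) Real.pi := by
  rw [fourInt, fourInt, ← intervalIntegral.integral_const_mul]
  congr 1
  ext t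
  rw [leadPot]
  ring

/-- ε^(M + 1) is odd in ε, so the transforms at ν and -ν add up to a cosine coefficient; the powers
of i combine to the sign. -/
theorem leadTerm_odd {s : ℕ} (hM : M = 2 * s) (σ : Sobolev (M + 1)) (ν : ℝ) : leadTerm σ ν =
    -((-1) ^ s * cosCoeff (topDeriv σ) (2 * ν) / (2 * (2 * (ν : ℂ)) ^ (2 * s + 1))) := by
  have hpi : (Real.pi : ℂ) ≠ 0 := Complex.ofReal_ne_zero.2 Real.pi_ne_zero
  have h1 := fourInt_add_fourInt_neg (memLp_topDeriv σ) ν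
  have h2 : (2 * Complex.I * ν : ℂ)⁻¹ ^ (M + 1) =
      -((-1) ^ s * Complex.I) * ((2 * (ν : ℂ)) ^ (2 * s + 1))⁻¹ := by
    rw [hM, mul_right_comm, mul_inv, mul_pow, Complex.inv_I, (odd_two_mul_add_one s).neg_pow,
      inv_pow, pow_succ Complex.I, pow_mul, Complex.I_sq]
    ring
  have h3 : (2 * Real.pi * Complex.I : ℂ)⁻¹ = -Complex.I / (2 * Real.pi) := by
    rw [mul_inv, Complex.inv_I]; ring
  have hodd : Odd (M + 1) := ⟨s, by omega⟩
  have heven : Even M := ⟨s, by omega⟩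
  rw [leadTerm, oscTerm, fourInt_leadPot, fourInt_leadPot, neg_pow (2 * Complex.I * (ν : ℂ))⁻¹, h2, h3, hodd.neg_one_pow,
    heven.neg_one_pow]
  generalize cosCoeff (topDeriv σ) (2 * ν) = c at *
  generalize (2 * (ν : ℂ)) ^ (2 * s + 1) = d
  calc _ = Complex.I ^ 2 * ((-1) ^ s * d⁻¹ * (2 * (Real.pi : ℂ))⁻¹) *
        (fourInt ν (topDeriv σ) Real.pi + fourInt (-ν) (topDeriv σ) Real.pi) := by ring
    _ = -((-1) ^ s * c / (2 * d)) * (Real.pi / Real.pi) := by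
        rw [h1, Complex.I_sq, mul_inv, div_eq_mul_inv, mul_inv]; ring
    _ = _ := by rw [div_self hpi, mul_one]

/-- Now ε^(M + 1) is even in ε, so the transforms at ν and -ν are subtracted and a sine coefficient
appears. -/
theorem leadTerm_even {s : ℕ} (hM : M + 1 = 2 * s) (σ : Sobolev (M + 1)) (ν : ℝ) : leadTerm σ ν =
    -((-1) ^ s * sinCoeff (topDeriv σ) (2 * ν) / (2 * (2 * (ν : ℂ)) ^ (2 * s))) := by
  have hpi : (Real.pi : ℂ) ≠ 0 := Complex.ofReal_ne_zero.2 Real.pi_ne_zero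
  have h1 := fourInt_sub_fourInt_neg (memLp_topDeriv σ) ν
  have h2 : (2 * Complex.I * ν : ℂ)⁻¹ ^ (M + 1) = (-1) ^ s * ((2 * (ν : ℂ)) ^ (2 * s))⁻¹ := by
    rw [hM, mul_right_comm, mul_inv, mul_pow, Complex.inv_I, (even_two_mul s).neg_pow,
      inv_pow, pow_mul Complex.I, Complex.I_sq]
    ring
  have h3 : (2 * Real.pi * Complex.I : ℂ)⁻¹ = -Complex.I / (2 * Real.pi) := by
    rw [mul_inv, Complex.inv_I]; ring
  have hodd : Odd M := ⟨s - 1, by omega⟩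
  have heven : Even (M + 1) := ⟨s, by omega⟩
  rw [leadTerm, oscTerm, fourInt_leadPot, fourInt_leadPot, neg_pow (2 * Complex.I * (ν : ℂ))⁻¹, h2, h3, heven.neg_one_pow,
    hodd.neg_one_pow]
  generalize sinCoeff (topDeriv σ) (2 * ν) = c at *
  generalize (2 * (ν : ℂ)) ^ (2 * s) = d
  calc _ = Complex.I * ((-1) ^ s * d⁻¹ * (2 * (Real.pi : ℂ))⁻¹) *
        (fourInt ν (topDeriv σ) Real.pi - fourInt (-ν) (topDeriv σ) Real.pi) := by ring
    _ = Complex.I ^ 2 * ((-1) ^ s * c / (2 * d)) * (Real.pi / Real.pi) := by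
        rw [h1, mul_inv, div_eq_mul_inv, mul_inv]; ring
    _ = _ := by rw [div_self hpi, mul_one, Complex.I_sq]; ring

end LeadTerm

/-! ### The functionals -/

section Functionals

variable {m : ℕ} {N : Sobolev m → ℝ}

theorem isContBdd_of_niceAlg {c : ℝ} (hc : ∀ σ, N σ ≤ c * ‖σ‖) (hc0 : 0 ≤ c) (f : niceAlg N) :
    IsContBdd f.1 := by
  refine ⟨f.2.1.continuous, fun R => ?_⟩
  obtain ⟨C, hC⟩ := f.2.2 (c * R)
  exact ⟨C, fun σ hσ => hC σ ((hc σ).trans (by gcongr))⟩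

theorem hasLinearPart_of_sub_mem {f : niceAlg N} {A : Sobolev m →L[ℂ] ℂ} {f₀ : Sobolev m → ℂ}
    (hA : (A : Sobolev m → ℂ) ∈ niceSubalg N) (h : f - toNice hA ∈ flatIdeal N)
    (hf₀ : ∀ σ, A σ = f₀ σ) : HasLinearPart f.1 f₀ := by
  obtain ⟨h1, h2⟩ := h
  have h3 : ∀ σ, (f - toNice hA).1 σ = f.1 σ - A σ := fun σ => rfl
  rw [h3, map_zero, sub_zero] at h1
  refine ⟨h1, A, hf₀, ?_⟩
  have h4 := h2.add A.hasFDerivAt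
  rw [zero_add] at h4
  refine h4.congr_of_eventuallyEq (.of_forall fun σ => ?_)
  rw [Pi.add_apply, h3, sub_add_cancel]

theorem toNice_mem_vanIdeal {A : Sobolev m →L[ℂ] ℂ} (hA : (A : Sobolev m → ℂ) ∈ niceSubalg N) :
    toNice hA ∈ vanIdeal N := A.map_zero

theorem mem_vanIdeal_of_sub_mem {f : niceAlg N} {A : Sobolev m →L[ℂ] ℂ}
    (hA : (A : Sobolev m → ℂ) ∈ niceSubalg N) (h : f - toNice hA ∈ flatIdeal N) :
    f ∈ vanIdeal N := by
  have := add_mem (flatIdeal_le_vanIdeal h) (toNice_mem_vanIdeal hA)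
  rwa [sub_add_cancel] at this

theorem smul_mem_niceSubalg (a : ℂ) {A : Sobolev m →L[ℂ] ℂ}
    (hA : (A : Sobolev m → ℂ) ∈ niceSubalg N) :
    ((a • A : Sobolev m →L[ℂ] ℂ) : Sobolev m → ℂ) ∈ niceSubalg N :=
  (niceSubalg N).smul_mem hA a

/-- The linear parts of the coefficients of the asymptotic expansion. -/
theorem hasLinearPart_rootCoeff {Θ : Polynomial (niceAlg N)} {s : ℕ}
    {A : ℕ → Sobolev m →L[ℂ] ℂ} (hA : ∀ l, (A l : Sobolev m → ℂ) ∈ niceSubalg N)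
    (h : ∀ l ≤ s, Θ.coeff (2 * l + 1) - toNice (hA l) ∈ flatIdeal N) {l : ℕ} (hl : l ≤ s)
    {f₀ : Sobolev m → ℂ} (hf₀ : ∀ σ, (-1) ^ l / Real.pi * A l σ = f₀ σ) :
    HasLinearPart (rootCoeff Θ s l).1 f₀ := by
  refine hasLinearPart_of_sub_mem (A := ((-1) ^ l / Real.pi : ℂ) • A l)
    (smul_mem_niceSubalg _ (hA l)) ?_ hf₀
  have h1 := rootCoeff_sub_mem (fun j hj => mem_vanIdeal_of_sub_mem (hA j) (h j hj)) hl
  have h2 := Ideal.mul_mem_left _ (algebraMap ℂ (niceAlg N) ((-1) ^ l / Real.pi)) (h l hl)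
  have h3 := add_mem h1 h2
  rw [mul_sub, ← relCoeff, sub_add_sub_cancel] at h3
  exact h3

end Functionals

end SturmLiouville

end

noncomputable section

namespace SturmLiouville

open Set intervalIntegral

/-! ### The two spectral problems -/

variable {M : ℕ}

theorem IsCharLike.fun_ne_zero {Δ : ℂ → ℂ} {e : ℕ} {θ K : ℝ} (h : IsCharLike Δ e θ K)
    (hK : 1 ≤ K) : Δ ≠ 0 := by
  obtain ⟨n, hn⟩ := exists_nat_gt (24 * K)
  have hθ := h.kind.bounds
  rintro rfl
  refine h.ne_zero hn (ρ := ((n + 1 / 2 - θ : ℝ) : ℂ)) ?_ hK rfl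
  rw [Complex.norm_real, Real.norm_of_nonneg (by linarith [hθ.2])]

theorem integral_norm_derivPot_le (σ : Sobolev (M + 1)) {R : ℝ} (hσ : potentialNorm σ ≤ R) :
    ∫ t in Icc 0 Real.pi, ‖derivPot σ 0 t‖ ≤ 20 * |R| := by
  have h1 := integral_norm_le_l2norm (memLp_derivPot σ (n := 0))
  have h2 := l2norm_derivPot_le σ (n := 0)
  linarith [le_abs_self R]

theorem exists_isCharLike_dirichlet (R : ℝ) : ∃ K : ℝ, 1 ≤ K ∧ ∀ σ : Sobolev (M + 1),
    potentialNorm σ ≤ R → IsCharLike (charFun (memLp_derivPot σ (n := 0)) 1 0) 1 0 K :=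
  ⟨2 * (20 * |R|) + 1, by linarith [abs_nonneg R], fun σ hσ =>
    isCharLike_dirichlet _ (integral_norm_derivPot_le σ hσ)⟩

theorem exists_isCharLike_neumann (R : ℝ) : ∃ K : ℝ, 1 ≤ K ∧ ∀ σ : Sobolev (M + 1),
    sizeDN σ ≤ R →
      IsCharLike (charFun (memLp_derivPot σ (n := 0)) (-rep σ 0 Real.pi) 1) 0 (1 / 2) K :=
  ⟨4 * (20 * |R|) + 1, by linarith [abs_nonneg R], fun σ hσ =>
    isCharLike_neumann _ (integral_norm_derivPot_le σ ((le_sizeDN σ).trans hσ))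
      (by linarith [(le_max_right _ _).trans hσ, le_abs_self R, abs_nonneg R])⟩

theorem algMult_opD (σ : Sobolev (M + 1)) (z : ℂ) :
    algMult (opD σ) z = analyticOrderAt (charFun (memLp_derivPot σ (n := 0)) 1 0) z := by
  obtain ⟨K, hK1, hK⟩ := exists_isCharLike_dirichlet (M := M) (potentialNorm σ)
  exact algMult_eq _ (hasACDeriv_derivPot σ (Nat.zero_le M)) (fun y w => by simp) z
    ((hK σ le_rfl).fun_ne_zero hK1)

/-- The condition y^{[1]}(π) = 0 in terms of y and y' has b₀ = -σ(π), b₁ = 1. -/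
theorem algMult_opDN (σ : Sobolev (M + 1)) (z : ℂ) : algMult (opDN σ) z =
    analyticOrderAt (charFun (memLp_derivPot σ (n := 0)) (-rep σ 0 Real.pi) 1) z := by
  obtain ⟨K, hK1, hK⟩ := exists_isCharLike_neumann (M := M) (sizeDN σ)
  refine algMult_eq _ (hasACDeriv_derivPot σ (Nat.zero_le M)) (fun y w => ?_) z
    ((hK σ le_rfl).fun_ne_zero hK1)
  rw [LinearMap.mem_ker, LinearMap.snd_apply, neg_mul, one_mul, neg_add_eq_sub]

/-- The coefficients of the asymptotics of the Dirichlet spectrum. -/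
def coeffD (M s l : ℕ) : niceAlg (potentialNorm (m := M + 1)) :=
  rootCoeff (phaseD fun _ => le_rfl) s l

/-- The coefficients of the asymptotics of the Dirichlet–Neumann spectrum. -/
def coeffDN (M s l : ℕ) : niceAlg (sizeDN (m := M + 1)) := rootCoeff (phaseDN M) s l

theorem isContBdd_coeffD (M s l : ℕ) : IsContBdd (coeffD M s l).1 :=
  isContBdd_of_niceAlg (c := 1) (fun σ => by rw [one_mul]; exact potentialNorm_le σ) zero_le_one _

/-- The factor 5 is the embedding constant of `norm_rep_le`, needed for σ(π). -/
theorem isContBdd_coeffDN (M s l : ℕ) : IsContBdd (coeffDN M s l).1 := by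
  refine isContBdd_of_niceAlg (c := 5) (fun σ => max_le ?_ ?_) (by norm_num) _
  · linarith [potentialNorm_le σ, norm_nonneg σ]
  · exact norm_rep_le σ (Nat.succ_pos M) pi_mem_Icc_pi

theorem hasLinearPart_coeffD {s l : ℕ} (hs : 2 * s ≤ M + 1) (hl : l ≤ s) :
    HasLinearPart (coeffD M s l).1 (hLin l) := by
  refine hasLinearPart_rootCoeff (A := fun l => jumpLin (2 * l))
    (fun l => jumpLin_mem (fun _ => le_rfl) (2 * l)) (fun j hj => ?_) hl fun σ => ?_
  · rw [coeff_phaseD _ (by omega)]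
    exact phaseEl_sub_mem _ (2 * j)
  · rw [jumpLin_apply, (even_two_mul l).neg_one_pow, one_mul, hLin]

theorem hasLinearPart_coeffDN {s l : ℕ} (hs : 2 * s ≤ M + 1) (hl : l ≤ s) :
    HasLinearPart (coeffDN M s l).1 (gLin l) := by
  refine hasLinearPart_rootCoeff (A := fun l => sumLin (2 * l))
    (fun l => sumLin_mem (2 * l)) (fun j hj => coeff_phaseDN_sub_mem (by omega)) hl fun σ => ?_
  rw [sumLin_apply, (odd_two_mul_add_one l).neg_one_pow, gLin]
  ring

/-- For m = 2s the index 2s lies beyond the existing representatives, so the general formula for the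
linear part also yields the exceptional value zero at j = s. -/
theorem hLin_eq_zero {m l : ℕ} (h : m ≤ 2 * l) : (hLin l : Sobolev m → ℂ) = 0 := by
  ext σ
  rw [hLin, rep_of_le σ h]
  simp

theorem gLin_eq_zero {m l : ℕ} (h : m ≤ 2 * l) : (gLin l : Sobolev m → ℂ) = 0 := by
  ext σ
  rw [gLin, rep_of_le σ h]
  simp

theorem exists_asymptotics_opD {s : ℕ} (hs : M ≤ 2 * s) (R : ℝ) : ∃ C : ℝ,
    ∀ σ : Sobolev (M + 1), potentialNorm σ ≤ R → ∀ ev : ℕ+ → ℂ, IsEigenvalueSeq (opD σ) ev →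
      ∃ α : lp (fun _ : ℕ+ => ℂ) 2, ‖α‖ ≤ C ∧ ∀ k : ℕ+, ev k ^ (1 / 2 : ℂ) = (k : ℂ)
        + ∑ j : Fin (s + 1), (coeffD M s j).1 σ / (2 * (k : ℂ)) ^ (2 * (j : ℕ) + 1)
        + leadTerm σ k + α k / (k : ℂ) ^ (M + 2) := by
  obtain ⟨C, hC⟩ := exists_lp_remainder (fun _ => le_rfl) phaseRel_dirichlet hs
    isCharModel_dirichlet exists_isCharLike_dirichlet algMult_opD R
  refine ⟨C, fun σ hσ ev hev => ?_⟩
  obtain ⟨α, hα, h⟩ := hC σ hσ ev hev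
  refine ⟨α, hα, fun k => (h k).trans ?_⟩
  simp only [sub_zero, Complex.ofReal_natCast]
  rw [Fin.sum_univ_eq_sum_range
    (fun j => (coeffD M s j).1 σ / (2 * (k : ℂ)) ^ (2 * j + 1)) (s + 1)]
  rfl

theorem exists_asymptotics_opDN {s : ℕ} (hs : M ≤ 2 * s) (R : ℝ) : ∃ C : ℝ,
    ∀ σ : Sobolev (M + 1), sizeDN σ ≤ R → ∀ ev : ℕ+ → ℂ, IsEigenvalueSeq (opDN σ) ev →
      ∃ α : lp (fun _ : ℕ+ => ℂ) 2, ‖α‖ ≤ C ∧ ∀ k : ℕ+, ev k ^ (1 / 2 : ℂ) = (k : ℂ) - 1 / 2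
        + ∑ j : Fin (s + 1), (coeffDN M s j).1 σ / (2 * (k : ℂ) - 1) ^ (2 * (j : ℕ) + 1)
        + leadTerm σ (k - 1 / 2) + α k / (k : ℂ) ^ (M + 2) := by
  obtain ⟨C, hC⟩ := exists_lp_remainder le_sizeDN phaseRel_neumann hs
    isCharModel_neumann exists_isCharLike_neumann algMult_opDN R
  refine ⟨C, fun σ hσ ev hev => ?_⟩
  obtain ⟨α, hα, h⟩ := hC σ hσ ev hev
  refine ⟨α, hα, fun k => (h k).trans ?_⟩
  have e1 : (((k : ℝ) - 1 / 2 : ℝ) : ℂ) = (k : ℂ) - 1 / 2 := by push_cast; rfl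
  have e2 : 2 * ((k : ℂ) - 1 / 2) = 2 * (k : ℂ) - 1 := by ring
  rw [e1, e2, Fin.sum_univ_eq_sum_range
    (fun j => (coeffDN M s j).1 σ / (2 * (k : ℂ) - 1) ^ (2 * j + 1)) (s + 1)]
  rfl

theorem leadTerm_odd_nat {s : ℕ} (hM : M = 2 * s) (σ : Sobolev (M + 1)) (k : ℕ+) :
    leadTerm σ k = -((-1) ^ s * cosCoeff (topDeriv σ) (2 * (k : ℝ)) /
      (2 * (2 * (k : ℂ)) ^ (2 * s + 1))) := by
  rw [leadTerm_odd hM, Complex.ofReal_natCast]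

theorem leadTerm_odd_half {s : ℕ} (hM : M = 2 * s) (σ : Sobolev (M + 1)) (k : ℕ+) :
    leadTerm σ (k - 1 / 2) = -((-1) ^ s * cosCoeff (topDeriv σ) (2 * (k : ℝ) - 1) /
      (2 * (2 * (k : ℂ) - 1) ^ (2 * s + 1))) := by
  rw [leadTerm_odd hM, show 2 * ((k : ℝ) - 1 / 2) = 2 * (k : ℝ) - 1 by ring,
    show 2 * (((k : ℝ) - 1 / 2 : ℝ) : ℂ) = 2 * (k : ℂ) - 1 by push_cast; ring]

theorem leadTerm_even_nat {s : ℕ} (hM : M + 1 = 2 * s) (σ : Sobolev (M + 1)) (k : ℕ+) :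
    leadTerm σ k = -((-1) ^ s * sinCoeff (topDeriv σ) (2 * (k : ℝ)) /
      (2 * (2 * (k : ℂ)) ^ (2 * s))) := by
  rw [leadTerm_even hM, Complex.ofReal_natCast]

theorem leadTerm_even_half {s : ℕ} (hM : M + 1 = 2 * s) (σ : Sobolev (M + 1)) (k : ℕ+) :
    leadTerm σ (k - 1 / 2) = -((-1) ^ s * sinCoeff (topDeriv σ) (2 * (k : ℝ) - 1) /
      (2 * (2 * (k : ℂ) - 1) ^ (2 * s))) := by
  rw [leadTerm_even hM, show 2 * ((k : ℝ) - 1 / 2) = 2 * (k : ℝ) - 1 by ring,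
    show 2 * (((k : ℝ) - 1 / 2 : ℝ) : ℂ) = 2 * (k : ℂ) - 1 by push_cast; ring]

/-- The asymptotics for the smoothness `m = 2 s + 1`. -/
theorem asymptotics_odd (s : ℕ) : ∃ h g : Fin (s + 1) → Sobolev (2 * s + 1) → ℂ,
    (∀ j, IsContBdd (h j) ∧ IsContBdd (g j) ∧
      HasLinearPart (h j) (hLin j) ∧ HasLinearPart (g j) (gLin j)) ∧
    ∀ R : ℝ, ∃ C : ℝ, ∀ σ : Sobolev (2 * s + 1), potentialNorm σ ≤ R →
      (∀ ev : ℕ+ → ℂ, IsEigenvalueSeq (opD σ) ev →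
        ∃ α : lp (fun _ : ℕ+ => ℂ) 2, ‖α‖ ≤ C ∧ ∀ k : ℕ+,
          ev k ^ (1 / 2 : ℂ) = (k : ℂ)
            + ∑ j : Fin (s + 1), h j σ / (2 * (k : ℂ)) ^ (2 * (j : ℕ) + 1)
            - (-1) ^ s * cosCoeff (topDeriv σ) (2 * (k : ℝ)) / (2 * (2 * (k : ℂ)) ^ (2 * s + 1))
            + α k / (k : ℂ) ^ (2 * s + 2)) ∧
      (‖rep σ 0 Real.pi‖ ≤ R → ∀ ev : ℕ+ → ℂ, IsEigenvalueSeq (opDN σ) ev →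
        ∃ α : lp (fun _ : ℕ+ => ℂ) 2, ‖α‖ ≤ C ∧ ∀ k : ℕ+,
          ev k ^ (1 / 2 : ℂ) = (k : ℂ) - 1 / 2
            + ∑ j : Fin (s + 1), g j σ / (2 * (k : ℂ) - 1) ^ (2 * (j : ℕ) + 1)
            - (-1) ^ s * cosCoeff (topDeriv σ) (2 * (k : ℝ) - 1)
                / (2 * (2 * (k : ℂ) - 1) ^ (2 * s + 1))
            + α k / (k : ℂ) ^ (2 * s + 2)) := by
  refine ⟨fun j => (coeffD (2 * s) s j).1, fun j => (coeffDN (2 * s) s j).1, fun j =>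
    ⟨isContBdd_coeffD .., isContBdd_coeffDN .., hasLinearPart_coeffD (by omega) (by omega),
      hasLinearPart_coeffDN (by omega) (by omega)⟩, fun R => ?_⟩
  obtain ⟨C, hC⟩ := exists_asymptotics_opD (M := 2 * s) le_rfl R
  obtain ⟨C', hC'⟩ := exists_asymptotics_opDN (M := 2 * s) le_rfl R
  refine ⟨max C C', fun σ hσ => ⟨fun ev hev => ?_, fun hπ ev hev => ?_⟩⟩
  · obtain ⟨α, hα, h⟩ := hC σ hσ ev hev
    refine ⟨α, hα.trans (le_max_left _ _), fun k => ?_⟩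
    rw [h k, leadTerm_odd_nat rfl, ← sub_eq_add_neg]
  · obtain ⟨α, hα, h⟩ := hC' σ (max_le hσ hπ) ev hev
    refine ⟨α, hα.trans (le_max_right _ _), fun k => ?_⟩
    rw [h k, leadTerm_odd_half rfl, ← sub_eq_add_neg]

/-- The asymptotics for the smoothness `m = 2 s`. -/
theorem asymptotics_even {m s : ℕ} (hm : m = 2 * s) (hs : 1 ≤ s) :
    ∃ h g : Fin (s + 1) → Sobolev m → ℂ,
    (∀ j, IsContBdd (h j) ∧ IsContBdd (g j)) ∧
    (∀ j : Fin (s + 1), (j : ℕ) < s →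
      HasLinearPart (h j) (hLin j) ∧ HasLinearPart (g j) (gLin j)) ∧
    HasLinearPart (h (Fin.last s)) 0 ∧ HasLinearPart (g (Fin.last s)) 0 ∧
    ∀ R : ℝ, ∃ C : ℝ, ∀ σ : Sobolev m, potentialNorm σ ≤ R →
      (∀ ev : ℕ+ → ℂ, IsEigenvalueSeq (opD σ) ev →
        ∃ α : lp (fun _ : ℕ+ => ℂ) 2, ‖α‖ ≤ C ∧ ∀ k : ℕ+,
          ev k ^ (1 / 2 : ℂ) = (k : ℂ)
            + ∑ j : Fin (s + 1), h j σ / (2 * (k : ℂ)) ^ (2 * (j : ℕ) + 1)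
            - (-1) ^ s * sinCoeff (topDeriv σ) (2 * (k : ℝ)) / (2 * (2 * (k : ℂ)) ^ (2 * s))
            + α k / (k : ℂ) ^ (2 * s + 1)) ∧
      (‖rep σ 0 Real.pi‖ ≤ R → ∀ ev : ℕ+ → ℂ, IsEigenvalueSeq (opDN σ) ev →
        ∃ α : lp (fun _ : ℕ+ => ℂ) 2, ‖α‖ ≤ C ∧ ∀ k : ℕ+,
          ev k ^ (1 / 2 : ℂ) = (k : ℂ) - 1 / 2
            + ∑ j : Fin (s + 1), g j σ / (2 * (k : ℂ) - 1) ^ (2 * (j : ℕ) + 1)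
            - (-1) ^ s * sinCoeff (topDeriv σ) (2 * (k : ℝ) - 1)
                / (2 * (2 * (k : ℂ) - 1) ^ (2 * s))
            + α k / (k : ℂ) ^ (2 * s + 1)) := by
  obtain ⟨M, rfl⟩ : ∃ M, m = M + 1 := ⟨m - 1, by omega⟩
  refine ⟨fun j => (coeffD M s j).1, fun j => (coeffDN M s j).1, fun j =>
    ⟨isContBdd_coeffD .., isContBdd_coeffDN ..⟩, fun j hj =>
    ⟨hasLinearPart_coeffD hm.ge hj.le, hasLinearPart_coeffDN hm.ge hj.le⟩, ?_, ?_, fun R => ?_⟩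
  · rw [← hLin_eq_zero hm.le]
    exact hasLinearPart_coeffD hm.ge le_rfl
  · rw [← gLin_eq_zero hm.le]
    exact hasLinearPart_coeffDN hm.ge le_rfl
  obtain ⟨C, hC⟩ := exists_asymptotics_opD (M := M) (s := s) (by omega) R
  obtain ⟨C', hC'⟩ := exists_asymptotics_opDN (M := M) (s := s) (by omega) R
  refine ⟨max C C', fun σ hσ => ⟨fun ev hev => ?_, fun hπ ev hev => ?_⟩⟩
  · obtain ⟨α, hα, h⟩ := hC σ hσ ev hev
    refine ⟨α, hα.trans (le_max_left _ _), fun k => ?_⟩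
    rw [h k, leadTerm_even_nat hm, ← sub_eq_add_neg, ← hm]
  · obtain ⟨α, hα, h⟩ := hC' σ (max_le hσ hπ) ev hev
    refine ⟨α, hα.trans (le_max_right _ _), fun k => ?_⟩
    rw [h k, leadTerm_even_half hm, ← sub_eq_add_neg, ← hm]

end SturmLiouville

end

theorem theorem4p1 :
    -- odd `m = 2 s + 1`
    (∀ s : ℕ, ∃ h g : Fin (s + 1) → Sobolev (2 * s + 1) → ℂ,
      (∀ j, IsContBdd (h j) ∧ IsContBdd (g j) ∧
        HasLinearPart (h j) (hLin j) ∧ HasLinearPart (g j) (gLin j)) ∧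
      ∀ R : ℝ, ∃ C : ℝ, ∀ σ : Sobolev (2 * s + 1), potentialNorm σ ≤ R →
        (∀ ev : ℕ+ → ℂ, IsEigenvalueSeq (opD σ) ev →
          ∃ α : lp (fun _ : ℕ+ => ℂ) 2, ‖α‖ ≤ C ∧ ∀ k : ℕ+,
            ev k ^ (1 / 2 : ℂ) = (k : ℂ)
              + ∑ j : Fin (s + 1), h j σ / (2 * (k : ℂ)) ^ (2 * (j : ℕ) + 1)
              - (-1) ^ s * cosCoeff (topDeriv σ) (2 * (k : ℝ)) / (2 * (2 * (k : ℂ)) ^ (2 * s + 1))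
              + α k / (k : ℂ) ^ (2 * s + 2)) ∧
        (‖rep σ 0 Real.pi‖ ≤ R → ∀ ev : ℕ+ → ℂ, IsEigenvalueSeq (opDN σ) ev →
          ∃ α : lp (fun _ : ℕ+ => ℂ) 2, ‖α‖ ≤ C ∧ ∀ k : ℕ+,
            ev k ^ (1 / 2 : ℂ) = (k : ℂ) - 1 / 2
              + ∑ j : Fin (s + 1), g j σ / (2 * (k : ℂ) - 1) ^ (2 * (j : ℕ) + 1)
              - (-1) ^ s * cosCoeff (topDeriv σ) (2 * (k : ℝ) - 1)
                  / (2 * (2 * (k : ℂ) - 1) ^ (2 * s + 1))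
              + α k / (k : ℂ) ^ (2 * s + 2))) ∧
    -- even `m = 2 s`
    (∀ s : ℕ, 1 ≤ s → ∃ h g : Fin (s + 1) → Sobolev (2 * s) → ℂ,
      (∀ j, IsContBdd (h j) ∧ IsContBdd (g j)) ∧
      (∀ j : Fin (s + 1), (j : ℕ) < s →
        HasLinearPart (h j) (hLin j) ∧ HasLinearPart (g j) (gLin j)) ∧
      HasLinearPart (h (Fin.last s)) 0 ∧ HasLinearPart (g (Fin.last s)) 0 ∧
      ∀ R : ℝ, ∃ C : ℝ, ∀ σ : Sobolev (2 * s), potentialNorm σ ≤ R →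
        (∀ ev : ℕ+ → ℂ, IsEigenvalueSeq (opD σ) ev →
          ∃ α : lp (fun _ : ℕ+ => ℂ) 2, ‖α‖ ≤ C ∧ ∀ k : ℕ+,
            ev k ^ (1 / 2 : ℂ) = (k : ℂ)
              + ∑ j : Fin (s + 1), h j σ / (2 * (k : ℂ)) ^ (2 * (j : ℕ) + 1)
              - (-1) ^ s * sinCoeff (topDeriv σ) (2 * (k : ℝ)) / (2 * (2 * (k : ℂ)) ^ (2 * s))
              + α k / (k : ℂ) ^ (2 * s + 1)) ∧
        (‖rep σ 0 Real.pi‖ ≤ R → ∀ ev : ℕ+ → ℂ, IsEigenvalueSeq (opDN σ) ev →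
          ∃ α : lp (fun _ : ℕ+ => ℂ) 2, ‖α‖ ≤ C ∧ ∀ k : ℕ+,
            ev k ^ (1 / 2 : ℂ) = (k : ℂ) - 1 / 2
              + ∑ j : Fin (s + 1), g j σ / (2 * (k : ℂ) - 1) ^ (2 * (j : ℕ) + 1)
              - (-1) ^ s * sinCoeff (topDeriv σ) (2 * (k : ℝ) - 1)
                  / (2 * (2 * (k : ℂ) - 1) ^ (2 * s))
              + α k / (k : ℂ) ^ (2 * s + 1))) :=
  ⟨asymptotics_odd, fun _ hs => asymptotics_even rfl hs⟩
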